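/- Let $d\in\{2,3\}$ and fix a Littlewood–Paley pair: radial nonnegative functions $\chi\in\mathcal D(\mathbb R^d)$, $\varphi\in\mathcal D(\mathbb R^d\setminus\{0\})$ with $\chi(\xi)+\sum_{q\ge0}\varphi(2^{-q}\xi)=1$ for all $\xi$, $\operatorname{supp}\chi\cap\operatorname{supp}\varphi(2^{-q}\cdot)=\varnothing$ for $q\ge1$, and $\operatorname{supp}\varphi(2^{-j}\cdot)\cap\operatorname{supp}\varphi(2^{-k}\cdot)=\varnothing$ for $|j-k|\ge2$. Put $\Delta_{-1}=\chi(D)$, $\Delta_q=\varphi(2^{-q}D)$ for $q\ge 0$, where $\sigma(D)$ is the Fourier multiplier with symbol $\sigma(\xi)$ ($\mathcal F u(\xi)=\int e^{-ix\cdot\xi}u(x)\,dx$), and define, with values in $[0,\infty]$, $$\|u\|_{B^0_{p,1}}=\sum_{q\ge-1}\|\Delta_qu\|_{L^p},\qquad \|f\|_{L^1_tB^0_{p,1}}=\int_0^t\|f(\tau)\|_{B^0_{p,1}}\,d\tau,\qquad \|\theta\|_{\widetilde L^\infty_tB^0_{p,1}}=\sum_{q\ge-1}\|\Delta_q\theta\|_{L^\infty(0,t;L^p)}.$$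 Let $\alpha\ge0$ and $\lambda\in\mathbb R$. Then there is a constant $C$, depending only on $\alpha$ and $\lambda$ (and on $d$ and the pair $(\chi,\varphi)$), such that the following holds for all $\kappa\ge0$, all $\beta\in\,]0,1]$ with $\lambda\ge e^{(3+2\alpha)/\beta}$, all $p\in[1,\infty]$ and all $T>0$. Let $v:[0,T]\times\mathbb R^d\to\mathbb R^d$ be $C^\infty$ with $\operatorname{div}v(\tau)=0$ for every $\tau$. Let $f,\theta:[0,T]\times\mathbb R^d\to\mathbb R$ be $C^\infty$ with all spatial derivatives (of every order, including $0$) bounded on $[0,T]\times\mathbb R^d$, and suppose that $$\partial_t\theta+v\cdot\nabla\theta+\kappa\,|D|^\beta\log^{-\alpha}(\lambda+|D|)\theta=f\quad\text{on }[0,T]\times\mathbb R^d,\qquad \theta|_{t=0}=\theta_0,$$ where $|D|^\beta\log^{-\alpha}(\lambda+|D|)$ is the Fourier multiplier with symbol $|\xi|^\beta\log^{-\alpha}(\lambda+|\xi|)$, acting on bounded functions by duality with test functions. Then, for every $t\in[0,T]$ with $\int_0^t\|\nabla v(\tau)\|_{L^\infty}d\tau<\infty$, $$\|\theta\|_{\widetilde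 L^\infty_tB^0_{p,1}}\le C\Big(\|\theta_0\|_{B^0_{p,1}}+\|f\|_{L^1_tB^0_{p,1}}\Big)\Big(1+\int_0^t\|\nabla v(\tau)\|_{L^\infty}\,d\tau\Big).$$ -/

import Mathlib

open MeasureTheory Set
open scoped FourierTransform ContDiff ENNReal NNReal

noncomputable section

/-- A Littlewood–Paley pair on `ℝ^d`: radial nonnegative `χ ∈ 𝓓(ℝ^d)` and `φ ∈ 𝓓(ℝ^d ∖ {0})`
forming an inhomogeneous dyadic partition of unity. -/
structure DyadicPartition (d : ℕ) where
  χ : EuclideanSpace ℝ (Fin d) → ℝ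
  φ : EuclideanSpace ℝ (Fin d) → ℝ
  χ_smooth : ContDiff ℝ ∞ χ
  φ_smooth : ContDiff ℝ ∞ φ
  χ_compact : HasCompactSupport χ
  φ_compact : HasCompactSupport φ
  φ_support : (0 : EuclideanSpace ℝ (Fin d)) ∉ tsupport φ
  χ_nonneg : ∀ ξ, 0 ≤ χ ξ
  φ_nonneg : ∀ ξ, 0 ≤ φ ξ
  χ_radial : ∀ ξ η, ‖ξ‖ = ‖η‖ → χ ξ = χ η
  φ_radial : ∀ ξ η, ‖ξ‖ = ‖η‖ → φ ξ = φ η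
  partition : ∀ ξ, HasSum (fun q : ℕ => φ ((2 : ℝ) ^ (-(q : ℤ)) • ξ)) (1 - χ ξ)
  disjoint_χ_φ : ∀ q : ℕ, 1 ≤ q →
    Disjoint (tsupport χ) (tsupport fun ξ => φ ((2 : ℝ) ^ (-(q : ℤ)) • ξ))
  disjoint_φ_φ : ∀ j k : ℤ, 2 ≤ |j - k| →
    Disjoint (tsupport fun ξ => φ ((2 : ℝ) ^ (-j) • ξ)) (tsupport fun ξ => φ ((2 : ℝ) ^ (-k) • ξ))

/-- The symbols of the Littlewood–Paley blocks, with the index shifted by one: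
index `0` is `χ` (the block `Δ_{-1}`), index `q + 1` is `φ(2^{-q} ·)` (the block `Δ_q`). -/
def DyadicPartition.symbol {d : ℕ} (P : DyadicPartition d) :
    ℕ → EuclideanSpace ℝ (Fin d) → ℝ
  | 0 => P.χ
  | q + 1 => fun ξ => P.φ ((2 : ℝ) ^ (-(q : ℤ)) • ξ)

/-- The convolution kernel of `σ(D)`, namely `(2π)^{-d} ∫ e^{i x·ξ} σ(ξ) dξ`.  The factor `2π` in
the argument converts from Mathlib's Fourier transform (character `e^{-2πi x·η}`) to the one with
character `e^{-i x·ξ}`, for which `D = -i∇` has symbol `ξ`. -/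
def multiplierKernel {d : ℕ} (σ : EuclideanSpace ℝ (Fin d) → ℝ) :
    EuclideanSpace ℝ (Fin d) → ℂ :=
  𝓕⁻ (fun η : EuclideanSpace ℝ (Fin d) => ((σ ((2 * Real.pi) • η) : ℝ) : ℂ))

/-- The dyadic block `Δ_q u = F^{-1}(symbol) ⋆ u` of a (bounded) function `u`,
with the shifted index. -/
def dyadicBlock {d : ℕ} (P : DyadicPartition d) (q : ℕ)
    (u : EuclideanSpace ℝ (Fin d) → ℝ) (x : EuclideanSpace ℝ (Fin d)) : ℂ :=
  ∫ y, multiplierKernel (P.symbol q) (x - y) * (u y : ℂ)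

/-- The norm of `B^0_{p,1}`: the sum over `q ≥ -1` of `‖Δ_q u‖_{L^p}`, in `[0, ∞]`. -/
def besovNorm {d : ℕ} (P : DyadicPartition d) (p : ℝ≥0∞)
    (u : EuclideanSpace ℝ (Fin d) → ℝ) : ℝ≥0∞ :=
  ∑' q : ℕ, eLpNorm (dyadicBlock P q u) p volume

/-- The norm of `L^1_t B^0_{p,1}` on the time interval `(0, t)`. -/
def timeL1BesovNorm {d : ℕ} (P : DyadicPartition d) (p : ℝ≥0∞) (t : ℝ)
    (u : ℝ → EuclideanSpace ℝ (Fin d) → ℝ) : ℝ≥0∞ :=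
  ∫⁻ τ in Ioc 0 t, besovNorm P p (u τ)

/-- The Chemin–Lerner norm of `L̃^∞_t B^0_{p,1}` on the time interval `(0, t)`: the sum over
`q ≥ -1` of `‖Δ_q u‖_{L^∞_t L^p}`. -/
def cheminLernerNorm {d : ℕ} (P : DyadicPartition d) (p : ℝ≥0∞) (t : ℝ)
    (u : ℝ → EuclideanSpace ℝ (Fin d) → ℝ) : ℝ≥0∞ :=
  ∑' q : ℕ, essSup (fun τ => eLpNorm (dyadicBlock P q (u τ)) p volume)
    (volume.restrict (Ioc 0 t))

/-- `∫_0^t ‖∇v(τ)‖_{L^∞} dτ`, in `[0, ∞]`. -/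
def lipschitzIntegral {d : ℕ} (t : ℝ)
    (v : ℝ → EuclideanSpace ℝ (Fin d) → EuclideanSpace ℝ (Fin d)) : ℝ≥0∞ :=
  ∫⁻ τ in Ioc 0 t, eLpNorm (fun x => fderiv ℝ (v τ) x) ∞ volume

/-- The symbol `|ξ|^β log^{-α}(λ + |ξ|)`. -/
def logSymbol {d : ℕ} (α β lam : ℝ) (ξ : EuclideanSpace ℝ (Fin d)) : ℝ :=
  ‖ξ‖ ^ β * Real.log (lam + ‖ξ‖) ^ (-α)

/-- `σ(D)ψ` for a test function `ψ`: its Fourier transform (character `e^{-i x·ξ}`) is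
`σ(ξ)` times that of `ψ`. -/
def multiplierOp {d : ℕ} (σ : EuclideanSpace ℝ (Fin d) → ℝ)
    (ψ : EuclideanSpace ℝ (Fin d) → ℂ) : EuclideanSpace ℝ (Fin d) → ℂ :=
  𝓕⁻ (fun η : EuclideanSpace ℝ (Fin d) => ((σ ((2 * Real.pi) • η) : ℝ) : ℂ) * 𝓕 ψ η)

/-- `w = σ(D)u` in the sense of distributions, for a bounded function `u` and an even real
symbol `σ` (so that `σ(D)` is its own transpose): `⟨w, ψ⟩ = ⟨u, σ(D)ψ⟩` for all test
functions `ψ`. -/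
def IsMultiplierImage {d : ℕ} (σ : EuclideanSpace ℝ (Fin d) → ℝ)
    (u w : EuclideanSpace ℝ (Fin d) → ℝ) : Prop :=
  LocallyIntegrable w volume ∧
  ∀ ψ : EuclideanSpace ℝ (Fin d) → ℝ, ContDiff ℝ ∞ ψ → HasCompactSupport ψ →
    ∫ x, (w x : ℂ) * (ψ x : ℂ) = ∫ x, (u x : ℂ) * multiplierOp σ (fun y => (ψ y : ℂ)) x

/-- A scalar function that is `C^∞` on `[0, T] × ℝ^d`, with all its spatial derivatives
(including the order zero) bounded on `[0, T] × ℝ^d`. -/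
structure IsSmoothBounded {d : ℕ} (T : ℝ) (u : ℝ → EuclideanSpace ℝ (Fin d) → ℝ) : Prop where
  smooth : ContDiffOn ℝ ∞ (fun z : ℝ × EuclideanSpace ℝ (Fin d) => u z.1 z.2) (Icc 0 T ×ˢ univ)
  bounded : ∀ k : ℕ, ∃ M : ℝ, ∀ t ∈ Icc 0 T, ∀ x, ‖iteratedFDeriv ℝ k (u t) x‖ ≤ M

/-- A vector field that is `C^∞` on `[0, T] × ℝ^d` with `div v(t) = 0` for every `t`. -/
structure IsSmoothDivFree {d : ℕ} (T : ℝ)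
    (v : ℝ → EuclideanSpace ℝ (Fin d) → EuclideanSpace ℝ (Fin d)) : Prop where
  smooth : ContDiffOn ℝ ∞ (fun z : ℝ × EuclideanSpace ℝ (Fin d) => v z.1 z.2) (Icc 0 T ×ˢ univ)
  div_eq_zero : ∀ t ∈ Icc 0 T, ∀ x,
    ∑ i : Fin d, (fderiv ℝ (v t) x (EuclideanSpace.single i (1 : ℝ))) i = 0

/-- `θ` is a smooth solution on `[0, T] × ℝ^d` of
`∂_t θ + v·∇θ + κ |D|^β log^{-α}(λ + |D|) θ = f`. -/
structure IsSmoothSolution {d : ℕ} (κ α β lam T : ℝ)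
    (v : ℝ → EuclideanSpace ℝ (Fin d) → EuclideanSpace ℝ (Fin d))
    (f θ : ℝ → EuclideanSpace ℝ (Fin d) → ℝ) : Prop where
  smooth : IsSmoothBounded T θ
  equation : ∃ Lθ : ℝ → EuclideanSpace ℝ (Fin d) → ℝ, ∀ t ∈ Icc 0 T,
    IsMultiplierImage (logSymbol α β lam) (θ t) (Lθ t) ∧
    ∀ x, derivWithin (fun s => θ s x) (Icc 0 T) t + fderiv ℝ (θ t) x (v t x) + κ * Lθ t x = f t x

end

open Filter Topology
open scoped SchwartzMap

variable {d : ℕ}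

/-! The argument is a duality argument. To bound `‖Δ_j θ(t)‖_p`, pair it with `g`, move `Δ_j` onto
`g`, and transport `Δ_j g` backwards in time. The operators that arise, here called propagators,
have two properties, shared by their transposes: they contract every `L^p` norm, and they multiply
the `L^p` norm of a gradient by at most `K = e^V`, where `V = ∫ ‖∇v‖_∞`. Comparing the kernel of
`Δ_i`, which has zero mean when `i` is not the lowest index, with the gradient of `Δ_j g`, or doing
the same for the transpose, gives `‖Δ_i S' Δ_j g‖ ≲ min(1, K 2^{-|i-j|}) ‖g‖`
(`exists_eLpNorm_block_propagator_block_le`). Since `∑_j min(1, K 2^{-|q-j|}) ≲ 1 + log K = 1 + V`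
(`tsum_offDiagonal_le`), the exponential growth of gradients costs only a linear factor after
summation over the blocks.

Transport contributes compositions with a volume-preserving Lipschitz flow
(`IsFlow.isPropagatorPair`). The flow is built from a velocity whose gradient alone is controlled,
and volume preservation is obtained without differentiating the flow in space.

Diffusion must contribute convolutions with probability measures, that is, `exp(-t σ)` must be a
characteristic function (`exists_measure_charFun`). In dimension three, write `G(r) = exp(-t g(r))`
with `g` the radial profile of the symbol. Then `G(r) = ∫_r^∞ m(s) H(r/s) ds`, where `H(r) = 1 -
3r/2 + r³/2` is the normalized overlap of two balls and `m(s) = (s/3)(G'' - s G''')(s)`. The overlap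
is an autocorrelation, hence has a nonnegative Fourier transform, and `m ≥ 0` because `g' ≥ 0`, `g''
≤ 0` and `g''' ≥ 0`. The threshold `λ ≥ e^{(3+2α)/β}` is what is used for these three signs.
Dimension two follows by projection.

The solution operator itself is never constructed. The generator is replaced by the bounded operator
`2^n (1 - μ_n ⋆)`, where `μ_n` is the law at time `2^{-n}`; on smooth bounded functions the error is
`O(2^{-n})` uniformly (`IsHeatFamily.exists_norm_approxGen_sub_le`). With `a = κ 2^n`, the Duhamel
formula along characteristics expresses `θ(t)` through `θ_0`, `f` and `a μ_n ⋆ θ`. Suppose that all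
pairings `⟨θ(τ), S' w⟩`, with `S'` running over all propagators whose expansion factor is at most
`e^{V(T) - V(τ)}`, are bounded by `b + ∫_0^τ g + D`. Reinserting this in the Duhamel formula
replaces `D` by `(1 - e^{-aT}) D` (`contraction_step`). Iteration removes `D`, and `n → ∞` removes
the residual. Nothing depends on the size of `κ`, so no smoothing by the diffusion is used. -/

/-- The Euclidean space `ℝ^d`. -/
abbrev Eucl (d : ℕ) := EuclideanSpace ℝ (Fin d)

/-! ### `L^p` norms by duality, and Minkowski's inequality -/

/-- Bounded measurable integrable functions, used to test `L^p` bounds by duality. -/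
structure IsTest {d : ℕ} {𝕜 : Type*} [RCLike 𝕜] (g : Eucl d → 𝕜) : Prop where
  measurable : Measurable g
  integrable : Integrable g
  bounded : ∃ M : ℝ, ∀ x, ‖g x‖ ≤ M

theorem lintegral_enorm_mul_le_eLpNorm_mul {X : Type*} [MeasurableSpace X] {μ : Measure X}
    (p q : ℝ≥0∞) [hpq : p.HolderConjugate q] {u g : X → ℂ}
    (hu : AEStronglyMeasurable u μ) (hg : AEStronglyMeasurable g μ) :
    ∫⁻ x, ‖u x‖ₑ * ‖g x‖ₑ ∂μ ≤ eLpNorm u p μ * eLpNorm g q μ := by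
  have := eLpNorm_smul_le_mul_eLpNorm (p := p) (q := q) (r := 1) hg hu
  rw [eLpNorm_one_eq_lintegral_enorm] at this
  simpa [enorm_smul] using this

theorem enorm_integral_mul_le_eLpNorm_mul {X : Type*} [MeasurableSpace X] {μ : Measure X}
    (p q : ℝ≥0∞) [hpq : p.HolderConjugate q] {u g : X → ℂ}
    (hu : AEStronglyMeasurable u μ) (hg : AEStronglyMeasurable g μ) :
    ‖∫ x, u x * g x ∂μ‖ₑ ≤ eLpNorm u p μ * eLpNorm g q μ := by
  refine (enorm_integral_le_lintegral_enorm _).trans ?_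
  simpa using lintegral_enorm_mul_le_eLpNorm_mul p q hu hg

/-- The conjugate phase `z̄ / |z|`. -/
noncomputable def conjPhase (z : ℂ) : ℂ := (starRingEnd ℂ) z / ‖z‖

theorem enorm_ofReal (a : ℝ) : ‖(a : ℂ)‖ₑ = ‖a‖ₑ := by
  rw [← ofReal_norm, Complex.norm_real, ofReal_norm]

theorem measurable_conjPhase : Measurable conjPhase := by
  unfold conjPhase; fun_prop

theorem mul_conjPhase (z : ℂ) : z * conjPhase z = ‖z‖ := by
  unfold conjPhase
  by_cases hz : z = 0
  · simp [hz]
  · have : (‖z‖ : ℂ) ≠ 0 := by simpa using hz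
    rw [← mul_div_assoc, Complex.mul_conj, Complex.normSq_eq_norm_sq]
    field_simp
    push_cast; ring

theorem norm_conjPhase_le (z : ℂ) : ‖conjPhase z‖ ≤ 1 := by
  unfold conjPhase
  simp only [norm_div, RCLike.norm_conj, Complex.norm_real, norm_norm]
  exact div_self_le_one _

theorem enorm_conjPhase_le (z : ℂ) : ‖conjPhase z‖ₑ ≤ 1 := by
  rw [← ofReal_norm]
  exact (ENNReal.ofReal_le_ofReal (norm_conjPhase_le z)).trans (by simp)

theorem isTest_indicator {s : Set (Eucl d)} (hs : MeasurableSet s) (hb : volume s < ⊤)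
    {h : Eucl d → ℂ} (hm : Measurable h) {M : ℝ} (hM : ∀ x ∈ s, ‖h x‖ ≤ M) :
    IsTest (s.indicator h) := by
  refine ⟨hm.indicator hs, ?_, ⟨max M 0, fun x => ?_⟩⟩
  · rw [integrable_indicator_iff hs]
    exact Measure.integrableOn_of_bounded (M := M) hb.ne hm.aestronglyMeasurable
      ((ae_restrict_iff' hs).2 (Eventually.of_forall hM))
  · by_cases hx : x ∈ s
    · simp [hx, hM x hx]
    · simp [hx]

theorem enorm_integral_ofReal_of_nonneg {X : Type*} [MeasurableSpace X] {μ : Measure X}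
    {a : X → ℝ} (ha : ∀ x, 0 ≤ a x) (hi : Integrable a μ) :
    ‖∫ x, (a x : ℂ) ∂μ‖ₑ = ∫⁻ x, ‖a x‖ₑ ∂μ := by
  rw [integral_complex_ofReal, ← ofReal_integral_norm_eq_lintegral_enorm hi, ← ofReal_norm,
    Complex.norm_real, Real.norm_of_nonneg (integral_nonneg ha)]
  congr 2; ext x; rw [Real.norm_of_nonneg (ha x)]

/-- The extremiser in Hölder's inequality, cut off to a bounded set so that it is an admissible test
function: its product with `w` is exactly `|w|^{s+1}` there. -/
theorem enorm_integral_mul_indicator_conjPhase {w : Eucl d → ℂ} (hw : Continuous w)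
    {B : Set (Eucl d)} (hB : MeasurableSet B) (hbd : Bornology.IsBounded B) {s : ℝ} (hs : 0 ≤ s) :
    IsTest (B.indicator fun x => conjPhase (w x) * (‖w x‖ ^ s : ℝ)) ∧
    ‖∫ x, w x * B.indicator (fun x => conjPhase (w x) * (‖w x‖ ^ s : ℝ)) x‖ₑ =
      ∫⁻ x in B, ‖w x‖ₑ ^ (s + 1) := by
  have hc : Continuous fun x => ‖w x‖ ^ s := hw.norm.rpow_const fun _ => Or.inr hs
  have hc1 : Continuous fun x => ‖w x‖ ^ (s + 1) := hw.norm.rpow_const fun _ => Or.inr (by linarith)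
  obtain ⟨M, hM⟩ := hbd.isCompact_closure.exists_bound_of_continuousOn hc.continuousOn
  have hfin : volume B < ⊤ := hbd.measure_lt_top
  constructor
  · refine isTest_indicator hB hfin ((measurable_conjPhase.comp hw.measurable).mul
      (Complex.measurable_ofReal.comp hc.measurable)) (M := M) fun x hx => ?_
    rw [norm_mul, Complex.norm_real]
    calc _ ≤ 1 * ‖‖w x‖ ^ s‖ := by gcongr; exact norm_conjPhase_le _
      _ ≤ M := by rw [one_mul]; exact hM x (subset_closure hx)
  · have h2 : ∀ x, w x * B.indicator (fun x => conjPhase (w x) * (‖w x‖ ^ s : ℝ)) x =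
        ((B.indicator (fun x => ‖w x‖ ^ (s + 1)) x : ℝ) : ℂ) := by
      intro x
      by_cases hx : x ∈ B
      · simp only [hx, indicator_of_mem]
        rw [← mul_assoc, mul_conjPhase, Real.rpow_add_one' (norm_nonneg _) (by linarith)]
        push_cast; ring
      · simp [hx]
    simp_rw [h2]
    rw [enorm_integral_ofReal_of_nonneg]
    · rw [← lintegral_indicator hB]
      congr 1; ext x
      by_cases hx : x ∈ B
      · simp only [hx, indicator_of_mem]
        rw [Real.enorm_rpow_of_nonneg (norm_nonneg _) (by linarith), enorm_norm]
      · simp [hx]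
    · intro x; exact indicator_nonneg (fun x _ => by positivity) x
    · rw [integrable_indicator_iff hB]
      exact (hc1.continuousOn.integrableOn_compact hbd.isCompact_closure).mono_set subset_closure

/-- If `|w| > M` on a set of positive measure, a bounded piece of it has positive finite measure,
and the conjugate phase of `w` on that piece violates the hypothesis. -/
theorem eLpNorm_top_le_of_forall_integral_mul_le {w : Eucl d → ℂ}
    (hw : Continuous w) {M : ℝ≥0∞}
    (h : ∀ g : Eucl d → ℂ, IsTest g → ‖∫ x, w x * g x‖ₑ ≤ M * eLpNorm g 1 volume) :
    eLpNorm w ⊤ volume ≤ M := by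
  rcases eq_or_ne M ⊤ with rfl | hMtop
  · simp
  refine eLpNormEssSup_le_of_ae_enorm_bound ?_
  rw [ae_iff]
  set s : Set (Eucl d) := {x | ¬‖w x‖ₑ ≤ M} with hs
  have hsm : MeasurableSet s :=
    (measurableSet_le (hw.measurable.enorm) measurable_const).compl
  have key : ∀ n : ℕ, volume (s ∩ Metric.ball 0 n) = 0 := by
    intro n
    set B := s ∩ Metric.ball (0 : Eucl d) n with hB
    have hBm : MeasurableSet B := hsm.inter measurableSet_ball
    have hBb : Bornology.IsBounded B := Metric.isBounded_ball.subset inter_subset_right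
    obtain ⟨ht, heq⟩ := enorm_integral_mul_indicator_conjPhase hw hBm hBb le_rfl
    have h1 := h _ ht
    have h3 : eLpNorm (B.indicator fun x => conjPhase (w x) * (‖w x‖ ^ (0 : ℝ) : ℝ)) 1 volume
        ≤ volume B := by
      rw [eLpNorm_one_eq_lintegral_enorm]
      calc _ ≤ ∫⁻ x, B.indicator 1 x := by
            refine lintegral_mono fun x => ?_
            by_cases hx : x ∈ B
            · simp only [hx, indicator_of_mem, Pi.one_apply]
              simpa using enorm_conjPhase_le (w x)
            · simp [hx]
        _ = volume B := by rw [lintegral_indicator_one hBm]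
    rw [heq] at h1
    simp only [zero_add, ENNReal.rpow_one] at h1
    by_contra hne
    have hlt : ∫⁻ x in B, M < ∫⁻ x in B, ‖w x‖ₑ :=
      setLIntegral_strict_mono hBm hne hw.measurable.enorm
        (by rw [setLIntegral_const]; exact ENNReal.mul_ne_top hMtop hBb.measure_lt_top.ne)
        (Eventually.of_forall fun x hx => not_le.1 hx.1)
    rw [setLIntegral_const] at hlt
    exact absurd (h1.trans (mul_le_mul_right h3 M)) (not_le.2 hlt)
  have : s = ⋃ n : ℕ, s ∩ Metric.ball 0 n := by
    rw [← inter_iUnion, Metric.iUnion_ball_nat, inter_univ]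
  rw [this]
  exact measure_iUnion_null key

/-- Testing on a ball against the phase of `w` times `|w|^{r-1}` gives `X ≤ M X^{1/q}` for `X = ∫
|w|^r` over the ball, hence `X^{1/r} ≤ M`. The balls then exhaust the space. -/
theorem eLpNorm_le_of_forall_integral_mul_le (p q : ℝ≥0∞) [hpq : p.HolderConjugate q]
    {w : Eucl d → ℂ} (hw : Continuous w) {M : ℝ≥0∞}
    (h : ∀ g : Eucl d → ℂ, IsTest g → ‖∫ x, w x * g x‖ₑ ≤ M * eLpNorm g q volume) :
    eLpNorm w p volume ≤ M := by
  have hp1 : 1 ≤ p := ENNReal.HolderConjugate.one_le p q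
  rcases eq_or_ne p ⊤ with rfl | hptop
  · obtain rfl : q = 1 := ENNReal.HolderConjugate.unique ⊤ q 1
    exact eLpNorm_top_le_of_forall_integral_mul_le hw h
  have hp0 : p ≠ 0 := (zero_lt_one.trans_le hp1).ne'
  set r := p.toReal with hr
  have hr1 : 1 ≤ r := by simpa using ENNReal.toReal_mono hptop hp1
  have hr0 : 0 < r := by linarith
  have key : ∀ n : ℕ, ∫⁻ x in Metric.ball (0 : Eucl d) n, ‖w x‖ₑ ^ r ≤ M ^ r := by
    intro n
    set B := Metric.ball (0 : Eucl d) n with hB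
    have hBm : MeasurableSet B := measurableSet_ball
    have hBb : Bornology.IsBounded B := Metric.isBounded_ball
    obtain ⟨ht, heq⟩ := enorm_integral_mul_indicator_conjPhase hw hBm hBb
      (s := r - 1) (by linarith)
    have h1 := h _ ht
    rw [heq, sub_add_cancel] at h1
    set X := ∫⁻ x in B, ‖w x‖ₑ ^ r with hX
    have hle : ∀ x, ‖B.indicator (fun x => conjPhase (w x) * (‖w x‖ ^ (r - 1) : ℝ)) x‖ₑ ≤
        B.indicator (fun x => ‖w x‖ₑ ^ (r - 1)) x := by
      intro x
      by_cases hx : x ∈ B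
      · simp only [hx, indicator_of_mem, enorm_mul]
        rw [enorm_ofReal, Real.enorm_rpow_of_nonneg (norm_nonneg _) (by linarith), enorm_norm]
        calc _ ≤ 1 * ‖w x‖ₑ ^ (r - 1) := by
              gcongr; exact enorm_conjPhase_le (w x)
          _ = _ := one_mul _
      · simp [hx]
    -- Continuity makes `w` bounded on the ball; finiteness of `X` is what allows `X^{1/q}` to be
    -- cancelled.
    have hXtop : X ≠ ⊤ := by
      obtain ⟨C, hC⟩ := hBb.isCompact_closure.exists_bound_of_continuousOn hw.continuousOn
      have : X ≤ ∫⁻ x in B, ENNReal.ofReal C ^ r := by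
        refine setLIntegral_mono measurable_const fun x hx => ?_
        gcongr
        rw [← ofReal_norm]
        exact ENNReal.ofReal_le_ofReal (hC x (subset_closure hx))
      refine (this.trans_lt ?_).ne
      rw [setLIntegral_const]
      exact ENNReal.mul_lt_top (ENNReal.rpow_lt_top_of_nonneg hr0.le ENNReal.ofReal_ne_top)
        hBb.measure_lt_top
    rcases eq_or_ne X 0 with hX0 | hX0
    · rw [hX0]; exact zero_le
    rcases eq_or_lt_of_le hp1 with hp1' | hp1'
    · have hq : q = ⊤ := by
        subst hp1'
        exact ENNReal.HolderConjugate.unique 1 q ⊤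
      have hr1' : r = 1 := by rw [hr, ← hp1']; simp
      have : eLpNorm (B.indicator fun x => conjPhase (w x) * (‖w x‖ ^ (r - 1) : ℝ)) q volume ≤ 1 := by
        rw [hq]
        refine eLpNormEssSup_le_of_ae_enorm_bound (Eventually.of_forall fun x => (hle x).trans ?_)
        by_cases hx : x ∈ B
        · simp [hx, hr1']
        · simp [hx]
      rw [hr1', ENNReal.rpow_one]
      simpa using h1.trans (mul_le_mul_right this M)
    · have hqtop : q ≠ ⊤ := by
        rintro rfl
        exact hp1'.ne' (@ENNReal.HolderConjugate.unique ⊤ p (hpq.symm) 1 _)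
      have hrq : r.HolderConjugate q.toReal := ENNReal.HolderConjugate.toReal_of_ne_top hptop hqtop
      have hq0 : q ≠ 0 := (zero_lt_one.trans_le (ENNReal.HolderConjugate.one_le q p)).ne'
      have hg : eLpNorm (B.indicator fun x => conjPhase (w x) * (‖w x‖ ^ (r - 1) : ℝ)) q volume ≤
          X ^ (1 / q.toReal) := by
        rw [eLpNorm_eq_lintegral_rpow_enorm_toReal hq0 hqtop]
        gcongr
        rw [hX, ← lintegral_indicator hBm]
        refine lintegral_mono fun x => ?_
        have := hle x
        by_cases hx : x ∈ B
        · simp only [hx, indicator_of_mem] at this ⊢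
          calc _ ≤ (‖w x‖ₑ ^ (r - 1)) ^ q.toReal := by gcongr
            _ = _ := by rw [← ENNReal.rpow_mul, hrq.sub_one_mul_conj]
        · simp [hx, hrq.symm.pos]
      have h2 : X ≤ M * X ^ (1 / q.toReal) := h1.trans (mul_le_mul_right hg M)
      have h3 : X = X ^ (1 / r) * X ^ (1 / q.toReal) := by
        rw [← ENNReal.rpow_add _ _ hX0 hXtop]
        have := hrq.inv_add_inv_eq_one
        rw [one_div, one_div, this, ENNReal.rpow_one]
      have h4 : X ^ (1 / r) ≤ M := by
        rw [h3] at h2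
        have hne : X ^ (1 / q.toReal) ≠ 0 := by simp [hX0, hXtop]
        have hnt : X ^ (1 / q.toReal) ≠ ⊤ :=
          (ENNReal.rpow_lt_top_of_nonneg (by have := hrq.symm.pos; positivity) hXtop).ne
        rw [← h3] at h2
        have h5 : X ^ (1 / r) * X ^ (1 / q.toReal) ≤ M * X ^ (1 / q.toReal) := by rw [← h3]; exact h2
        exact (ENNReal.mul_le_mul_iff_left hne hnt).1 h5
      calc X = (X ^ (1 / r)) ^ r := by rw [← ENNReal.rpow_mul]; field_simp; simp
        _ ≤ M ^ r := by gcongr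
  have htot : ∫⁻ x, ‖w x‖ₑ ^ r ≤ M ^ r := by
    rw [← setLIntegral_univ, ← Metric.iUnion_ball_nat (0 : Eucl d), setLIntegral_iUnion_of_directed]
    · exact iSup_le key
    · refine Monotone.directed_le fun a b hab => Metric.ball_subset_ball (by exact_mod_cast hab)
  rw [eLpNorm_eq_lintegral_rpow_enorm_toReal hp0 hptop]
  calc _ ≤ (M ^ r) ^ (1 / r) := by gcongr
    _ = M := by rw [← ENNReal.rpow_mul]; field_simp; simp

theorem IsTest.memLp {g : Eucl d → ℂ} (hg : IsTest g) {q : ℝ≥0∞} (hq : 1 ≤ q) :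
    MemLp g q volume := by
  obtain ⟨M, hM⟩ := hg.bounded
  rcases eq_or_ne q ⊤ with rfl | hqt
  · exact memLp_top_of_bound hg.measurable.aestronglyMeasurable M (Eventually.of_forall hM)
  refine ⟨hg.measurable.aestronglyMeasurable, ?_⟩
  have hq0 : q ≠ 0 := (zero_lt_one.trans_le hq).ne'
  have hq1 : 1 ≤ q.toReal := by simpa using ENNReal.toReal_mono hqt hq
  rw [eLpNorm_lt_top_iff_lintegral_rpow_enorm_lt_top hq0 hqt]
  have hb : ∀ x, ‖g x‖ₑ ≤ ENNReal.ofReal M := fun x => by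
    rw [← ofReal_norm]; exact ENNReal.ofReal_le_ofReal (hM x)
  calc _ ≤ ∫⁻ x, ENNReal.ofReal M ^ (q.toReal - 1) * ‖g x‖ₑ := by
        refine lintegral_mono fun x => ?_
        calc ‖g x‖ₑ ^ q.toReal = ‖g x‖ₑ ^ ((q.toReal - 1) + 1) := by rw [sub_add_cancel]
          _ = ‖g x‖ₑ ^ (q.toReal - 1) * ‖g x‖ₑ := by
            rw [ENNReal.rpow_add_of_nonneg _ _ (by linarith) zero_le_one, ENNReal.rpow_one]
          _ ≤ _ := by gcongr; exact hb x
    _ = ENNReal.ofReal M ^ (q.toReal - 1) * ∫⁻ x, ‖g x‖ₑ :=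
        lintegral_const_mul _ hg.measurable.enorm
    _ < ⊤ := ENNReal.mul_lt_top
        (ENNReal.rpow_lt_top_of_nonneg (by linarith) ENNReal.ofReal_ne_top) hg.integrable.2

/-- Minkowski's integral inequality, for a continuous function dominated by a superposition. -/
theorem eLpNorm_le_lintegral_eLpNorm {Y F : Type*} [MeasurableSpace Y] {m : Measure Y} [SFinite m]
    [NormedAddCommGroup F] (p : ℝ≥0∞) (hp : 1 ≤ p)
    {w : Eucl d → F} (hw : Continuous w) {G : Y → Eucl d → ℝ≥0∞} 
    (hG : Measurable (Function.uncurry G)) {N : Y → ℝ≥0∞}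
    (hN : ∀ y q, p.HolderConjugate q → ∀ g : Eucl d → ℂ, IsTest g →
      ∫⁻ x, G y x * ‖g x‖ₑ ≤ N y * eLpNorm g q volume)
    (hle : ∀ x, ‖w x‖ₑ ≤ ∫⁻ y, G y x ∂m) :
    eLpNorm w p volume ≤ ∫⁻ y, N y ∂m := by
  have hpq := ENNReal.HolderConjugate.conjExponent hp
  have : eLpNorm (fun x => (‖w x‖ : ℂ)) p volume ≤ ∫⁻ y, N y ∂m := by
    refine eLpNorm_le_of_forall_integral_mul_le p p.conjExponent (by fun_prop) fun g hg => ?_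
    have htop : eLpNorm g p.conjExponent volume ≠ ⊤ :=
      (hg.memLp (@ENNReal.HolderConjugate.one_le _ _ hpq.symm)).eLpNorm_ne_top
    calc _ ≤ ∫⁻ x, ‖w x‖ₑ * ‖g x‖ₑ := by
          refine (enorm_integral_le_lintegral_enorm _).trans (lintegral_mono fun x => ?_)
          rw [enorm_mul, enorm_ofReal, enorm_norm]
      _ ≤ ∫⁻ x, ∫⁻ y, G y x * ‖g x‖ₑ ∂m := by
          refine lintegral_mono fun x => ?_
          rw [lintegral_mul_const _ (hG.of_uncurry_right)]
          gcongr; exact hle x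
      _ = ∫⁻ y, (∫⁻ x, G y x * ‖g x‖ₑ) ∂m := by
          rw [lintegral_lintegral_swap]
          exact ((hG.comp measurable_swap).mul
            (hg.measurable.enorm.comp measurable_fst)).aemeasurable
      _ ≤ ∫⁻ y, N y * eLpNorm g p.conjExponent volume ∂m := 
          lintegral_mono fun y => hN y _ hpq g hg
      _ = _ := by
          rw [lintegral_mul_const' _ _ htop]
  refine (le_of_eq (eLpNorm_congr_norm_ae (Eventually.of_forall fun x => ?_))).trans this
  rw [Complex.norm_real, norm_norm]

/-! ### Propagators: `L^p` contractions with controlled expansion of gradients -/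

/-- Bounded continuous functions. -/
structure IsBC {F : Type*} [NormedAddCommGroup F] (u : Eucl d → F) : Prop where
  continuous : Continuous u
  bounded : ∃ M : ℝ, ∀ x, ‖u x‖ ≤ M

/-- `g` controls the increments of `u` along segments. -/
def UpperGradient (u : Eucl d → ℂ) (g : Eucl d → ℝ) : Prop :=
  ∀ x z, ‖u (x + z) - u x‖ ≤ ‖z‖ * ∫ s in (0 : ℝ)..1, g (x + s • z)

/-- Operators on bounded continuous functions that contract all `L^p` norms and expand upper
gradients at most by the factor `K`. -/
structure IsPropagator (K : ℝ≥0) (S : (Eucl d → ℂ) → Eucl d → ℂ) : Prop where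
  continuous : ∀ u, IsBC u → Continuous (S u)
  bound : ∀ u M, IsBC u → (∀ x, ‖u x‖ ≤ M) → ∀ x, ‖S u x‖ ≤ M
  eLpNorm_le : ∀ u (p : ℝ≥0∞), IsBC u → 1 ≤ p → eLpNorm (S u) p volume ≤ eLpNorm u p volume
  upper : ∀ u g, IsBC u → IsBC g → (∀ x, 0 ≤ g x) → UpperGradient u g →
    ∃ g', IsBC g' ∧ (∀ x, 0 ≤ g' x) ∧ UpperGradient (S u) g' ∧
      ∀ p : ℝ≥0∞, 1 ≤ p → eLpNorm g' p volume ≤ K * eLpNorm g p volume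

/-- A propagator together with its transpose. -/
structure IsPropagatorPair (K : ℝ≥0) (S S' : (Eucl d → ℂ) → Eucl d → ℂ) : Prop where
  left : IsPropagator K S
  right : IsPropagator K S'
  duality : ∀ u w, IsBC u → IsBC w → Integrable w → ∫ x, S u x * w x = ∫ x, u x * S' w x

theorem IsPropagator.isBC {K : ℝ≥0} {S : (Eucl d → ℂ) → Eucl d → ℂ} (hS : IsPropagator K S)
    {u : Eucl d → ℂ} (hu : IsBC u) : IsBC (S u) :=
  ⟨hS.continuous u hu, hu.bounded.imp fun M hM => hS.bound u M hu hM⟩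

theorem IsPropagator.integrable {K : ℝ≥0} {S : (Eucl d → ℂ) → Eucl d → ℂ} (hS : IsPropagator K S)
    {u : Eucl d → ℂ} (hu : IsBC u) (hi : Integrable u) : Integrable (S u) := by
  rw [← memLp_one_iff_integrable] at hi ⊢
  exact ⟨(hS.continuous u hu).aestronglyMeasurable,
    (hS.eLpNorm_le u 1 hu le_rfl).trans_lt hi.2⟩

theorem IsPropagator.mono {K K' : ℝ≥0} {S : (Eucl d → ℂ) → Eucl d → ℂ} (hS : IsPropagator K S)
    (h : K ≤ K') : IsPropagator K' S where
  continuous := hS.continuous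
  bound := hS.bound
  eLpNorm_le := hS.eLpNorm_le
  upper u g hu hg h0 hug := by
    obtain ⟨g', h1, h2, h3, h4⟩ := hS.upper u g hu hg h0 hug
    exact ⟨g', h1, h2, h3, fun p hp => (h4 p hp).trans (by gcongr)⟩

theorem IsPropagatorPair.mono {K K' : ℝ≥0} {S S' : (Eucl d → ℂ) → Eucl d → ℂ}
    (hS : IsPropagatorPair K S S') (h : K ≤ K') : IsPropagatorPair K' S S' :=
  ⟨hS.left.mono h, hS.right.mono h, hS.duality⟩

theorem isPropagator_id : IsPropagator (d := d) 1 (fun u => u) where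
  continuous u hu := hu.continuous
  bound u M _ h := h
  eLpNorm_le u p _ _ := le_rfl
  upper u g hu hg h0 hug := ⟨g, hg, h0, hug, fun p _ => by simp⟩

theorem isPropagatorPair_id : IsPropagatorPair (d := d) 1 (fun u => u) (fun u => u) :=
  ⟨isPropagator_id, isPropagator_id, fun _ _ _ _ _ => rfl⟩

theorem IsPropagator.comp {K L : ℝ≥0} {S R : (Eucl d → ℂ) → Eucl d → ℂ} (hS : IsPropagator K S)
    (hR : IsPropagator L R) : IsPropagator (K * L) (fun u => S (R u)) where
  continuous u hu := hS.continuous _ (hR.isBC hu)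
  bound u M hu h := hS.bound _ M (hR.isBC hu) (hR.bound u M hu h)
  eLpNorm_le u p hu hp := (hS.eLpNorm_le _ p (hR.isBC hu) hp).trans (hR.eLpNorm_le u p hu hp)
  upper u g hu hg h0 hug := by
    obtain ⟨g', h1, h2, h3, h4⟩ := hR.upper u g hu hg h0 hug
    obtain ⟨g'', k1, k2, k3, k4⟩ := hS.upper _ g' (hR.isBC hu) h1 h2 h3
    refine ⟨g'', k1, k2, k3, fun p hp => (k4 p hp).trans ?_⟩
    rw [ENNReal.coe_mul, mul_assoc]
    gcongr
    exact h4 p hp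

theorem IsPropagatorPair.comp {K L : ℝ≥0} {S S' R R' : (Eucl d → ℂ) → Eucl d → ℂ}
    (hS : IsPropagatorPair K S S') (hR : IsPropagatorPair L R R') :
    IsPropagatorPair (K * L) (fun u => S (R u)) (fun w => R' (S' w)) where
  left := hS.left.comp hR.left
  right := by rw [mul_comm]; exact hR.right.comp hS.right
  duality u w hu hw hi := by
    rw [hS.duality _ w (hR.left.isBC hu) hw hi,
      hR.duality u _ hu (hS.right.isBC hw) (hS.right.integrable hw hi)]

theorem IsPropagatorPair.symm {K : ℝ≥0} {S S' : (Eucl d → ℂ) → Eucl d → ℂ}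
    (hS : IsPropagatorPair K S S') {u w : Eucl d → ℂ} (hu : IsBC u) (hw : IsBC w)
    (hi : Integrable w) : ∫ x, S' w x * u x = ∫ x, w x * S u x := by
  simp_rw [mul_comm _ (u _), mul_comm (w _)]
  exact (hS.duality u w hu hw hi).symm

/-- The image of a segment under `Y` is only a Lipschitz curve, so no chain rule is available.
Instead the increment of `u` along the curve is compared with the integral of `K ‖z‖ g`: on a short
chord `g` is within `δ` of its value at the base point, which bounds the right slope at every point.
-/
theorem upperGradient_comp {u : Eucl d → ℂ} {g : Eucl d → ℝ} {Y : Eucl d → Eucl d} {K : ℝ≥0}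
    (hu : Continuous u) (hg : Continuous g) (h0 : ∀ x, 0 ≤ g x) (hug : UpperGradient u g)
    (hY : LipschitzWith K Y) : UpperGradient (fun x => u (Y x)) (fun x => K * g (Y x)) := by
  intro x z
  set y : ℝ → Eucl d := fun s => Y (x + s • z) with hy
  have hyc : Continuous y := hY.continuous.comp (by fun_prop)
  have hylip : ∀ s s', ‖y s' - y s‖ ≤ K * ‖z‖ * |s' - s| := by
    intro s s'
    have := hY.dist_le_mul (x + s' • z) (x + s • z)
    rw [dist_eq_norm, dist_eq_norm, add_sub_add_left_eq_sub, ← sub_smul, norm_smul,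
      Real.norm_eq_abs] at this
    linarith
  set b : ℝ → ℝ := fun s => ‖z‖ * (K * g (y s)) with hb
  have hbc : Continuous b := by fun_prop
  have key := image_le_of_liminf_slope_right_le_deriv_boundary (a := 0) (b := 1)
    (f := fun s => ‖u (y s) - u (y 0)‖) (B := fun s => ∫ τ in (0 : ℝ)..s, b τ) (B' := b)
    (by fun_prop) (by simp) (fun s _ => (intervalIntegral.continuous_primitive
      (fun _ _ => hbc.intervalIntegrable _ _) 0).continuousWithinAt)
    (fun s _ => (hbc.integral_hasStrictDerivAt 0 s).hasDerivAt.hasDerivWithinAt) ?_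
    (right_mem_Icc.2 zero_le_one)
  · simpa [hy, hb, intervalIntegral.integral_const_mul] using key
  intro s _ r hr
  obtain ⟨δ, hδ0, hδ⟩ : ∃ δ > 0, K * ‖z‖ * (g (y s) + δ) < r := by
    have h1 : Tendsto (fun δ => K * ‖z‖ * (g (y s) + δ)) (𝓝[>] 0) (𝓝 (K * ‖z‖ * (g (y s) + 0))) :=
      ((by fun_prop : Continuous fun δ : ℝ => K * ‖z‖ * (g (y s) + δ)).tendsto 0).mono_left
        nhdsWithin_le_nhds
    have h2 : K * ‖z‖ * (g (y s) + 0) < r := by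
      have : b s = K * ‖z‖ * (g (y s) + 0) := by simp only [hb]; ring
      linarith
    obtain ⟨δ, h3, h4⟩ := ((h1.eventually (gt_mem_nhds h2)).and self_mem_nhdsWithin).exists
    exact ⟨δ, h4, h3⟩
  obtain ⟨ε, hε0, hε⟩ := Metric.continuousAt_iff.1 (hg.continuousAt (x := y s)) δ hδ0
  have hev : ∀ᶠ s' in 𝓝[>] s, ‖y s' - y s‖ < ε := by
    have : Tendsto (fun s' => ‖y s' - y s‖) (𝓝[>] s) (𝓝 ‖y s - y s‖) :=
      ((by fun_prop : Continuous fun s' => ‖y s' - y s‖).tendsto s).mono_left nhdsWithin_le_nhds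
    exact this.eventually (gt_mem_nhds (by simpa using hε0))
  refine Eventually.frequently ?_
  filter_upwards [hev, self_mem_nhdsWithin] with s' h1 (h2 : s < s')
  have hpos : 0 < s' - s := sub_pos.2 h2
  rw [slope_def_field, div_lt_iff₀ hpos]
  have hnn : 0 ≤ g (y s) + δ := add_nonneg (h0 _) hδ0.le
  calc ‖u (y s') - u (y 0)‖ - ‖u (y s) - u (y 0)‖ ≤ ‖u (y s') - u (y s)‖ := by
        refine (norm_sub_norm_le _ _).trans (le_of_eq ?_); congr 1; abel
    _ ≤ ‖y s' - y s‖ * ∫ τ in (0 : ℝ)..1, g (y s + τ • (y s' - y s)) := by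
        have := hug (y s) (y s' - y s); rwa [add_sub_cancel] at this
    _ ≤ ‖y s' - y s‖ * (g (y s) + δ) := by
        gcongr
        have : ∫ τ in (0 : ℝ)..1, g (y s + τ • (y s' - y s)) ≤ ∫ τ in (0 : ℝ)..1, (g (y s) + δ) := by
          refine intervalIntegral.integral_mono_on zero_le_one
            (Continuous.intervalIntegrable (by fun_prop) _ _) (by simp) fun τ hτ => ?_
          have : dist (y s + τ • (y s' - y s)) (y s) < ε := by
            rw [dist_eq_norm, add_sub_cancel_left, norm_smul, Real.norm_eq_abs, abs_of_nonneg hτ.1]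
            exact (mul_le_of_le_one_left (norm_nonneg _) hτ.2).trans_lt h1
          have := hε this
          rw [Real.dist_eq] at this
          linarith [(abs_lt.1 this).2]
        simpa using this
    _ ≤ K * ‖z‖ * |s' - s| * (g (y s) + δ) := by gcongr; exact hylip s s'
    _ = K * ‖z‖ * (g (y s) + δ) * (s' - s) := by rw [abs_of_pos hpos]; ring
    _ < r * (s' - s) := by gcongr

/-- Volume preservation gives equality of `L^p` norms; the Lipschitz constant is the only source of
the factor `K`. -/
theorem isPropagator_comp {Y : Eucl d → Eucl d} {K : ℝ≥0} (hY : LipschitzWith K Y)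
    (hm : MeasurePreserving Y volume volume) : IsPropagator K (fun u x => u (Y x)) where
  continuous u hu := hu.continuous.comp hY.continuous
  bound u M _ h x := h _
  eLpNorm_le u p hu _ :=
    (eLpNorm_comp_measurePreserving hu.continuous.aestronglyMeasurable hm).le
  upper u g hu hg h0 hug := by
    obtain ⟨M, hM⟩ := hg.bounded
    refine ⟨fun x => K * g (Y x), ⟨continuous_const.mul (hg.continuous.comp hY.continuous),
      K * M, fun x => ?_⟩, fun x => mul_nonneg K.2 (h0 _),
      upperGradient_comp hu.continuous hg.continuous h0 hug hY, fun p _ => ?_⟩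
    · rw [norm_mul, NNReal.norm_eq]
      gcongr
      exact hM _
    · rw [← eLpNorm_comp_measurePreserving hg.continuous.aestronglyMeasurable hm]
      have := eLpNorm_const_smul (K : ℝ) (g ∘ Y) p (volume : Measure (Eucl d))
      refine (le_of_eq this).trans (le_of_eq ?_)
      congr 1
      simp

theorem isPropagatorPair_comp {Y Y' : Eucl d → Eucl d} {K : ℝ≥0} (hY : LipschitzWith K Y)
    (hY' : LipschitzWith K Y') (hm : MeasurePreserving Y volume volume)
    (hm' : MeasurePreserving Y' volume volume) (hinv : ∀ x, Y' (Y x) = x) :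
    IsPropagatorPair K (fun u x => u (Y x)) (fun w x => w (Y' x)) where
  left := isPropagator_comp hY hm
  right := isPropagator_comp hY' hm'
  duality u w hu hw _ := by
    have hc : Continuous fun x => u x * w (Y' x) :=
      hu.continuous.mul (hw.continuous.comp hY'.continuous)
    have := integral_map (μ := volume) (f := fun x => u x * w (Y' x)) hm.measurable.aemeasurable
      hc.aestronglyMeasurable
    rw [hm.map_eq] at this
    simpa [hinv] using this.symm

/-! ### Convolution with a probability measure is a propagator with factor one -/

/-- Convolution with a measure. -/
noncomputable def measureConv {F : Type*} [NormedAddCommGroup F] [NormedSpace ℝ F]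
    (μ : Measure (Eucl d)) (u : Eucl d → F) (x : Eucl d) : F := ∫ z, u (x - z) ∂μ

section measureConv

variable {F : Type*} [NormedAddCommGroup F] {μ : Measure (Eucl d)}

theorem IsBC.integrable_comp {Y : Type*} [MeasurableSpace Y] {u : Eucl d → F} (hu : IsBC u)
    {m : Measure Y} [IsFiniteMeasure m] {h : Y → Eucl d} (hh : Measurable h) :
    Integrable (fun y => u (h y)) m := by
  obtain ⟨M, hM⟩ := hu.bounded
  exact .of_bound (hu.continuous.stronglyMeasurable.comp_measurable hh).aestronglyMeasurable M
    (Eventually.of_forall fun y => hM _)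

theorem lintegral_comp_sub_mul_le {u : Eucl d → F} (hu : StronglyMeasurable u) (p q : ℝ≥0∞)
    [hpq : p.HolderConjugate q] (z : Eucl d) {g : Eucl d → ℂ} (hg : AEStronglyMeasurable g) :
    ∫⁻ x, ‖u (x - z)‖ₑ * ‖g x‖ₑ ≤ eLpNorm u p volume * eLpNorm g q volume := by
  have h1 := lintegral_enorm_mul_le_eLpNorm_mul p q (μ := volume)
    (u := fun x => ((‖u (x - z)‖ : ℝ) : ℂ)) (g := g)
    (Complex.continuous_ofReal.comp_stronglyMeasurable
      (hu.comp_measurable (by fun_prop : Measurable fun x => x - z)).norm).aestronglyMeasurable hg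
  have h2 : eLpNorm (fun x => ((‖u (x - z)‖ : ℝ) : ℂ)) p volume = eLpNorm u p volume := by
    rw [← eLpNorm_comp_measurePreserving hu.aestronglyMeasurable
      (measurePreserving_sub_right volume z)]
    exact eLpNorm_congr_norm_ae (Eventually.of_forall fun x => by simp)
  rw [h2] at h1
  simpa [enorm_ofReal] using h1

variable [NormedSpace ℝ F]

theorem norm_measureConv_le [IsProbabilityMeasure μ] {u : Eucl d → F} {M : ℝ}
    (hM : ∀ x, ‖u x‖ ≤ M) (x : Eucl d) : ‖measureConv μ u x‖ ≤ M := by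
  have := norm_integral_le_of_norm_le_const (μ := μ) (f := fun z => u (x - z)) (C := M)
    (Eventually.of_forall fun z => hM _)
  simpa [measureConv] using this

theorem isBC_measureConv [IsProbabilityMeasure μ] {u : Eucl d → F} (hu : IsBC u) :
    IsBC (measureConv μ u) := by
  obtain ⟨M, hM⟩ := hu.bounded
  refine ⟨?_, M, norm_measureConv_le hM⟩
  have := hu.continuous
  exact continuous_of_dominated (bound := fun _ => M)
    (fun x => (by fun_prop : Continuous fun z => u (x - z)).aestronglyMeasurable)
    (fun x => Eventually.of_forall fun z => hM _) (integrable_const M)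
    (Eventually.of_forall fun z => by fun_prop)

theorem eLpNorm_measureConv_le [IsProbabilityMeasure μ] {u : Eucl d → F} (hu : IsBC u)
    {p : ℝ≥0∞} (hp : 1 ≤ p) : eLpNorm (measureConv μ u) p volume ≤ eLpNorm u p volume := by
  have h := eLpNorm_le_lintegral_eLpNorm (m := μ) p hp (isBC_measureConv hu).continuous
    (G := fun z x => ‖u (x - z)‖ₑ)
    (by have := hu.continuous; exact (by fun_prop : Continuous fun a : Eucl d × Eucl d =>
      u (a.2 - a.1)).enorm.measurable)
    (N := fun _ => eLpNorm u p volume)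
    (fun z q hpq g hg => lintegral_comp_sub_mul_le hu.continuous.stronglyMeasurable p q z
      hg.measurable.aestronglyMeasurable)
    (fun x => enorm_integral_le_lintegral_enorm _)
  simpa using h

end measureConv

theorem upperGradient_measureConv {μ : Measure (Eucl d)} [IsProbabilityMeasure μ]
    {u : Eucl d → ℂ} {g : Eucl d → ℝ} (hu : IsBC u) (hg : IsBC g) (hug : UpperGradient u g) :
    UpperGradient (measureConv μ u) (measureConv μ g) := by
  intro x y
  have hcu := hu.continuous
  have hcg := hg.continuous
  have hgp : Integrable (fun a : ℝ × Eucl d => g (x + a.1 • y - a.2))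
      ((volume.restrict (Ioc (0 : ℝ) 1)).prod μ) := hg.integrable_comp (by fun_prop)
  have h1 : measureConv μ u (x + y) - measureConv μ u x = ∫ z, (u (x - z + y) - u (x - z)) ∂μ := by
    unfold measureConv
    rw [← integral_sub (hu.integrable_comp (by fun_prop)) (hu.integrable_comp (by fun_prop))]
    simp_rw [add_sub_right_comm]
  rw [h1]
  calc _ ≤ ∫ z, (‖y‖ * ∫ s in (0 : ℝ)..1, g (x + s • y - z)) ∂μ := by
        refine norm_integral_le_of_norm_le ?_ (Eventually.of_forall fun z => ?_)
        · simp_rw [intervalIntegral.integral_of_le zero_le_one]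
          exact hgp.integral_prod_right.const_mul _
        · simpa only [add_sub_right_comm] using hug (x - z) y
    _ = _ := by
        rw [integral_const_mul]
        congr 1
        simp_rw [intervalIntegral.integral_of_le zero_le_one, measureConv]
        exact (integral_integral_swap (f := fun (s : ℝ) z => g (x + s • y - z)) hgp).symm

theorem isPropagator_measureConv {μ : Measure (Eucl d)} [IsProbabilityMeasure μ] :
    IsPropagator 1 (measureConv (F := ℂ) μ) where
  continuous u hu := (isBC_measureConv hu).continuous
  bound u M _ h := norm_measureConv_le h
  eLpNorm_le u p hu hp := eLpNorm_measureConv_le hu hp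
  upper u g hu hg h0 hug := ⟨measureConv μ g, isBC_measureConv hg,
    fun x => integral_nonneg fun z => h0 _, upperGradient_measureConv hu hg hug,
    fun p hp => by simpa using eLpNorm_measureConv_le hg hp⟩

/-- Fubini followed by the reflection `z ↦ -z`: a symmetric measure gives a self-transposed
convolution. -/
theorem integral_measureConv_mul {μ : Measure (Eucl d)} [IsProbabilityMeasure μ]
    (hsymm : μ.map (fun x => -x) = μ) {u w : Eucl d → ℂ} (hu : IsBC u) (hw : IsBC w)
    (hi : Integrable w) : ∫ x, measureConv μ u x * w x = ∫ x, u x * measureConv μ w x := by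
  have hcu := hu.continuous
  have hcw := hw.continuous
  obtain ⟨M, hM⟩ := hu.bounded
  have hI : Integrable (fun a : Eucl d × Eucl d => u (a.1 - a.2) * w a.1) (volume.prod μ) := by
    refine (Integrable.comp_fst (hi.norm.const_mul M) μ).mono'
      (by fun_prop : Continuous _).aestronglyMeasurable (Eventually.of_forall fun a => ?_)
    rw [norm_mul]; gcongr; exact hM _
  calc ∫ x, measureConv μ u x * w x = ∫ x, (∫ z, u (x - z) * w x ∂μ) := by
        simp_rw [measureConv, integral_mul_const]
    _ = ∫ z, (∫ x, u (x - z) * w x) ∂μ := integral_integral_swap hI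
    _ = ∫ z, (∫ x, u x * w (x + z)) ∂μ := by
        congr 1; ext z
        have := integral_sub_right_eq_self (fun x => u x * w (x + z)) z (μ := volume)
        simpa using this
    _ = ∫ z, (∫ x, u x * w (x - z)) ∂μ := by
        have hmm : StronglyMeasurable fun z => ∫ x, u x * w (x - z) :=
          ((by fun_prop : Continuous fun a : Eucl d × Eucl d =>
            u a.2 * w (a.2 - a.1)).stronglyMeasurable).integral_prod_right
        have := integral_map (μ := μ) (φ := fun x => -x) (f := fun z => ∫ x, u x * w (x - z))
          (by fun_prop) hmm.aestronglyMeasurable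
        rw [hsymm] at this
        simpa using this.symm
    _ = ∫ x, (∫ z, u x * w (x - z) ∂μ) := by
        refine (integral_integral_swap ?_).symm
        have h1 : Integrable (fun a : Eucl d × Eucl d => w (a.1 - a.2)) (volume.prod μ) := by
          rw [integrable_prod_iff' (by fun_prop : Continuous _).aestronglyMeasurable]
          refine ⟨Eventually.of_forall fun z => hi.comp_sub_right z, ?_⟩
          simp_rw [integral_sub_right_eq_self (fun x => ‖w x‖)]
          exact integrable_const _
        refine (h1.norm.const_mul M).mono' (by fun_prop : Continuous _).aestronglyMeasurable
          (Eventually.of_forall fun a => ?_)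
        simp only [Function.uncurry]
        rw [norm_mul]; gcongr; exact hM _
    _ = _ := by simp_rw [measureConv, integral_const_mul]

theorem isPropagatorPair_measureConv {μ : Measure (Eucl d)} [IsProbabilityMeasure μ]
    (hsymm : μ.map (fun x => -x) = μ) :
    IsPropagatorPair 1 (measureConv (F := ℂ) μ) (measureConv μ) :=
  ⟨isPropagator_measureConv, isPropagator_measureConv,
    fun _ _ hu hw hi => integral_measureConv_mul hsymm hu hw hi⟩

/-! ### Convolution with integrable kernels -/

/-- Convolution with a kernel. -/
noncomputable def kernelConv {𝕜 : Type*} [RCLike 𝕜] (k u : Eucl d → 𝕜) (x : Eucl d) : 𝕜 :=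
  ∫ y, k (x - y) * u y

section kernelConv

variable {𝕜 : Type*} [RCLike 𝕜] {k u : Eucl d → 𝕜}

theorem kernelConv_eq (k u : Eucl d → 𝕜) (x : Eucl d) :
    kernelConv k u x = ∫ y, k y * u (x - y) := by
  rw [kernelConv, ← integral_sub_left_eq_self _ _ x]
  simp

theorem isBC_kernelConv_of_isBC (hk : Integrable k) (hu : IsBC u) : IsBC (kernelConv k u) := by
  obtain ⟨M, hM⟩ := hu.bounded
  have hc := hu.continuous
  have hle : ∀ x y, ‖k y * u (x - y)‖ ≤ ‖k y‖ * M := fun x y => by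
    rw [norm_mul]; gcongr; exact hM _
  have heq : kernelConv k u = fun x => ∫ y, k y * u (x - y) := funext (kernelConv_eq k u)
  rw [heq]
  refine ⟨continuous_of_dominated (bound := fun y => ‖k y‖ * M)
    (fun x => hk.1.mul (by fun_prop : Continuous fun y => u (x - y)).aestronglyMeasurable)
    (fun x => Eventually.of_forall (hle x)) (hk.norm.mul_const M)
    (Eventually.of_forall fun y => by fun_prop), ∫ y, ‖k y‖ * M, fun x => ?_⟩
  exact norm_integral_le_of_norm_le (hk.norm.mul_const M) (Eventually.of_forall (hle x))

theorem isBC_kernelConv_of_isTest (hk : IsBC k) (hu : IsTest u) : IsBC (kernelConv k u) := by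
  obtain ⟨M, hM⟩ := hk.bounded
  have hc := hk.continuous
  have hle : ∀ x y, ‖k (x - y) * u y‖ ≤ M * ‖u y‖ := fun x y => by
    rw [norm_mul]; gcongr; exact hM _
  refine ⟨continuous_of_dominated (bound := fun y => M * ‖u y‖)
    (fun x => (by fun_prop : Continuous fun y => k (x - y)).aestronglyMeasurable.mul
      hu.measurable.aestronglyMeasurable)
    (fun x => Eventually.of_forall (hle x)) (hu.integrable.norm.const_mul M)
    (Eventually.of_forall fun y => by fun_prop), ∫ y, M * ‖u y‖, fun x => ?_⟩
  exact norm_integral_le_of_norm_le (hu.integrable.norm.const_mul M) (Eventually.of_forall (hle x))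

/-- Young's inequality `L^1 * L^p ⊆ L^p`. -/
theorem eLpNorm_kernelConv_le (hk : Measurable k) (hu : Measurable u)
    (hc : Continuous (kernelConv k u)) {p : ℝ≥0∞} (hp : 1 ≤ p) :
    eLpNorm (kernelConv k u) p volume ≤ (∫⁻ y, ‖k y‖ₑ) * eLpNorm u p volume := by
  have h := eLpNorm_le_lintegral_eLpNorm (m := (volume : Measure (Eucl d))) p hp hc
    (G := fun y x => ‖k y‖ₑ * ‖u (x - y)‖ₑ)
    ((hk.comp measurable_fst).enorm.mul
      (hu.comp (measurable_snd.sub measurable_fst)).enorm)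
    (N := fun y => ‖k y‖ₑ * eLpNorm u p volume)
    (fun y q hpq g hg => by
      simp_rw [mul_assoc]
      rw [lintegral_const_mul' _ _ enorm_ne_top]
      gcongr
      exact lintegral_comp_sub_mul_le hu.stronglyMeasurable p q y
        hg.measurable.aestronglyMeasurable)
    (fun x => by
      rw [kernelConv_eq]
      refine (enorm_integral_le_lintegral_enorm _).trans (le_of_eq ?_)
      simp_rw [enorm_mul])
  rwa [lintegral_mul_const _ hk.enorm] at h

theorem isTest_kernelConv (hk : IsBC k) (hki : Integrable k) (hu : IsTest u) :
    IsTest (kernelConv k u) := by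
  have hbc := isBC_kernelConv_of_isTest hk hu
  refine ⟨hbc.continuous.measurable, ?_, hbc.bounded⟩
  rw [← memLp_one_iff_integrable]
  refine ⟨hbc.continuous.aestronglyMeasurable,
    (eLpNorm_kernelConv_le hk.continuous.measurable hu.measurable hbc.continuous le_rfl).trans_lt ?_⟩
  rw [eLpNorm_one_eq_lintegral_enorm]
  exact ENNReal.mul_lt_top hki.2 hu.integrable.2

theorem integral_kernelConv_mul (hk : Continuous k) (hki : Integrable k) (heven : ∀ x, k (-x) = k x)
    {w : Eucl d → 𝕜} (hu : Measurable u) {M : ℝ} (hM : ∀ x, ‖u x‖ ≤ M) (hw : Integrable w) :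
    ∫ x, kernelConv k u x * w x = ∫ x, u x * kernelConv k w x := by
  have hI : Integrable (fun a : Eucl d × Eucl d => k (a.1 - a.2) * u a.2 * w a.1)
      (volume.prod volume) := by
    have h1 : Integrable (fun a : Eucl d × Eucl d => k (a.1 - a.2) * w a.1)
        (volume.prod volume) := by
      have hme : AEStronglyMeasurable (fun a : Eucl d × Eucl d => k (a.1 - a.2) * w a.1)
          (volume.prod volume) :=
        (by fun_prop : Continuous fun a : Eucl d × Eucl d => k (a.1 - a.2)).aestronglyMeasurable.mul
          hw.1.comp_fst
      rw [integrable_prod_iff hme]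
      refine ⟨Eventually.of_forall fun x => (hki.comp_sub_left x).mul_const (w x), ?_⟩
      simp_rw [norm_mul, integral_mul_const, integral_sub_left_eq_self (fun y => ‖k y‖)]
      exact hw.norm.const_mul _
    refine (h1.norm.const_mul M).mono' ?_ (Eventually.of_forall fun a => ?_)
    · exact ((by fun_prop : Continuous fun a : Eucl d × Eucl d =>
        k (a.1 - a.2)).aestronglyMeasurable.mul (hu.comp measurable_snd).aestronglyMeasurable).mul
          hw.1.comp_fst
    · rw [norm_mul, norm_mul, norm_mul]
      have := hM a.2
      have h1 := norm_nonneg (k (a.1 - a.2)); have h2 := norm_nonneg (w a.1)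
      calc _ ≤ ‖k (a.1 - a.2)‖ * M * ‖w a.1‖ := by gcongr
        _ = _ := by ring
  calc ∫ x, kernelConv k u x * w x = ∫ x, ∫ y, k (x - y) * u y * w x := by
        simp_rw [kernelConv, integral_mul_const]
    _ = ∫ y, ∫ x, k (x - y) * u y * w x := integral_integral_swap hI
    _ = _ := by
        congr 1; ext y
        rw [kernelConv, ← integral_const_mul]
        congr 1; ext x
        rw [← heven (y - x), neg_sub]; ring

end kernelConv

/-! ### Kernels at a frequency scale and their interaction with propagators -/

/-- Quantitative bounds on a convolution kernel at the frequency scale `R`. -/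
structure IsKernelBound (C R : ℝ≥0) (k : Eucl d → ℂ) : Prop where
  isBC : IsBC k
  integrable : Integrable k
  even : ∀ x, k (-x) = k x
  differentiable : ContDiff ℝ 1 k
  isBC_fderiv : IsBC (fderiv ℝ k)
  l1_le : ∫⁻ y, ‖k y‖ₑ ≤ C
  moment_le : ∫⁻ y, ‖k y‖ₑ * ‖y‖ₑ ≤ C / R
  grad_le : ∫⁻ y, ‖fderiv ℝ k y‖ₑ ≤ C * R

/-- The derivative falls on the kernel: integrate `∇k` along the segment, then exchange the two
integrals. -/
theorem upperGradient_kernelConv {k u : Eucl d → ℂ} (hk : IsBC k) (hki : ContDiff ℝ 1 k)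
    (hk' : IsBC (fderiv ℝ k)) (hu : IsTest u) :
    UpperGradient (kernelConv k u) (kernelConv (fun y => ‖fderiv ℝ k y‖) (fun y => ‖u y‖)) := by
  intro x z
  obtain ⟨M, hM⟩ := hk.bounded
  obtain ⟨M', hM'⟩ := hk'.bounded
  have hc := hk.continuous
  have hc' := hk'.continuous
  have hint : ∀ x, Integrable (fun y => k (x - y) * u y) := fun x =>
    hu.integrable.bdd_mul (c := M) (by fun_prop : Continuous fun y => k (x - y)).aestronglyMeasurable
      (Eventually.of_forall fun y => hM _)
  have hgp : Integrable (fun a : ℝ × Eucl d => ‖fderiv ℝ k (x + a.1 • z - a.2)‖ * ‖u a.2‖)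
      ((volume.restrict (Ioc (0 : ℝ) 1)).prod volume) := by
    refine (hu.integrable.norm.comp_snd _).bdd_mul (c := M') (by fun_prop : Continuous fun a : ℝ × Eucl d =>
      ‖fderiv ℝ k (x + a.1 • z - a.2)‖).aestronglyMeasurable (Eventually.of_forall fun a => ?_)
    rw [norm_norm]; exact hM' _
  rw [kernelConv, kernelConv, ← integral_sub (hint _) (hint _)]
  calc _ ≤ ∫ y, ‖z‖ * ∫ s in (0 : ℝ)..1, ‖fderiv ℝ k (x + s • z - y)‖ * ‖u y‖ := by
        refine norm_integral_le_of_norm_le ?_ (Eventually.of_forall fun y => ?_)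
        · simp_rw [intervalIntegral.integral_of_le zero_le_one]
          exact hgp.integral_prod_right.const_mul _
        · rw [← sub_mul, norm_mul, intervalIntegral.integral_mul_const, ← mul_assoc]
          gcongr
          have hd : ∀ s : ℝ, HasDerivAt (fun s : ℝ => k (x - y + s • z))
              (fderiv ℝ k (x - y + s • z) z) s := by
            intro s
            have h1 : HasDerivAt (fun s : ℝ => x - y + s • z) z s := by
              simpa using ((hasDerivAt_id s).smul_const z).const_add (x - y)
            exact ((hki.differentiable one_ne_zero) _).hasFDerivAt.comp_hasDerivAt s h1
          have h2 := intervalIntegral.integral_eq_sub_of_hasDerivAt (a := 0) (b := 1)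
            (fun s _ => hd s) (Continuous.intervalIntegrable (by fun_prop) _ _)
          simp only [one_smul, zero_smul, add_zero] at h2
          rw [add_sub_right_comm, ← h2, ← intervalIntegral.integral_const_mul]
          refine intervalIntegral.norm_integral_le_of_norm_le zero_le_one
            (Eventually.of_forall fun s _ => ?_) (Continuous.intervalIntegrable (by fun_prop) _ _)
          rw [add_sub_right_comm, mul_comm]
          exact ContinuousLinearMap.le_opNorm _ _
    _ = _ := by
        rw [integral_const_mul]
        congr 1
        simp_rw [intervalIntegral.integral_of_le zero_le_one, kernelConv]
        exact (integral_integral_swap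
          (f := fun (s : ℝ) y => ‖fderiv ℝ k (x + s • z - y)‖ * ‖u y‖) hgp).symm

/-- Zero mean of the kernel replaces `w(x-y)` by `w(x-y) - w(x)`, which is at most `|y|` times the
average of `g` on a segment. Minkowski over `y` and the segment parameter leaves the first moment of
`k`. -/
theorem eLpNorm_kernelConv_le_of_upperGradient {k w : Eucl d → ℂ} {g : Eucl d → ℝ}
    (hk : IsBC k) (hki : Integrable k) (h0 : ∫ y, k y = 0) (hw : IsBC w) (hg : IsBC g)
    (hwg : UpperGradient w g) {p : ℝ≥0∞} (hp : 1 ≤ p) :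
    eLpNorm (kernelConv k w) p volume ≤ (∫⁻ y, ‖k y‖ₑ * ‖y‖ₑ) * eLpNorm g p volume := by
  have hkc := hk.continuous
  have hgc := hg.continuous
  have hwc := hw.continuous
  have h := eLpNorm_le_lintegral_eLpNorm
    (m := (volume : Measure (Eucl d)).prod (volume.restrict (Ioc (0 : ℝ) 1))) p hp
    (isBC_kernelConv_of_isBC hki hw).continuous
    (G := fun a x => ‖k a.1‖ₑ * ‖a.1‖ₑ * ‖g (x - a.2 • a.1)‖ₑ)
    (by
      have h1 : Continuous fun b : (Eucl d × ℝ) × Eucl d => g (b.2 - b.1.2 • b.1.1) := by fun_prop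
      have h2 : Continuous fun b : (Eucl d × ℝ) × Eucl d => k b.1.1 := by fun_prop
      have h3 : Continuous fun b : (Eucl d × ℝ) × Eucl d => b.1.1 := by fun_prop
      exact (h2.enorm.measurable.mul h3.enorm.measurable).mul h1.enorm.measurable)
    (N := fun a => ‖k a.1‖ₑ * ‖a.1‖ₑ * eLpNorm g p volume)
    (fun a q hpq t ht => by
      simp_rw [mul_assoc]
      rw [lintegral_const_mul' _ _ enorm_ne_top, lintegral_const_mul' _ _ enorm_ne_top]
      gcongr
      exact lintegral_comp_sub_mul_le hgc.stronglyMeasurable p q _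
        ht.measurable.aestronglyMeasurable)
    (fun x => by
      obtain ⟨M, hM⟩ := hw.bounded
      have hi : Integrable fun y => k y * w (x - y) :=
        hki.mul_bdd (c := M) (by fun_prop : Continuous fun y => w (x - y)).aestronglyMeasurable
          (Eventually.of_forall fun y => hM _)
      have h1 : kernelConv k w x = ∫ y, k y * (w (x - y) - w x) := by
        simp_rw [mul_sub]
        rw [integral_sub hi (hki.mul_const _), integral_mul_const, h0, zero_mul, sub_zero,
          kernelConv_eq]
      rw [h1]
      refine (enorm_integral_le_lintegral_enorm _).trans ?_
      rw [lintegral_prod _ (by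
        have h1 : Continuous fun b : (Eucl d × ℝ) => g (x - b.2 • b.1) := by fun_prop
        have h2 : Continuous fun b : (Eucl d × ℝ) => k b.1 := by fun_prop
        have h3 : Continuous fun b : (Eucl d × ℝ) => b.1 := by fun_prop
        exact ((h2.enorm.measurable.mul h3.enorm.measurable).mul h1.enorm.measurable).aemeasurable)]
      refine lintegral_mono fun y => ?_
      dsimp only
      rw [lintegral_const_mul' _ _ (ENNReal.mul_ne_top enorm_ne_top enorm_ne_top), enorm_mul,
        mul_assoc]
      gcongr
      have h2 := hwg x (-y)
      rw [norm_neg, intervalIntegral.integral_of_le zero_le_one] at h2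
      have h3 : ‖w (x - y) - w x‖ ≤ ‖y‖ * ‖∫ s in Ioc (0 : ℝ) 1, g (x + s • -y)‖ := by
        rw [sub_eq_add_neg]
        exact h2.trans (by gcongr; exact Real.le_norm_self _)
      calc ‖w (x - y) - w x‖ₑ ≤ ‖y‖ₑ * ‖∫ s in Ioc (0 : ℝ) 1, g (x + s • -y)‖ₑ := by
            rw [← ofReal_norm, ← ofReal_norm, ← ofReal_norm, ← ENNReal.ofReal_mul (norm_nonneg _)]
            exact ENNReal.ofReal_le_ofReal h3
        _ ≤ _ := by
            gcongr
            refine (enorm_integral_le_lintegral_enorm _).trans (le_of_eq ?_)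
            simp [sub_eq_add_neg])
  have hcalc : ∫⁻ a : Eucl d × ℝ, ‖k a.1‖ₑ * ‖a.1‖ₑ * eLpNorm g p volume
      ∂((volume : Measure (Eucl d)).prod (volume.restrict (Ioc (0 : ℝ) 1))) =
      (∫⁻ y, ‖k y‖ₑ * ‖y‖ₑ) * eLpNorm g p volume := by
    have hm : Measurable fun y : Eucl d => ‖k y‖ₑ * ‖y‖ₑ :=
      hkc.enorm.measurable.mul continuous_enorm.measurable
    have hm' : Measurable fun a : Eucl d × ℝ => ‖k a.1‖ₑ * ‖a.1‖ₑ * eLpNorm g p volume :=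
      (hm.comp measurable_fst).mul_const _
    rw [lintegral_prod _ hm'.aemeasurable]
    simp [lintegral_mul_const _ hm]
  rwa [hcalc] at h

theorem eLpNorm_kernelConv_propagator_le {C R₁ R₂ K : ℝ≥0} {k₁ k₂ : Eucl d → ℂ}
    (h₁ : IsKernelBound C R₁ k₁) (h₂ : IsKernelBound C R₂ k₂) {S : (Eucl d → ℂ) → Eucl d → ℂ}
    (hS : IsPropagator K S) {g : Eucl d → ℂ} (hg : IsTest g) {p : ℝ≥0∞} (hp : 1 ≤ p) :
    eLpNorm (kernelConv k₁ (S (kernelConv k₂ g))) p volume ≤ C * C * eLpNorm g p volume := by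
  have hu := isBC_kernelConv_of_isTest h₂.isBC hg
  have hSu := hS.isBC hu
  calc _ ≤ (∫⁻ y, ‖k₁ y‖ₑ) * eLpNorm (S (kernelConv k₂ g)) p volume :=
        eLpNorm_kernelConv_le h₁.isBC.continuous.measurable hSu.continuous.measurable
          (isBC_kernelConv_of_isBC h₁.integrable hSu).continuous hp
    _ ≤ C * ((∫⁻ y, ‖k₂ y‖ₑ) * eLpNorm g p volume) := by
        gcongr
        · exact h₁.l1_le
        · exact (hS.eLpNorm_le _ p hu hp).trans (eLpNorm_kernelConv_le
            h₂.isBC.continuous.measurable hg.measurable hu.continuous hp)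
    _ ≤ _ := by rw [mul_assoc]; gcongr; exact h₂.l1_le

/-- The zero-mean outer kernel sees only the gradient of what it acts on and gains `1/R₁`; the
gradient of the inner kernel costs `R₂`, and the propagator costs `K` in between. The bound is
useful when the outer frequency is the higher one. -/
theorem eLpNorm_kernelConv_propagator_le_ratio {C R₁ R₂ K : ℝ≥0} {k₁ k₂ : Eucl d → ℂ}
    (h₁ : IsKernelBound C R₁ k₁) (h0 : ∫ y, k₁ y = 0) (h₂ : IsKernelBound C R₂ k₂)
    {S : (Eucl d → ℂ) → Eucl d → ℂ} (hS : IsPropagator K S) {g : Eucl d → ℂ} (hg : IsTest g)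
    {p : ℝ≥0∞} (hp : 1 ≤ p) :
    eLpNorm (kernelConv k₁ (S (kernelConv k₂ g))) p volume ≤
      C * C * (K * (R₂ / R₁)) * eLpNorm g p volume := by
  have hu := isBC_kernelConv_of_isTest h₂.isBC hg
  have hSu := hS.isBC hu
  have hgn : IsTest fun y => ‖g y‖ :=
    ⟨hg.measurable.norm, hg.integrable.norm, by simpa using hg.bounded⟩
  have hkn : IsBC fun y => ‖fderiv ℝ k₂ y‖ :=
    ⟨h₂.isBC_fderiv.continuous.norm, by simpa using h₂.isBC_fderiv.bounded⟩
  have hG := isBC_kernelConv_of_isTest hkn hgn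
  obtain ⟨g', hg', hg0, hug, hle⟩ := hS.upper _ _ hu hG
    (fun x => integral_nonneg fun y => by positivity)
    (upperGradient_kernelConv h₂.isBC h₂.differentiable h₂.isBC_fderiv hg)
  calc _ ≤ (∫⁻ y, ‖k₁ y‖ₑ * ‖y‖ₑ) * eLpNorm g' p volume :=
        eLpNorm_kernelConv_le_of_upperGradient h₁.isBC h₁.integrable h0 hSu hg' hug hp
    _ ≤ (C / R₁) * (K * ((∫⁻ y, ‖fderiv ℝ k₂ y‖ₑ) * eLpNorm g p volume)) := by
        gcongr
        · exact h₁.moment_le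
        · refine (hle p hp).trans ?_
          gcongr
          have := eLpNorm_kernelConv_le hkn.continuous.measurable hgn.measurable hG.continuous hp
          simpa using this
    _ ≤ (C / R₁) * (K * ((C * R₂) * eLpNorm g p volume)) := by gcongr; exact h₂.grad_le
    _ = _ := by simp only [div_eq_mul_inv]; ring

/-- The complementary case, useful when the inner frequency is the higher one: pairing with a test
function exchanges the two kernels and replaces `S'` by `S`, so the previous bound applies in the
conjugate exponent. -/
theorem eLpNorm_kernelConv_propagator_le_ratio' {C R₁ R₂ K : ℝ≥0} {k₁ k₂ : Eucl d → ℂ}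
    (h₁ : IsKernelBound C R₁ k₁) (h₂ : IsKernelBound C R₂ k₂) (h0 : ∫ y, k₂ y = 0)
    {S S' : (Eucl d → ℂ) → Eucl d → ℂ} (hS : IsPropagatorPair K S S')
    {g : Eucl d → ℂ} (hg : IsTest g) {p : ℝ≥0∞} (hp : 1 ≤ p) :
    eLpNorm (kernelConv k₁ (S' (kernelConv k₂ g))) p volume ≤
      C * C * (K * (R₁ / R₂)) * eLpNorm g p volume := by
  have hpq := ENNReal.HolderConjugate.conjExponent hp
  have hq : 1 ≤ p.conjExponent := @ENNReal.HolderConjugate.one_le _ _ hpq.symm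
  have hu := isBC_kernelConv_of_isTest h₂.isBC hg
  have hui := (isTest_kernelConv h₂.isBC h₂.integrable hg).integrable
  have hSu := hS.right.isBC hu
  have hSi := hS.right.integrable hu hui
  refine eLpNorm_le_of_forall_integral_mul_le p p.conjExponent
    (isBC_kernelConv_of_isBC h₁.integrable hSu).continuous fun w hw => ?_
  obtain ⟨M, hM⟩ := hSu.bounded
  obtain ⟨M', hM'⟩ := hg.bounded
  have hw1 := isBC_kernelConv_of_isTest h₁.isBC hw
  have hw1i := (isTest_kernelConv h₁.isBC h₁.integrable hw).integrable
  have hSw := isBC_kernelConv_of_isBC h₂.integrable (hS.left.isBC hw1)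
  have e : ∫ x, kernelConv k₁ (S' (kernelConv k₂ g)) x * w x =
      ∫ x, g x * kernelConv k₂ (S (kernelConv k₁ w)) x := by
    rw [integral_kernelConv_mul h₁.isBC.continuous h₁.integrable h₁.even
      hSu.continuous.measurable hM hw.integrable, hS.symm hw1 hu hui,
      integral_kernelConv_mul h₂.isBC.continuous h₂.integrable h₂.even hg.measurable hM'
      (hS.left.integrable hw1 hw1i)]
  rw [e]
  calc _ ≤ eLpNorm g p volume * eLpNorm (kernelConv k₂ (S (kernelConv k₁ w))) p.conjExponent volume :=
        enorm_integral_mul_le_eLpNorm_mul p _ hg.measurable.aestronglyMeasurable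
          hSw.continuous.aestronglyMeasurable
    _ ≤ eLpNorm g p volume *
        (C * C * (K * (R₁ / R₂)) * eLpNorm w p.conjExponent volume) := by
        gcongr
        exact eLpNorm_kernelConv_propagator_le_ratio h₂ h0 h₁ hS.left hw hq
    _ = _ := by ring

/-! ### Convolution kernels of Fourier multipliers -/

/-- The symbol of a multiplier as a Schwartz function, in the variable of Mathlib's Fourier
transform. -/
noncomputable def symbolSchwartz {σ : Eucl d → ℝ} (hs : ContDiff ℝ ∞ σ) (hc : HasCompactSupport σ) :
    𝓢(Eucl d, ℂ) :=
  HasCompactSupport.toSchwartzMap (f := fun η : Eucl d => ((σ ((2 * Real.pi) • η) : ℝ) : ℂ))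
    (by
      have h1 : HasCompactSupport fun η : Eucl d => σ ((2 * Real.pi) • η) :=
        hc.comp_homeomorph (Homeomorph.smulOfNeZero (2 * Real.pi) (by positivity))
      exact h1.comp_left (g := fun a : ℝ => (a : ℂ)) (by simp))
    (Complex.ofRealCLM.contDiff.comp (hs.comp (contDiff_const_smul _)))

theorem symbolSchwartz_apply {σ : Eucl d → ℝ} (hs : ContDiff ℝ ∞ σ) (hc : HasCompactSupport σ)
    (η : Eucl d) : symbolSchwartz hs hc η = ((σ ((2 * Real.pi) • η) : ℝ) : ℂ) := rfl

/-- The convolution kernel of a multiplier as a Schwartz function. -/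
noncomputable def kernelSchwartz {σ : Eucl d → ℝ} (hs : ContDiff ℝ ∞ σ) (hc : HasCompactSupport σ) :
    𝓢(Eucl d, ℂ) := 𝓕⁻ (symbolSchwartz hs hc)

theorem coe_kernelSchwartz {σ : Eucl d → ℝ} (hs : ContDiff ℝ ∞ σ)
    (hc : HasCompactSupport σ) : ⇑(kernelSchwartz hs hc) = multiplierKernel σ := by
  rw [kernelSchwartz, SchwartzMap.fourierInv_coe]; rfl

theorem fourier_multiplierKernel {σ : Eucl d → ℝ} (hs : ContDiff ℝ ∞ σ)
    (hc : HasCompactSupport σ) (η : Eucl d) :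
    𝓕 (multiplierKernel σ) η = ((σ ((2 * Real.pi) • η) : ℝ) : ℂ) := by
  rw [← coe_kernelSchwartz hs hc, ← SchwartzMap.fourier_coe]
  simp [kernelSchwartz, symbolSchwartz_apply]

theorem integrable_multiplierKernel {σ : Eucl d → ℝ} (hs : ContDiff ℝ ∞ σ)
    (hc : HasCompactSupport σ) : Integrable (multiplierKernel σ) := by
  rw [← coe_kernelSchwartz hs hc]; exact SchwartzMap.integrable _

theorem integral_multiplierKernel {σ : Eucl d → ℝ} (hs : ContDiff ℝ ∞ σ)
    (hc : HasCompactSupport σ) : ∫ y, multiplierKernel σ y = σ 0 := by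
  have := fourier_multiplierKernel hs hc 0
  rw [Real.fourier_eq] at this
  simpa using this

theorem multiplierKernel_neg {σ : Eucl d → ℝ} (he : ∀ ξ, σ (-ξ) = σ ξ) (x : Eucl d) :
    multiplierKernel σ (-x) = multiplierKernel σ x := by
  unfold multiplierKernel
  rw [Real.fourierInv_eq, Real.fourierInv_eq, ← integral_neg_eq_self]
  congr 1; ext η
  rw [inner_neg_neg, smul_neg, he]

theorem isBC_schwartz {F : Type*} [NormedAddCommGroup F] [NormedSpace ℝ F] (h : 𝓢(Eucl d, F)) :
    IsBC (h : Eucl d → F) := by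
  refine ⟨h.continuous, ?_⟩
  obtain ⟨C, _, hC⟩ := h.decay 0 0
  exact ⟨C, fun x => by simpa using hC x⟩

theorem multiplierKernel_comp_smul (σ : Eucl d → ℝ) {R : ℝ} (hR : 0 < R) (x : Eucl d) :
    multiplierKernel (fun ξ => σ (R⁻¹ • ξ)) x = (R ^ d : ℝ) • multiplierKernel σ (R • x) := by
  unfold multiplierKernel
  rw [Real.fourierInv_eq, Real.fourierInv_eq]
  have := Measure.integral_comp_smul (volume : Measure (Eucl d))
    (fun η => 𝐞 (inner ℝ η (R • x)) • ((σ ((2 * Real.pi) • η) : ℝ) : ℂ)) R⁻¹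
  simp only [finrank_euclideanSpace, Fintype.card_fin, inv_pow, inv_inv] at this
  rw [abs_of_pos (by positivity)] at this
  rw [← this]
  congr 1; ext η
  rw [inner_smul_left, inner_smul_right, smul_comm (2 * Real.pi)]
  simp only [conj_trivial]
  rw [← mul_assoc, inv_mul_cancel₀ hR.ne', one_mul]

theorem lintegral_comp_smul_eucl {F : Eucl d → ℝ≥0∞} (hF : Measurable F) {R : ℝ} (hR : 0 < R) :
    ENNReal.ofReal (R ^ d) * ∫⁻ x, F (R • x) = ∫⁻ x, F x := by
  have h1 : Measurable fun x : Eucl d => R • x := by fun_prop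
  have := lintegral_map (μ := volume) hF h1
  rw [Measure.map_addHaar_smul _ hR.ne'] at this
  rw [← this, lintegral_smul_measure]
  simp only [finrank_euclideanSpace, Fintype.card_fin]
  rw [abs_of_pos (by positivity), smul_eq_mul, ← mul_assoc, ← ENNReal.ofReal_mul (by positivity),
    mul_inv_cancel₀ (by positivity)]
  simp

/-- All three integrals are scale invariant up to the displayed power of `R`, so one constant, built
from a fixed Schwartz function, serves every scale. -/
theorem isKernelBound_smul (h : 𝓢(Eucl d, ℂ)) (heven : ∀ x, h (-x) = h x) :
    ∃ C : ℝ≥0, ∀ R : ℝ≥0, 0 < R →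
      IsKernelBound C R (fun x => ((R : ℝ) ^ d) • h ((R : ℝ) • x)) := by
  have hbc := isBC_schwartz h
  set h' : 𝓢(Eucl d, Eucl d →L[ℝ] ℂ) := SchwartzMap.fderivCLM ℝ (Eucl d) ℂ h with hh'
  have hh'' : ∀ x, fderiv ℝ h x = h' x := fun x => by simp [hh']
  have hbc' := isBC_schwartz h'
  have i1 : ∫⁻ y, ‖h y‖ₑ < ⊤ := (SchwartzMap.integrable (μ := volume) h).2
  have i2 : ∫⁻ y, ‖h y‖ₑ * ‖y‖ₑ < ⊤ := by
    have := (SchwartzMap.integrable_pow_mul volume h 1).2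
    rw [hasFiniteIntegral_iff_enorm] at this
    simpa [enorm_mul, mul_comm] using this
  have i3 : ∫⁻ y, ‖h' y‖ₑ < ⊤ := (SchwartzMap.integrable (μ := volume) h').2
  refine ⟨(∫⁻ y, ‖h y‖ₑ).toNNReal + (∫⁻ y, ‖h y‖ₑ * ‖y‖ₑ).toNNReal + (∫⁻ y, ‖h' y‖ₑ).toNNReal,
    fun R hR => ?_⟩
  have hR' : (0 : ℝ) < R := hR
  have hRe : ENNReal.ofReal (R : ℝ) = R := ENNReal.ofReal_coe_nnreal
  have hRd : ‖(R : ℝ) ^ d‖ₑ = ENNReal.ofReal ((R : ℝ) ^ d) := by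
    rw [← ofReal_norm, Real.norm_of_nonneg (by positivity)]
  have hRn : ‖(R : ℝ)‖ₑ = R := by
    rw [← ofReal_norm, Real.norm_of_nonneg hR'.le, hRe]
  have hsm : ∀ x : Eucl d, HasFDerivAt (fun x : Eucl d => (R : ℝ) • x)
      ((R : ℝ) • ContinuousLinearMap.id ℝ (Eucl d)) x := fun x =>
    (hasFDerivAt_id x).const_smul (R : ℝ)
  have hfd : fderiv ℝ (fun x => ((R : ℝ) ^ d) • h ((R : ℝ) • x)) =
      fun x => (((R : ℝ) ^ d) * R) • h' ((R : ℝ) • x) := by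
    ext1 x
    have h1 := ((h.differentiableAt (x := (R : ℝ) • x)).hasFDerivAt.comp x (hsm x)).const_smul
      ((R : ℝ) ^ d)
    have h2 := h1.fderiv
    rw [hh''] at h2
    refine Eq.trans h2 ?_
    rw [ContinuousLinearMap.comp_smul, ContinuousLinearMap.comp_id, smul_smul]
  refine ⟨⟨?_, ?_⟩, ?_, fun x => by simp [heven], ?_, ?_, ?_, ?_, ?_⟩
  · have := hbc.continuous; fun_prop
  · obtain ⟨M, hM⟩ := hbc.bounded
    refine ⟨(R : ℝ) ^ d * M, fun x => ?_⟩
    rw [norm_smul, Real.norm_of_nonneg (by positivity)]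
    gcongr; exact hM _
  · exact ((SchwartzMap.integrable (μ := volume) h).comp_smul hR'.ne').smul ((R : ℝ) ^ d)
  · exact ((h.smooth 1).comp (contDiff_const_smul _)).const_smul _
  · rw [hfd]
    obtain ⟨M, hM⟩ := hbc'.bounded
    refine ⟨by have := hbc'.continuous; fun_prop, (R : ℝ) ^ d * R * M, fun x => ?_⟩
    rw [norm_smul, Real.norm_of_nonneg (by positivity)]
    gcongr; exact hM _
  · simp_rw [enorm_smul, hRd]
    rw [lintegral_const_mul' _ _ ENNReal.ofReal_ne_top,
      lintegral_comp_smul_eucl (F := fun x => ‖h x‖ₑ) hbc.continuous.enorm.measurable hR']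
    push_cast
    rw [ENNReal.coe_toNNReal i1.ne]
    exact le_add_right (le_add_right le_rfl)
  · have e : ∀ y : Eucl d, ‖((R : ℝ) ^ d) • h ((R : ℝ) • y)‖ₑ * ‖y‖ₑ =
        ENNReal.ofReal ((R : ℝ) ^ d) * ((R : ℝ≥0∞)⁻¹ * (‖h ((R : ℝ) • y)‖ₑ * ‖(R : ℝ) • y‖ₑ)) := by
      intro y
      rw [enorm_smul, hRd, enorm_smul, hRn]
      have : (R : ℝ≥0∞)⁻¹ * R = 1 := ENNReal.inv_mul_cancel (by exact_mod_cast hR.ne') (by simp)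
      calc _ = ENNReal.ofReal ((R : ℝ) ^ d) * (((R : ℝ≥0∞)⁻¹ * R) * (‖h ((R : ℝ) • y)‖ₑ * ‖y‖ₑ)) := by
            rw [this]; ring
        _ = _ := by ring
    simp_rw [e]
    rw [lintegral_const_mul' _ _ ENNReal.ofReal_ne_top, lintegral_const_mul' _ _ (by simp [hR.ne']),
      mul_left_comm, lintegral_comp_smul_eucl (F := fun x => ‖h x‖ₑ * ‖x‖ₑ)
        (hbc.continuous.enorm.measurable.mul continuous_enorm.measurable) hR',
      div_eq_mul_inv, mul_comm]
    push_cast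
    rw [ENNReal.coe_toNNReal i2.ne]
    gcongr
    exact le_add_right (le_add_left le_rfl)
  · rw [hfd]
    simp_rw [enorm_smul, enorm_mul, hRd, hRn]
    have e : ∀ y : Eucl d, ENNReal.ofReal ((R : ℝ) ^ d) * R * ‖h' ((R : ℝ) • y)‖ₑ =
        ENNReal.ofReal ((R : ℝ) ^ d) * (R * ‖h' ((R : ℝ) • y)‖ₑ) := fun y => mul_assoc _ _ _
    simp_rw [e]
    rw [lintegral_const_mul' _ _ ENNReal.ofReal_ne_top, lintegral_const_mul' _ _ (by simp),
      mul_left_comm, lintegral_comp_smul_eucl (F := fun x => ‖h' x‖ₑ)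
        hbc'.continuous.enorm.measurable hR', mul_comm]
    push_cast
    rw [ENNReal.coe_toNNReal i3.ne]
    gcongr
    exact le_add_left le_rfl

/-- Absorbs the shift of the block index: the block of index `q + 1` lives at frequency `2^q` but is
to be recorded at scale `2^{q+1}`. -/
theorem IsKernelBound.double {C R : ℝ≥0} {k : Eucl d → ℂ} (h : IsKernelBound C R k) :
    IsKernelBound (2 * C) (2 * R) k where
  isBC := h.isBC
  integrable := h.integrable
  even := h.even
  differentiable := h.differentiable
  isBC_fderiv := h.isBC_fderiv
  l1_le := h.l1_le.trans (by exact_mod_cast le_mul_of_one_le_left (zero_le) one_le_two)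
  moment_le := h.moment_le.trans (le_of_eq (by
    push_cast
    rw [ENNReal.mul_div_mul_left _ _ (by simp) (by simp)]))
  grad_le := h.grad_le.trans (by
    have : (C * R : ℝ≥0) ≤ 2 * C * (2 * R) := by
      have := zero_le (a := C * R)
      calc C * R ≤ 4 * (C * R) := le_mul_of_one_le_left this (by norm_num)
        _ = _ := by ring
    exact_mod_cast this)

theorem IsKernelBound.mono {C C' R : ℝ≥0} {k : Eucl d → ℂ} (h : IsKernelBound C R k)
    (hC : C ≤ C') : IsKernelBound C' R k where
  isBC := h.isBC
  integrable := h.integrable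
  even := h.even
  differentiable := h.differentiable
  isBC_fderiv := h.isBC_fderiv
  l1_le := h.l1_le.trans (by gcongr)
  moment_le := h.moment_le.trans (by gcongr)
  grad_le := h.grad_le.trans (by gcongr)

theorem kernelConv_kernelConv {k₁ k₂ u : Eucl d → ℂ} (h1 : Continuous k₁) (h1i : Integrable k₁)
    (h2 : Continuous k₂) (h2i : Integrable k₂) (hu : Measurable u) {M : ℝ} (hM : ∀ x, ‖u x‖ ≤ M)
    (x : Eucl d) : kernelConv k₁ (kernelConv k₂ u) x = kernelConv (kernelConv k₁ k₂) u x := by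
  have hI : Integrable (fun a : Eucl d × Eucl d => k₁ (x - a.1) * (k₂ (a.1 - a.2) * u a.2))
      (volume.prod volume) := by
    have hI1 : Integrable (fun a : Eucl d × Eucl d => k₁ (x - a.1) * k₂ (a.1 - a.2))
        (volume.prod volume) := by
      rw [integrable_prod_iff (by fun_prop : Continuous _).aestronglyMeasurable]
      refine ⟨Eventually.of_forall fun y => (h2i.comp_sub_left y).const_mul (k₁ (x - y)), ?_⟩
      simp_rw [norm_mul, integral_const_mul, integral_sub_left_eq_self (fun y => ‖k₂ y‖)]
      exact (h1i.comp_sub_left x).norm.mul_const _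
    have := hI1.mul_bdd (c := M) (hu.comp measurable_snd).aestronglyMeasurable
      (Eventually.of_forall fun a => hM _)
    simpa [mul_assoc] using this
  calc _ = ∫ y, ∫ z, k₁ (x - y) * (k₂ (y - z) * u z) := by
        simp_rw [integral_const_mul]; rfl
    _ = ∫ z, ∫ y, k₁ (x - y) * (k₂ (y - z) * u z) := integral_integral_swap hI
    _ = _ := by
        rw [kernelConv]
        congr 1; ext z
        rw [kernelConv, ← integral_mul_const, ← integral_add_right_eq_self _ z]
        congr 1; ext y
        rw [add_sub_cancel_right, ← mul_assoc, sub_add_eq_sub_sub_swap]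

theorem kernelConv_multiplierKernel {σ₁ σ₂ : Eucl d → ℝ} (hs₁ : ContDiff ℝ ∞ σ₁)
    (hc₁ : HasCompactSupport σ₁) (hs₂ : ContDiff ℝ ∞ σ₂) (hc₂ : HasCompactSupport σ₂) :
    kernelConv (multiplierKernel σ₁) (multiplierKernel σ₂) =
      multiplierKernel (fun ξ => σ₁ ξ * σ₂ ξ) := by
  have i1 := integrable_multiplierKernel hs₁ hc₁
  have i2 := integrable_multiplierKernel hs₂ hc₂
  have b1 : IsBC (multiplierKernel σ₁) := by
    rw [← coe_kernelSchwartz hs₁ hc₁]; exact isBC_schwartz _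
  have b2 : IsBC (multiplierKernel σ₂) := by
    rw [← coe_kernelSchwartz hs₂ hc₂]; exact isBC_schwartz _
  have ht : IsTest (multiplierKernel σ₂) := ⟨b2.continuous.measurable, i2, b2.bounded⟩
  have hconv : kernelConv (multiplierKernel σ₁) (multiplierKernel σ₂) =
      convolution (multiplierKernel σ₁) (multiplierKernel σ₂) (ContinuousLinearMap.mul ℂ ℂ)
        volume := by
    ext x; rw [kernelConv_eq]; rfl
  have hF : 𝓕 (kernelConv (multiplierKernel σ₁) (multiplierKernel σ₂)) =
      fun η => ((σ₁ ((2 * Real.pi) • η) * σ₂ ((2 * Real.pi) • η) : ℝ) : ℂ) := by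
    ext η
    rw [hconv, Real.fourier_mul_convolution_eq i1 i2, fourier_multiplierKernel hs₁ hc₁,
      fourier_multiplierKernel hs₂ hc₂]
    push_cast; rfl
  have hk := isTest_kernelConv b1 i1 ht
  have := (isBC_kernelConv_of_isTest b1 ht).continuous.fourierInv_fourier_eq hk.integrable (by
    rw [hF]
    exact SchwartzMap.integrable (symbolSchwartz (hs₁.mul hs₂) (hc₁.mul_right)))
  rw [← this, hF]
  rfl

/-! ### Dyadic blocks -/

/-- The convolution kernel of a dyadic block. -/
noncomputable def blockKernel (P : DyadicPartition d) (j : ℕ) : Eucl d → ℂ :=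
  multiplierKernel (P.symbol j)

theorem DyadicPartition.symbol_smooth (P : DyadicPartition d) (j : ℕ) :
    ContDiff ℝ ∞ (P.symbol j) := by
  cases j with
  | zero => exact P.χ_smooth
  | succ q => exact P.φ_smooth.comp (contDiff_const_smul _)

theorem hasCompactSupport_comp_smul {σ : Eucl d → ℝ} (h : HasCompactSupport σ) {R : ℝ}
    (hR : R ≠ 0) : HasCompactSupport fun ξ => σ (R • ξ) :=
  HasCompactSupport.comp_homeomorph h (Homeomorph.smulOfNeZero (G₀ := ℝ) (α := Eucl d) R hR)

theorem DyadicPartition.symbol_compact (P : DyadicPartition d) (j : ℕ) :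
    HasCompactSupport (P.symbol j) := by
  cases j with
  | zero => exact P.χ_compact
  | succ q => exact hasCompactSupport_comp_smul P.φ_compact (by positivity)

theorem DyadicPartition.symbol_succ_zero (P : DyadicPartition d) (q : ℕ) :
    P.symbol (q + 1) 0 = 0 := by
  simp only [DyadicPartition.symbol, smul_zero]
  exact image_eq_zero_of_notMem_tsupport P.φ_support

theorem DyadicPartition.hasSum_symbol (P : DyadicPartition d) (ξ : Eucl d) :
    HasSum (fun j => P.symbol j ξ) 1 := by
  rw [← hasSum_nat_add_iff' 1]
  simpa [DyadicPartition.symbol] using P.partition ξ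

theorem DyadicPartition.symbol_mul_eq_zero (P : DyadicPartition d) {i j : ℕ} (h : i + 2 ≤ j)
    (ξ : Eucl d) : P.symbol i ξ * P.symbol j ξ = 0 := by
  have key : Disjoint (tsupport (P.symbol i)) (tsupport (P.symbol j)) := by
    obtain ⟨q, rfl⟩ : ∃ q, j = q + 1 := ⟨j - 1, by omega⟩
    cases i with
    | zero => exact P.disjoint_χ_φ q (by omega)
    | succ m => exact P.disjoint_φ_φ m q (by rw [abs_sub_comm, abs_of_nonneg] <;> omega)
  by_contra hne
  exact Set.disjoint_left.1 key (subset_tsupport _ (left_ne_zero_of_mul hne))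
    (subset_tsupport _ (right_ne_zero_of_mul hne))

/-- Where the symbol of index `q` is nonzero only its neighbours can be nonzero, so these already
sum to one. For `q = 0` the truncated subtraction makes the range `{0, 1}`, as it should be. -/
theorem DyadicPartition.sum_near_mul_symbol (P : DyadicPartition d) (q : ℕ) (ξ : Eucl d) :
    ∑ i ∈ Finset.Icc (q - 1) (q + 1), P.symbol i ξ * P.symbol q ξ = P.symbol q ξ := by
  by_cases h0 : P.symbol q ξ = 0
  · simp [h0]
  rw [← Finset.sum_mul]
  have h1 := P.hasSum_symbol ξ
  have h2 : HasSum (fun j => P.symbol j ξ) (∑ i ∈ Finset.Icc (q - 1) (q + 1), P.symbol i ξ) := by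
    refine hasSum_sum_of_ne_finset_zero fun i hi => ?_
    rw [Finset.mem_Icc, not_and_or, not_le, not_le] at hi
    rcases hi with hi | hi
    · exact (mul_eq_zero.1 (P.symbol_mul_eq_zero (i := i) (j := q) (by omega) ξ)).resolve_right h0
    · exact (mul_eq_zero.1 (P.symbol_mul_eq_zero (i := q) (j := i) (by omega) ξ)).resolve_left h0
  rw [h2.unique h1, one_mul]

/-- The partition of unity at the dilated point `2^{-N} ξ` has the blocks of index above `N` as its
tail; comparing it with the partition at `ξ` leaves the low-frequency cutoff. -/
theorem DyadicPartition.sum_range_symbol (P : DyadicPartition d) (N : ℕ) (ξ : Eucl d) :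
    ∑ i ∈ Finset.range (N + 1), P.symbol i ξ = P.χ (((2 : ℝ) ^ N)⁻¹ • ξ) := by
  have h1 := (hasSum_nat_add_iff' (N + 1)).2 (P.hasSum_symbol ξ)
  have h2 := P.partition (((2 : ℝ) ^ N)⁻¹ • ξ)
  have h3 : (fun q : ℕ => P.φ ((2 : ℝ) ^ (-(q : ℤ)) • ((2 : ℝ) ^ N)⁻¹ • ξ)) =
      fun n => P.symbol (n + (N + 1)) ξ := by
    ext q
    rw [← add_assoc]
    simp only [DyadicPartition.symbol]
    congr 1
    rw [smul_smul]
    congr 1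
    rw [← zpow_natCast, ← zpow_neg, ← zpow_add₀ two_ne_zero]
    congr 1
    push_cast; ring
  rw [h3] at h2
  have := h1.unique h2
  linarith

theorem DyadicPartition.χ_zero (P : DyadicPartition d) : P.χ 0 = 1 := by
  have := P.sum_range_symbol 0 0
  have h2 := P.partition 0
  have h3 : P.φ 0 = 0 := image_eq_zero_of_notMem_tsupport P.φ_support
  simp only [smul_zero, h3] at h2
  linarith [h2.unique hasSum_zero]

theorem exists_isKernelBound_multiplierKernel {σ : Eucl d → ℝ} (hs : ContDiff ℝ ∞ σ)
    (hc : HasCompactSupport σ) (he : ∀ ξ, σ (-ξ) = σ ξ) :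
    ∃ C : ℝ≥0, ∀ n : ℕ, IsKernelBound C (2 ^ n)
      (multiplierKernel (fun ξ => σ (((2 : ℝ) ^ n)⁻¹ • ξ))) := by
  obtain ⟨C, hC⟩ := isKernelBound_smul (kernelSchwartz hs hc)
    (fun x => by rw [coe_kernelSchwartz]; exact multiplierKernel_neg he x)
  refine ⟨C, fun n => ?_⟩
  have h := hC (2 ^ n) (by positivity)
  rw [coe_kernelSchwartz] at h
  convert h using 1
  ext x
  rw [multiplierKernel_comp_smul _ (by positivity)]
  simp

theorem DyadicPartition.exists_isKernelBound (P : DyadicPartition d) :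
    ∃ C : ℝ≥0, ∀ j, IsKernelBound C (2 ^ j) (blockKernel P j) := by
  obtain ⟨C₁, h₁⟩ := exists_isKernelBound_multiplierKernel P.χ_smooth P.χ_compact
    (fun ξ => P.χ_radial _ _ (norm_neg ξ))
  obtain ⟨C₂, h₂⟩ := exists_isKernelBound_multiplierKernel P.φ_smooth P.φ_compact
    (fun ξ => P.φ_radial _ _ (norm_neg ξ))
  refine ⟨C₁ + 2 * C₂, fun j => ?_⟩
  cases j with
  | zero =>
    have := h₁ 0
    simp only [pow_zero, inv_one, one_smul] at this
    rw [pow_zero]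
    exact this.mono (by simp)
  | succ q =>
    have := (h₂ q).double
    rw [← pow_succ'] at this
    refine IsKernelBound.mono (C := 2 * C₂) ?_ (by simp)
    convert this using 1
    unfold blockKernel
    congr 1
    ext ξ
    simp [DyadicPartition.symbol]

theorem integral_blockKernel_succ (P : DyadicPartition d) (q : ℕ) :
    ∫ y, blockKernel P (q + 1) y = 0 := by
  rw [blockKernel, integral_multiplierKernel (P.symbol_smooth _) (P.symbol_compact _),
    P.symbol_succ_zero]
  simp

theorem multiplierKernel_sum (s : Finset ℕ) (σ : ℕ → Eucl d → ℝ) (hs : ∀ i, ContDiff ℝ ∞ (σ i))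
    (hc : ∀ i, HasCompactSupport (σ i)) (x : Eucl d) :
    multiplierKernel (fun ξ => ∑ i ∈ s, σ i ξ) x = ∑ i ∈ s, multiplierKernel (σ i) x := by
  unfold multiplierKernel
  simp_rw [Real.fourierInv_eq]
  rw [← integral_finsetSum]
  · congr 1; ext η
    push_cast
    rw [Finset.smul_sum]
  · intro i _
    have := (SchwartzMap.integrable (μ := volume) (symbolSchwartz (hs i) (hc i)))
    refine this.norm.mono' ?_ (Eventually.of_forall fun η => ?_)
    · have h1 := (symbolSchwartz (hs i) (hc i)).continuous
      have h2 : Continuous fun η : Eucl d => 𝐞 (inner ℝ η x) :=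
        Real.continuous_fourierChar.comp (by fun_prop)
      exact (h2.smul h1).aestronglyMeasurable
    · rw [Circle.norm_smul]; rfl

theorem sum_near_kernelConv_dyadicBlock (P : DyadicPartition d) (q : ℕ) {u : Eucl d → ℂ}
    (hu : Measurable u) {M : ℝ} (hM : ∀ x, ‖u x‖ ≤ M) (x : Eucl d) :
    ∑ i ∈ Finset.Icc (q - 1) (q + 1),
      kernelConv (blockKernel P i) (kernelConv (blockKernel P q) u) x =
      kernelConv (blockKernel P q) u x := by
  obtain ⟨C, hC⟩ := P.exists_isKernelBound
  have hi : ∀ i, Integrable fun y => kernelConv (blockKernel P i) (blockKernel P q) (x - y) * u y := by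
    intro i
    have ht := isTest_kernelConv (hC i).isBC (hC i).integrable
      ⟨(hC q).isBC.continuous.measurable, (hC q).integrable, (hC q).isBC.bounded⟩
    exact (ht.integrable.comp_sub_left x).mul_bdd (c := M) hu.aestronglyMeasurable
      (Eventually.of_forall hM)
  simp_rw [fun i => kernelConv_kernelConv (hC i).isBC.continuous (hC i).integrable
    (hC q).isBC.continuous (hC q).integrable hu hM x]
  simp only [kernelConv] at hi ⊢
  rw [← integral_finsetSum _ fun i _ => hi i]
  congr 1; ext y
  rw [← Finset.sum_mul]
  congr 1
  have := multiplierKernel_sum (Finset.Icc (q - 1) (q + 1)) (fun i ξ => P.symbol i ξ * P.symbol q ξ)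
    (fun i => (P.symbol_smooth i).mul (P.symbol_smooth q))
    (fun i => (P.symbol_compact i).mul_right) (x - y)
  simp_rw [P.sum_near_mul_symbol] at this
  rw [blockKernel, this]
  refine Finset.sum_congr rfl fun i _ => ?_
  rw [← kernelConv_multiplierKernel (P.symbol_smooth i) (P.symbol_compact i) (P.symbol_smooth q)
    (P.symbol_compact q)]
  rfl

/-- The partial sum is convolution with a kernel of total mass one and first moment `O(2^{-N})`. A
Lipschitz bound thus gives uniform convergence of the decomposition even though `u` is merely
bounded and need not lie in any `L^p` with finite `p`. -/
theorem exists_norm_sum_kernelConv_sub_le (P : DyadicPartition d) :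
    ∃ C : ℝ≥0, ∀ (u : Eucl d → ℂ) (L : ℝ), IsBC u → 0 ≤ L → (∀ x y, ‖u x - u y‖ ≤ L * ‖x - y‖) →
      ∀ (N : ℕ) (x : Eucl d),
      ‖∑ i ∈ Finset.range (N + 1), kernelConv (blockKernel P i) u x - u x‖ ≤ L * (C / 2 ^ N) := by
  obtain ⟨C, hC⟩ := exists_isKernelBound_multiplierKernel P.χ_smooth P.χ_compact
    (fun ξ => P.χ_radial _ _ (norm_neg ξ))
  obtain ⟨C', hC'⟩ := P.exists_isKernelBound
  refine ⟨C, fun u L hu hL0 hL N x => ?_⟩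
  obtain ⟨M, hM⟩ := hu.bounded
  have hK := hC N
  set k := multiplierKernel (fun ξ => P.χ (((2 : ℝ) ^ N)⁻¹ • ξ)) with hk
  have hsum : ∀ y, ∑ i ∈ Finset.range (N + 1), blockKernel P i y = k y := by
    intro y
    have := multiplierKernel_sum (Finset.range (N + 1)) (fun i => P.symbol i)
      P.symbol_smooth P.symbol_compact y
    simp_rw [P.sum_range_symbol] at this
    rw [hk, this]
    rfl
  have hone : ∫ y, k y = 1 := by
    have hs : ContDiff ℝ ∞ fun ξ : Eucl d => P.χ (((2 : ℝ) ^ N)⁻¹ • ξ) :=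
      P.χ_smooth.comp (contDiff_const_smul _)
    have := integral_multiplierKernel hs
      (hasCompactSupport_comp_smul P.χ_compact (inv_ne_zero (by positivity)))
    rw [hk, this]
    simp [P.χ_zero]
  have hint : ∀ k : Eucl d → ℂ, Integrable k → Integrable fun y => k y * u (x - y) := fun k hk =>
    hk.mul_bdd (c := M) (by have := hu.continuous; fun_prop : Continuous fun y => u (x - y)).aestronglyMeasurable
      (Eventually.of_forall fun y => hM _)
  have e : ∑ i ∈ Finset.range (N + 1), kernelConv (blockKernel P i) u x - u x =
      ∫ y, k y * (u (x - y) - u x) := by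
    simp_rw [mul_sub]
    rw [integral_sub (hint k hK.integrable) (hK.integrable.mul_const _), integral_mul_const, hone,
      one_mul]
    congr 1
    simp_rw [kernelConv_eq]
    rw [← integral_finsetSum _ fun i _ => hint _ (hC' i).integrable]
    congr 1; ext y
    rw [← Finset.sum_mul, hsum]
  have hmom : Integrable fun y => ‖k y‖ * ‖y‖ := by
    refine ⟨(by have := hK.isBC.continuous; fun_prop : Continuous fun y => ‖k y‖ * ‖y‖).aestronglyMeasurable, ?_⟩
    rw [hasFiniteIntegral_iff_enorm]
    simp_rw [enorm_mul, enorm_norm]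
    refine hK.moment_le.trans_lt (ENNReal.div_lt_top (by simp) (by simp))
  have hmle : ∫ y, ‖k y‖ * ‖y‖ ≤ C / 2 ^ N := by
    rw [integral_eq_lintegral_of_nonneg_ae (Eventually.of_forall fun y => by positivity) hmom.1]
    refine ENNReal.toReal_le_of_le_ofReal (by positivity) ?_
    have h1 := hK.moment_le
    have h2 : ENNReal.ofReal ((C : ℝ) / 2 ^ N) = (C : ℝ≥0∞) / ((2 ^ N : ℝ≥0) : ℝ≥0∞) := by
      rw [ENNReal.ofReal_div_of_pos (by positivity)]
      congr 1
      · simp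
      · rw [ENNReal.ofReal_pow (by norm_num)]; simp
    rw [h2]
    simpa [ENNReal.ofReal_mul] using h1
  rw [e]
  calc _ ≤ ∫ y, L * (‖k y‖ * ‖y‖) := by
        refine norm_integral_le_of_norm_le (hmom.const_mul L) (Eventually.of_forall fun y => ?_)
        rw [norm_mul]
        have := hL (x - y) x
        rw [sub_sub_cancel_left, norm_neg] at this
        calc _ ≤ ‖k y‖ * (L * ‖y‖) := by gcongr
          _ = _ := by ring
    _ ≤ _ := by rw [integral_const_mul]; gcongr

/-! ### Almost-orthogonality of dyadic blocks and its logarithmic summation -/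

/-- The off-diagonal gain of a propagator with gradient constant `K`. -/
noncomputable def offDiagonal (K : ℝ≥0) (i j : ℕ) : ℝ≥0∞ := min 1 (K * (2⁻¹) ^ Nat.dist i j)

theorem offDiagonal_le_two_mul (K : ℝ≥0) {i q : ℕ} (j : ℕ) (h : Nat.dist q j ≤ Nat.dist i j + 1) :
    offDiagonal K i j ≤ 2 * offDiagonal K q j := by
  unfold offDiagonal
  rw [mul_min, mul_one]
  refine min_le_min one_le_two ?_
  have h2 : (2⁻¹ : ℝ≥0∞) ^ (Nat.dist i j) ≤ 2 * 2⁻¹ ^ Nat.dist q j := by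
    calc (2⁻¹ : ℝ≥0∞) ^ (Nat.dist i j) = 2 * 2⁻¹ ^ (Nat.dist i j + 1) := by
          rw [pow_succ, mul_comm, mul_assoc, ENNReal.inv_mul_cancel two_ne_zero (by simp), mul_one]
      _ ≤ _ := by
          gcongr 2 * ?_
          exact pow_le_pow_right_of_le_one' (by simp) h
  calc _ ≤ K * (2 * (2⁻¹ : ℝ≥0∞) ^ Nat.dist q j) := by gcongr
    _ = _ := by ring

theorem two_pow_div_two_pow {i j : ℕ} (h : i ≤ j) :
    (((2 ^ i : ℝ≥0) : ℝ≥0∞) / ((2 ^ j : ℝ≥0) : ℝ≥0∞)) = 2⁻¹ ^ (j - i) := by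
  obtain ⟨n, rfl⟩ := Nat.exists_eq_add_of_le h
  rw [Nat.add_sub_cancel_left]
  push_cast
  rw [pow_add, ENNReal.div_eq_inv_mul, ENNReal.mul_inv (by simp) (by simp), mul_right_comm,
    ENNReal.inv_mul_cancel (by simp) (by simp), one_mul, ENNReal.inv_pow]

/-- Of two distinct indices the larger is a successor, so its kernel has zero mean. If it is the
outer one the direct bound applies to `S'`, if it is the inner one the transposed bound applies. On
the diagonal the plain `L^p` bound suffices because `1 ≤ K`. -/
theorem exists_eLpNorm_block_propagator_block_le (P : DyadicPartition d) :
    ∃ C : ℝ≥0, ∀ (K : ℝ≥0) (S S' : (Eucl d → ℂ) → Eucl d → ℂ), 1 ≤ K → IsPropagatorPair K S S' →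
      ∀ (i j : ℕ) (g : Eucl d → ℂ) (p : ℝ≥0∞), IsTest g → 1 ≤ p →
      eLpNorm (kernelConv (blockKernel P i) (S' (kernelConv (blockKernel P j) g))) p volume ≤
        C * offDiagonal K i j * eLpNorm g p volume := by
  obtain ⟨C, hC⟩ := P.exists_isKernelBound
  refine ⟨C * C, fun K S S' hK hS i j g p hg hp => ?_⟩
  have h1 := eLpNorm_kernelConv_propagator_le (hC i) (hC j) hS.right hg hp
  have h2 : eLpNorm (kernelConv (blockKernel P i) (S' (kernelConv (blockKernel P j) g))) p volume ≤
      C * C * (K * 2⁻¹ ^ Nat.dist i j) * eLpNorm g p volume := by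
    rcases lt_trichotomy i j with h | h | h
    · obtain ⟨m, rfl⟩ : ∃ m, j = m + 1 := ⟨j - 1, by omega⟩
      have := eLpNorm_kernelConv_propagator_le_ratio' (hC i) (hC (m + 1))
        (integral_blockKernel_succ P m) hS hg hp
      rwa [two_pow_div_two_pow h.le, ← Nat.dist_eq_sub_of_le h.le] at this
    · subst h
      rw [Nat.dist_self, pow_zero, mul_one]
      refine h1.trans ?_
      calc _ = (C : ℝ≥0∞) * C * ((1 : ℝ≥0) : ℝ≥0∞) * eLpNorm g p volume := by simp
        _ ≤ _ := by gcongr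
    · obtain ⟨m, rfl⟩ : ∃ m, i = m + 1 := ⟨i - 1, by omega⟩
      have := eLpNorm_kernelConv_propagator_le_ratio (hC (m + 1))
        (integral_blockKernel_succ P m) (hC j) hS.right hg hp
      rwa [two_pow_div_two_pow h.le, ← Nat.dist_eq_sub_of_le_right h.le] at this
  unfold offDiagonal
  rcases min_choice (1 : ℝ≥0∞) (K * 2⁻¹ ^ Nat.dist i j) with h | h <;> rw [h]
  · simpa using h1
  · simpa using h2

/-- The functional that controls the pairing of `u` with a back-propagated dyadic block. -/
noncomputable def blockSum (P : DyadicPartition d) (p : ℝ≥0∞) (K : ℝ≥0) (j : ℕ) (u : Eucl d → ℝ) :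
    ℝ≥0∞ := ∑' q, offDiagonal K q j * eLpNorm (dyadicBlock P q u) p volume

/-- Decompose `u` into blocks, write each block as the sum of its re-localizations by neighbouring
blocks, and move the outer localization onto the back-propagated function, where the off-diagonal
gain is available. The Lipschitz constant of `u` serves only to justify the decomposition and does
not enter the bound. -/
theorem exists_enorm_integral_mul_propagator_block_le (P : DyadicPartition d) :
    ∃ C : ℝ≥0, ∀ (K : ℝ≥0) (S S' : (Eucl d → ℂ) → Eucl d → ℂ), 1 ≤ K → IsPropagatorPair K S S' →
      ∀ (j : ℕ) (g : Eucl d → ℂ) (p q : ℝ≥0∞), p.HolderConjugate q → IsTest g →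
      ∀ (u : Eucl d → ℝ) (L : ℝ), IsBC u → 0 ≤ L → (∀ x y, ‖u x - u y‖ ≤ L * ‖x - y‖) →
      ‖∫ x, (u x : ℂ) * S' (kernelConv (blockKernel P j) g) x‖ₑ ≤
        C * blockSum P p K j u * eLpNorm g q volume := by
  obtain ⟨C, hC⟩ := exists_eLpNorm_block_propagator_block_le P
  obtain ⟨C₁, hC₁⟩ := exists_norm_sum_kernelConv_sub_le P
  obtain ⟨C₂, hC₂⟩ := P.exists_isKernelBound
  -- Three neighbouring blocks, times the factor two lost when the index of the gain is moved to a
  -- neighbour.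
  refine ⟨6 * C, fun K S S' hK hS j g p q hpq hg u L hu hL0 hL => ?_⟩
  have hq : 1 ≤ q := @ENNReal.HolderConjugate.one_le _ _ hpq.symm
  obtain ⟨M, hM⟩ := hu.bounded
  set uc : Eucl d → ℂ := fun x => (u x : ℂ) with huc
  have hucBC : IsBC uc := ⟨Complex.continuous_ofReal.comp hu.continuous, M, fun x => by
    simpa [huc] using hM x⟩
  have hkg := isTest_kernelConv (hC₂ j).isBC (hC₂ j).integrable hg
  have hkgBC := isBC_kernelConv_of_isTest (hC₂ j).isBC hg
  set w := S' (kernelConv (blockKernel P j) g) with hw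
  have hwBC : IsBC w := hS.right.isBC hkgBC
  have hwi : Integrable w := hS.right.integrable hkgBC hkg.integrable
  obtain ⟨Mw, hMw⟩ := hwBC.bounded
  have hD : ∀ m, IsBC (kernelConv (blockKernel P m) uc) := fun m =>
    isBC_kernelConv_of_isBC (hC₂ m).integrable hucBC
  have hint : ∀ m, Integrable fun x => kernelConv (blockKernel P m) uc x * w x := by
    intro m
    obtain ⟨M', hM'⟩ := (hD m).bounded
    exact hwi.bdd_mul (hD m).continuous.aestronglyMeasurable (Eventually.of_forall hM')
  have hblock : ∀ m, ‖∫ x, kernelConv (blockKernel P m) uc x * w x‖ₑ ≤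
      6 * C * (offDiagonal K m j * eLpNorm (dyadicBlock P m u) p volume) * eLpNorm g q volume := by
    intro m
    obtain ⟨M', hM'⟩ := (hD m).bounded
    have e : ∫ x, kernelConv (blockKernel P m) uc x * w x =
        ∑ i ∈ Finset.Icc (m - 1) (m + 1),
          ∫ x, kernelConv (blockKernel P m) uc x * kernelConv (blockKernel P i) w x := by
      have h1 : ∀ i, Integrable fun x =>
          kernelConv (blockKernel P i) (kernelConv (blockKernel P m) uc) x * w x := by
        intro i
        have hb := isBC_kernelConv_of_isBC (hC₂ i).integrable (hD m)
        obtain ⟨M'', hM''⟩ := hb.bounded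
        exact hwi.bdd_mul hb.continuous.aestronglyMeasurable (Eventually.of_forall hM'')
      simp_rw [fun i => (integral_kernelConv_mul (hC₂ i).isBC.continuous (hC₂ i).integrable
        (hC₂ i).even (hD m).continuous.measurable hM' hwi).symm]
      rw [← integral_finsetSum _ fun i _ => h1 i]
      congr 1; ext x
      rw [← Finset.sum_mul, sum_near_kernelConv_dyadicBlock P m hucBC.continuous.measurable
        (M := M) (fun x => by simpa [huc] using hM x)]
    rw [e]
    calc _ ≤ ∑ i ∈ Finset.Icc (m - 1) (m + 1),
          ‖∫ x, kernelConv (blockKernel P m) uc x * kernelConv (blockKernel P i) w x‖ₑ :=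
          enorm_sum_le _ _
      _ ≤ ∑ i ∈ Finset.Icc (m - 1) (m + 1), 2 * C *
          (offDiagonal K m j * eLpNorm (dyadicBlock P m u) p volume) * eLpNorm g q volume := by
          refine Finset.sum_le_sum fun i hi => ?_
          rw [Finset.mem_Icc] at hi
          have h3 := hC K S S' hK hS i j g q hg hq
          have h4 := offDiagonal_le_two_mul K (i := i) (q := m) j (by
            unfold Nat.dist; omega)
          calc _ ≤ eLpNorm (kernelConv (blockKernel P m) uc) p volume *
                eLpNorm (kernelConv (blockKernel P i) w) q volume :=
                enorm_integral_mul_le_eLpNorm_mul p q (hD m).continuous.aestronglyMeasurable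
                  (isBC_kernelConv_of_isBC (hC₂ i).integrable hwBC).continuous.aestronglyMeasurable
            _ ≤ eLpNorm (kernelConv (blockKernel P m) uc) p volume *
                (C * (2 * offDiagonal K m j) * eLpNorm g q volume) := by
                gcongr
                exact h3.trans (by gcongr)
            _ = 2 * C * (offDiagonal K m j * eLpNorm (kernelConv (blockKernel P m) uc) p volume) *
                eLpNorm g q volume := by ring
      _ ≤ 3 • (2 * C *
          (offDiagonal K m j * eLpNorm (dyadicBlock P m u) p volume) * eLpNorm g q volume) := by
          rw [Finset.sum_const]
          gcongr
          rw [Nat.card_Icc]; omega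
      _ = _ := by rw [nsmul_eq_mul]; push_cast; ring
  have hlim : Tendsto (fun N : ℕ => ∑ i ∈ Finset.range (N + 1),
      ∫ x, kernelConv (blockKernel P i) uc x * w x) atTop (𝓝 (∫ x, uc x * w x)) := by
    have h1 : ∀ N : ℕ, ∑ i ∈ Finset.range (N + 1), ∫ x, kernelConv (blockKernel P i) uc x * w x =
        ∫ x, (∑ i ∈ Finset.range (N + 1), kernelConv (blockKernel P i) uc x) * w x := by
      intro N
      rw [← integral_finsetSum _ fun i _ => hint i]
      simp_rw [Finset.sum_mul]
    have hLc : ∀ x y, ‖uc x - uc y‖ ≤ L * ‖x - y‖ := fun x y => by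
      have := hL x y
      simp only [huc]
      rwa [← Complex.ofReal_sub, Complex.norm_real]
    have happ := hC₁ uc L hucBC hL0 hLc
    simp_rw [h1]
    have hb0 : ∀ N : ℕ, L * (C₁ / 2 ^ N) ≤ L * C₁ := fun N => by
      gcongr
      exact div_le_self C₁.2 (one_le_pow₀ one_le_two)
    refine tendsto_integral_of_dominated_convergence (fun x => (L * C₁ + M) * ‖w x‖) (fun N => ?_)
      (hwi.norm.const_mul _) (fun N => Eventually.of_forall fun x => ?_)
      (Eventually.of_forall fun x => ?_)
    · exact (Continuous.aestronglyMeasurable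
        (continuous_finsetSum _ fun i _ => (hD i).continuous)).mul hwi.1
    · rw [norm_mul]
      gcongr
      have h2 := norm_le_norm_add_norm_sub' (∑ i ∈ Finset.range (N + 1),
        kernelConv (blockKernel P i) uc x) (uc x)
      have h3 : ‖uc x‖ ≤ M := by simpa [huc] using hM x
      linarith [happ N x, hb0 N]
    · refine Tendsto.mul_const _ ?_
      rw [tendsto_iff_norm_sub_tendsto_zero]
      -- The uniform error of the partial sums is a constant times `2^{-N}`.
      refine squeeze_zero (fun _ => norm_nonneg _) (fun N => happ N x) ?_
      have h5 : Tendsto (fun N : ℕ => L * ((C₁ : ℝ) * ((1 / 2) ^ N))) atTop (𝓝 (L * (C₁ * 0))) :=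
        ((tendsto_pow_atTop_nhds_zero_of_lt_one (by norm_num) (by norm_num)).const_mul _).const_mul _
      simpa [div_eq_mul_inv] using h5
  refine le_of_tendsto ((continuous_enorm.tendsto _).comp hlim) (Eventually.of_forall fun N => ?_)
  simp only [Function.comp]
  calc _ ≤ ∑ i ∈ Finset.range (N + 1), ‖∫ x, kernelConv (blockKernel P i) uc x * w x‖ₑ :=
        enorm_sum_le _ _
    _ ≤ ∑ i ∈ Finset.range (N + 1), 6 * C *
        (offDiagonal K i j * eLpNorm (dyadicBlock P i u) p volume) * eLpNorm g q volume :=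
        Finset.sum_le_sum fun i _ => hblock i
    _ = 6 * C * (∑ i ∈ Finset.range (N + 1), offDiagonal K i j *
        eLpNorm (dyadicBlock P i u) p volume) * eLpNorm g q volume := by
        rw [← Finset.sum_mul, ← Finset.mul_sum]
    _ ≤ _ := by
        push_cast
        gcongr
        exact ENNReal.sum_le_tsum _

/-- Every distance from `q` is attained by at most one index on each side. -/
theorem tsum_comp_dist_le (f : ℕ → ℝ≥0∞) (q : ℕ) :
    ∑' j, f (Nat.dist q j) ≤ 2 * ∑' m, f m := by
  rw [← Summable.sum_add_tsum_nat_add' (k := q) ENNReal.summable, two_mul]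
  gcongr ?_ + ?_
  · calc ∑ j ∈ Finset.range q, f (Nat.dist q j) = ∑ j ∈ Finset.range q, f (q - 1 - j + 1) := by
          refine Finset.sum_congr rfl fun j hj => ?_
          rw [Finset.mem_range] at hj
          congr 1
          unfold Nat.dist
          omega
      _ = ∑ j ∈ Finset.range q, f (j + 1) := Finset.sum_range_reflect (fun m => f (m + 1)) q
      _ ≤ ∑' j, f (j + 1) := ENNReal.sum_le_tsum _
      _ ≤ _ := ENNReal.tsum_comp_le_tsum_of_injective (add_left_injective 1) f
  · refine le_of_eq (tsum_congr fun j => ?_)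
    congr 1
    unfold Nat.dist
    omega

/-- The terms equal to one are those at distance at most about `log₂ K`, a number proportional to
`V`; beyond that the series is geometric. This is where the exponential becomes linear. -/
theorem tsum_offDiagonal_le {V : ℝ} (hV : 0 ≤ V) (q : ℕ) :
    ∑' j, offDiagonal (Real.toNNReal (Real.exp V)) q j ≤ 12 * (1 + ENNReal.ofReal V) := by
  have hlog : (1 / 2 : ℝ) < Real.log 2 := by linarith [Real.log_two_gt_d9]
  -- Since `log 2 > 1/2`, this is enough for `e^V ≤ 2^M`. The sum is then at most `2 (M + 2) ≤ 4V +
  -- 6`, well within the claimed bound.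
  set M := ⌈2 * V⌉₊ with hM
  have hMV : (M : ℝ) ≤ 2 * V + 1 := (Nat.ceil_lt_add_one (by positivity)).le
  have hexp : Real.toNNReal (Real.exp V) ≤ 2 ^ M := by
    rw [Real.toNNReal_le_iff_le_coe]
    push_cast
    rw [← Real.le_log_iff_exp_le (by positivity), Real.log_pow]
    have := Nat.le_ceil (2 * V)
    nlinarith
  set f : ℕ → ℝ≥0∞ := fun m => min 1 (2 ^ M * 2⁻¹ ^ m) with hf
  have h1 : ∀ j, offDiagonal (Real.toNNReal (Real.exp V)) q j ≤ f (Nat.dist q j) := by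
    intro j
    unfold offDiagonal
    refine min_le_min le_rfl ?_
    gcongr
    exact_mod_cast ENNReal.coe_le_coe.2 hexp
  have h2 : ∑' m, f m ≤ M + 2 := by
    rw [← Summable.sum_add_tsum_nat_add' (k := M) ENNReal.summable]
    gcongr ?_ + ?_
    · calc _ ≤ ∑ m ∈ Finset.range M, (1 : ℝ≥0∞) := Finset.sum_le_sum fun m _ => min_le_left _ _
        _ = _ := by simp
    · calc ∑' m, f (m + M) ≤ ∑' m, (2⁻¹ : ℝ≥0∞) ^ m := by
            refine ENNReal.tsum_le_tsum fun m => (min_le_right _ _).trans (le_of_eq ?_)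
            rw [pow_add, mul_comm, mul_assoc, ← mul_pow,
              ENNReal.inv_mul_cancel two_ne_zero (by simp), one_pow, mul_one]
        _ = 2 := by rw [ENNReal.tsum_geometric, ENNReal.one_sub_inv_two, inv_inv]
  calc _ ≤ ∑' j, f (Nat.dist q j) := ENNReal.tsum_le_tsum h1
    _ ≤ 2 * (M + 2) := (tsum_comp_dist_le f q).trans (by gcongr)
    _ ≤ ENNReal.ofReal (12 * (1 + V)) := by
        rw [show (2 : ℝ≥0∞) * (M + 2) = ENNReal.ofReal (2 * (M + 2)) by
          rw [ENNReal.ofReal_mul (by norm_num), ENNReal.ofReal_add (by positivity) (by norm_num)]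
          simp]
        exact ENNReal.ofReal_le_ofReal (by linarith)
    _ = _ := by
        rw [ENNReal.ofReal_mul (by norm_num), ENNReal.ofReal_add (by norm_num) hV]
        simp

/-! ### Time slices and the velocity gradient -/

section slice

variable {F : Type*} [NormedAddCommGroup F] [NormedSpace ℝ F] {T τ : ℝ} {u : ℝ → Eucl d → F}

theorem contDiff_slice
    (hu : ContDiffOn ℝ ∞ (fun z : ℝ × Eucl d => u z.1 z.2) (Icc 0 T ×ˢ univ))
    (hτ : τ ∈ Icc 0 T) : ContDiff ℝ ∞ (u τ) := by
  rw [← contDiffOn_univ]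
  exact hu.comp (f := fun x : Eucl d => (τ, x)) (contDiff_prodMk_right τ).contDiffOn
    fun x _ => ⟨hτ, mem_univ x⟩

theorem fderiv_slice_eq
    (hu : ContDiffOn ℝ ∞ (fun z : ℝ × Eucl d => u z.1 z.2) (Icc 0 T ×ˢ univ))
    (hτ : τ ∈ Icc 0 T) (x : Eucl d) :
    fderiv ℝ (u τ) x = (fderivWithin ℝ (fun z : ℝ × Eucl d => u z.1 z.2) (Icc 0 T ×ˢ univ)
      (τ, x)).comp (ContinuousLinearMap.inr ℝ ℝ (Eucl d)) := by
  have h1 := ((hu.differentiableOn (by simp)) (τ, x) ⟨hτ, mem_univ x⟩).hasFDerivWithinAt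
  have h2 : HasFDerivWithinAt (fun x : Eucl d => (τ, x)) (ContinuousLinearMap.inr ℝ ℝ (Eucl d))
      univ x := (hasFDerivAt_prodMk_right τ x).hasFDerivWithinAt
  have h3 := HasFDerivWithinAt.comp x h1 h2 fun y _ => ⟨hτ, mem_univ y⟩
  exact (hasFDerivWithinAt_univ.1 h3).fderiv

theorem continuousOn_fderiv_slice (hT : 0 < T)
    (hu : ContDiffOn ℝ ∞ (fun z : ℝ × Eucl d => u z.1 z.2) (Icc 0 T ×ˢ univ)) :
    ContinuousOn (fun z : ℝ × Eucl d => fderiv ℝ (u z.1) z.2) (Icc 0 T ×ˢ univ) := by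
  have h1 := hu.continuousOn_fderivWithin ((uniqueDiffOn_Icc hT).prod uniqueDiffOn_univ) (by simp)
  refine ContinuousOn.congr (h1.clm_comp (continuousOn_const
    (c := ContinuousLinearMap.inr ℝ ℝ (Eucl d)))) fun z hz => ?_
  exact fderiv_slice_eq hu hz.1 z.2

end slice

/-- A set of full Lebesgue measure is dense, and the inequality defines a closed set. -/
theorem nnnorm_le_eLpNorm_top {F : Type*} [NormedAddCommGroup F] {u : Eucl d → F}
    (hu : Continuous u) (x : Eucl d) : ‖u x‖ₑ ≤ eLpNorm u ⊤ volume := by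
  rw [eLpNorm_exponent_top]
  have hd := Measure.dense_of_ae (enorm_ae_le_eLpNormEssSup u (volume : Measure (Eucl d)))
  have hc : IsClosed {x | ‖u x‖ₑ ≤ eLpNormEssSup u (volume : Measure (Eucl d))} :=
    isClosed_le hu.enorm continuous_const
  have := hd.closure_eq
  rw [hc.closure_eq] at this
  exact (this ▸ mem_univ x : x ∈ {x | ‖u x‖ₑ ≤ eLpNormEssSup u (volume : Measure (Eucl d))})

theorem IsSmoothDivFree.mono {T t : ℝ} {v : ℝ → Eucl d → Eucl d} (hv : IsSmoothDivFree T v)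
    (ht : t ≤ T) : IsSmoothDivFree t v :=
  ⟨hv.smooth.mono (prod_mono_left (Icc_subset_Icc_right ht)),
    fun τ hτ => hv.div_eq_zero τ ⟨hτ.1, hτ.2.trans ht⟩⟩

section gradSup

variable {T : ℝ} {v : ℝ → Eucl d → Eucl d}

/-- The supremum of the velocity gradient over a ball, constant in time outside `[0, T]`. -/
noncomputable def gradSup (T : ℝ) (v : ℝ → Eucl d → Eucl d) (R τ : ℝ) : ℝ :=
  sSup ((fun x => ‖fderiv ℝ (v (max 0 (min T τ))) x‖) '' Metric.closedBall 0 R)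

theorem clamp_mem {T : ℝ} (hT : 0 < T) (τ : ℝ) : max 0 (min T τ) ∈ Icc 0 T :=
  ⟨le_max_left _ _, max_le hT.le (min_le_left _ _)⟩

theorem clamp_eq {T τ : ℝ} (hτ : τ ∈ Icc 0 T) : max 0 (min T τ) = τ := by
  rw [min_eq_right hτ.2, max_eq_right hτ.1]

/-- The supremum over a compact ball is continuous in time, unlike what is known of the supremum
over the whole space; this makes classical Gronwall arguments possible. The radius disappears
afterwards because each such supremum is below the global norm. -/
theorem continuous_gradSup (hT : 0 < T) (hv : IsSmoothDivFree T v) (R : ℝ) :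
    Continuous (gradSup T v R) := by
  refine IsCompact.continuous_sSup (isCompact_closedBall 0 R) ?_
  have h := ((continuousOn_fderiv_slice hT hv.smooth).norm).comp_continuous
    (f := fun z : ℝ × Eucl d => (max 0 (min T z.1), z.2)) (by fun_prop)
    fun z => ⟨clamp_mem hT z.1, mem_univ _⟩
  exact h

theorem norm_fderiv_le_gradSup (hv : IsSmoothDivFree T v) {R τ : ℝ} (hτ : τ ∈ Icc 0 T)
    {x : Eucl d} (hx : ‖x‖ ≤ R) : ‖fderiv ℝ (v τ) x‖ ≤ gradSup T v R τ := by
  unfold gradSup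
  rw [clamp_eq hτ]
  refine le_csSup (IsCompact.bddAbove_image (isCompact_closedBall 0 R) ?_)
    ⟨x, by simpa using hx, rfl⟩
  exact (((contDiff_slice hv.smooth hτ).continuous_fderiv (by simp)).norm).continuousOn

theorem gradSup_nonneg (R τ : ℝ) : 0 ≤ gradSup T v R τ := by
  refine Real.sSup_nonneg ?_
  rintro _ ⟨x, _, rfl⟩
  exact norm_nonneg _

theorem ofReal_gradSup_le (hv : IsSmoothDivFree T v) {R τ : ℝ} (hτ : τ ∈ Icc 0 T) :
    ENNReal.ofReal (gradSup T v R τ) ≤ eLpNorm (fun x => fderiv ℝ (v τ) x) ⊤ volume := by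
  have hc := (contDiff_slice hv.smooth hτ).continuous_fderiv (by simp)
  by_cases htop : eLpNorm (fun x => fderiv ℝ (v τ) x) ⊤ volume = ⊤
  · rw [htop]; exact le_top
  refine ENNReal.ofReal_le_of_le_toReal (Real.sSup_le ?_ ENNReal.toReal_nonneg)
  rintro _ ⟨x, _, rfl⟩
  rw [clamp_eq hτ]
  have := ENNReal.toReal_mono htop (nnnorm_le_eLpNorm_top hc x)
  simpa using this

theorem norm_sub_le_gradSup_mul (hv : IsSmoothDivFree T v) {R τ : ℝ} (hτ : τ ∈ Icc 0 T)
    {x y : Eucl d} (hx : ‖x‖ ≤ R) (hy : ‖y‖ ≤ R) :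
    ‖v τ x - v τ y‖ ≤ gradSup T v R τ * ‖x - y‖ := by
  have hd := (contDiff_slice hv.smooth hτ).differentiable (by simp)
  exact Convex.norm_image_sub_le_of_norm_fderiv_le (s := Metric.closedBall (0 : Eucl d) R)
    (fun z _ => hd z) (fun z hz => norm_fderiv_le_gradSup hv hτ (by simpa using hz))
    (convex_closedBall 0 R) (by simpa using hy) (by simpa using hx)

/-- The real-valued Lipschitz integral. -/
noncomputable def lipTime (v : ℝ → Eucl d → Eucl d) (τ : ℝ) : ℝ := (lipschitzIntegral τ v).toReal

theorem lipschitzIntegral_mono {s t : ℝ} (h : s ≤ t) :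
    lipschitzIntegral s v ≤ lipschitzIntegral t v :=
  lintegral_mono_set (Ioc_subset_Ioc_right h)

theorem lipschitzIntegral_add {s t : ℝ} (hs : 0 ≤ s) (h : s ≤ t) :
    lipschitzIntegral t v = lipschitzIntegral s v +
      ∫⁻ τ in Ioc s t, eLpNorm (fun x => fderiv ℝ (v τ) x) ⊤ volume := by
  unfold lipschitzIntegral
  rw [← lintegral_union measurableSet_Ioc (Ioc_disjoint_Ioc_of_le le_rfl),
    Ioc_union_Ioc_eq_Ioc hs h]

theorem lipTime_sub_eq (hV : lipschitzIntegral T v ≠ ⊤) {s t : ℝ} (hs : 0 ≤ s) (h : s ≤ t)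
    (ht : t ≤ T) : lipTime v t - lipTime v s =
      (∫⁻ τ in Ioc s t, eLpNorm (fun x => fderiv ℝ (v τ) x) ⊤ volume).toReal := by
  have h1 : lipschitzIntegral t v ≠ ⊤ := ne_top_of_le_ne_top hV (lipschitzIntegral_mono ht)
  have h2 := lipschitzIntegral_add (v := v) hs h
  unfold lipTime
  rw [h2, ENNReal.toReal_add, add_sub_cancel_left]
  · exact ne_top_of_le_ne_top h1 (h2 ▸ le_self_add)
  · exact ne_top_of_le_ne_top h1 (h2 ▸ le_add_self)

theorem lipTime_mono (hV : lipschitzIntegral T v ≠ ⊤) {s t : ℝ} (hs : 0 ≤ s) (h : s ≤ t)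
    (ht : t ≤ T) : lipTime v s ≤ lipTime v t := by
  have := lipTime_sub_eq hV hs h ht
  linarith [this ▸ (ENNReal.toReal_nonneg : 0 ≤
    (∫⁻ τ in Ioc s t, eLpNorm (fun x => fderiv ℝ (v τ) x) ⊤ volume).toReal)]

theorem lipTime_zero : lipTime v 0 = 0 := by
  simp [lipTime, lipschitzIntegral]

theorem integral_gradSup_le (hT : 0 < T) (hv : IsSmoothDivFree T v)
    (hV : lipschitzIntegral T v ≠ ⊤) {s t : ℝ} (hs : 0 ≤ s) (h : s ≤ t) (ht : t ≤ T) (R : ℝ) :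
    ∫ τ in s..t, gradSup T v R τ ≤ lipTime v t - lipTime v s := by
  rw [lipTime_sub_eq hV hs h ht, intervalIntegral.integral_of_le h,
    integral_eq_lintegral_of_nonneg_ae (Eventually.of_forall fun _ => gradSup_nonneg _ _)
      (continuous_gradSup hT hv R).aestronglyMeasurable]
  refine ENNReal.toReal_mono ?_ ?_
  · refine ne_top_of_le_ne_top hV (lintegral_mono_set ?_)
    exact Ioc_subset_Ioc hs ht
  · refine setLIntegral_mono' measurableSet_Ioc fun τ hτ => ofReal_gradSup_le hv ?_
    exact ⟨hs.trans hτ.1.le, hτ.2.trans ht⟩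

theorem abs_integral_gradSup_le (hT : 0 < T) (hv : IsSmoothDivFree T v)
    (hV : lipschitzIntegral T v ≠ ⊤) {s t : ℝ} (hs : s ∈ Icc 0 T) (ht : t ∈ Icc 0 T) (R : ℝ) :
    |∫ τ in s..t, gradSup T v R τ| ≤ |lipTime v t - lipTime v s| := by
  rcases le_total s t with h | h
  · rw [abs_of_nonneg (intervalIntegral.integral_nonneg h fun _ _ => gradSup_nonneg _ _)]
    exact (integral_gradSup_le hT hv hV hs.1 h ht.2 R).trans (le_abs_self _)
  · rw [intervalIntegral.integral_symm, abs_neg,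
      abs_of_nonneg (intervalIntegral.integral_nonneg h fun _ _ => gradSup_nonneg _ _), abs_sub_comm]
    exact (integral_gradSup_le hT hv hV ht.1 h hs.2 R).trans (le_abs_self _)

end gradSup

/-! ### Gronwall estimates for trajectories -/

/-- Multiplication by `exp(-∫c)` or `exp(∫c)` makes `N` monotone; the two-sided hypothesis on the
derivative covers both forward and backward times. -/
theorem le_exp_mul_of_abs_deriv_le {N N' c : ℝ → ℝ} {T : ℝ}
    (hN : ∀ τ ∈ Icc 0 T, HasDerivWithinAt N (N' τ) (Icc 0 T) τ) (hc : Continuous c)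
    (h0 : ∀ τ, 0 ≤ N τ) (h : ∀ τ ∈ Icc 0 T, |N' τ| ≤ c τ * N τ) {s τ : ℝ} (hs : s ∈ Icc 0 T)
    (hτ : τ ∈ Icc 0 T) : N τ ≤ Real.exp |∫ r in s..τ, c r| * N s := by
  set C : ℝ → ℝ := fun τ => ∫ r in (0 : ℝ)..τ, c r with hC
  have hCd : ∀ τ, HasDerivAt C (c τ) τ := fun τ => (hc.integral_hasStrictDerivAt 0 τ).hasDerivAt
  have hcont : ContinuousOn N (Icc 0 T) := fun τ hτ => (hN τ hτ).continuousWithinAt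
  have hCc : Continuous C := continuous_iff_continuousAt.2 fun τ => (hCd τ).continuousAt
  have hderiv : ∀ τ ∈ interior (Icc 0 T), HasDerivAt N (N' τ) τ := fun τ hτ => by
    rw [interior_Icc] at hτ
    exact (hN τ ⟨hτ.1.le, hτ.2.le⟩).hasDerivAt (Icc_mem_nhds hτ.1 hτ.2)
  have hsub : C τ - C s = ∫ r in s..τ, c r :=
    intervalIntegral.integral_interval_sub_left (hc.intervalIntegrable _ _)
      (hc.intervalIntegrable _ _)
  have key : N τ ≤ N s * Real.exp |C τ - C s| := by
    rcases le_total s τ with hst | hst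
    · have hanti : AntitoneOn (fun τ => N τ * Real.exp (-C τ)) (Icc 0 T) := by
        refine antitoneOn_of_hasDerivWithinAt_nonpos (convex_Icc 0 T)
          (f' := fun τ => N' τ * Real.exp (-C τ) + N τ * (Real.exp (-C τ) * -c τ)) (by fun_prop)
          (fun τ hτ => ((hderiv τ hτ).mul ((hCd τ).neg.exp)).hasDerivWithinAt) fun τ hτ => ?_
        have := h τ (interior_subset hτ)
        have h1 := (abs_le.1 this).2
        nlinarith [Real.exp_pos (-C τ)]
      have := hanti hs hτ hst
      simp only at this
      calc N τ = N τ * Real.exp (-C τ) * Real.exp (C τ) := by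
            rw [mul_assoc, ← Real.exp_add]; simp
        _ ≤ N s * Real.exp (-C s) * Real.exp (C τ) := by gcongr
        _ = N s * Real.exp (C τ - C s) := by rw [mul_assoc, ← Real.exp_add]; ring_nf
        _ ≤ _ := by gcongr; exacts [h0 s, le_abs_self _]
    · have hmono : MonotoneOn (fun τ => N τ * Real.exp (C τ)) (Icc 0 T) := by
        refine monotoneOn_of_hasDerivWithinAt_nonneg (convex_Icc 0 T)
          (f' := fun τ => N' τ * Real.exp (C τ) + N τ * (Real.exp (C τ) * c τ)) (by fun_prop)
          (fun τ hτ => ((hderiv τ hτ).mul ((hCd τ).exp)).hasDerivWithinAt) fun τ hτ => ?_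
        have := h τ (interior_subset hτ)
        have h1 := (abs_le.1 this).1
        nlinarith [Real.exp_pos (C τ)]
      have := hmono hτ hs hst
      simp only at this
      calc N τ = N τ * Real.exp (C τ) * Real.exp (-C τ) := by
            rw [mul_assoc, ← Real.exp_add]; simp
        _ ≤ N s * Real.exp (C s) * Real.exp (-C τ) := by gcongr
        _ = N s * Real.exp (-(C τ - C s)) := by rw [mul_assoc, ← Real.exp_add]; ring_nf
        _ ≤ _ := by gcongr; exacts [h0 s, neg_le_abs _]
  rw [← hsub, mul_comm]
  exact key

/-- `X` is an integral curve of `v` on `[0, T]`. -/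
def IsTrajectory (T : ℝ) (v : ℝ → Eucl d → Eucl d) (X : ℝ → Eucl d) : Prop :=
  ∀ τ ∈ Icc 0 T, HasDerivWithinAt X (v τ (X τ)) (Icc 0 T) τ

theorem IsTrajectory.continuousOn {T : ℝ} {v : ℝ → Eucl d → Eucl d} {X : ℝ → Eucl d}
    (hX : IsTrajectory T v X) : ContinuousOn X (Icc 0 T) :=
  fun τ hτ => (hX τ hτ).continuousWithinAt

theorem IsTrajectory.exists_norm_le {T : ℝ} {v : ℝ → Eucl d → Eucl d} {X : ℝ → Eucl d}
    (hX : IsTrajectory T v X) : ∃ R, ∀ τ ∈ Icc 0 T, ‖X τ‖ ≤ R :=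
  isCompact_Icc.exists_bound_of_continuousOn hX.continuousOn

/-- Both curves stay in a common ball on the compact time interval, so Gronwall applies to the
squared distance with the gradient supremum over that ball. The final bound no longer sees the ball.
The case of equal starting points is uniqueness. -/
theorem IsTrajectory.norm_sub_le {T : ℝ} (hT : 0 < T) {v : ℝ → Eucl d → Eucl d}
    (hv : IsSmoothDivFree T v) (hV : lipschitzIntegral T v ≠ ⊤) {X Y : ℝ → Eucl d}
    (hX : IsTrajectory T v X) (hY : IsTrajectory T v Y) {s τ : ℝ} (hs : s ∈ Icc 0 T)
    (hτ : τ ∈ Icc 0 T) :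
    ‖X τ - Y τ‖ ≤ Real.exp |lipTime v τ - lipTime v s| * ‖X s - Y s‖ := by
  obtain ⟨R₁, h₁⟩ := hX.exists_norm_le
  obtain ⟨R₂, h₂⟩ := hY.exists_norm_le
  set R := max R₁ R₂
  have hk := continuous_gradSup hT hv R
  have h := le_exp_mul_of_abs_deriv_le (T := T) (N := fun τ => ‖X τ - Y τ‖ ^ 2)
    (c := fun τ => 2 * gradSup T v R τ)
    (fun τ hτ => (((hX τ hτ).sub (hY τ hτ)).norm_sq)) (by fun_prop) (fun τ => by positivity)
    (fun τ hτ => by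
      rw [abs_mul, abs_two, mul_assoc]
      gcongr
      refine (abs_real_inner_le_norm _ _).trans ?_
      have := norm_sub_le_gradSup_mul hv hτ ((h₁ τ hτ).trans (le_max_left R₁ R₂))
        ((h₂ τ hτ).trans (le_max_right R₁ R₂))
      calc ‖(X - Y) τ‖ * ‖v τ (X τ) - v τ (Y τ)‖ ≤
          ‖X τ - Y τ‖ * (gradSup T v R τ * ‖X τ - Y τ‖) := by
            simp only [Pi.sub_apply]; gcongr
        _ = _ := by ring) hs hτ
  rw [intervalIntegral.integral_const_mul, abs_mul, abs_two, two_mul, Real.exp_add] at h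
  have h' : ‖X τ - Y τ‖ ≤ Real.exp |∫ r in s..τ, gradSup T v R r| * ‖X s - Y s‖ :=
    (pow_le_pow_iff_left₀ (norm_nonneg _) (by positivity) two_ne_zero).1 (by linarith)
  exact h'.trans (mul_le_mul_of_nonneg_right
    (Real.exp_le_exp.2 (abs_integral_gradSup_le hT hv hV hs hτ R)) (norm_nonneg _))

/-! ### Construction of the flow -/

section flow

variable {T : ℝ} {v : ℝ → Eucl d → Eucl d}

/-- The gradient bound gives `|v(τ,x)| ≤ |v(τ,0)| + k(τ) |x|`, hence a Gronwall inequality for `1 +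
|X|²`. Because `ρ ≤ 1`, the constant is the same for all cutoffs, which is what permits the cutoff
to be removed later. -/
theorem exists_growth_cutoff (hT : 0 < T) (hv : IsSmoothDivFree T v)
    (hV : lipschitzIntegral T v ≠ ⊤) :
    ∃ G : ℝ, 0 < G ∧ ∀ (ρ : Eucl d → ℝ) (R : ℝ), (∀ x, 0 ≤ ρ x) → (∀ x, ρ x ≤ 1) →
      (∀ x, ρ x ≠ 0 → ‖x‖ ≤ R) → 0 ≤ R → ∀ X : ℝ → Eucl d,
      IsTrajectory T (fun τ x => ρ x • v τ x) X → ∀ s ∈ Icc 0 T, ∀ τ ∈ Icc 0 T,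
      1 + ‖X τ‖ ^ 2 ≤ G * (1 + ‖X s‖ ^ 2) := by
  have ha : Continuous fun τ : ℝ => ‖v (max 0 (min T τ)) 0‖ :=
    (hv.smooth.continuousOn.comp_continuous (f := fun τ : ℝ => (max 0 (min T τ), (0 : Eucl d)))
      (by fun_prop) fun τ => ⟨clamp_mem hT τ, mem_univ _⟩).norm
  -- From `2 |X| (|v(τ,0)| + k |X|) ≤ (|v(τ,0)| + 2k)(1 + |X|²)`, with `∫ k` at most the Lipschitz
  -- integral.
  refine ⟨Real.exp ((∫ τ in (0 : ℝ)..T, ‖v (max 0 (min T τ)) 0‖) + 2 * lipTime v T),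
    Real.exp_pos _, fun ρ R h0 h1 hR hR0 X hX s hs τ hτ => ?_⟩
  have hk := continuous_gradSup hT hv R
  have h := le_exp_mul_of_abs_deriv_le (T := T) (N := fun τ => 1 + ‖X τ‖ ^ 2)
    (c := fun τ => ‖v (max 0 (min T τ)) 0‖ + 2 * gradSup T v R τ)
    (fun τ hτ => ((hX τ hτ).norm_sq).const_add 1) (by fun_prop) (fun τ => by positivity)
    (fun τ hτ => by
      rw [abs_mul, abs_two]
      have hk0 := gradSup_nonneg (T := T) (v := v) R τ
      by_cases hz : ρ (X τ) = 0
      · simp only [hz, zero_smul, inner_zero_right, abs_zero, mul_zero]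
        positivity
      have hXR := hR _ hz
      have hb := norm_sub_le_gradSup_mul hv hτ hXR (y := 0) (by simpa using hR0)
      rw [sub_zero] at hb
      have hb' : ‖v τ (X τ)‖ ≤ ‖v τ 0‖ + gradSup T v R τ * ‖X τ‖ := by
        have := norm_le_norm_add_norm_sub' (v τ (X τ)) (v τ 0)
        linarith
      rw [clamp_eq hτ]
      have hin : |inner ℝ (X τ) (ρ (X τ) • v τ (X τ))| ≤
          ‖X τ‖ * (‖v τ 0‖ + gradSup T v R τ * ‖X τ‖) := by
        refine (abs_real_inner_le_norm _ _).trans ?_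
        rw [norm_smul, Real.norm_of_nonneg (h0 _)]
        gcongr
        exact (mul_le_of_le_one_left (norm_nonneg _) (h1 _)).trans hb'
      nlinarith [norm_nonneg (v τ 0), norm_nonneg (X τ), sq_nonneg (‖X τ‖ - 1),
        mul_nonneg (norm_nonneg (v τ 0)) (sq_nonneg (‖X τ‖ - 1))]) hs hτ
  refine h.trans ?_
  gcongr
  rw [intervalIntegral.integral_add (ha.intervalIntegrable _ _)
    ((by fun_prop : Continuous fun r => 2 * gradSup T v R r).intervalIntegrable _ _),
    intervalIntegral.integral_const_mul]
  refine (abs_add_le _ _).trans ?_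
  have hsub : uIoc s τ ⊆ uIoc 0 T := by
    rw [uIoc_of_le hT.le]
    exact fun r hr => ⟨(le_min hs.1 hτ.1).trans_lt hr.1, hr.2.trans (max_le hs.2 hτ.2)⟩
  refine add_le_add ?_ ?_
  · have := intervalIntegral.abs_integral_mono_interval (μ := volume) hsub
      (Eventually.of_forall fun r => norm_nonneg _) (ha.intervalIntegrable 0 T)
    rwa [abs_of_nonneg (intervalIntegral.integral_nonneg hT.le fun r _ => norm_nonneg _)] at this
  · rw [abs_mul, abs_two]
    gcongr
    have := intervalIntegral.abs_integral_mono_interval (μ := volume) hsub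
      (Eventually.of_forall fun r => gradSup_nonneg R r) (hk.intervalIntegrable 0 T)
    rw [abs_of_nonneg (intervalIntegral.integral_nonneg hT.le fun r _ => gradSup_nonneg _ _)] at this
    have h2 := integral_gradSup_le hT hv hV le_rfl hT.le le_rfl R
    rw [lipTime_zero, sub_zero] at h2
    exact this.trans h2

theorem exists_growth (hT : 0 < T) (hv : IsSmoothDivFree T v) (hV : lipschitzIntegral T v ≠ ⊤) :
    ∃ G : ℝ, 0 < G ∧ ∀ X : ℝ → Eucl d, IsTrajectory T v X → ∀ s ∈ Icc 0 T, ∀ τ ∈ Icc 0 T,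
      1 + ‖X τ‖ ^ 2 ≤ G * (1 + ‖X s‖ ^ 2) := by
  obtain ⟨G, hG, h⟩ := exists_growth_cutoff hT hv hV
  refine ⟨G, hG, fun X hX => ?_⟩
  obtain ⟨R, hR⟩ := hX.exists_norm_le
  classical
  -- No regularity of `ρ` is asked for, so a sharp cutoff at a radius that the curve never exceeds
  -- is admissible.
  refine h (fun x => if ‖x‖ ≤ R then 1 else 0) R (fun x => by positivity)
    (fun x => by split_ifs <;> norm_num) (fun x hx => by_contra fun h => hx (if_neg h))
    ((norm_nonneg _).trans (hR 0 ⟨le_rfl, hT.le⟩)) X fun τ hτ => ?_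
  simp only [if_pos (hR τ hτ), one_smul]
  exact hX τ hτ

theorem exists_trajectory_of_compact (hT : 0 < T) {w : ℝ → Eucl d → Eucl d}
    (hw : ContDiffOn ℝ ∞ (fun z : ℝ × Eucl d => w z.1 z.2) (Icc 0 T ×ˢ univ)) {R : ℝ}
    (hR : ∀ τ x, R < ‖x‖ → w τ x = 0) {s : ℝ} (hs : s ∈ Icc 0 T) (x : Eucl d) :
    ∃ X, X s = x ∧ IsTrajectory T w X := by
  have hK := (isCompact_Icc (a := (0 : ℝ)) (b := T)).prod (isCompact_closedBall (0 : Eucl d) R)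
  have hsub : Icc (0 : ℝ) T ×ˢ Metric.closedBall (0 : Eucl d) R ⊆ Icc 0 T ×ˢ univ :=
    prod_mono_right (subset_univ _)
  obtain ⟨L, hL⟩ := hK.exists_bound_of_continuousOn (hw.continuousOn.mono hsub)
  obtain ⟨K, hK'⟩ := hK.exists_bound_of_continuousOn ((continuousOn_fderiv_slice hT hw).mono hsub)
  have hL' : ∀ τ ∈ Icc 0 T, ∀ y, ‖w τ y‖ ≤ L.toNNReal := by
    intro τ hτ y
    rcases le_or_gt ‖y‖ R with h | h
    · exact (hL (τ, y) ⟨hτ, by simpa using h⟩).trans (Real.le_coe_toNNReal _)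
    · rw [hR τ y h, norm_zero]; exact NNReal.coe_nonneg _
  have hlip : ∀ τ ∈ Icc 0 T, LipschitzWith K.toNNReal (w τ) := by
    intro τ hτ
    refine lipschitzWith_of_nnnorm_fderiv_le ((contDiff_slice hw hτ).differentiable (by simp))
      fun y => ?_
    rw [← NNReal.coe_le_coe, coe_nnnorm]
    rcases le_or_gt ‖y‖ R with h | h
    · exact (hK' (τ, y) ⟨hτ, by simpa using h⟩).trans (Real.le_coe_toNNReal _)
    · have : w τ =ᶠ[𝓝 y] fun _ => 0 := by
        filter_upwards [(isOpen_lt continuous_const continuous_norm).mem_nhds h] with z hz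
        exact hR τ z hz
      rw [this.fderiv_eq]
      simp
  have hpl : IsPicardLindelof w (⟨s, hs⟩ : Icc 0 T) x (L.toNNReal * T.toNNReal) 0 L.toNNReal
      K.toNNReal :=
    { lipschitzOnWith := fun τ hτ => (hlip τ hτ).lipschitzOnWith
      continuousOn := fun y _ => hw.continuousOn.comp (f := fun τ : ℝ => (τ, y)) (by fun_prop)
        fun τ hτ => ⟨hτ, mem_univ _⟩
      norm_le := fun τ hτ y _ => hL' τ hτ y
      mul_max_le := by
        simp only [NNReal.coe_mul, NNReal.coe_zero, sub_zero]
        gcongr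
        rw [Real.coe_toNNReal _ hT.le]
        exact max_le (by linarith [hs.1]) hs.2 }
  exact hpl.exists_eq_forall_mem_Icc_hasDerivWithinAt₀

/-- Solve for the velocity multiplied by a bump function. The growth bound, uniform in the cutoff,
confines the curve to the ball where the bump equals one, so it solves the original equation. -/
theorem exists_trajectory (hT : 0 < T) (hv : IsSmoothDivFree T v)
    (hV : lipschitzIntegral T v ≠ ⊤) {s : ℝ} (hs : s ∈ Icc 0 T) (x : Eucl d) :
    ∃ X, X s = x ∧ IsTrajectory T v X := by
  obtain ⟨G, hG, h⟩ := exists_growth_cutoff hT hv hV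
  set R := Real.sqrt (G * (1 + ‖x‖ ^ 2)) with hR
  have hR0 : 0 < R := Real.sqrt_pos.2 (by positivity)
  let ρ : ContDiffBump (0 : Eucl d) := ⟨R, R + 1, hR0, by linarith⟩
  have hw : ContDiffOn ℝ ∞ (fun z : ℝ × Eucl d => ρ z.2 • v z.1 z.2) (Icc 0 T ×ˢ univ) :=
    (ρ.contDiff.comp contDiff_snd).contDiffOn.smul hv.smooth
  have hz : ∀ y, R + 1 < ‖y‖ → ρ y = 0 := fun y hy =>
    ρ.zero_of_le_dist (by rw [dist_zero_right]; exact hy.le)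
  obtain ⟨X, hXs, hX⟩ := exists_trajectory_of_compact hT (w := fun τ y => ρ y • v τ y) hw (R := R + 1)
    (fun τ y hy => by rw [hz y hy, zero_smul]) hs x
  refine ⟨X, hXs, fun τ hτ => ?_⟩
  have := h ρ (R + 1) (fun _ => ρ.nonneg) (fun _ => ρ.le_one)
    (fun y hy => not_lt.1 fun h' => hy (hz y h')) (by positivity) X hX s hs τ hτ
  have hXR : ‖X τ‖ ≤ R := Real.le_sqrt_of_sq_le (by rw [hXs] at this; linarith)
  have h1 : ρ (X τ) = 1 := ρ.one_of_mem_closedBall (by simpa using hXR)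
  simpa [h1] using hX τ hτ

/-- `Φ s τ` maps the position at time `s` to the position at time `τ` along `v`. -/
structure IsFlow (T : ℝ) (v : ℝ → Eucl d → Eucl d) (Φ : ℝ → ℝ → Eucl d → Eucl d) : Prop where
  trajectory : ∀ s ∈ Icc 0 T, ∀ x, IsTrajectory T v fun τ => Φ s τ x
  self : ∀ s ∈ Icc 0 T, ∀ x, Φ s s x = x

theorem exists_isFlow (hT : 0 < T) (hv : IsSmoothDivFree T v) (hV : lipschitzIntegral T v ≠ ⊤) :
    ∃ Φ : ℝ → ℝ → Eucl d → Eucl d, IsFlow T v Φ := by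
  choose X h1 h2 using fun (s : Icc 0 T) => exists_trajectory hT hv hV s.2
  classical
  refine ⟨fun s τ x => if hs : s ∈ Icc 0 T then X ⟨s, hs⟩ x τ else x, fun s hs x => ?_,
    fun s hs x => ?_⟩
  · simp only [dif_pos hs]; exact h2 ⟨s, hs⟩ x
  · simp only [dif_pos hs]; exact h1 ⟨s, hs⟩ x

namespace IsFlow

variable {Φ : ℝ → ℝ → Eucl d → Eucl d} {s τ σ : ℝ}

theorem norm_sub_le (hΦ : IsFlow T v Φ) (hT : 0 < T) (hv : IsSmoothDivFree T v)
    (hV : lipschitzIntegral T v ≠ ⊤) (hs : s ∈ Icc 0 T) (hτ : τ ∈ Icc 0 T) (x y : Eucl d) :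
    ‖Φ s τ x - Φ s τ y‖ ≤ Real.exp |lipTime v τ - lipTime v s| * ‖x - y‖ := by
  have := (hΦ.trajectory s hs x).norm_sub_le hT hv hV (hΦ.trajectory s hs y) hs hτ
  rwa [hΦ.self s hs, hΦ.self s hs] at this

theorem comp (hΦ : IsFlow T v Φ) (hT : 0 < T) (hv : IsSmoothDivFree T v)
    (hV : lipschitzIntegral T v ≠ ⊤) (hs : s ∈ Icc 0 T) (hτ : τ ∈ Icc 0 T) (hσ : σ ∈ Icc 0 T)
    (x : Eucl d) : Φ τ σ (Φ s τ x) = Φ s σ x := by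
  have := (hΦ.trajectory τ hτ (Φ s τ x)).norm_sub_le hT hv hV (hΦ.trajectory s hs x) hτ hσ
  rw [hΦ.self τ hτ, sub_self, norm_zero, mul_zero] at this
  exact sub_eq_zero.1 (norm_le_zero_iff.1 this)

theorem lipschitzWith (hΦ : IsFlow T v Φ) (hT : 0 < T) (hv : IsSmoothDivFree T v)
    (hV : lipschitzIntegral T v ≠ ⊤) (hs : s ∈ Icc 0 T) (hτ : τ ∈ Icc 0 T) :
    LipschitzWith (Real.toNNReal (Real.exp |lipTime v τ - lipTime v s|)) (Φ s τ) := by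
  refine LipschitzWith.of_dist_le_mul fun x y => ?_
  rw [dist_eq_norm, dist_eq_norm, Real.coe_toNNReal _ (Real.exp_pos _).le]
  exact hΦ.norm_sub_le hT hv hV hs hτ x y

theorem exists_norm_le (hΦ : IsFlow T v Φ) (hT : 0 < T) (hv : IsSmoothDivFree T v)
    (hV : lipschitzIntegral T v ≠ ⊤) (R : ℝ) : ∃ R', ∀ s ∈ Icc 0 T, ∀ τ ∈ Icc 0 T, ∀ x,
      ‖x‖ ≤ R → ‖Φ s τ x‖ ≤ R' := by
  obtain ⟨G, hG, h⟩ := exists_growth hT hv hV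
  refine ⟨Real.sqrt (G * (1 + R ^ 2)), fun s hs τ hτ x hx => Real.le_sqrt_of_sq_le ?_⟩
  have := h _ (hΦ.trajectory s hs x) s hs τ hτ
  simp only [hΦ.self s hs] at this
  have h2 : G * (1 + ‖x‖ ^ 2) ≤ G * (1 + R ^ 2) := by gcongr
  linarith

theorem exists_norm_sub_self_le (hΦ : IsFlow T v Φ) (hT : 0 < T) (hv : IsSmoothDivFree T v)
    (hV : lipschitzIntegral T v ≠ ⊤) (R : ℝ) : ∃ B, ∀ s ∈ Icc 0 T, ∀ τ ∈ Icc 0 T, ∀ x,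
      ‖x‖ ≤ R → ‖Φ s τ x - x‖ ≤ B * |τ - s| := by
  obtain ⟨R', hR'⟩ := hΦ.exists_norm_le hT hv hV R
  have hK := (isCompact_Icc (a := (0 : ℝ)) (b := T)).prod (isCompact_closedBall (0 : Eucl d) R')
  obtain ⟨B, hB⟩ := hK.exists_bound_of_continuousOn
    (hv.smooth.continuousOn.mono (prod_mono_right (subset_univ _)))
  refine ⟨B, fun s hs τ hτ x hx => ?_⟩
  have := Convex.norm_image_sub_le_of_norm_hasDerivWithin_le (hΦ.trajectory s hs x)
    (fun r hr => hB (r, Φ s r x) ⟨hr, by simpa using hR' s hs r hr x hx⟩) (convex_Icc 0 T) hs hτ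
  simpa [hΦ.self s hs] using this

end IsFlow

end flow

namespace IsFlow

variable {T : ℝ} {v : ℝ → Eucl d → Eucl d} {Φ : ℝ → ℝ → Eucl d → Eucl d} {s τ σ : ℝ}

/-- Over the short time from `σ` to `s` the curve starting at `x` moves by `(s - σ) v(s,x)` up to a
small error, by continuity of `v` alone. Differentiability of the flow in space is not needed. -/
theorem hasDerivAt_initial (hΦ : IsFlow T v Φ) (hT : 0 < T) (hv : IsSmoothDivFree T v)
    (hV : lipschitzIntegral T v ≠ ⊤) (hs : s ∈ Ioo 0 T) (x : Eucl d) :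
    HasDerivAt (fun σ => Φ σ s x) (-v s x) s := by
  have hs' : s ∈ Icc 0 T := Ioo_subset_Icc_self hs
  obtain ⟨B, hB⟩ := hΦ.exists_norm_sub_self_le hT hv hV ‖x‖
  have hc : ContinuousAt (fun z : ℝ × Eucl d => v z.1 z.2) (s, x) :=
    (hv.smooth.continuousOn (s, x) ⟨hs', mem_univ _⟩).continuousAt
      (prod_mem_nhds (Icc_mem_nhds hs.1 hs.2) univ_mem)
  rw [hasDerivAt_iff_isLittleO, Asymptotics.isLittleO_iff]
  intro ε hε
  obtain ⟨δ, hδ, h⟩ := Metric.continuousAt_iff.1 hc ε hε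
  have h1 : ∀ᶠ σ in 𝓝 s, |σ - s| < δ ∧ |B| * |σ - s| < δ ∧ σ ∈ Icc 0 T := by
    have c1 : Tendsto (fun σ => |σ - s|) (𝓝 s) (𝓝 |s - s|) := by
      exact (by fun_prop : Continuous fun σ => |σ - s|).tendsto s
    have c2 : Tendsto (fun σ => |B| * |σ - s|) (𝓝 s) (𝓝 (|B| * |s - s|)) := by
      exact (by fun_prop : Continuous fun σ => |B| * |σ - s|).tendsto s
    exact (c1.eventually (gt_mem_nhds (by simpa using hδ))).and
      ((c2.eventually (gt_mem_nhds (by simpa using hδ))).and (Icc_mem_nhds hs.1 hs.2))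
  filter_upwards [h1] with σ ⟨k1, k2, k3⟩
  have hsub : uIcc σ s ⊆ Icc 0 T := uIcc_subset_Icc k3 hs'
  have hd : ∀ r ∈ uIcc σ s, HasDerivWithinAt (fun r => Φ σ r x - r • v s x)
      (v r (Φ σ r x) - (1 : ℝ) • v s x) (uIcc σ s) r := fun r hr =>
    ((hΦ.trajectory σ k3 x r (hsub hr)).mono hsub).sub
      ((hasDerivAt_id r).smul_const (v s x)).hasDerivWithinAt
  have hle : ∀ r ∈ uIcc σ s, |r - s| ≤ |σ - s| ∧ |r - σ| ≤ |σ - s| := fun r hr =>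
    ⟨by rw [abs_sub_comm σ s, abs_sub_comm r s]; exact abs_sub_right_of_mem_uIcc hr,
      by rw [abs_sub_comm σ s]; exact abs_sub_left_of_mem_uIcc hr⟩
  have := Convex.norm_image_sub_le_of_norm_hasDerivWithin_le hd (C := ε) (fun r hr => by
    rw [one_smul, ← dist_eq_norm]
    refine (h (x := (r, Φ σ r x)) ?_).le
    rw [Prod.dist_eq, max_lt_iff]
    refine ⟨(hle r hr).1.trans_lt k1, ?_⟩
    rw [dist_eq_norm]
    calc ‖Φ σ r x - x‖ ≤ B * |r - σ| := hB σ k3 r (hsub hr) x le_rfl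
      _ ≤ |B| * |σ - s| := mul_le_mul (le_abs_self B) (hle r hr).2 (abs_nonneg _) (abs_nonneg _)
      _ < δ := k2) (convex_uIcc _ _) left_mem_uIcc right_mem_uIcc
  rw [hΦ.self σ k3] at this
  rw [Real.norm_eq_abs, abs_sub_comm] at this
  rw [hΦ.self s hs', Real.norm_eq_abs]
  refine le_trans (le_of_eq ?_) this
  congr 1
  module

end IsFlow

/-! ### The flow preserves volume -/

/-- Coordinatewise integration by parts for Lipschitz functions; `b` is cut off outside the support
of `u`, so the divergence that appears against `u` is that of `b`. The integrand is written with
line derivatives in order to be defined and measurable everywhere. -/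
theorem integral_lineDeriv_sum_eq_zero {u : Eucl d → ℝ} {L : ℝ≥0} (hu : LipschitzWith L u)
    {b : Eucl d → Eucl d} (hb : ContDiff ℝ ∞ b)
    (hdiv : ∀ x, ∑ i : Fin d, (fderiv ℝ b x (EuclideanSpace.single i (1 : ℝ))) i = 0)
    {R : ℝ} (hR : 0 < R) (hsupp : ∀ x, u x ≠ 0 → ‖x‖ ≤ R) :
    ∃ D : Eucl d → ℝ, Measurable D ∧ (∀ x, DifferentiableAt ℝ u x → D x = fderiv ℝ u x (b x)) ∧
      ∫ x, D x = 0 := by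
  let ρ : ContDiffBump (0 : Eucl d) := ⟨R + 1, R + 2, by positivity, by linarith⟩
  have hbi : ∀ i, ContDiff ℝ ∞ fun x => b x i := fun i => by fun_prop
  have hg : ∀ i, ContDiff ℝ ∞ fun x => ρ x * b x i := fun i => ρ.contDiff.mul (hbi i)
  have hgc : ∀ i, HasCompactSupport fun x => ρ x * b x i := fun i =>
    ρ.hasCompactSupport.mul_right
  have hgl : ∀ i, ∃ C : ℝ≥0, LipschitzWith C fun x => ρ x * b x i := fun i =>
    ContDiff.lipschitzWith_of_hasCompactSupport (hgc i) (hg i) (by simp)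
  choose C hC using hgl
  have hul : ∀ i : Fin d, Measurable fun x => lineDeriv ℝ u x (EuclideanSpace.single i (1 : ℝ)) :=
    fun i => measurable_lineDeriv hu.continuous
  have hρ : ∀ x, ‖x‖ < R + 1 → ρ =ᶠ[𝓝 x] fun _ => 1 := fun x hx => by
    have : x ∈ Metric.ball (0 : Eucl d) (R + 1) := by simpa using hx
    filter_upwards [Metric.isOpen_ball.mem_nhds this] with y hy
    exact ρ.one_of_mem_closedBall (Metric.ball_subset_closedBall hy)
  refine ⟨fun x => ∑ i, lineDeriv ℝ u x (EuclideanSpace.single i (1 : ℝ)) * (ρ x * b x i),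
    Finset.measurable_sum _ fun i _ => (hul i).mul (hg i).continuous.measurable, fun x hx => ?_, ?_⟩
  · rcases le_or_gt ‖x‖ R with h | h
    · have h1 : ρ x = 1 := (hρ x (by linarith)).eq_of_nhds
      simp only [h1, one_mul, hx.lineDeriv_eq_fderiv]
      conv_rhs => rw [← (EuclideanSpace.basisFun (Fin d) ℝ).sum_repr (b x)]
      rw [map_sum]
      refine Finset.sum_congr rfl fun i _ => ?_
      rw [map_smul, smul_eq_mul, mul_comm]
      simp
    · have hz : u =ᶠ[𝓝 x] fun _ => 0 := by
        filter_upwards [(isOpen_lt continuous_const continuous_norm).mem_nhds h] with z hz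
        by_contra hne
        exact absurd (hsupp z hne) (not_le.2 hz)
      simp only [hx.lineDeriv_eq_fderiv, hz.fderiv_eq]
      simp
  · have hLC : ∀ i : Fin d, ∀ x, ‖lineDeriv ℝ u x (EuclideanSpace.single i (1 : ℝ))‖ ≤ L := by
      intro i x
      have := norm_lineDeriv_le_of_lipschitz ℝ hu (x₀ := x) (v := EuclideanSpace.single i (1 : ℝ))
      simpa using this
    have hint : ∀ i, Integrable fun x =>
        lineDeriv ℝ u x (EuclideanSpace.single i (1 : ℝ)) * (ρ x * b x i) := fun i =>
      ((hg i).continuous.integrable_of_hasCompactSupport (hgc i)).bdd_mul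
        (hul i).aestronglyMeasurable (Eventually.of_forall (hLC i))
    rw [integral_finsetSum _ fun i _ => hint i]
    rw [Finset.sum_congr rfl fun i _ => hu.integral_lineDeriv_mul_eq (μ := volume) (hC i) (hgc i)
      (EuclideanSpace.single i (1 : ℝ))]
    have huR : HasCompactSupport u := by
      refine HasCompactSupport.of_support_subset_isCompact (isCompact_closedBall 0 R) fun x hx => ?_
      simpa using hsupp x hx
    have hint2 : ∀ i, Integrable fun x =>
        lineDeriv ℝ (fun x => ρ x * b x i) x (-EuclideanSpace.single i (1 : ℝ)) * u x := by
      intro i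
      have hdi := (hg i).differentiable (by simp)
      have hdc := (hg i).continuous_fderiv (by simp)
      have hc : Continuous fun x => fderiv ℝ (fun x => ρ x * b x i) x
          (-EuclideanSpace.single i (1 : ℝ)) :=
        hdc.clm_apply continuous_const
      refine ((hc.mul hu.continuous).integrable_of_hasCompactSupport huR.mul_left).congr
        (Eventually.of_forall fun x => ?_)
      dsimp only
      rw [(hdi x).lineDeriv_eq_fderiv]
      rfl
    rw [← integral_finsetSum _ fun i _ => hint2 i]
    refine integral_eq_zero_of_ae (Eventually.of_forall fun x => ?_)
    simp only [Pi.zero_apply]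
    rw [← Finset.sum_mul]
    by_cases hx : u x = 0
    · rw [hx, mul_zero]
    have hd := hdiv x
    have e : ∀ i : Fin d, lineDeriv ℝ (fun x => ρ x * b x i) x (-EuclideanSpace.single i (1 : ℝ)) =
        -(fderiv ℝ b x (EuclideanSpace.single i (1 : ℝ))) i := by
      intro i
      have h1 : (fun x => ρ x * b x i) =ᶠ[𝓝 x] fun x => b x i := by
        filter_upwards [hρ x ((hsupp x hx).trans_lt (by linarith))] with y hy
        rw [hy, one_mul]
      have hbd := (hb.differentiable (by simp) x)
      rw [((hg i).differentiable (by simp) x).lineDeriv_eq_fderiv, h1.fderiv_eq, map_neg]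
      have h2 : HasFDerivAt (fun x => b x i)
          ((EuclideanSpace.proj i : Eucl d →L[ℝ] ℝ).comp (fderiv ℝ b x)) x :=
        (EuclideanSpace.proj i : Eucl d →L[ℝ] ℝ).hasFDerivAt.comp x hbd.hasFDerivAt
      rw [h2.fderiv]
      simp
    simp_rw [e, Finset.sum_neg_distrib, hd, neg_zero, zero_mul]

namespace IsFlow

variable {T : ℝ} {v : ℝ → Eucl d → Eucl d} {Φ : ℝ → ℝ → Eucl d → Eucl d} {s τ σ : ℝ}

/-- Fix the final time `τ` and vary the initial time `σ`. The function `x ↦ w(Φ σ τ x)` solves the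
transport equation almost everywhere by Rademacher, so its integral has derivative `-∫ v·∇u = 0`. It
equals `∫ w` at `σ = τ`. -/
theorem integral_comp_eq (hΦ : IsFlow T v Φ) (hT : 0 < T) (hv : IsSmoothDivFree T v)
    (hV : lipschitzIntegral T v ≠ ⊤) (hs : s ∈ Icc 0 T) (hτ : τ ∈ Icc 0 T) {w : Eucl d → ℝ}
    {L : ℝ≥0} (hw : LipschitzWith L w) {R : ℝ}
    (hR : ∀ x, w x ≠ 0 → ‖x‖ ≤ R) : ∫ x, w (Φ s τ x) = ∫ x, w x := by
  obtain ⟨R₀, hR₀⟩ := hΦ.exists_norm_le hT hv hV R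
  set R' := max R₀ 1 with hR'
  obtain ⟨B, hB⟩ := hΦ.exists_norm_sub_self_le hT hv hV R'
  set u : ℝ → Eucl d → ℝ := fun σ x => w (Φ σ τ x) with hu
  set L' : ℝ≥0 := L * Real.toNNReal (Real.exp (lipTime v T)) with hL'
  have hlip : ∀ σ ∈ Icc 0 T, LipschitzWith L' (u σ) := by
    intro σ hσ
    refine (hw.comp (hΦ.lipschitzWith hT hv hV hσ hτ)).weaken ?_
    have a1 := lipTime_mono hV le_rfl hσ.1 hσ.2
    have a2 := lipTime_mono hV le_rfl hτ.1 hτ.2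
    have a3 := lipTime_mono hV hσ.1 hσ.2 le_rfl
    have a4 := lipTime_mono hV hτ.1 hτ.2 le_rfl
    rw [lipTime_zero] at a1 a2
    rw [hL']
    gcongr
    rw [abs_le]
    constructor <;> linarith
  have hsupp : ∀ σ ∈ Icc 0 T, ∀ x, u σ x ≠ 0 → ‖x‖ ≤ R' := by
    intro σ hσ x hx
    have := hR₀ τ hτ σ hσ _ (hR _ hx)
    rw [hΦ.comp hT hv hV hσ hτ hσ, hΦ.self σ hσ] at this
    exact this.trans (le_max_left _ _)
  have hiii : ∀ σ ∈ Icc 0 T, ∀ r ∈ Icc 0 T, ∀ x, u σ x = u r (Φ σ r x) := by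
    intro σ hσ r hr x
    simp only [hu, hΦ.comp hT hv hV hσ hr hτ]
  have hB0 : 0 ≤ B := by
    have := hB 0 ⟨le_rfl, hT.le⟩ T ⟨hT.le, le_rfl⟩ 0 (by rw [norm_zero]; positivity)
    rw [sub_zero T, abs_of_pos hT] at this
    exact nonneg_of_mul_nonneg_left ((norm_nonneg _).trans this) hT
  -- The displacement over a time `|σ - r|` is at most `B |σ - r|` on the common support, and each
  -- `u σ` is `L'`-Lipschitz: this is the dominating function for differentiation under the
  -- integral.
  set b : Eucl d → ℝ := (Metric.closedBall 0 R').indicator fun _ => L' * B with hb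
  have hbi : Integrable b := (integrableOn_const (s := Metric.closedBall (0 : Eucl d) R')
    (measure_closedBall_lt_top).ne).integrable_indicator Metric.isClosed_closedBall.measurableSet
  have hiv : ∀ σ ∈ Icc 0 T, ∀ r ∈ Icc 0 T, ∀ x, ‖u σ x - u r x‖ ≤ b x * |σ - r| := by
    intro σ hσ r hr x
    by_cases hx : ‖x‖ ≤ R'
    · rw [hb, indicator_of_mem (by simpa using hx), hiii σ hσ r hr]
      have h1 := (hlip r hr).dist_le_mul (Φ σ r x) x
      rw [dist_eq_norm, dist_eq_norm] at h1
      refine h1.trans ?_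
      rw [mul_assoc, abs_sub_comm]
      gcongr
      exact hB σ hσ r hr x hx
    · have h1 : u σ x = 0 := by_contra fun h => hx (hsupp σ hσ x h)
      have h2 : u r x = 0 := by_contra fun h => hx (hsupp r hr x h)
      rw [h1, h2, sub_self, norm_zero]
      exact mul_nonneg (indicator_nonneg (fun _ _ => by positivity) _) (abs_nonneg _)
  have hui : ∀ σ ∈ Icc 0 T, Integrable (u σ) := fun σ hσ =>
    (hlip σ hσ).continuous.integrable_of_hasCompactSupport
      (HasCompactSupport.of_support_subset_isCompact (isCompact_closedBall 0 R')
        fun x hx => by simpa using hsupp σ hσ x hx)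
  have hJlip : ∀ σ ∈ Icc 0 T, ∀ r ∈ Icc 0 T, dist (∫ x, u σ x) (∫ x, u r x) ≤
      Real.toNNReal (∫ x, b x) * dist σ r := by
    intro σ hσ r hr
    rw [dist_eq_norm, ← integral_sub (hui σ hσ) (hui r hr), Real.dist_eq]
    refine (norm_integral_le_of_norm_le (hbi.mul_const _)
      (Eventually.of_forall (hiv σ hσ r hr))).trans ?_
    rw [integral_mul_const]
    gcongr
    exact Real.le_coe_toNNReal _
  have hJc : ContinuousOn (fun σ => ∫ x, u σ x) (Icc 0 T) :=
    (LipschitzOnWith.of_dist_le_mul hJlip).continuousOn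
  have hJd : ∀ σ ∈ Ioo 0 T, HasDerivAt (fun σ => ∫ x, u σ x) 0 σ := by
    intro σ hσ
    have hσ' : σ ∈ Icc 0 T := Ioo_subset_Icc_self hσ
    obtain ⟨D, hDm, hD, hD0⟩ := integral_lineDeriv_sum_eq_zero (hlip σ hσ')
      (contDiff_slice hv.smooth hσ') (hv.div_eq_zero σ hσ') (R := R') (by positivity) (hsupp σ hσ')
    have hnb : Icc 0 T ∈ 𝓝 σ := Icc_mem_nhds hσ.1 hσ.2
    have := (hasDerivAt_integral_of_dominated_loc_of_lip (μ := volume) (F := u) (x₀ := σ)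
      (F' := fun x => -D x) (bound := b) hnb
      (by filter_upwards [hnb] with r hr using (hlip r hr).continuous.aestronglyMeasurable)
      (hui σ hσ') hDm.neg.aestronglyMeasurable (Eventually.of_forall fun x => ?_) hbi ?_).2
    · rwa [integral_neg, hD0, neg_zero] at this
    · refine LipschitzOnWith.of_dist_le_mul fun r hr r' hr' => ?_
      rw [dist_eq_norm, Real.dist_eq, Real.coe_nnabs]
      refine (hiv r hr r' hr' x).trans ?_
      gcongr
      exact le_abs_self _
    · filter_upwards [(hlip σ hσ').ae_differentiableAt (μ := volume)] with x hx
      have h1 := hΦ.hasDerivAt_initial hT hv hV hσ x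
      have h2 : HasFDerivAt (u σ) (fderiv ℝ (u σ) x) (Φ σ σ x) := by
        rw [hΦ.self σ hσ']; exact hx.hasFDerivAt
      have h3 := h2.comp_hasDerivAt σ h1
      rw [map_neg, ← hD x hx] at h3
      refine h3.congr_of_eventuallyEq ?_
      filter_upwards [hnb] with r hr
      exact hiii r hr σ hσ' x
  have hconst : ∀ a ∈ Icc 0 T, ∀ c ∈ Icc 0 T, a < c → ∫ x, u a x = ∫ x, u c x := by
    intro a ha c hc hac
    obtain ⟨r, hr, h⟩ := exists_hasDerivAt_eq_slope (fun σ => ∫ x, u σ x) (fun _ => 0) hac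
      (hJc.mono (Icc_subset_Icc ha.1 hc.2))
      (fun r hr => hJd r ⟨ha.1.trans_lt hr.1, hr.2.trans_le hc.2⟩)
    have := sub_pos.2 hac
    rw [eq_comm, div_eq_zero_iff] at h
    rcases h with h | h <;> linarith
  have hfin : ∫ x, u s x = ∫ x, u τ x := by
    rcases lt_trichotomy s τ with h | h | h
    · exact hconst s hs τ hτ h
    · rw [h]
    · exact (hconst τ hτ s hs h).symm
  simpa only [hu, hΦ.self τ hτ] using hfin

end IsFlow

/-- Thickened indicators are Lipschitz and decrease to the indicator of a compact set, so the
measures agree on compact sets; inner and outer regularity do the rest. -/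
theorem measure_ext_of_integral_lipschitz {μ ν : Measure (Eucl d)} [μ.Regular] [ν.Regular]
    (h : ∀ (w : Eucl d → ℝ) (L : ℝ≥0) (R : ℝ), LipschitzWith L w → (∀ x, ‖w x‖ ≤ 1) →
      (∀ x, w x ≠ 0 → ‖x‖ ≤ R) → ∫ x, w x ∂μ = ∫ x, w x ∂ν) : μ = ν := by
  refine Measure.OuterRegular.ext_isOpen fun U hU => ?_
  refine Measure.InnerRegularWRT.eq_of_innerRegularWRT_of_forall_eq Measure.Regular.innerRegular
    Measure.Regular.innerRegular (fun K hK => ?_) hU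
  obtain ⟨R, hR⟩ := hK.isBounded.exists_norm_le
  have hδ : ∀ n : ℕ, (0 : ℝ) < 1 / ((n : ℝ) + 1) := fun n => by positivity
  set w : ℕ → Eucl d → ℝ := fun n x => (thickenedIndicator (hδ n) K x : ℝ) with hw
  have hsupp : ∀ n x, w n x ≠ 0 → ‖x‖ ≤ R + 1 := by
    intro n x hx
    have h1 : x ∈ Metric.thickening (1 / ((n : ℝ) + 1)) K := by
      by_contra hne
      exact hx (by simp only [hw, thickenedIndicator_zero (hδ n) K hne, NNReal.coe_zero])
    obtain ⟨z, hz, hxz⟩ := Metric.mem_thickening_iff.1 h1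
    have h2 := hR z hz
    have h3 : 1 / ((n : ℝ) + 1) ≤ 1 := by
      rw [div_le_one (by positivity)]; linarith [(Nat.cast_nonneg n : (0:ℝ) ≤ n)]
    rw [dist_eq_norm] at hxz
    have := norm_le_norm_add_norm_sub' x z
    linarith
  have hlip : ∀ n, ∃ L, LipschitzWith L (w n) := fun n =>
    ⟨_, (LipschitzWith.subtype_val _).comp (lipschitzWith_thickenedIndicator (hδ n) K)⟩
  have hle : ∀ n x, ‖w n x‖ ≤ 1 := fun n x => by
    simp only [hw, NNReal.norm_eq]
    exact_mod_cast thickenedIndicator_le_one (hδ n) K x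
  have hlim : ∀ m : Measure (Eucl d), [m.Regular] → Tendsto (fun n => ∫ x, w n x ∂m) atTop
      (𝓝 (∫ x, K.indicator (fun _ => (1 : ℝ)) x ∂m)) := by
    intro m _
    refine tendsto_integral_of_dominated_convergence
      ((Metric.closedBall (0 : Eucl d) (R + 1)).indicator fun _ => (1 : ℝ))
      (fun n => ((hlip n).choose_spec).continuous.aestronglyMeasurable)
      ((integrableOn_const (measure_closedBall_lt_top).ne).integrable_indicator
        Metric.isClosed_closedBall.measurableSet) (fun n => Eventually.of_forall fun x => ?_)
      (Eventually.of_forall fun x => ?_)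
    · by_cases hx : w n x = 0
      · rw [hx, norm_zero]; exact indicator_nonneg (fun _ _ => zero_le_one) _
      · rw [indicator_of_mem (by simpa using hsupp n x hx)]; exact hle n x
    · have h1 := thickenedIndicator_tendsto_indicator_closure hδ
        tendsto_one_div_add_atTop_nhds_zero_nat K
      rw [tendsto_pi_nhds] at h1
      have h2 := (NNReal.continuous_coe.tendsto _).comp (h1 x)
      rw [hK.isClosed.closure_eq] at h2
      have h3 : ((K.indicator (fun _ => (1 : ℝ≥0)) x : ℝ≥0) : ℝ) = K.indicator (fun _ => (1 : ℝ)) x := by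
        by_cases hx : x ∈ K <;> simp [hx]
      rw [← h3]
      exact h2
  have h1 := hlim μ
  have h2 := hlim ν
  simp_rw [fun n => h (w n) _ _ (hlip n).choose_spec (hle n) (hsupp n)] at h1
  have h3 := tendsto_nhds_unique h1 h2
  rw [integral_indicator_const _ hK.measurableSet, integral_indicator_const _ hK.measurableSet,
    smul_eq_mul, smul_eq_mul, mul_one, mul_one, measureReal_eq_measureReal_iff hK.measure_ne_top
      hK.measure_ne_top] at h3
  exact h3

namespace IsFlow

variable {T : ℝ} {v : ℝ → Eucl d → Eucl d} {Φ : ℝ → ℝ → Eucl d → Eucl d} {s τ σ : ℝ}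

theorem measurePreserving (hΦ : IsFlow T v Φ) (hT : 0 < T) (hv : IsSmoothDivFree T v)
    (hV : lipschitzIntegral T v ≠ ⊤) (hs : s ∈ Icc 0 T) (hτ : τ ∈ Icc 0 T) :
    MeasurePreserving (Φ s τ) volume volume := by
  let e : Eucl d ≃ₜ Eucl d :=
    { toFun := Φ s τ
      invFun := Φ τ s
      left_inv := fun x => by rw [hΦ.comp hT hv hV hs hτ hs, hΦ.self s hs]
      right_inv := fun x => by rw [hΦ.comp hT hv hV hτ hs hτ, hΦ.self τ hτ]
      continuous_toFun := (hΦ.lipschitzWith hT hv hV hs hτ).continuous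
      continuous_invFun := (hΦ.lipschitzWith hT hv hV hτ hs).continuous }
  have hreg : (Measure.map (Φ s τ) (volume : Measure (Eucl d))).Regular :=
    Measure.Regular.map e
  have hm := (hΦ.lipschitzWith hT hv hV hs hτ).continuous.measurable
  refine ⟨hm, measure_ext_of_integral_lipschitz fun w L R hw _ hR => ?_⟩
  rw [integral_map hm.aemeasurable hw.continuous.aestronglyMeasurable]
  exact hΦ.integral_comp_eq hT hv hV hs hτ hw hR

theorem isPropagatorPair (hΦ : IsFlow T v Φ) (hT : 0 < T) (hv : IsSmoothDivFree T v)
    (hV : lipschitzIntegral T v ≠ ⊤) (hs : s ∈ Icc 0 T) (hτ : τ ∈ Icc 0 T) :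
    IsPropagatorPair (Real.toNNReal (Real.exp |lipTime v τ - lipTime v s|))
      (fun u x => u (Φ s τ x)) (fun w x => w (Φ τ s x)) := by
  refine isPropagatorPair_comp (hΦ.lipschitzWith hT hv hV hs hτ) ?_
    (hΦ.measurePreserving hT hv hV hs hτ) (hΦ.measurePreserving hT hv hV hτ hs)
    fun x => by rw [hΦ.comp hT hv hV hs hτ hs, hΦ.self s hs]
  rw [abs_sub_comm]
  exact hΦ.lipschitzWith hT hv hV hτ hs

end IsFlow

/-! ### The overlap of two balls in dimension three -/

/-- The normalized volume of the intersection of two balls of unit diameter in dimension three,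
as a function of the distance of the centres. -/
noncomputable def ballOverlap (r : ℝ) : ℝ := 1 - 3 / 2 * min r 1 + min r 1 ^ 3 / 2

theorem continuous_ballOverlap : Continuous ballOverlap := by
  unfold ballOverlap; fun_prop

theorem ballOverlap_of_one_le {r : ℝ} (hr : 1 ≤ r) : ballOverlap r = 0 := by
  rw [ballOverlap, min_eq_right hr]; norm_num

theorem integral_cap_eq (r : ℝ) :
    ∫ x in (r / 2)..1, (1 - x ^ 2) = 2 / 3 * (1 - 3 / 2 * (r / 2) + (r / 2) ^ 3 / 2) := by
  have h : ∀ x ∈ uIcc (r / 2) 1, HasDerivAt (fun x : ℝ => x - x ^ 3 / 3) (1 - x ^ 2) x := by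
    intro x _
    refine ((hasDerivAt_id' x).sub ((hasDerivAt_pow 3 x).div_const 3)).congr_deriv ?_
    push_cast
    ring
  rw [intervalIntegral.integral_eq_sub_of_hasDerivAt h
    ((by fun_prop : Continuous fun x : ℝ => 1 - x ^ 2).intervalIntegrable _ _)]
  ring

/-- Sections orthogonal to the axis of centres are concentric discs, and the smaller one has the
area integrated here; `ENNReal.ofReal` discards empty sections. The integrand is symmetric about
`r/2`, which leaves twice a spherical cap. -/
theorem integral_min_caps {r : ℝ} (hr : 0 ≤ r) :
    ∫⁻ x, ENNReal.ofReal (Real.pi * min (1 - x ^ 2) (1 - (x - r) ^ 2)) =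
      ENNReal.ofReal (4 / 3 * Real.pi * ballOverlap (r / 2)) := by
  have hpi := Real.pi_pos
  rcases le_or_gt 2 r with h2 | h2
  · rw [ballOverlap_of_one_le (by linarith), mul_zero, ENNReal.ofReal_zero]
    simp_rw [lintegral_eq_zero_iff' (by fun_prop : AEMeasurable fun x : ℝ =>
      ENNReal.ofReal (Real.pi * min (1 - x ^ 2) (1 - (x - r) ^ 2)))]
    refine Eventually.of_forall fun x => ENNReal.ofReal_eq_zero.2 ?_
    refine mul_nonpos_of_nonneg_of_nonpos hpi.le ?_
    rcases le_total x 1 with hx | hx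
    · exact (min_le_right _ _).trans (by nlinarith)
    · exact (min_le_left _ _).trans (by nlinarith)
  set F : ℝ → ℝ := fun x => Real.pi * min (1 - x ^ 2) (1 - (x - r) ^ 2) with hF
  have hFc : Continuous F := by fun_prop
  have hF0 : ∀ x ∉ Ioc (r - 1) 1, ENNReal.ofReal (F x) = 0 := by
    intro x hx
    refine ENNReal.ofReal_eq_zero.2 (mul_nonpos_of_nonneg_of_nonpos hpi.le ?_)
    rw [mem_Ioc, not_and_or, not_lt, not_le] at hx
    rcases hx with hx | hx
    · exact (min_le_right _ _).trans (by nlinarith)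
    · exact (min_le_left _ _).trans (by nlinarith)
  have hFpos : ∀ x ∈ Ioc (r - 1) 1, 0 ≤ F x := fun x hx =>
    mul_nonneg hpi.le (le_min (by nlinarith [hx.1, hx.2]) (by nlinarith [hx.1, hx.2]))
  have e1 : ∫⁻ x, ENNReal.ofReal (F x) = ∫⁻ x in Ioc (r - 1) 1, ENNReal.ofReal (F x) := by
    rw [← lintegral_indicator measurableSet_Ioc]
    refine lintegral_congr fun x => ?_
    by_cases hx : x ∈ Ioc (r - 1) 1
    · rw [indicator_of_mem hx]
    · rw [indicator_of_notMem hx, hF0 x hx]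
  rw [e1, ← ofReal_integral_eq_lintegral_ofReal
    (hFc.integrableOn_Ioc) ((ae_restrict_iff' measurableSet_Ioc).2 (Eventually.of_forall hFpos)),
    ← intervalIntegral.integral_of_le (by linarith),
    ← intervalIntegral.integral_add_adjacent_intervals (b := r / 2) (hFc.intervalIntegrable _ _)
      (hFc.intervalIntegrable _ _)]
  have e2 : ∫ x in (r / 2)..1, F x = Real.pi * ∫ x in (r / 2)..1, (1 - x ^ 2) := by
    rw [← intervalIntegral.integral_const_mul]
    refine intervalIntegral.integral_congr fun x hx => ?_
    rw [uIcc_of_le (by linarith)] at hx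
    simp only [hF]
    rw [min_eq_left (by nlinarith [hx.1])]
  have e3 : ∫ x in (r - 1)..(r / 2), F x = Real.pi * ∫ x in (r / 2)..1, (1 - x ^ 2) := by
    have h1 := intervalIntegral.integral_comp_sub_left (a := r / 2) (b := 1) F r
    rw [show r - r / 2 = r / 2 by ring] at h1
    rw [← h1, ← e2]
    refine intervalIntegral.integral_congr fun x hx => ?_
    simp only [hF]
    rw [min_comm]
    ring_nf
  rw [e2, e3, integral_cap_eq, ballOverlap, min_eq_left (by linarith)]
  congr 1
  ring

theorem volume_slice (m : ℝ) : volume {y : Eucl 2 | ‖y‖ ^ 2 ≤ m} = ENNReal.ofReal (Real.pi * m) := by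
  rcases le_or_gt 0 m with h | h
  · have : {y : Eucl 2 | ‖y‖ ^ 2 ≤ m} = Metric.closedBall 0 (Real.sqrt m) := by
      ext y
      simp [Real.le_sqrt (norm_nonneg _) h]
    rw [this, EuclideanSpace.volume_closedBall_fin_two, ← ENNReal.ofReal_pow (Real.sqrt_nonneg _),
      Real.sq_sqrt h, mul_comm, ENNReal.ofReal_mul Real.pi_pos.le]
  · have : {y : Eucl 2 | ‖y‖ ^ 2 ≤ m} = ∅ := by
      ext y
      simp only [mem_ofPred_eq, mem_empty_iff_false, iff_false, not_le]
      exact h.trans_le (sq_nonneg _)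
    rw [this, measure_empty, ENNReal.ofReal_of_nonpos]
    exact mul_nonpos_of_nonneg_of_nonpos Real.pi_pos.le h.le

/-- Three-dimensional space, as the orthogonal sum of a line and a plane. -/
abbrev AxisSpace := WithLp 2 (ℝ × Eucl 2)

/-- A reflection carries `ξ` to the distinguished axis, and the volume is then computed by slices.
-/
theorem volume_closedBall_inter (ξ : AxisSpace) :
    volume (Metric.closedBall (0 : AxisSpace) 1 ∩ Metric.closedBall ξ 1) =
      ENNReal.ofReal (4 / 3 * Real.pi * ballOverlap (‖ξ‖ / 2)) := by
  set ζ : AxisSpace := WithLp.toLp 2 (‖ξ‖, 0) with hζ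
  have hn : ‖ξ‖ = ‖ζ‖ := by
    rw [hζ, WithLp.prod_norm_eq_of_L2 (WithLp.toLp 2 (‖ξ‖, (0 : Eucl 2)))]; simp
  let e : AxisSpace ≃ₗᵢ[ℝ] AxisSpace := (ℝ ∙ (ξ - ζ))ᗮ.reflection
  have he : e ξ = ζ := Submodule.reflection_sub hn
  have h1 : Metric.closedBall (0 : AxisSpace) 1 ∩ Metric.closedBall ξ 1 =
      e ⁻¹' (Metric.closedBall 0 1 ∩ Metric.closedBall ζ 1) := by
    ext x
    simp only [mem_inter_iff, mem_preimage, Metric.mem_closedBall]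
    rw [← he, e.dist_map, ← e.map_zero, e.dist_map, e.map_zero]
  rw [h1, e.measurePreserving.measure_preimage
    (Metric.isClosed_closedBall.inter Metric.isClosed_closedBall).measurableSet.nullMeasurableSet,
    ← (WithLp.volume_preserving_toLp ℝ (Eucl 2)).measure_preimage
    (Metric.isClosed_closedBall.inter Metric.isClosed_closedBall).measurableSet.nullMeasurableSet]
  rw [Measure.volume_eq_prod, Measure.prod_apply ((WithLp.volume_preserving_toLp ℝ (Eucl 2)).measurable
    (Metric.isClosed_closedBall.inter Metric.isClosed_closedBall).measurableSet)]
  rw [← integral_min_caps (norm_nonneg ξ)]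
  refine lintegral_congr fun x => ?_
  rw [← volume_slice]
  congr 1
  ext y
  have a1 : dist (WithLp.toLp 2 (x, y) : AxisSpace) 0 ≤ 1 ↔ x ^ 2 + ‖y‖ ^ 2 ≤ 1 := by
    rw [dist_eq_norm, WithLp.prod_norm_eq_of_L2, Real.sqrt_le_one]
    simp
  have a2 : dist (WithLp.toLp 2 (x, y) : AxisSpace) ζ ≤ 1 ↔ (x - ‖ξ‖) ^ 2 + ‖y‖ ^ 2 ≤ 1 := by
    rw [dist_eq_norm, WithLp.prod_norm_eq_of_L2, Real.sqrt_le_one]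
    simp [hζ]
  simp only [mem_preimage, mem_inter_iff, Metric.mem_closedBall, mem_ofPred_eq, le_min_iff]
  rw [a1, a2]
  constructor <;> rintro ⟨h1, h2⟩ <;> constructor <;> linarith

/-! ### The overlap is a characteristic function -/

section positive

variable {V : Type*} [NormedAddCommGroup V] [InnerProductSpace ℝ V] [MeasurableSpace V]
  [BorelSpace V] [FiniteDimensional ℝ V]

/-- Gaussian-weighted integrals of the transform converge to the finite value `f 0`; for a
nonnegative transform Fatou's lemma then bounds the full integral. -/
theorem integrable_fourier_of_nonneg {f : V → ℂ} (hf : Integrable f) (hc : ContinuousAt f 0)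
    {r : V → ℝ} (hr : ∀ w, 𝓕 f w = r w) (h0 : ∀ w, 0 ≤ r w) : Integrable (𝓕 f) := by
  have hcont : Continuous (𝓕 f) := VectorFourier.fourierIntegral_continuous
    Real.continuous_fourierChar (L := innerₗ V) continuous_inner hf
  have hrc : Continuous r := by
    have : r = fun w => (𝓕 f w).re := by ext w; rw [hr, Complex.ofReal_re]
    rw [this]
    exact Complex.continuous_re.comp hcont
  have hlim : Tendsto (fun n : ℕ => ∫ w : V, Real.exp (-((n : ℝ) + 1)⁻¹ * ‖w‖ ^ 2) * r w) atTop
      (𝓝 (f 0).re) := by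
    have h1 := Real.tendsto_integral_gaussian_smul' hf hc
    have h2 : Tendsto (fun n : ℕ => (n : ℝ) + 1) atTop atTop :=
      tendsto_atTop_add_const_right _ _ tendsto_natCast_atTop_atTop
    have h3 := (Complex.continuous_re.tendsto _).comp (h1.comp h2)
    refine h3.congr fun n => ?_
    have hc : 0 < (n : ℝ) + 1 := by positivity
    have hc' : 0 < ((((n : ℝ) + 1 : ℝ) : ℂ)⁻¹).re := by
      rw [← Complex.ofReal_inv, Complex.ofReal_re]; positivity
    have J : Integrable (fun w : V => Complex.exp (-(((n : ℝ) + 1 : ℝ) : ℂ)⁻¹ * ‖w‖ ^ 2 +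
        2 * Real.pi * Complex.I * inner ℝ (0 : V) w)) :=
      GaussianFourier.integrable_cexp_neg_mul_sq_norm_add hc' _ _
    have h4 := VectorFourier.integral_fourierIntegral_smul_eq_flip (L := innerₗ V)
      Real.continuous_fourierChar continuous_inner J hf
    have h5 : ∫ w : V, (𝓕 (fun w : V => Complex.exp (-(((n : ℝ) + 1 : ℝ) : ℂ)⁻¹ * ‖w‖ ^ 2 +
        2 * Real.pi * Complex.I * inner ℝ (0 : V) w)) w) • f w =
        ∫ w : V, Complex.exp (-(((n : ℝ) + 1 : ℝ) : ℂ)⁻¹ * ‖w‖ ^ 2 +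
        2 * Real.pi * Complex.I * inner ℝ (0 : V) w) • 𝓕 f w := by
      simpa using! h4
    simp only [Function.comp]
    have h6 : ∫ w : V, Complex.exp (-(((n : ℝ) + 1 : ℝ) : ℂ)⁻¹ * ‖w‖ ^ 2 +
        2 * Real.pi * Complex.I * inner ℝ (0 : V) w) • 𝓕 f w =
        ((∫ w : V, Real.exp (-((n : ℝ) + 1)⁻¹ * ‖w‖ ^ 2) * r w : ℝ) : ℂ) := by
      rw [← integral_complex_ofReal]
      congr 1; ext w
      rw [hr]
      push_cast
      simp
    rw [← Complex.ofReal_re (∫ w : V, Real.exp (-((n : ℝ) + 1)⁻¹ * ‖w‖ ^ 2) * r w), ← h6, ← h5]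
    congr 1
    congr 1; ext w
    congr 1
    rw [fourier_gaussian_innerProductSpace' hc']
    simp only [div_inv_eq_mul]
    push_cast
    ring_nf
  have hint : ∀ n : ℕ, Integrable fun w : V => Real.exp (-((n : ℝ) + 1)⁻¹ * ‖w‖ ^ 2) * r w := by
    intro n
    have h1 := GaussianFourier.integrable_cexp_neg_mul_sq_norm_add (V := V)
      (b := ((((n : ℝ) + 1)⁻¹ : ℝ) : ℂ)) (by rw [Complex.ofReal_re]; positivity) 0 0
    refine (h1.norm.mul_const (∫ w, ‖f w‖)).mono' (by fun_prop : Continuous _).aestronglyMeasurable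
      (Eventually.of_forall fun w => ?_)
    rw [norm_mul]
    gcongr
    · rw [Complex.norm_exp, Real.norm_of_nonneg (Real.exp_pos _).le]
      refine le_of_eq ?_
      congr 1
      norm_cast
      simp
    · rw [← Complex.norm_real, ← hr]
      exact VectorFourier.norm_fourierIntegral_le_integral_norm _ _ _ _ _
  refine ⟨hcont.aestronglyMeasurable, ?_⟩
  rw [hasFiniteIntegral_iff_enorm]
  have e : ∀ w, ‖𝓕 f w‖ₑ = ENNReal.ofReal (r w) := fun w => by
    rw [hr, ← ofReal_norm, Complex.norm_real, Real.norm_of_nonneg (h0 w)]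
  simp_rw [e]
  have hpt : ∀ w : V, ENNReal.ofReal (r w) =
      liminf (fun n : ℕ => ENNReal.ofReal (Real.exp (-((n : ℝ) + 1)⁻¹ * ‖w‖ ^ 2) * r w)) atTop := by
    intro w
    refine (Tendsto.liminf_eq ?_).symm
    refine (ENNReal.continuous_ofReal.tendsto _).comp ?_
    have h1 : Tendsto (fun n : ℕ => ((n : ℝ) + 1)⁻¹) atTop (𝓝 0) := by
      simpa using tendsto_one_div_add_atTop_nhds_zero_nat (𝕜 := ℝ)
    have h2 := ((Real.continuous_exp.tendsto _).comp (h1.neg.mul_const (‖w‖ ^ 2))).mul_const (r w)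
    simpa using h2
  simp_rw [hpt]
  refine (lintegral_liminf_le fun n => ?_).trans_lt ?_
  · exact (by fun_prop : Continuous fun w : V =>
      Real.exp (-((n : ℝ) + 1)⁻¹ * ‖w‖ ^ 2) * r w).measurable.ennreal_ofReal
  · simp_rw [fun n : ℕ => (ofReal_integral_eq_lintegral_ofReal (hint n)
      (Eventually.of_forall fun w => mul_nonneg (Real.exp_pos _).le (h0 w))).symm]
    have h := ((ENNReal.continuous_ofReal.tendsto _).comp hlim).liminf_eq
    exact (le_of_eq h).trans_lt ENNReal.ofReal_lt_top

end positive

open scoped Convolution in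
-- The overlap is the convolution of the indicator of a ball with itself. The indicator is even, so
-- its transform is real, and the transform of the convolution is a square. Fourier inversion
-- exhibits the overlap as the transform of a positive density.
theorem exists_measure_charFun_ballOverlap : ∃ μ : Measure AxisSpace, IsProbabilityMeasure μ ∧
    ∀ ξ, charFun μ ξ = (ballOverlap ‖ξ‖ : ℂ) := by
  set B : Set AxisSpace := Metric.closedBall 0 1 with hB
  have hBm : MeasurableSet B := Metric.isClosed_closedBall.measurableSet
  set f : AxisSpace → ℂ := B.indicator fun _ => 1 with hf
  have hfi : Integrable f :=
    (integrableOn_const (measure_closedBall_lt_top).ne).integrable_indicator hBm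
  set c : ℝ := 4 / 3 * Real.pi with hc
  have hc0 : 0 < c := by positivity
  set V : AxisSpace → ℂ := f ⋆[ContinuousLinearMap.mul ℂ ℂ] f with hV
  have hVeq : ∀ ξ, V ξ = ((c * ballOverlap (‖ξ‖ / 2) : ℝ) : ℂ) := by
    intro ξ
    have h1 : ∀ t, f t * f (ξ - t) = (B ∩ Metric.closedBall ξ 1).indicator (fun _ => (1 : ℂ)) t := by
      intro t
      have h2 : ξ - t ∈ B ↔ t ∈ Metric.closedBall ξ 1 := by
        rw [hB, Metric.mem_closedBall, Metric.mem_closedBall, dist_zero_right, dist_comm, dist_eq_norm]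
      by_cases ht : t ∈ B <;> by_cases ht' : t ∈ Metric.closedBall ξ 1 <;>
        simp [hf, ht, ht', h2, -Metric.mem_closedBall]
    rw [hV, convolution_def]
    simp only [ContinuousLinearMap.mul_apply']
    simp_rw [h1]
    rw [integral_indicator_const _ (hBm.inter Metric.isClosed_closedBall.measurableSet),
      Measure.real, hB, volume_closedBall_inter, ENNReal.toReal_ofReal, Complex.real_smul, mul_one]
    refine mul_nonneg hc0.le ?_
    unfold ballOverlap
    have h3 : min (‖ξ‖ / 2) 1 ≤ 1 := min_le_right _ _
    have h4 : 0 ≤ min (‖ξ‖ / 2) 1 := by positivity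
    nlinarith [mul_nonneg h4 (sq_nonneg (min (‖ξ‖ / 2) 1 - 1)), sq_nonneg (min (‖ξ‖ / 2) 1 - 1)]
  have hVfun : V = fun ξ => ((c * ballOverlap (‖ξ‖ / 2) : ℝ) : ℂ) := funext hVeq
  have hVc : Continuous V := by
    have := continuous_ballOverlap
    rw [hVfun]
    fun_prop
  have hVi : Integrable V := hfi.integrable_convolution _ hfi
  have hreal : ∀ w, ((𝓕 f w).re : ℂ) = 𝓕 f w := by
    intro w
    refine Complex.conj_eq_iff_re.1 ?_
    rw [Real.fourier_eq, ← integral_conj]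
    rw [← integral_neg_eq_self]
    congr 1; ext x
    have h1 : f (-x) = f x := by
      have : -x ∈ B ↔ x ∈ B := by simp [hB]
      by_cases hx : x ∈ B <;> simp [hf, hx, this]
    have h2 : (starRingEnd ℂ) (f x) = f x := by
      by_cases hx : x ∈ B <;> simp [hf, hx]
    rw [h1, Circle.smul_def, Circle.smul_def, smul_eq_mul, smul_eq_mul, map_mul, h2, inner_neg_left,
      ← Circle.coe_inv_eq_conj, ← AddChar.map_neg_eq_inv, neg_neg]
  set r : AxisSpace → ℝ := fun w => (𝓕 f w).re ^ 2 with hr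
  have hFV : ∀ w, 𝓕 V w = (r w : ℂ) := by
    intro w
    rw [hV, Real.fourier_mul_convolution_eq hfi hfi, hr]
    push_cast
    rw [hreal, sq]
  have hFVi := integrable_fourier_of_nonneg hVi hVc.continuousAt hFV fun w => sq_nonneg _
  have hinv := hVc.fourierInv_fourier_eq hVi hFVi
  have hrc : Continuous r := by
    have h1 : Continuous (𝓕 f) := VectorFourier.fourierIntegral_continuous
      Real.continuous_fourierChar (L := innerₗ AxisSpace) continuous_inner hfi
    exact (Complex.continuous_re.comp h1).pow 2
  have hri : Integrable r := by
    have := hFVi.re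
    refine this.congr (Eventually.of_forall fun w => ?_)
    simp only [hFV]
    exact Complex.ofReal_re _
  set ν : Measure AxisSpace := volume.withDensity fun w => ENNReal.ofReal (r w / c) with hν
  have hchar : ∀ ξ, charFun ν ξ = (ballOverlap (‖ξ‖ / (4 * Real.pi)) : ℂ) := by
    intro ξ
    rw [charFun_apply, hν, integral_withDensity_eq_integral_toReal_smul
      (hrc.div_const c).measurable.ennreal_ofReal
      (Eventually.of_forall fun _ => ENNReal.ofReal_lt_top)]
    have h1 := congrFun hinv ((2 * Real.pi)⁻¹ • ξ)
    rw [Real.fourierInv_eq, hVeq, norm_smul, Real.norm_of_nonneg (by positivity)] at h1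
    have h2 : ∀ x, (ENNReal.ofReal (r x / c)).toReal • Complex.exp (inner ℝ x ξ * Complex.I) =
        (c : ℂ)⁻¹ * (𝐞 (inner ℝ x ((2 * Real.pi)⁻¹ • ξ)) • 𝓕 V x) := by
      intro x
      rw [ENNReal.toReal_ofReal (div_nonneg (sq_nonneg _) hc0.le), hFV, Circle.smul_def,
        Real.fourierChar_apply, inner_smul_right, Complex.real_smul, smul_eq_mul]
      have : 2 * Real.pi * ((2 * Real.pi)⁻¹ * inner ℝ x ξ) = inner ℝ x ξ := by
        rw [← mul_assoc, mul_inv_cancel₀ (by positivity), one_mul]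
      rw [this]
      simp only [Complex.ofReal_div]
      ring
    simp_rw [h2]
    rw [integral_const_mul, h1]
    push_cast
    rw [← mul_assoc, inv_mul_cancel₀ (by exact_mod_cast hc0.ne'), one_mul]
    congr 2
    field_simp
    ring
  have hfin : IsFiniteMeasure ν := by
    refine isFiniteMeasure_withDensity_ofReal (hri.div_const c).2
  have hprob : IsProbabilityMeasure ν := by
    have h1 := hchar 0
    rw [charFun_zero] at h1
    simp only [norm_zero, zero_div] at h1
    have h2 : ballOverlap 0 = 1 := by norm_num [ballOverlap]
    rw [h2] at h1
    have h3 : ν.real univ = 1 := by exact_mod_cast h1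
    exact ⟨by rw [← ENNReal.ofReal_toReal (measure_ne_top ν univ)]; simp [← Measure.real_def, h3]⟩
  -- The factor `4π` is the diameter `2` of the unit ball times the `2π` between the two Fourier
  -- conventions.
  refine ⟨ν.map fun x => (4 * Real.pi) • x, Measure.isProbabilityMeasure_map (by fun_prop),
    fun ξ => ?_⟩
  rw [charFun_map_smul, hchar, norm_smul, Real.norm_of_nonneg (by positivity),
    mul_div_cancel_left₀ _ (by positivity)]

/-! ### Sign conditions on the derivatives of the symbol -/

/-- Here `a = r/(λ+r)`, `e = 1/log(λ+r)`, and `b = β - αae` is the logarithmic derivative `r g'/g`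
of the profile. The threshold on `λ` enters only as `(3+2α) e ≤ β`. This and the next two results on
`b` give the signs of `g'`, `g''` and `g'''`. -/
theorem logSymbol_first {α β a e : ℝ} (hα : 0 ≤ α) (hβ : β ≤ 1) (ha : 0 ≤ a) (ha1 : a ≤ 1)
    (he : 0 < e) (hle : (3 + 2 * α) * e ≤ β) :
    3 * e ≤ β - α * a * e ∧ β - α * a * e ≤ 1 := by
  have h1 : 0 ≤ α * e := by positivity
  have h2 : α * a * e ≤ α * e := by nlinarith
  have h3 : 0 ≤ α * a * e := by positivity
  constructor <;> nlinarith

theorem logSymbol_second {α β a e b : ℝ} (hα : 0 ≤ α) (hβ : β ≤ 1) (ha : 0 ≤ a) (ha1 : a ≤ 1)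
    (he : 0 < e) (hle : (3 + 2 * α) * e ≤ β) (hb : b = β - α * a * e) :
    b ^ 2 - b + (-(α * a * e) * (1 - a - a * e)) ≤ 0 := by
  obtain ⟨h1, h2⟩ := logSymbol_first hα hβ ha ha1 he hle
  rw [← hb] at h1 h2
  set p := α * a * e with hp
  have hp0 : 0 ≤ p := by positivity
  have hw : p ≤ 1 - b := by rw [hb]; linarith
  have h3 : 0 ≤ b := by linarith
  have h4 : b * p ≤ b * (1 - b) := by gcongr
  have h5 : 3 * e * p ≤ b * p := by gcongr
  have h6 : p * (a * e) ≤ p * e := by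
    gcongr
    nlinarith
  have h7 : 0 ≤ p * (1 - a) := mul_nonneg hp0 (by linarith)
  nlinarith [mul_nonneg hp0 he.le]

/-- For `w ≤ 1/2` the map `s ↦ s(1 - s²)` does not decrease from `p` to `w`, and the bracket is at
most `1 - p²`. For `w ≥ 1/2` one uses `p ≤ a(1-w)` instead and compares after removing the factor `1
- w`. -/
theorem logSymbol_aux {p a w : ℝ} (ha : 0 ≤ a) (ha1 : a ≤ 1) (hp0 : 0 ≤ p) (hpw : p ≤ w)
    (hw1 : w ≤ 1) (hpa : p ≤ a / 2) (hpb : p ≤ a * (1 - w)) :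
    p * (1 - 3 * a + 20 / 9 * a ^ 2 + w * a) ≤ w * (1 - w) * (1 + w) := by
  have hw0 : 0 ≤ w := hp0.trans hpw
  have ha0 : 0 ≤ 1 - a := by linarith
  have haa : a ^ 2 ≤ a := by nlinarith
  rcases le_total w (1 / 2) with h | h
  · have h5 : 0 ≤ 1 - w ^ 2 - w * p - p ^ 2 := by nlinarith
    have k1 : p * (1 - p ^ 2) ≤ w * (1 - w ^ 2) := by
      linarith [mul_nonneg (sub_nonneg.2 hpw) h5]
    have k3 : p ^ 2 ≤ a / 4 := by nlinarith
    have k4 : w * a ≤ a / 2 := by nlinarith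
    have k2 : 1 - 3 * a + 20 / 9 * a ^ 2 + w * a ≤ 1 - p ^ 2 := by linarith
    calc _ ≤ p * (1 - p ^ 2) := by gcongr
      _ ≤ _ := by linarith
  · have hb0 : 0 ≤ 1 - w := by linarith
    have k3 : a - 3 * a ^ 2 + 20 / 9 * a ^ 3 ≤ 1 / 4 := by
      linarith [mul_nonneg ha0 (sq_nonneg (1 / 2 - 3 / 4 * a)), mul_nonneg (sq_nonneg a) ha0,
        sq_nonneg a]
    have k4 : a * (1 - 3 * a + 20 / 9 * a ^ 2 + w * a) ≤ w * (1 + w) := by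
      have h1 : w * a ^ 2 ≤ w := by nlinarith
      have h2 : 1 / 4 ≤ w ^ 2 := by nlinarith
      linarith
    have k5 : 0 ≤ 1 - 3 * a + 20 / 9 * a ^ 2 + w * a := by
      linarith [sq_nonneg (a - 9 / 16), mul_nonneg ha (sub_nonneg.2 h)]
    calc _ ≤ a * (1 - w) * (1 - 3 * a + 20 / 9 * a ^ 2 + w * a) := by gcongr
      _ = (1 - w) * (a * (1 - 3 * a + 20 / 9 * a ^ 2 + w * a)) := by ring
      _ ≤ (1 - w) * (w * (1 + w)) := by gcongr
      _ = _ := by ring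

/-- With `w = 1 - b` and `p = αae`, the leading term is `w(1-w)(1+w)`; after dropping nonnegative
terms one has to absorb `p((1-a)(1-2a) + 2a²e² + 3wae)`. The bound `e ≤ 1/3` turns the last bracket
into the one of `logSymbol_aux`, whence the coefficient `20/9 = 2 + 2/9`. -/
theorem logSymbol_third {α β a e b : ℝ} (hα : 0 ≤ α) (hβ : β ≤ 1) (ha : 0 ≤ a) (ha1 : a ≤ 1)
    (he : 0 < e) (hle : (3 + 2 * α) * e ≤ β) (hb : b = β - α * a * e) :
    0 ≤ b * (b - 1) * (b - 2) + 3 * (-(α * a * e) * (1 - a - a * e)) * (b - 1) +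
      (-(α * a * e) * ((1 - a) * (1 - 2 * a) - 3 * a * (1 - a) * e + 2 * a ^ 2 * e ^ 2)) := by
  obtain ⟨h1, h2⟩ := logSymbol_first hα hβ ha ha1 he hle
  rw [← hb] at h1 h2
  have he3 : e ≤ 1 / 3 := by linarith
  have hαe : α * e ≤ 1 / 2 := by nlinarith
  set p := α * a * e with hp
  have hp0 : 0 ≤ p := by positivity
  set w := 1 - b with hw
  have hbw : b = 1 - w := by rw [hw]; ring
  have hpw : p ≤ w := by rw [hw, hb]; linarith
  have hw0 : 0 ≤ w := hp0.trans hpw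
  have hpa : p ≤ a / 2 := by
    have : p = α * e * a := by rw [hp]; ring
    rw [this]; nlinarith
  have hw1 : w ≤ 1 := by linarith
  have hpb : p ≤ a * (1 - w) := by
    rw [← hbw, hb]
    have : p = α * e * a := by rw [hp]; ring
    rw [this]
    have : α * e ≤ β - α * a * e := by nlinarith [mul_nonneg hα he.le]
    nlinarith
  have hmain : p * ((1 - a) * (1 - 2 * a) + 2 * a ^ 2 * e ^ 2 + 3 * w * (a * e)) ≤
      w * (1 - w) * (1 + w) := by
    have hae : a * e ≤ a / 3 := by nlinarith
    have hae2 : 2 * a ^ 2 * e ^ 2 ≤ 2 * a ^ 2 / 9 := by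
      have : a * e * (a * e) ≤ a / 3 * (a / 3) := by gcongr
      nlinarith
    have hX : (1 - a) * (1 - 2 * a) + 2 * a ^ 2 * e ^ 2 + 3 * w * (a * e) ≤
        1 - 3 * a + 2 * a ^ 2 + 2 * a ^ 2 / 9 + w * a := by nlinarith
    refine le_trans ?_ (logSymbol_aux ha ha1 hp0 hpw hw1 hpa hpb)
    exact mul_le_mul_of_nonneg_left (by linarith) hp0
  have hpos : 0 ≤ p * (3 * a * (1 - a) * e) := by
    have : 0 ≤ 1 - a := by linarith
    positivity
  have hpos2 : 0 ≤ 3 * p * w * (1 - a) := by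
    have : 0 ≤ 1 - a := by linarith
    positivity
  rw [hbw]
  linarith

/-! ### Calculus of the radial profile -/

/-- The radial profile of the symbol. -/
noncomputable def logProfile (α β lam r : ℝ) : ℝ := r ^ β * Real.log (lam + r) ^ (-α)

section profile

variable {α β lam : ℝ}

theorem logProfile_norm (ξ : Eucl d) : logProfile α β lam ‖ξ‖ = logSymbol α β lam ξ := rfl

/-- The ratio `r / (λ + r)`. -/
noncomputable def profileA (lam r : ℝ) : ℝ := r / (lam + r)

/-- The inverse logarithm `1 / log (λ + r)`. -/
noncomputable def profileE (lam r : ℝ) : ℝ := (Real.log (lam + r))⁻¹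

/-- The logarithmic derivative `r g' / g` of the profile `g`. -/
noncomputable def profileB (α β lam r : ℝ) : ℝ := β - α * profileA lam r * profileE lam r

/-- The Euler derivative of `profileB`. -/
noncomputable def profileC (α lam r : ℝ) : ℝ :=
  -(α * profileA lam r * profileE lam r) * (1 - profileA lam r - profileA lam r * profileE lam r)

/-- The Euler derivative of `profileC`. -/
noncomputable def profileD (α lam r : ℝ) : ℝ :=
  -(α * profileA lam r * profileE lam r) * ((1 - profileA lam r) * (1 - 2 * profileA lam r) -
    3 * profileA lam r * (1 - profileA lam r) * profileE lam r +
    2 * profileA lam r ^ 2 * profileE lam r ^ 2)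

structure LogParam (α β lam : ℝ) : Prop where
  α_nonneg : 0 ≤ α
  β_pos : 0 < β
  β_le : β ≤ 1
  lam_ge : Real.exp ((3 + 2 * α) / β) ≤ lam

variable {r : ℝ}

theorem LogParam.lam_pos (h : LogParam α β lam) : 0 < lam := (Real.exp_pos _).trans_le h.lam_ge

theorem LogParam.log_ge (h : LogParam α β lam) (hr : 0 ≤ r) :
    (3 + 2 * α) / β ≤ Real.log (lam + r) := by
  rw [Real.le_log_iff_exp_le (by linarith [h.lam_pos])]
  linarith [h.lam_ge]

theorem LogParam.log_pos (h : LogParam α β lam) (hr : 0 ≤ r) : 0 < Real.log (lam + r) :=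
  lt_of_lt_of_le (div_pos (by linarith [h.α_nonneg]) h.β_pos) (h.log_ge hr)

theorem LogParam.profileE_pos (h : LogParam α β lam) (hr : 0 ≤ r) : 0 < profileE lam r :=
  inv_pos.2 (h.log_pos hr)

theorem LogParam.profileE_le (h : LogParam α β lam) (hr : 0 ≤ r) :
    (3 + 2 * α) * profileE lam r ≤ β := by
  have h1 := h.log_ge hr
  rw [div_le_iff₀ h.β_pos] at h1
  rw [profileE, mul_inv_le_iff₀ (h.log_pos hr)]
  linarith

theorem LogParam.profileA_nonneg (h : LogParam α β lam) (hr : 0 ≤ r) : 0 ≤ profileA lam r :=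
  div_nonneg hr (by linarith [h.lam_pos])

theorem LogParam.profileA_le (h : LogParam α β lam) (hr : 0 ≤ r) : profileA lam r ≤ 1 := by
  rw [profileA, div_le_one (by linarith [h.lam_pos])]
  linarith [h.lam_pos]

theorem LogParam.profileB_nonneg (h : LogParam α β lam) (hr : 0 ≤ r) : 0 ≤ profileB α β lam r := by
  have := (logSymbol_first h.α_nonneg h.β_le (h.profileA_nonneg hr) (h.profileA_le hr)
    (h.profileE_pos hr) (h.profileE_le hr)).1
  have h2 := h.profileE_pos hr
  unfold profileB
  linarith

theorem LogParam.profileB_le (h : LogParam α β lam) (hr : 0 ≤ r) : profileB α β lam r ≤ 1 :=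
  (logSymbol_first h.α_nonneg h.β_le (h.profileA_nonneg hr) (h.profileA_le hr)
    (h.profileE_pos hr) (h.profileE_le hr)).2

theorem LogParam.second_nonpos (h : LogParam α β lam) (hr : 0 ≤ r) :
    profileB α β lam r ^ 2 - profileB α β lam r + profileC α lam r ≤ 0 :=
  logSymbol_second h.α_nonneg h.β_le (h.profileA_nonneg hr) (h.profileA_le hr)
    (h.profileE_pos hr) (h.profileE_le hr) rfl

theorem LogParam.third_nonneg (h : LogParam α β lam) (hr : 0 ≤ r) :
    0 ≤ profileB α β lam r * (profileB α β lam r - 1) * (profileB α β lam r - 2) +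
      3 * profileC α lam r * (profileB α β lam r - 1) + profileD α lam r :=
  logSymbol_third h.α_nonneg h.β_le (h.profileA_nonneg hr) (h.profileA_le hr)
    (h.profileE_pos hr) (h.profileE_le hr) rfl

theorem LogParam.abs_second_le (h : LogParam α β lam) (hr : 0 ≤ r) :
    |profileB α β lam r ^ 2 - profileB α β lam r + profileC α lam r| ≤ 2 := by
  have h1 := h.second_nonpos hr
  have h2 := h.profileB_nonneg hr
  have h3 := h.profileB_le hr
  have h4 := h.profileA_nonneg hr
  have h5 := h.profileA_le hr
  have h6 := h.profileE_pos hr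
  have h7 := h.profileE_le hr
  have h8 := h.β_le
  have h9 := h.α_nonneg
  have h10 : α * profileE lam r ≤ 1 := by nlinarith
  have h11 : α * profileA lam r * profileE lam r ≤ 1 := by
    calc _ = α * profileE lam r * profileA lam r := by ring
      _ ≤ 1 * 1 := by gcongr
      _ = 1 := one_mul 1
  have h12 : 0 ≤ α * profileA lam r * profileE lam r := by positivity
  have h13 : -1 ≤ profileC α lam r := by
    unfold profileC
    have : 1 - profileA lam r - profileA lam r * profileE lam r ≤ 1 := by
      have := mul_nonneg h4 h6.le
      linarith
    nlinarith
  rw [abs_of_nonpos h1]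
  nlinarith

theorem hasDerivAt_profileA (h : LogParam α β lam) (hr : 0 < r) :
    HasDerivAt (profileA lam) (profileA lam r * (1 - profileA lam r) / r) r := by
  have h1 : lam + r ≠ 0 := by linarith [h.lam_pos]
  refine ((hasDerivAt_id' r).div ((hasDerivAt_id' r).const_add lam) h1).congr_deriv ?_
  unfold profileA
  field_simp

theorem hasDerivAt_profileE (h : LogParam α β lam) (hr : 0 < r) :
    HasDerivAt (profileE lam) (-(profileA lam r * profileE lam r ^ 2) / r) r := by
  have h1 : lam + r ≠ 0 := by linarith [h.lam_pos]
  have h2 := (h.log_pos hr.le).ne'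
  refine ((((hasDerivAt_id' r).const_add lam).log h1).inv h2).congr_deriv ?_
  unfold profileA profileE
  field_simp

theorem hasDerivAt_profileB (h : LogParam α β lam) (hr : 0 < r) :
    HasDerivAt (profileB α β lam) (profileC α lam r / r) r := by
  refine ((((hasDerivAt_profileA h hr).const_mul α).mul (hasDerivAt_profileE h hr)).const_sub
    β).congr_deriv ?_
  unfold profileC
  field_simp
  ring

theorem hasDerivAt_profileC (h : LogParam α β lam) (hr : 0 < r) :
    HasDerivAt (profileC α lam) (profileD α lam r / r) r := by
  have hA := hasDerivAt_profileA h hr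
  have hE := hasDerivAt_profileE h hr
  refine (((hA.const_mul α).mul hE).neg.mul ((hA.const_sub 1).sub (hA.mul hE))).congr_deriv ?_
  unfold profileD
  simp only [Pi.mul_apply, Pi.neg_apply, Pi.sub_apply]
  field_simp
  ring

theorem hasDerivAt_logProfile (h : LogParam α β lam) (hr : 0 < r) :
    HasDerivAt (logProfile α β lam) (logProfile α β lam r * profileB α β lam r / r) r := by
  have h1 : lam + r ≠ 0 := by linarith [h.lam_pos]
  have h2 := h.log_pos hr.le
  have h3 := (Real.hasDerivAt_rpow_const (p := β) (Or.inl hr.ne')).mul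
    ((((hasDerivAt_id' r).const_add lam).log h1).rpow_const (p := -α) (Or.inl h2.ne'))
  refine h3.congr_deriv ?_
  unfold logProfile profileB profileA profileE
  rw [Real.rpow_sub_one hr.ne', Real.rpow_sub_one h2.ne']
  field_simp
  ring

theorem logProfile_nonneg (h : LogParam α β lam) (hr : 0 ≤ r) : 0 ≤ logProfile α β lam r :=
  mul_nonneg (Real.rpow_nonneg hr _) (Real.rpow_nonneg (h.log_pos hr).le _)

theorem logProfile_zero (h : LogParam α β lam) : logProfile α β lam 0 = 0 := by
  rw [logProfile, Real.zero_rpow h.β_pos.ne', zero_mul]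

theorem continuousAt_logProfile (h : LogParam α β lam) (hr : 0 ≤ r) :
    ContinuousAt (logProfile α β lam) r := by
  have h1 : lam + r ≠ 0 := by linarith [h.lam_pos]
  refine (Real.continuousAt_rpow_const r β (Or.inr h.β_pos.le)).mul ?_
  refine ContinuousAt.rpow_const ?_ (Or.inl (h.log_pos hr).ne')
  exact (continuousAt_const.add continuousAt_id).log h1

/-- The logarithm to the power `α` is eventually below `2 r^{β/2}`, so half of the power of `r`
survives. This makes the boundary term at infinity vanish in the mixture formula. -/
theorem tendsto_logProfile (h : LogParam α β lam) : Tendsto (logProfile α β lam) atTop atTop := by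
  have h1 := isLittleO_log_rpow_rpow_atTop α (half_pos h.β_pos)
  have h2 : ∀ᶠ y in atTop, Real.log y ^ α ≤ y ^ (β / 2) := by
    filter_upwards [h1.bound one_pos, eventually_ge_atTop 1] with y hy hy1
    rw [one_mul, Real.norm_of_nonneg (Real.rpow_nonneg (by linarith : (0 : ℝ) ≤ y) (β / 2))] at hy
    exact (le_abs_self _).trans hy
  have h3 : Tendsto (fun r : ℝ => lam + r) atTop atTop := tendsto_atTop_add_const_left _ _ tendsto_id
  have h4 : Tendsto (fun r : ℝ => 2⁻¹ * r ^ (β / 2)) atTop atTop :=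
    (tendsto_rpow_atTop (half_pos h.β_pos)).const_mul_atTop (by norm_num)
  refine tendsto_atTop_mono' _ ?_ h4
  filter_upwards [h3.eventually h2, eventually_ge_atTop lam, eventually_gt_atTop 0] with r hr hlr hr0
  have hL := h.log_pos hr0.le
  have h5 : Real.log (lam + r) ^ α ≤ 2 * r ^ (β / 2) := by
    refine hr.trans ?_
    calc (lam + r) ^ (β / 2) ≤ (2 * r) ^ (β / 2) :=
          Real.rpow_le_rpow (by linarith [h.lam_pos]) (by linarith) (half_pos h.β_pos).le
      _ = 2 ^ (β / 2) * r ^ (β / 2) := Real.mul_rpow (by norm_num) hr0.le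
      _ ≤ 2 ^ (1 : ℝ) * r ^ (β / 2) := by
          gcongr
          · norm_num
          · linarith [h.β_le]
      _ = _ := by rw [Real.rpow_one]
  unfold logProfile
  rw [Real.rpow_neg hL.le, ← div_eq_mul_inv, le_div_iff₀ (Real.rpow_pos_of_pos hL _)]
  calc 2⁻¹ * r ^ (β / 2) * Real.log (lam + r) ^ α ≤ 2⁻¹ * r ^ (β / 2) * (2 * r ^ (β / 2)) := by
        gcongr
    _ = r ^ (β / 2) * r ^ (β / 2) := by ring
    _ = r ^ β := by rw [← Real.rpow_add hr0]; congr 1; ring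

end profile

/-! ### The semigroup kernel as a mixture of dilated overlaps -/

section mixture

/-- With `G = e^{-x}` and `H(y) = 1 - 3y/2 + y³/2`, the primitive is `-(1/3) H(r/s) s² G'' + (s - r)
G' - G` and its derivative is `(s/3)(G'' - s G''') H(r/s)`. Everything is written with Euler
derivatives: `s x' = x b`, `s b' = c`, `s c' = D`. -/
theorem hasDerivAt_mixture_primitive {x b c : ℝ → ℝ} {D r s : ℝ} (hs : 0 < s)
    (hx : HasDerivAt x (x s * b s / s) s) (hb : HasDerivAt b (c s / s) s)
    (hc : HasDerivAt c (D / s) s) :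
    HasDerivAt (fun s => -(1 / 3) * (1 - 3 / 2 * (r / s) + (r / s) ^ 3 / 2) *
        (x s * (x s * b s ^ 2 - (b s ^ 2 - b s + c s))) * Real.exp (-x s) -
        (1 - r / s) * (x s * b s) * Real.exp (-x s) - Real.exp (-x s))
      (Real.exp (-x s) * (x s / (3 * s)) * (x s * b s ^ 2 - (b s ^ 2 - b s + c s) -
        3 * x s * b s * (b s ^ 2 - b s + c s) +
        (b s * (b s - 1) * (b s - 2) + 3 * c s * (b s - 1) + D) + x s ^ 2 * b s ^ 3) *
        (1 - 3 / 2 * (r / s) + (r / s) ^ 3 / 2)) s := by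
  have hrs : HasDerivAt (fun s : ℝ => r / s) (-r / s ^ 2) s := by
    have := (hasDerivAt_inv hs.ne').const_mul r
    refine this.congr_deriv ?_
    field_simp
  have hE : HasDerivAt (fun s => Real.exp (-x s)) (Real.exp (-x s) * -(x s * b s / s)) s :=
    hx.neg.exp
  have hH := ((hrs.const_mul (3 / 2)).const_sub 1).add ((hrs.pow 3).div_const 2)
  have hQ := hx.mul ((hx.mul (hb.pow 2)).sub (((hb.pow 2).sub hb).add hc))
  have := ((((hH.const_mul (-(1 / 3))).mul hQ).mul hE).sub
    (((hrs.const_sub 1).mul (hx.mul hb)).mul hE)).sub hE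
  refine this.congr_deriv ?_
  simp only [Pi.mul_apply, Pi.add_apply, Pi.sub_apply, Pi.pow_apply, Nat.cast_ofNat,
    Nat.add_one_sub_one, pow_one, div_pow]
  field_simp
  ring

variable {α β lam t r s : ℝ}

/-- The density of the mixing variable. -/
noncomputable def mixDensity (α β lam t s : ℝ) : ℝ :=
  Real.exp (-(t * logProfile α β lam s)) * (t * logProfile α β lam s / (3 * s)) *
    (t * logProfile α β lam s * profileB α β lam s ^ 2 -
      (profileB α β lam s ^ 2 - profileB α β lam s + profileC α lam s) -
      3 * (t * logProfile α β lam s) * profileB α β lam s *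
        (profileB α β lam s ^ 2 - profileB α β lam s + profileC α lam s) +
      (profileB α β lam s * (profileB α β lam s - 1) * (profileB α β lam s - 2) +
        3 * profileC α lam s * (profileB α β lam s - 1) + profileD α lam s) +
      (t * logProfile α β lam s) ^ 2 * profileB α β lam s ^ 3)

/-- Each summand in the bracket is nonnegative by itself, by the signs of the three derivatives of
the profile. -/
theorem mixDensity_nonneg (h : LogParam α β lam) (ht : 0 ≤ t) (hs : 0 ≤ s) :
    0 ≤ mixDensity α β lam t s := by
  have h1 := mul_nonneg ht (logProfile_nonneg h hs)
  have h2 := h.profileB_nonneg hs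
  have h3 := h.second_nonpos hs
  have h4 := h.third_nonneg hs
  unfold mixDensity
  set x := t * logProfile α β lam s
  set b := profileB α β lam s
  set q := b ^ 2 - b + profileC α lam s
  have h5 : 0 ≤ x * b * -q := mul_nonneg (mul_nonneg h1 h2) (by linarith)
  have h6 : 0 ≤ x * b ^ 2 := by positivity
  have h7 : 0 ≤ x ^ 2 * b ^ 3 := by positivity
  refine mul_nonneg (by positivity) ?_
  linarith

theorem measurable_mixDensity : Measurable (mixDensity α β lam t) := by
  unfold mixDensity logProfile profileB profileC profileD profileA profileE
  fun_prop

theorem continuousAt_profile (h : LogParam α β lam) (hr : 0 ≤ r) :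
    ContinuousAt (profileB α β lam) r ∧ ContinuousAt (profileC α lam) r := by
  have h1 : lam + r ≠ 0 := by linarith [h.lam_pos]
  have h2 := (h.log_pos hr).ne'
  have hA : ContinuousAt (profileA lam) r :=
    continuousAt_id.div (continuousAt_const.add continuousAt_id) h1
  have hE : ContinuousAt (profileE lam) r :=
    ((continuousAt_const.add continuousAt_id).log h1).inv₀ h2
  constructor
  · exact continuousAt_const.sub ((continuousAt_const.mul hA).mul hE)
  · exact (((continuousAt_const.mul hA).mul hE).neg).mul
      ((continuousAt_const.sub hA).sub (hA.mul hE))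

/-- The primitive vanishes at infinity because polynomials in `x` are killed by `e^{-x}`. At `s = r`
both `H(1)` and `s - r` vanish, which leaves `-G(r)`. Nonnegativity of the integrand provides
integrability. -/
theorem integral_mixDensity (h : LogParam α β lam) (ht : 0 < t) (hr : 0 ≤ r) :
    IntegrableOn (fun s => mixDensity α β lam t s * (1 - 3 / 2 * (r / s) + (r / s) ^ 3 / 2)) (Ioi r) ∧
    ∫ s in Ioi r, mixDensity α β lam t s * (1 - 3 / 2 * (r / s) + (r / s) ^ 3 / 2) =
      Real.exp (-(t * logProfile α β lam r)) := by
  set x : ℝ → ℝ := fun s => t * logProfile α β lam s with hx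
  set b : ℝ → ℝ := profileB α β lam with hb
  set c : ℝ → ℝ := profileC α lam with hc
  set Ψ : ℝ → ℝ := fun s => -(1 / 3) * (1 - 3 / 2 * (r / s) + (r / s) ^ 3 / 2) *
        (x s * (x s * b s ^ 2 - (b s ^ 2 - b s + c s))) * Real.exp (-x s) -
        (1 - r / s) * (x s * b s) * Real.exp (-x s) - Real.exp (-x s) with hΨ
  have hderiv : ∀ s ∈ Ioi r, HasDerivAt Ψ
      (mixDensity α β lam t s * (1 - 3 / 2 * (r / s) + (r / s) ^ 3 / 2)) s := by
    intro s hs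
    have hs0 : 0 < s := hr.trans_lt hs
    refine hasDerivAt_mixture_primitive hs0 ?_ (hasDerivAt_profileB h hs0) (hasDerivAt_profileC h hs0)
    refine ((hasDerivAt_logProfile h hs0).const_mul t).congr_deriv ?_
    simp only [hx]
    ring
  have hH : ∀ s ∈ Ioi r, 0 ≤ r / s ∧ r / s ≤ 1 := fun s hs =>
    ⟨div_nonneg hr (hr.trans (le_of_lt hs)), (div_le_one (hr.trans_lt hs)).2 (le_of_lt hs)⟩
  have hH0 : ∀ s ∈ Ioi r, 0 ≤ 1 - 3 / 2 * (r / s) + (r / s) ^ 3 / 2 := fun s hs => by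
    obtain ⟨h1, h2⟩ := hH s hs
    nlinarith [mul_nonneg h1 (sq_nonneg (r / s - 1)), sq_nonneg (r / s - 1)]
  have hH1 : ∀ s ∈ Ioi r, 1 - 3 / 2 * (r / s) + (r / s) ^ 3 / 2 ≤ 1 := fun s hs => by
    obtain ⟨h1, h2⟩ := hH s hs
    have : (r / s) ^ 3 ≤ r / s := by
      calc (r / s) ^ 3 = (r / s) * (r / s) ^ 2 := by ring
        _ ≤ (r / s) * 1 := by gcongr; exact pow_le_one₀ h1 h2
        _ = _ := mul_one _
    linarith
  have hpos : ∀ s ∈ Ioi r, 0 ≤ mixDensity α β lam t s * (1 - 3 / 2 * (r / s) + (r / s) ^ 3 / 2) :=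
    fun s hs => mul_nonneg (mixDensity_nonneg h ht.le (hr.trans (le_of_lt hs))) (hH0 s hs)
  have hxc : ContinuousWithinAt x (Ici r) r :=
    (continuousAt_const.mul (continuousAt_logProfile h hr)).continuousWithinAt
  have hbc : ContinuousWithinAt b (Ici r) r := (continuousAt_profile h hr).1.continuousWithinAt
  have hcc : ContinuousWithinAt c (Ici r) r := (continuousAt_profile h hr).2.continuousWithinAt
  have hrs : ContinuousWithinAt (fun s => r / s) (Ici r) r := by
    rcases hr.eq_or_lt with h0 | h0
    · rw [← h0]; simpa using continuousWithinAt_const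
    · exact (continuousAt_const.div continuousAt_id h0.ne').continuousWithinAt
  have hcont : ContinuousWithinAt Ψ (Ici r) r := by
    simp only [hΨ]
    have hE : ContinuousWithinAt (fun s => Real.exp (-x s)) (Ici r) r := hxc.neg.rexp
    exact (((continuousWithinAt_const.mul ((continuousWithinAt_const.sub
      (continuousWithinAt_const.mul hrs)).add ((hrs.pow 3).div_const 2))).mul
      (hxc.mul ((hxc.mul (hbc.pow 2)).sub (((hbc.pow 2).sub hbc).add hcc)))).mul hE).sub
      (((continuousWithinAt_const.sub hrs).mul (hxc.mul hbc)).mul hE) |>.sub hE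
  have hxinf : Tendsto x atTop atTop := (tendsto_logProfile h).const_mul_atTop ht
  have hlim : Tendsto Ψ atTop (𝓝 0) := by
    have h1 : Tendsto (fun y : ℝ => y ^ 2 * Real.exp (-y) + 3 * (y ^ 1 * Real.exp (-y)) +
        y ^ 0 * Real.exp (-y)) atTop (𝓝 (0 + 3 * 0 + 0)) :=
      ((Real.tendsto_pow_mul_exp_neg_atTop_nhds_zero 2).add
        ((Real.tendsto_pow_mul_exp_neg_atTop_nhds_zero 1).const_mul 3)).add
        (Real.tendsto_pow_mul_exp_neg_atTop_nhds_zero 0)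
    rw [show (0 : ℝ) + 3 * 0 + 0 = 0 by ring] at h1
    refine squeeze_zero_norm' ?_ (h1.comp hxinf)
    filter_upwards [eventually_gt_atTop r] with s hs
    have hs0 : 0 ≤ s := hr.trans hs.le
    obtain ⟨k1, k2⟩ := hH s hs
    have k3 := hH0 s hs
    have k4 := hH1 s hs
    have k5 : 0 ≤ x s := mul_nonneg ht.le (logProfile_nonneg h hs0)
    have k6 := h.profileB_nonneg hs0
    have k7 := h.profileB_le hs0
    have k8 := h.second_nonpos hs0
    have k9 := h.abs_second_le hs0
    rw [abs_of_nonpos k8] at k9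
    have k10 : b s ^ 2 ≤ 1 := pow_le_one₀ k6 k7
    have m1 : 0 ≤ x s * (x s * b s ^ 2 - (b s ^ 2 - b s + c s)) :=
      mul_nonneg k5 (by have := mul_nonneg k5 (sq_nonneg (b s)); linarith)
    have m2 : x s * (x s * b s ^ 2 - (b s ^ 2 - b s + c s)) ≤ x s * (x s * 1 + 2) := by
      gcongr
      have : x s * b s ^ 2 ≤ x s * 1 := by gcongr
      linarith
    have m3 : x s * b s ≤ x s * 1 := by gcongr
    have m4 : 0 ≤ x s * b s := mul_nonneg k5 k6
    have m5 : (1 - 3 / 2 * (r / s) + (r / s) ^ 3 / 2) *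
        (x s * (x s * b s ^ 2 - (b s ^ 2 - b s + c s))) ≤ 1 * (x s * (x s * 1 + 2)) :=
      mul_le_mul k4 m2 m1 zero_le_one
    have m6 : (1 - r / s) * (x s * b s) ≤ 1 * (x s * 1) :=
      mul_le_mul (by linarith) m3 m4 zero_le_one
    have m7 : 0 ≤ (1 - 3 / 2 * (r / s) + (r / s) ^ 3 / 2) *
        (x s * (x s * b s ^ 2 - (b s ^ 2 - b s + c s))) := mul_nonneg k3 m1
    have m8 : 0 ≤ (1 - r / s) * (x s * b s) := mul_nonneg (by linarith) m4
    have e1 : Ψ s = -((1 / 3 * ((1 - 3 / 2 * (r / s) + (r / s) ^ 3 / 2) *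
        (x s * (x s * b s ^ 2 - (b s ^ 2 - b s + c s)))) + (1 - r / s) * (x s * b s) + 1) *
        Real.exp (-x s)) := by
      simp only [hΨ]; ring
    have hep := Real.exp_pos (-x s)
    rw [e1, norm_neg, Real.norm_of_nonneg (mul_nonneg (by linarith) hep.le)]
    calc _ ≤ (x s ^ 2 + 3 * x s + 1) * Real.exp (-x s) := by
          refine mul_le_mul_of_nonneg_right ?_ hep.le
          nlinarith
      _ = _ := by simp only [Function.comp]; ring
  -- At `r = 0` the quotient `0/0` is zero, so `H` is one and not zero there; the terms vanish
  -- because the profile does.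
  have hΨr : Ψ r = -Real.exp (-(t * logProfile α β lam r)) := by
    simp only [hΨ]
    rcases hr.eq_or_lt with h0 | h0
    · rw [← h0]
      simp [hx, logProfile_zero h]
    · rw [div_self h0.ne']
      ring_nf
      simp [hx]
  refine ⟨integrableOn_Ioi_deriv_of_nonneg hcont hderiv hpos hlim, ?_⟩
  rw [integral_Ioi_of_hasDerivAt_of_nonneg hcont hderiv hpos hlim, hΨr]
  ring

theorem integral_mixDensity_mul_ballOverlap (h : LogParam α β lam) (ht : 0 < t) (hr : 0 ≤ r) :
    ∫ s in Ioi 0, mixDensity α β lam t s * ballOverlap (r / s) =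
      Real.exp (-(t * logProfile α β lam r)) := by
  rw [← (integral_mixDensity h ht hr).2]
  have h1 : ∀ s ∈ Ioi r, mixDensity α β lam t s * ballOverlap (r / s) =
      mixDensity α β lam t s * (1 - 3 / 2 * (r / s) + (r / s) ^ 3 / 2) := fun s hs => by
    rw [ballOverlap, min_eq_left ((div_le_one (hr.trans_lt hs)).2 (le_of_lt hs))]
  rw [← setIntegral_congr_fun measurableSet_Ioi h1]
  refine setIntegral_eq_of_subset_of_forall_sdiff_eq_zero measurableSet_Ioi
    (Ioi_subset_Ioi hr) fun s hs => ?_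
  rw [ballOverlap_of_one_le, mul_zero]
  rw [one_le_div hs.1]
  exact not_lt.1 hs.2

/-- Take `Y` with the overlap as characteristic function and an independent `s` with the mixing
density: `Y/s` has the required law. -/
theorem exists_measure_charFun_axisSpace (h : LogParam α β lam) (ht : 0 < t) :
    ∃ μ : Measure AxisSpace, IsProbabilityMeasure μ ∧
      ∀ ξ, charFun μ ξ = (Real.exp (-(t * logProfile α β lam ‖ξ‖)) : ℂ) := by
  obtain ⟨μ, hμ, hμc⟩ := exists_measure_charFun_ballOverlap
  set n : ℝ → ℝ≥0∞ := fun s => ENNReal.ofReal (mixDensity α β lam t s) with hn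
  have hnm : Measurable n := measurable_mixDensity.ennreal_ofReal
  set m : Measure ℝ := (volume.restrict (Ioi 0)).withDensity n with hm
  -- At `r = 0` the mixture formula says that the mixing density has total mass one.
  have hmix := integral_mixDensity h ht le_rfl
  simp only [zero_div, mul_zero, sub_zero, ne_eq, OfNat.ofNat_ne_zero, not_false_eq_true, zero_pow,
    add_zero, mul_one, logProfile_zero h, neg_zero, Real.exp_zero] at hmix
  have hmp : IsProbabilityMeasure m := by
    refine ⟨?_⟩
    rw [hm, withDensity_apply _ MeasurableSet.univ, Measure.restrict_univ, hn,
      ← ofReal_integral_eq_lintegral_ofReal hmix.1, hmix.2, ENNReal.ofReal_one]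
    exact (ae_restrict_iff' measurableSet_Ioi).2 (Eventually.of_forall fun s hs =>
      mixDensity_nonneg h ht.le (le_of_lt hs))
  have hφ : Measurable fun a : ℝ × AxisSpace => a.1⁻¹ • a.2 := by fun_prop
  refine ⟨(m.prod μ).map fun a => a.1⁻¹ • a.2, Measure.isProbabilityMeasure_map hφ.aemeasurable,
    fun ξ => ?_⟩
  rw [charFun_apply, integral_map hφ.aemeasurable
    (by fun_prop : Continuous _).aestronglyMeasurable]
  rw [integral_prod (fun a : ℝ × AxisSpace => Complex.exp (inner ℝ (a.1⁻¹ • a.2) ξ * Complex.I))]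
  · have h1 : ∀ s : ℝ, ∫ y, Complex.exp (inner ℝ (s⁻¹ • y) ξ * Complex.I) ∂μ =
        (ballOverlap (‖s⁻¹ • ξ‖) : ℂ) := by
      intro s
      rw [← hμc, charFun_apply]
      simp_rw [real_inner_smul_left, real_inner_smul_right]
    simp_rw [h1]
    rw [hm, integral_withDensity_eq_integral_toReal_smul hnm
      (Eventually.of_forall fun _ => ENNReal.ofReal_lt_top),
      ← integral_mixDensity_mul_ballOverlap h ht (norm_nonneg ξ), ← integral_complex_ofReal]
    refine setIntegral_congr_fun measurableSet_Ioi fun s (hs : 0 < s) => ?_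
    simp only [hn]
    rw [ENNReal.toReal_ofReal (mixDensity_nonneg h ht.le hs.le), norm_smul, norm_inv,
      Real.norm_of_nonneg hs.le, Complex.real_smul]
    push_cast
    rw [inv_mul_eq_div]
  · refine Integrable.of_bound (C := 1) ?_ (Eventually.of_forall fun a => ?_)
    · exact Measurable.aestronglyMeasurable (by fun_prop)
    · rw [Complex.norm_exp_ofReal_mul_I]

/-- In dimension two, project the three-dimensional law to the plane: its characteristic function is
the restriction to that plane. In dimension three, transport by a linear isometry. -/
theorem exists_measure_charFun (hd : d = 2 ∨ d = 3) (h : LogParam α β lam) (ht : 0 < t) :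
    ∃ μ : Measure (Eucl d), IsProbabilityMeasure μ ∧
      ∀ ξ, charFun μ ξ = (Real.exp (-(t * logSymbol α β lam ξ)) : ℂ) := by
  obtain ⟨μ, hμ, hμc⟩ := exists_measure_charFun_axisSpace h ht
  rcases hd with rfl | rfl
  · have hm : Measurable fun a : AxisSpace => a.snd := by fun_prop
    refine ⟨μ.map fun a => a.snd, Measure.isProbabilityMeasure_map hm.aemeasurable, fun ξ => ?_⟩
    have h1 := hμc (WithLp.toLp 2 (0, ξ))
    rw [charFun_apply, integral_map hm.aemeasurable (by fun_prop : Continuous _).aestronglyMeasurable]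
    rw [charFun_apply] at h1
    have h2 : ‖(WithLp.toLp 2 (0, ξ) : AxisSpace)‖ = ‖ξ‖ := by
      rw [WithLp.prod_norm_eq_of_L2 (WithLp.toLp 2 ((0 : ℝ), ξ))]
      simp
    rw [h2] at h1
    rw [← logProfile_norm, ← h1]
    simp [WithLp.prod_inner_apply]
  · have hfr : Module.finrank ℝ AxisSpace = 3 := by
      rw [(WithLp.linearEquiv 2 ℝ (ℝ × Eucl 2)).finrank_eq]
      simp
    let e : AxisSpace ≃ₗᵢ[ℝ] Eucl 3 := 
      ((stdOrthonormalBasis ℝ AxisSpace).reindex (finCongr hfr)).repr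
    have hm : Measurable e := e.continuous.measurable
    refine ⟨μ.map e, Measure.isProbabilityMeasure_map hm.aemeasurable, fun ξ => ?_⟩
    have h1 := hμc (e.symm ξ)
    rw [charFun_apply, integral_map hm.aemeasurable (by fun_prop : Continuous _).aestronglyMeasurable]
    rw [charFun_apply, e.symm.norm_map] at h1
    rw [← logProfile_norm, ← h1]
    congr 1; ext x
    rw [← e.inner_map_map, e.apply_symm_apply]

end mixture

/-! ### Second differences -/

section secondDifference

/-- The centred second difference of `u` with step `z`. -/
def secondDiff {E F : Type*} [AddCommGroup E] [AddCommGroup F] (z : E) (u : E → F) (x : E) : F :=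
  (u (x + z) - u x) + (u (x - z) - u x)

variable {E F : Type*} [NormedAddCommGroup E] [NormedAddCommGroup F]

theorem norm_secondDiff_le_four_mul {u : E → F} {M : ℝ} (h : ∀ x, ‖u x‖ ≤ M) (z x : E) :
    ‖secondDiff z u x‖ ≤ 4 * M := by
  unfold secondDiff
  have h1 := norm_add_le (u (x + z) - u x) (u (x - z) - u x)
  have h2 := norm_sub_le (u (x + z)) (u x)
  have h3 := norm_sub_le (u (x - z)) (u x)
  linarith [h x, h (x + z), h (x - z)]

/-- The truncated square of the norm. -/
noncomputable def truncSq (z : E) : ℝ≥0 := min 1 (‖z‖₊ ^ 2)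

theorem le_mul_truncSq {a B : ℝ} {z : E} (h1 : a ≤ B) (h2 : a ≤ B * ‖z‖ ^ 2) :
    a ≤ B * truncSq z := by
  unfold truncSq
  rcases min_choice (1 : ℝ≥0) (‖z‖₊ ^ 2) with h | h <;> rw [h] <;> simpa

variable [NormedSpace ℝ E] [NormedSpace ℝ F]

theorem norm_secondDiff_le {u : E → F} (hu : ContDiff ℝ 2 u) {B : ℝ}
    (hB : ∀ x, ‖fderiv ℝ (fderiv ℝ u) x‖ ≤ B) (z x : E) :
    ‖secondDiff z u x‖ ≤ 2 * B * ‖z‖ ^ 2 := by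
  have hd : Differentiable ℝ u := hu.differentiable (by simp)
  have hd2 : Differentiable ℝ (fderiv ℝ u) :=
    (hu.fderiv_right (m := 1) (by norm_num)).differentiable (by simp)
  have hB0 : 0 ≤ B := (norm_nonneg (fderiv ℝ (fderiv ℝ u) x)).trans (hB x)
  have hlip : ∀ a b, ‖fderiv ℝ u a - fderiv ℝ u b‖ ≤ B * ‖a - b‖ := fun a b =>
    Convex.norm_image_sub_le_of_norm_fderiv_le (s := univ) (fun y _ => hd2 y) (fun y _ => hB y)
      convex_univ (mem_univ _) (mem_univ _)
  have hder : ∀ s : ℝ, HasDerivAt (fun s : ℝ => u (x + s • z) + u (x - s • z))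
      (fderiv ℝ u (x + s • z) z - fderiv ℝ u (x - s • z) z) s := by
    intro s
    have k1 : HasDerivAt (fun s : ℝ => x + s • z) z s := by
      simpa using ((hasDerivAt_id s).smul_const z).const_add x
    have k2 : HasDerivAt (fun s : ℝ => x - s • z) (-z) s := by
      simpa using ((hasDerivAt_id s).smul_const z).const_sub x
    have := ((hd _).hasFDerivAt.comp_hasDerivAt s k1).add ((hd _).hasFDerivAt.comp_hasDerivAt s k2)
    refine this.congr_deriv ?_
    rw [map_neg, ← sub_eq_add_neg]
  have key := Convex.norm_image_sub_le_of_norm_hasDerivWithin_le (s := Icc (0 : ℝ) 1) (x := 0) (y := 1)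
    (C := 2 * B * ‖z‖ ^ 2) (fun s _ => (hder s).hasDerivWithinAt) (fun s hs => ?_) (convex_Icc 0 1)
    (by simp) (by simp)
  · refine le_trans (le_of_eq ?_) (key.trans (by simp))
    simp only [one_smul, zero_smul, add_zero, sub_zero, secondDiff]
    congr 1; abel
  · rw [← sub_apply]
    refine (ContinuousLinearMap.le_opNorm _ _).trans ?_
    have h1 := hlip (x + s • z) (x - s • z)
    have h2 : ‖x + s • z - (x - s • z)‖ ≤ 2 * ‖z‖ := by
      rw [show x + s • z - (x - s • z) = (2 * s) • z by module, norm_smul, norm_mul,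
        Real.norm_of_nonneg hs.1]
      norm_num
      have := mul_le_mul_of_nonneg_right hs.2 (norm_nonneg z)
      linarith
    calc _ ≤ B * (2 * ‖z‖) * ‖z‖ := by
          gcongr; exact h1.trans (by gcongr)
      _ = _ := by ring

theorem fderiv_secondDiff {u : E → F} (hu : Differentiable ℝ u) (z : E) :
    fderiv ℝ (secondDiff z u) = secondDiff z (fderiv ℝ u) := by
  ext1 x
  have h1 : HasFDerivAt (fun x => u (x + z)) (fderiv ℝ u (x + z)) x := by
    simpa [Function.comp_def] using (hu (x + z)).hasFDerivAt.comp x ((hasFDerivAt_id x).add_const z)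
  have h2 : HasFDerivAt (fun x => u (x - z)) (fderiv ℝ u (x - z)) x := by
    simpa [Function.comp_def] using (hu (x - z)).hasFDerivAt.comp x ((hasFDerivAt_id x).sub_const z)
  exact ((h1.sub (hu x).hasFDerivAt).add (h2.sub (hu x).hasFDerivAt)).fderiv

theorem contDiff_secondDiff {u : E → F} {n : WithTop ℕ∞} (hu : ContDiff ℝ n u) (z : E) :
    ContDiff ℝ n (secondDiff z u) := by
  unfold secondDiff
  fun_prop

theorem norm_secondDiff_le_mul_truncSq {u : E → F} (hu : ContDiff ℝ 2 u) {B : ℝ}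
    (h0 : ∀ x, ‖u x‖ ≤ B) (h2 : ∀ x, ‖iteratedFDeriv ℝ 2 u x‖ ≤ B) (z x : E) :
    ‖secondDiff z u x‖ ≤ 4 * B * truncSq z := by
  have : 0 ≤ B := (norm_nonneg _).trans (h0 x)
  refine le_mul_truncSq (norm_secondDiff_le_four_mul h0 z x) ?_
  refine (norm_secondDiff_le hu (fun x => ?_) z x).trans
    (mul_le_mul_of_nonneg_right (by linarith : 2 * B ≤ 4 * B) (by positivity))
  have := h2 x
  rwa [← norm_iteratedFDeriv_fderiv, ← norm_iteratedFDeriv_fderiv, norm_iteratedFDeriv_zero] at this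

/-- Apply the bound for a single second difference to `secondDiff z u`, whose second derivative is
the second difference of the second derivative of `u`. -/
theorem norm_secondDiff_secondDiff_le {u : E → F} (hu : ContDiff ℝ 4 u) {B : ℝ}
    (h0 : ∀ x, ‖iteratedFDeriv ℝ 0 u x‖ ≤ B) (h2 : ∀ x, ‖iteratedFDeriv ℝ 2 u x‖ ≤ B)
    (h4 : ∀ x, ‖iteratedFDeriv ℝ 4 u x‖ ≤ B) (y z x : E) :
    ‖secondDiff y (secondDiff z u) x‖ ≤ 16 * B * truncSq y * truncSq z := by
  have e2 : ∀ x, ‖fderiv ℝ (fderiv ℝ u) x‖ ≤ B := fun x => by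
    have := h2 x
    rwa [← norm_iteratedFDeriv_fderiv, ← norm_iteratedFDeriv_fderiv, norm_iteratedFDeriv_zero] at this
  have c1 : ContDiff ℝ 3 (fderiv ℝ u) := hu.fderiv_right (by norm_num)
  have c2 : ContDiff ℝ 2 (fderiv ℝ (fderiv ℝ u)) := c1.fderiv_right (by norm_num)
  have b0 := norm_secondDiff_le_mul_truncSq (hu.of_le (by norm_num)) (fun x => by simpa using h0 x) h2 z
  have b2 := norm_secondDiff_le_mul_truncSq c2 e2
    (fun x => by rw [norm_iteratedFDeriv_fderiv, norm_iteratedFDeriv_fderiv]; exact h4 x) z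
  have b3 := norm_secondDiff_le_mul_truncSq (u := secondDiff z u) (B := 4 * B * truncSq z)
    ((contDiff_secondDiff hu z).of_le (by norm_num)) b0 (fun x => by
      rw [← norm_iteratedFDeriv_fderiv, ← norm_iteratedFDeriv_fderiv, norm_iteratedFDeriv_zero,
        fderiv_secondDiff (hu.differentiable (by simp)),
        fderiv_secondDiff (c1.differentiable (by simp))]
      exact b2 x) y x
  refine b3.trans (le_of_eq ?_)
  ring

end secondDifference

/-- The second differences of `u` of order two by two are controlled in `L^p`. -/
def HasSecondDiffBound (p : ℝ≥0∞) (M : ℝ≥0) (u : Eucl d → ℂ) : Prop :=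
  ∀ y z, eLpNorm (secondDiff y (secondDiff z u)) p volume ≤ M * truncSq y * truncSq z

theorem hasSecondDiffBound_top {u : Eucl d → ℂ} (hu : ContDiff ℝ 4 u) {B : ℝ≥0}
    (h0 : ∀ x, ‖iteratedFDeriv ℝ 0 u x‖ ≤ B) (h2 : ∀ x, ‖iteratedFDeriv ℝ 2 u x‖ ≤ B)
    (h4 : ∀ x, ‖iteratedFDeriv ℝ 4 u x‖ ≤ B) : HasSecondDiffBound ⊤ (16 * B) u := by
  intro y z
  rw [eLpNorm_exponent_top]
  refine (eLpNormEssSup_le_of_ae_nnnorm_bound (C := 16 * B * truncSq y * truncSq z)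
    (Eventually.of_forall fun x => ?_)).trans (le_of_eq (by push_cast; rfl))
  exact norm_secondDiff_secondDiff_le hu h0 h2 h4 y z x

theorem eLpNorm_secondDiff_le {u : Eucl d → ℂ} (hu : Continuous u) {p : ℝ≥0∞} (hp : 1 ≤ p)
    (z : Eucl d) : eLpNorm (secondDiff z u) p volume ≤ 4 * eLpNorm u p volume := by
  have k1 : eLpNorm (fun x => u (x + z)) p volume = eLpNorm u p volume :=
    eLpNorm_comp_measurePreserving hu.aestronglyMeasurable (measurePreserving_add_right volume z)
  have k2 : eLpNorm (fun x => u (x - z)) p volume = eLpNorm u p volume :=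
    eLpNorm_comp_measurePreserving hu.aestronglyMeasurable (measurePreserving_sub_right volume z)
  have a1 : AEStronglyMeasurable (fun x => u (x + z)) volume :=
    (by fun_prop : Continuous _).aestronglyMeasurable
  have a2 : AEStronglyMeasurable (fun x => u (x - z)) volume :=
    (by fun_prop : Continuous _).aestronglyMeasurable
  have a3 := hu.aestronglyMeasurable (μ := volume)
  calc _ ≤ eLpNorm (fun x => u (x + z) - u x) p volume + eLpNorm (fun x => u (x - z) - u x) p volume :=
        eLpNorm_add_le (a1.sub a3) (a2.sub a3) hp
    _ ≤ (eLpNorm u p volume + eLpNorm u p volume) + (eLpNorm u p volume + eLpNorm u p volume) :=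
        add_le_add ((eLpNorm_sub_le a1 a3 hp).trans (by rw [k1]))
          ((eLpNorm_sub_le a2 a3 hp).trans (by rw [k2]))
    _ = _ := by ring

theorem secondDiff_comm {E F : Type*} [AddCommGroup E] [AddCommGroup F] (y z : E) (u : E → F) :
    secondDiff y (secondDiff z u) = secondDiff z (secondDiff y u) := by
  ext x
  simp only [secondDiff]
  rw [add_right_comm x z y, sub_add_eq_add_sub x z y, ← add_sub_right_comm x z y, sub_right_comm x z y]
  abel

theorem eLpNorm_one_le_of_support {w : Eucl d → ℂ} {b : ℝ} {R : ℝ} (hb : ∀ x, ‖w x‖ ≤ b)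
    (hR : ∀ x, R < ‖x‖ → w x = 0) :
    eLpNorm w 1 volume ≤ ENNReal.ofReal b * volume (Metric.closedBall (0 : Eucl d) R) := by
  rw [eLpNorm_one_eq_lintegral_enorm, ← setLIntegral_const]
  rw [← setLIntegral_eq_of_support_subset (s := Metric.closedBall (0 : Eucl d) R)]
  · refine lintegral_mono fun x => ?_
    rw [← ofReal_norm]
    exact ENNReal.ofReal_le_ofReal (hb x)
  · intro x hx
    by_contra h
    rw [mem_closedBall_zero_iff, not_le] at h
    exact hx (by simp [hR x h])

theorem secondDiff_eq_zero_of_support {w : Eucl d → ℂ} {R : ℝ} (hR : ∀ x, R < ‖x‖ → w x = 0)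
    {z : Eucl d} (hz : ‖z‖ ≤ 1) (x : Eucl d) (hx : R + 1 < ‖x‖) : secondDiff z w x = 0 := by
  have h1 : ‖x‖ - ‖z‖ ≤ ‖x + z‖ := by
    have := norm_sub_le (x + z) z
    rw [add_sub_cancel_right] at this
    linarith
  have h2 := norm_sub_norm_le x z
  simp only [secondDiff]
  rw [hR (x + z) (by linarith), hR (x - z) (by linarith), hR x (by linarith)]
  simp

/-- If both steps are at most one, the support grows by at most two units and the pointwise bound is
integrated. A step longer than one costs only a factor `4` of the `L^1` norm, and its truncated
square is one. -/
theorem exists_hasSecondDiffBound_one {u : Eucl d → ℂ} (hu : ContDiff ℝ ∞ u)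
    (hc : HasCompactSupport u) : ∃ M, HasSecondDiffBound 1 M u := by
  have hb : ∀ k : ℕ, ∃ B : ℝ, ∀ x, ‖iteratedFDeriv ℝ k u x‖ ≤ B := fun k =>
    (hu.continuous_iteratedFDeriv (by exact_mod_cast le_top)).bounded_above_of_compact_support
      (hc.iteratedFDeriv k)
  obtain ⟨B0, h0⟩ := hb 0
  obtain ⟨B2, h2⟩ := hb 2
  obtain ⟨B4, h4⟩ := hb 4
  set B := max B0 (max B2 B4) with hB
  replace h0 : ∀ x, ‖iteratedFDeriv ℝ 0 u x‖ ≤ B := fun x => (h0 x).trans (le_max_left _ _)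
  replace h2 : ∀ x, ‖iteratedFDeriv ℝ 2 u x‖ ≤ B := fun x =>
    (h2 x).trans ((le_max_left _ _).trans (le_max_right _ _))
  have hp := norm_secondDiff_secondDiff_le (hu.of_le ENat.LEInfty.out) h0 h2
    (fun x => (h4 x).trans ((le_max_right _ _).trans (le_max_right _ _)))
  have hp1 := norm_secondDiff_le_mul_truncSq (hu.of_le ENat.LEInfty.out)
    (fun x => by simpa using h0 x) h2
  have hB0 : 0 ≤ B := (norm_nonneg _).trans (h0 0)
  obtain ⟨R, hR⟩ := hc.isCompact.isBounded.subset_closedBall (0 : Eucl d)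
  have hz : ∀ x, R < ‖x‖ → u x = 0 := fun x hx => image_eq_zero_of_notMem_tsupport fun h => by
    have := hR h; rw [mem_closedBall_zero_iff] at this; linarith
  set N : ℝ≥0∞ := eLpNorm u 1 volume with hN
  have hNt : N ≠ ⊤ := (hu.continuous.memLp_of_hasCompactSupport hc).eLpNorm_ne_top
  set W : ℝ≥0∞ := volume (Metric.closedBall (0 : Eucl d) (R + 1 + 1)) with hW
  have hWt : W ≠ ⊤ := measure_closedBall_lt_top.ne
  set M : ℝ≥0∞ := 16 * N + 16 * ENNReal.ofReal B * W with hM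
  have hMt : M ≠ ⊤ := by finiteness
  have t1 : ∀ z : Eucl d, 1 ≤ ‖z‖ → truncSq z = 1 := fun z hz =>
    min_eq_left (one_le_pow₀ (by exact_mod_cast hz))
  have e16 : ENNReal.ofReal 16 = 16 := by norm_num
  have e4 : ENNReal.ofReal 4 = 4 := by norm_num
  have hone : ∀ z : Eucl d, 4 * eLpNorm (secondDiff z u) 1 volume ≤ M * truncSq z := by
    intro z
    rcases le_total ‖z‖ 1 with hz1 | hz1
    · have k := eLpNorm_one_le_of_support (hp1 z) (secondDiff_eq_zero_of_support hz hz1)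
      rw [ENNReal.ofReal_mul (by positivity), ENNReal.ofReal_mul (by positivity),
        ENNReal.ofReal_coe_nnreal, e4] at k
      calc _ ≤ 4 * (4 * ENNReal.ofReal B * truncSq z * W) := by
            gcongr
            refine k.trans ?_
            gcongr
            exact measure_mono (Metric.closedBall_subset_closedBall (by linarith))
        _ = (16 * ENNReal.ofReal B * W) * truncSq z := by ring
        _ ≤ _ := by gcongr; exact le_add_self
    · rw [t1 z hz1]
      calc _ ≤ 4 * (4 * N) := by gcongr; exact eLpNorm_secondDiff_le hu.continuous le_rfl z
        _ = 16 * N := by ring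
        _ ≤ _ := by rw [ENNReal.coe_one, mul_one]; exact le_self_add
  have hcs : ∀ z, Continuous (secondDiff z u) := fun z =>
    (contDiff_secondDiff hu z).continuous
  refine ⟨M.toNNReal, fun y z => ?_⟩
  rw [ENNReal.coe_toNNReal hMt]
  rcases le_total 1 ‖y‖ with hy1 | hy1
  · rw [t1 y hy1, ENNReal.coe_one, mul_one]
    exact (eLpNorm_secondDiff_le (hcs z) le_rfl y).trans (hone z)
  rcases le_total 1 ‖z‖ with hz1 | hz1
  · rw [t1 z hz1, ENNReal.coe_one, mul_one, secondDiff_comm]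
    exact (eLpNorm_secondDiff_le (hcs y) le_rfl z).trans (hone y)
  have k := eLpNorm_one_le_of_support (hp y z)
    (secondDiff_eq_zero_of_support (secondDiff_eq_zero_of_support hz hz1) hy1)
  rw [ENNReal.ofReal_mul (by positivity), ENNReal.ofReal_mul (by positivity),
    ENNReal.ofReal_mul (by positivity), ENNReal.ofReal_coe_nnreal, ENNReal.ofReal_coe_nnreal,
    e16] at k
  calc _ ≤ _ := k
    _ = (16 * ENNReal.ofReal B * W) * truncSq y * truncSq z := by ring
    _ ≤ _ := by gcongr; exact le_add_self

/-! ### The dyadic family of heat laws -/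

section heat

/-- `μ n` is the law at time `2⁻ⁿ` of the convolution semigroup generated by `-σ(D)`. -/
structure IsHeatFamily (σ : Eucl d → ℝ) (μ : ℕ → Measure (Eucl d)) : Prop where
  continuous : Continuous σ
  nonneg : ∀ ξ, 0 ≤ σ ξ
  even : ∀ ξ, σ (-ξ) = σ ξ
  le : ∀ ξ, σ ξ ≤ 1 + ‖ξ‖
  prob : ∀ n, IsProbabilityMeasure (μ n)
  charFun_eq : ∀ n ξ, charFun (μ n) ξ = (Real.exp (-((1 / 2) ^ n * σ ξ)) : ℂ)

theorem exists_isHeatFamily (hd : d = 2 ∨ d = 3) {α β lam : ℝ} (h : LogParam α β lam) :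
    ∃ μ : ℕ → Measure (Eucl d), IsHeatFamily (logSymbol α β lam) μ := by
  choose μ h1 h2 using fun n : ℕ =>
    exists_measure_charFun hd h (t := (1 / 2) ^ n) (by positivity)
  refine ⟨μ, ?_, fun ξ => ?_, fun ξ => ?_, fun ξ => ?_, h1, fun n ξ => by exact_mod_cast h2 n ξ⟩
  · refine continuous_iff_continuousAt.2 fun ξ => ?_
    exact (continuousAt_logProfile h (norm_nonneg ξ)).comp continuous_norm.continuousAt
  · exact logProfile_nonneg h (norm_nonneg ξ)
  · simp [logSymbol]
  · have hl : 1 ≤ Real.log (lam + ‖ξ‖) := by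
      refine le_trans ?_ (h.log_ge (norm_nonneg ξ))
      rw [one_le_div h.β_pos]
      linarith [h.β_le, h.α_nonneg]
    have h3 : Real.log (lam + ‖ξ‖) ^ (-α) ≤ 1 :=
      Real.rpow_le_one_of_one_le_of_nonpos hl (by linarith [h.α_nonneg])
    have h4 : ‖ξ‖ ^ β ≤ 1 + ‖ξ‖ := by
      rcases le_total ‖ξ‖ 1 with h5 | h5
      · have := Real.rpow_le_one (norm_nonneg ξ) h5 h.β_pos.le
        linarith [norm_nonneg ξ]
      · have := Real.rpow_le_rpow_of_exponent_le h5 h.β_le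
        rw [Real.rpow_one] at this
        linarith
    calc logSymbol α β lam ξ ≤ ‖ξ‖ ^ β * 1 := by unfold logSymbol; gcongr
      _ ≤ _ := by linarith

namespace IsHeatFamily

variable {σ : Eucl d → ℝ} {μ : ℕ → Measure (Eucl d)}

theorem map_neg (h : IsHeatFamily σ μ) (n : ℕ) : (μ n).map (fun x => -x) = μ n := by
  have := h.prob n
  have : IsProbabilityMeasure ((μ n).map (fun x => -x)) :=
    Measure.isProbabilityMeasure_map (by fun_prop)
  refine Measure.ext_of_charFun (funext fun ξ => ?_)
  have := charFun_map_smul (μ := μ n) (-1) ξ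
  simp only [neg_smul, one_smul] at this
  rw [this, h.charFun_eq, h.charFun_eq, h.even]

theorem conv_self (h : IsHeatFamily σ μ) (n : ℕ) : μ (n + 1) ∗ μ (n + 1) = μ n := by
  have := h.prob n
  have := h.prob (n + 1)
  refine Measure.ext_of_charFun (funext fun ξ => ?_)
  rw [charFun_conv, h.charFun_eq, h.charFun_eq, ← Complex.ofReal_mul, ← Real.exp_add]
  congr 3
  rw [pow_succ]
  ring

theorem measureConv_measureConv (h : IsHeatFamily σ μ) (n : ℕ) {u : Eucl d → ℂ} (hu : IsBC u)
    (x : Eucl d) :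
    measureConv (μ (n + 1)) (measureConv (μ (n + 1)) u) x = measureConv (μ n) u x := by
  have := h.prob n
  have := h.prob (n + 1)
  unfold measureConv
  rw [← h.conv_self n, integral_conv]
  · simp_rw [sub_sub]
  · rw [h.conv_self n]
    exact hu.integrable_comp (by fun_prop)

theorem norm_one_sub_charFun_le (h : IsHeatFamily σ μ) (n : ℕ) (ξ : Eucl d) :
    ‖1 - charFun (μ n) ξ‖ ≤ (1 / 2) ^ n * (1 + ‖ξ‖) := by
  have h1 : 0 ≤ (1 / 2 : ℝ) ^ n * σ ξ := mul_nonneg (by positivity) (h.nonneg ξ)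
  have h2 := Real.add_one_le_exp (-((1 / 2 : ℝ) ^ n * σ ξ))
  have h3 : Real.exp (-((1 / 2 : ℝ) ^ n * σ ξ)) ≤ 1 := Real.exp_le_one_iff.2 (by linarith)
  rw [h.charFun_eq, ← Complex.ofReal_one, ← Complex.ofReal_sub, Complex.norm_real,
    Real.norm_of_nonneg (by linarith)]
  calc _ ≤ (1 / 2 : ℝ) ^ n * σ ξ := by linarith
    _ ≤ _ := by gcongr; exact h.le ξ

/-- The tail of a coordinate is controlled by the average of one minus the characteristic function
near the origin, where it is `O(2^{-n})`. -/
theorem measureReal_one_lt_abs_le (h : IsHeatFamily σ μ) (n : ℕ) (i : Fin d) :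
    (μ n).real {z | 1 < |z i|} ≤ 6 * (1 / 2) ^ n := by
  have := h.prob n
  have h1 := measureReal_abs_inner_gt_le_integral_charFun (μ := μ n)
    (a := EuclideanSpace.single i (1 : ℝ)) (r := 1) one_pos
  have h2 : ‖∫ s in (-2 : ℝ)..2, 1 - charFun (μ n) (s • EuclideanSpace.single i (1 : ℝ))‖ ≤
      3 * (1 / 2) ^ n * |2 - (-2)| := by
    refine intervalIntegral.norm_integral_le_of_norm_le_const fun s hs => ?_
    rw [uIoc_of_le (by norm_num)] at hs
    refine (h.norm_one_sub_charFun_le n _).trans ?_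
    have : |s| ≤ 2 := abs_le.2 ⟨hs.1.le, hs.2⟩
    rw [norm_smul, PiLp.norm_single, norm_one, mul_one, Real.norm_eq_abs, mul_comm]
    gcongr
    linarith
  simp only [EuclideanSpace.inner_single_left, map_one, one_mul, inv_one, mul_one] at h1
  refine h1.trans ?_
  norm_num at h2 ⊢
  linarith

theorem integral_one_sub_cos_le (h : IsHeatFamily σ μ) (n : ℕ) (i : Fin d) :
    ∫ z, (1 - Real.cos (z i)) ∂(μ n) ≤ 2 * (1 / 2) ^ n := by
  have := h.prob n
  have h1 : ((1 - charFun (μ n) (EuclideanSpace.single i (1 : ℝ))).re) =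
      ∫ z, (1 - Real.cos (z i)) ∂(μ n) := by
    have hi : Integrable (fun z : Eucl d => Complex.exp (inner ℝ z (EuclideanSpace.single i (1 : ℝ)) *
        Complex.I)) (μ n) := by
      refine Integrable.of_bound (C := 1) (by fun_prop : Continuous _).aestronglyMeasurable
        (Eventually.of_forall fun z => ?_)
      rw [Complex.norm_exp_ofReal_mul_I]
    have hc : Integrable (fun z : Eucl d => Real.cos (z i)) (μ n) :=
      Integrable.of_bound (C := 1) (by fun_prop : Continuous _).aestronglyMeasurable
        (Eventually.of_forall fun z => Real.abs_cos_le_one _)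
    rw [integral_sub (integrable_const 1) hc, charFun_apply, Complex.sub_re,
      ← RCLike.re_eq_complex_re, ← integral_re hi]
    simp [EuclideanSpace.inner_single_right, Complex.exp_ofReal_mul_I_re]
  rw [← h1]
  refine ((Complex.re_le_norm _).trans (h.norm_one_sub_charFun_le n _)).trans (le_of_eq ?_)
  rw [PiLp.norm_single, norm_one]
  ring

/-- If a coordinate exceeds one, its indicator dominates. Otherwise `1 - cos z_i ≥ (2/π²) z_i² ≥
z_i²/5`, hence the factor `5`. -/
theorem truncSq_le_sum (z : Eucl d) :
    (truncSq z : ℝ) ≤ ∑ i, ({z : Eucl d | 1 < |z i|}.indicator 1 z + 5 * (1 - Real.cos (z i))) := by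
  have hc : ∀ i, 0 ≤ 5 * (1 - Real.cos (z i)) := fun i => by linarith [Real.cos_le_one (z i)]
  have hi : ∀ i, (0 : ℝ) ≤ {z : Eucl d | 1 < |z i|}.indicator 1 z := fun i =>
    indicator_nonneg (fun _ _ => zero_le_one) _
  have hnn : ∀ i ∈ Finset.univ, 0 ≤ ({z : Eucl d | 1 < |z i|}.indicator 1 z + 5 * (1 - Real.cos (z i))) :=
    fun i _ => add_nonneg (hi i) (hc i)
  by_cases hex : ∃ i, 1 < |z i|
  · obtain ⟨i, hiz⟩ := hex
    refine le_trans ?_ (Finset.single_le_sum hnn (Finset.mem_univ i))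
    have h1 : ({z : Eucl d | 1 < |z i|}.indicator 1 z : ℝ) = 1 :=
      indicator_of_mem (s := {z : Eucl d | 1 < |z i|}) hiz _
    have h2 : (truncSq z : ℝ) ≤ 1 := by exact_mod_cast min_le_left _ _
    rw [h1]
    linarith [hc i]
  · push Not at hex
    have h2 : (truncSq z : ℝ) ≤ ‖z‖ ^ 2 := by exact_mod_cast min_le_right _ _
    rw [EuclideanSpace.norm_sq_eq] at h2
    refine h2.trans (Finset.sum_le_sum fun i _ => ?_)
    have h3 : |z i| ≤ Real.pi := (hex i).trans (by linarith [Real.pi_gt_three])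
    have h4 := Real.cos_le_one_sub_mul_cos_sq h3
    have h5 : Real.pi ^ 2 ≤ 10 := by nlinarith [Real.pi_lt_d2, Real.pi_pos]
    have h6 : 1 / 5 ≤ 2 / Real.pi ^ 2 := by
      rw [div_le_div_iff₀ (by norm_num) (by positivity)]
      linarith
    have h7 := mul_le_mul_of_nonneg_right h6 (sq_nonneg (z i))
    rw [Real.norm_eq_abs, sq_abs]
    linarith [hi i]

theorem lintegral_truncSq_le (h : IsHeatFamily σ μ) :
    ∃ c : ℝ≥0, ∀ n, ∫⁻ z, truncSq z ∂(μ n) ≤ c * ((1 / 2) ^ n : ℝ≥0) := by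
  -- Per coordinate: `6` from the tail and `5 · 2` from the cosine.
  refine ⟨16 * d, fun n => ?_⟩
  have := h.prob n
  have hm : ∀ i, MeasurableSet {z : Eucl d | 1 < |z i|} := fun i =>
    measurableSet_lt measurable_const (by fun_prop)
  have hi1 : ∀ i, Integrable ({z : Eucl d | 1 < |z i|}.indicator (1 : Eucl d → ℝ)) (μ n) := fun i =>
    (integrable_const (1 : ℝ)).indicator (hm i)
  have hi2 : ∀ i, Integrable (fun z : Eucl d => 5 * (1 - Real.cos (z i))) (μ n) := fun i =>
    ((integrable_const 1).sub (Integrable.of_bound (C := 1)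
      (by fun_prop : Continuous _).aestronglyMeasurable
        (Eventually.of_forall fun z => Real.abs_cos_le_one _))).const_mul _
  have hct : Continuous fun z : Eucl d => truncSq z := by unfold truncSq; fun_prop
  have hit : Integrable (fun z : Eucl d => (truncSq z : ℝ)) (μ n) :=
    Integrable.of_bound (C := 1) (by fun_prop : Continuous _).aestronglyMeasurable
        (Eventually.of_forall fun z => by
          rw [Real.norm_of_nonneg NNReal.zero_le_coe]
          exact_mod_cast min_le_left _ _)
  have key : ∫ z, (truncSq z : ℝ) ∂(μ n) ≤ 16 * d * (1 / 2) ^ n := by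
    calc _ ≤ ∫ z, ∑ i, ({z : Eucl d | 1 < |z i|}.indicator 1 z + 5 * (1 - Real.cos (z i))) ∂(μ n) :=
          integral_mono hit (integrable_finsetSum _ fun i _ => (hi1 i).add (hi2 i)) truncSq_le_sum
      _ = ∑ i, ∫ z, ({z : Eucl d | 1 < |z i|}.indicator 1 z + 5 * (1 - Real.cos (z i))) ∂(μ n) :=
          integral_finsetSum _ fun i _ => (hi1 i).add (hi2 i)
      _ ≤ ∑ _i : Fin d, 16 * (1 / 2 : ℝ) ^ n := by
          refine Finset.sum_le_sum fun i _ => ?_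
          rw [integral_add (hi1 i) (hi2 i), integral_const_mul, integral_indicator_one (hm i)]
          linarith [h.measureReal_one_lt_abs_le n i, h.integral_one_sub_cos_le n i]
      _ = _ := by simp; ring
  rw [lintegral_coe_eq_integral _ hit]
  refine (ENNReal.ofReal_le_ofReal key).trans (le_of_eq ?_)
  rw [← ENNReal.coe_mul, ← ENNReal.ofReal_coe_nnreal]
  push_cast
  rfl

end IsHeatFamily

end heat

/-! ### Bounded approximations of the generator -/

section approxGen

/-- The bounded approximation `2ⁿ (u - μ ⋆ u)` of the generator. -/
noncomputable def approxGen (n : ℕ) (μ : Measure (Eucl d)) (u : Eucl d → ℂ) (x : Eucl d) : ℂ :=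
  2 ^ n * (u x - measureConv μ u x)

theorem IsBC.secondDiff {u : Eucl d → ℂ} (hu : IsBC u) (z : Eucl d) : IsBC (secondDiff z u) := by
  obtain ⟨M, hM⟩ := hu.bounded
  refine ⟨?_, 4 * M, norm_secondDiff_le_four_mul hM z⟩
  have := hu.continuous
  unfold _root_.secondDiff
  fun_prop

theorem IsBC.sub {u w : Eucl d → ℂ} (hu : IsBC u) (hw : IsBC w) : IsBC fun x => u x - w x := by
  obtain ⟨M, hM⟩ := hu.bounded
  obtain ⟨N, hN⟩ := hw.bounded
  exact ⟨hu.continuous.sub hw.continuous, M + N, fun x => (norm_sub_le _ _).trans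
    (add_le_add (hM x) (hN x))⟩

theorem isBC_approxGen {μ : Measure (Eucl d)} [IsProbabilityMeasure μ] {u : Eucl d → ℂ} (hu : IsBC u)
    (n : ℕ) : IsBC (approxGen n μ u) := by
  obtain ⟨M, hM⟩ := (hu.sub (isBC_measureConv (μ := μ) hu)).bounded
  have h1 := hu.continuous
  have h2 := (isBC_measureConv (μ := μ) hu).continuous
  refine ⟨by unfold approxGen; fun_prop, 2 ^ n * M, fun x => ?_⟩
  unfold approxGen
  rw [norm_mul, norm_pow, Complex.norm_ofNat]
  gcongr
  exact hM x

/-- Symmetrizing in `z` turns first differences into second differences. -/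
theorem sub_measureConv_eq {μ : Measure (Eucl d)} [IsProbabilityMeasure μ]
    (hμ : μ.map (fun x => -x) = μ) {u : Eucl d → ℂ} (hu : IsBC u) (x : Eucl d) :
    u x - measureConv μ u x = -(1 / 2) * ∫ z, secondDiff z u x ∂μ := by
  have h1 : Integrable (fun z => u (x + z)) μ := hu.integrable_comp (by fun_prop)
  have h2 : Integrable (fun z => u (x - z)) μ := hu.integrable_comp (by fun_prop)
  have h3 : ∫ z, u (x + z) ∂μ = ∫ z, u (x - z) ∂μ := by
    have hc := hu.continuous
    have := integral_map (μ := μ) (φ := fun x => -x) (f := fun z => u (x - z)) (by fun_prop)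
      (by fun_prop : Continuous _).aestronglyMeasurable
    rw [hμ] at this
    simpa using this.symm
  have h4 : Integrable (fun z => u (x + z) - u x) μ := h1.sub (integrable_const _)
  have h5 : Integrable (fun z => u (x - z) - u x) μ := h2.sub (integrable_const _)
  unfold secondDiff measureConv
  rw [integral_add h4 h5, integral_sub h1 (integrable_const _), integral_sub h2 (integrable_const _), h3]
  simp
  ring

theorem measureConv_sub {μ : Measure (Eucl d)} [IsProbabilityMeasure μ] {u w : Eucl d → ℂ}
    (hu : IsBC u) (hw : IsBC w) (x : Eucl d) :
    measureConv μ (fun x => u x - w x) x = measureConv μ u x - measureConv μ w x :=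
  integral_sub (hu.integrable_comp (by fun_prop)) (hw.integrable_comp (by fun_prop))

theorem secondDiff_sub_measureConv {μ : Measure (Eucl d)} [IsProbabilityMeasure μ]
    {u : Eucl d → ℂ} (hu : IsBC u) (y x : Eucl d) :
    secondDiff y (fun x => u x - measureConv μ u x) x =
      secondDiff y u x - measureConv μ (secondDiff y u) x := by
  have h1 : ∀ x, Integrable (fun z => u (x - z)) μ := fun x => hu.integrable_comp (by fun_prop)
  have h2 : measureConv μ (secondDiff y u) x =
      (measureConv μ u (x + y) - measureConv μ u x) + (measureConv μ u (x - y) - measureConv μ u x) := by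
    have h3 : Integrable (fun z => u (x + y - z) - u (x - z)) μ := (h1 _).sub (h1 _)
    have h4 : Integrable (fun z => u (x - y - z) - u (x - z)) μ := (h1 _).sub (h1 _)
    unfold secondDiff measureConv
    rw [← integral_sub (h1 _) (h1 _), ← integral_sub (h1 _) (h1 _), ← integral_add h3 h4]
    simp_rw [add_sub_right_comm, sub_right_comm x y]
  rw [h2]
  unfold secondDiff
  ring

theorem sub_measureConv_twice_eq {μ : Measure (Eucl d)} [IsProbabilityMeasure μ]
    (hμ : μ.map (fun x => -x) = μ) {u : Eucl d → ℂ} (hu : IsBC u) (x : Eucl d) :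
    (u x - measureConv μ u x) - measureConv μ (fun x => u x - measureConv μ u x) x =
      1 / 4 * ∫ a, secondDiff a.2 (secondDiff a.1 u) x ∂(μ.prod μ) := by
  have hw : IsBC fun x => u x - measureConv μ u x := hu.sub (isBC_measureConv hu)
  rw [sub_measureConv_eq hμ hw]
  simp_rw [secondDiff_sub_measureConv hu, sub_measureConv_eq hμ (hu.secondDiff _)]
  rw [integral_const_mul, integral_prod (fun a : Eucl d × Eucl d => secondDiff a.2 (secondDiff a.1 u) x)]
  · ring
  · obtain ⟨M, hM⟩ := hu.bounded
    have hc := hu.continuous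
    refine Integrable.of_bound (C := 4 * (4 * M)) ?_ (Eventually.of_forall fun a =>
      norm_secondDiff_le_four_mul (norm_secondDiff_le_four_mul hM a.1) a.2 x)
    refine Continuous.aestronglyMeasurable ?_
    unfold secondDiff
    fun_prop

variable {σ : Eucl d → ℝ} {μ : ℕ → Measure (Eucl d)}

/-- With `P` the convolution at time `2^{-(n+1)}`, the semigroup property gives `2(1 - P) - (1 - P²)
= (1 - P)²`: consecutive approximations differ by a square, hence by a quantity of second order. -/
theorem IsHeatFamily.approxGen_succ_sub (h : IsHeatFamily σ μ) {u : Eucl d → ℂ} (hu : IsBC u) (n : ℕ)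
    (x : Eucl d) : approxGen (n + 1) (μ (n + 1)) u x - approxGen n (μ n) u x = 2 ^ n *
      ((u x - measureConv (μ (n + 1)) u x) -
        measureConv (μ (n + 1)) (fun x => u x - measureConv (μ (n + 1)) u x) x) := by
  have := h.prob (n + 1)
  have h1 : measureConv (μ (n + 1)) (fun x => u x - measureConv (μ (n + 1)) u x) x =
      measureConv (μ (n + 1)) u x - measureConv (μ n) u x := by
    rw [← h.measureConv_measureConv n hu]
    exact measureConv_sub hu (isBC_measureConv hu) x
  rw [h1]
  unfold approxGen
  ring

theorem eLpNorm_sub_measureConv_twice_le {μ : Measure (Eucl d)} [IsProbabilityMeasure μ]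
    (hμ : μ.map (fun x => -x) = μ) {u : Eucl d → ℂ} (hu : IsBC u) {p : ℝ≥0∞} (hp : 1 ≤ p) {M : ℝ≥0}
    (hM : HasSecondDiffBound p M u) :
    eLpNorm (fun x => (u x - measureConv μ u x) - measureConv μ (fun x => u x - measureConv μ u x) x)
      p volume ≤ M * (∫⁻ z, truncSq z ∂μ) ^ 2 := by
  have hw : IsBC fun x => u x - measureConv μ u x := hu.sub (isBC_measureConv hu)
  have hc := hu.continuous
  have hct : Continuous fun z : Eucl d => truncSq z := by unfold truncSq; fun_prop
  have key := eLpNorm_le_lintegral_eLpNorm (m := μ.prod μ) p hp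
    (hw.sub (isBC_measureConv (μ := μ) hw)).continuous
    (G := fun a x => ‖secondDiff a.2 (secondDiff a.1 u) x‖ₑ)
    (by
      refine Measurable.enorm (Continuous.measurable ?_)
      unfold secondDiff
      fun_prop)
    (N := fun a => M * truncSq a.1 * truncSq a.2)
    (fun a q hpq g hg => ?_) (fun x => ?_)
  · refine key.trans (le_of_eq ?_)
    simp_rw [mul_assoc]
    rw [lintegral_const_mul _ (by fun_prop)]
    congr 1
    have := lintegral_prod_mul (μ := μ) (ν := μ) (f := fun z => (truncSq z : ℝ≥0∞))
      (g := fun z => (truncSq z : ℝ≥0∞)) (by fun_prop) (by fun_prop)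
    rw [pow_two]
    exact this
  · exact (lintegral_enorm_mul_le_eLpNorm_mul p q
      ((hu.secondDiff _).secondDiff _).continuous.aestronglyMeasurable
      hg.measurable.aestronglyMeasurable).trans (by
        gcongr; exact (hM _ _).trans (le_of_eq (by ring)))
  · rw [sub_measureConv_twice_eq hμ hu, enorm_mul]
    calc _ ≤ 1 * ‖∫ a, secondDiff a.2 (secondDiff a.1 u) x ∂(μ.prod μ)‖ₑ := by
          gcongr
          rw [← ofReal_norm]
          norm_num
      _ ≤ _ := by rw [one_mul]; exact enorm_integral_le_lintegral_enorm _

/-- One step costs `2^n · M (c 2^{-(n+1)})² ≤ c² M 2^{-(n+1)}`; summing from `n` to `m` gives a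
geometric difference. -/
theorem IsHeatFamily.exists_eLpNorm_approxGen_sub_le (h : IsHeatFamily σ μ) :
    ∃ c : ℝ≥0, ∀ (p : ℝ≥0∞) (M : ℝ≥0) (u : Eucl d → ℂ), 1 ≤ p → IsBC u → HasSecondDiffBound p M u →
      ∀ n m, n ≤ m → eLpNorm (fun x => approxGen n (μ n) u x - approxGen m (μ m) u x) p volume ≤
        c * M * (((1 / 2) ^ n - (1 / 2) ^ m : ℝ≥0)) := by
  obtain ⟨c, hc⟩ := h.lintegral_truncSq_le
  refine ⟨c ^ 2, fun p M u hp hu hM n m hnm => ?_⟩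
  have hprob := h.prob
  have step : ∀ n, eLpNorm (fun x => approxGen (n + 1) (μ (n + 1)) u x - approxGen n (μ n) u x) p volume ≤
      c ^ 2 * M * ((1 / 2) ^ (n + 1) : ℝ≥0) := by
    intro n
    have e1 := eLpNorm_sub_measureConv_twice_le (h.map_neg (n + 1)) hu hp hM
    have e2 : (fun x => approxGen (n + 1) (μ (n + 1)) u x - approxGen n (μ n) u x) =
        (2 ^ n : ℂ) • (fun x => (u x - measureConv (μ (n + 1)) u x) -
          measureConv (μ (n + 1)) (fun x => u x - measureConv (μ (n + 1)) u x) x) := by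
      ext x; exact h.approxGen_succ_sub hu n x
    rw [e2, eLpNorm_const_smul]
    have e3 : ‖(2 ^ n : ℂ)‖ₑ = ((2 ^ n : ℝ≥0) : ℝ≥0∞) := by
      rw [← ofReal_norm, norm_pow, Complex.norm_ofNat, ← ENNReal.ofReal_coe_nnreal]
      push_cast; rfl
    rw [e3]
    calc _ ≤ ((2 ^ n : ℝ≥0) : ℝ≥0∞) * (M * (c * ((1 / 2) ^ (n + 1) : ℝ≥0)) ^ 2) := by
          gcongr; exact e1.trans (by gcongr; exact hc _)
      _ = ((2 ^ n * (M * (c * (1 / 2) ^ (n + 1)) ^ 2) : ℝ≥0) : ℝ≥0∞) := by push_cast; ring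
      _ ≤ ((c ^ 2 * M * (1 / 2) ^ (n + 1) : ℝ≥0) : ℝ≥0∞) := by
          rw [ENNReal.coe_le_coe]
          have : (2 : ℝ≥0) ^ n * (1 / 2) ^ (n + 1) ≤ 1 := by
            rw [pow_succ, ← mul_assoc, ← mul_pow]
            norm_num
          calc _ = (2 ^ n * (1 / 2) ^ (n + 1)) * (c ^ 2 * M * (1 / 2) ^ (n + 1)) := by ring
            _ ≤ _ := mul_le_of_le_one_left (by positivity) this
      _ = _ := by push_cast; ring
  induction m, hnm using Nat.le_induction with
  | base => simp
  | succ m hnm ih =>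
    have hA : ∀ k, AEStronglyMeasurable (approxGen k (μ k) u) volume := fun k =>
      (isBC_approxGen hu k).continuous.aestronglyMeasurable
    have e1 : (fun x => approxGen n (μ n) u x - approxGen (m + 1) (μ (m + 1)) u x) =
        (fun x => approxGen n (μ n) u x - approxGen m (μ m) u x) -
        (fun x => approxGen (m + 1) (μ (m + 1)) u x - approxGen m (μ m) u x) := by
      ext x; simp
    rw [e1]
    refine (eLpNorm_sub_le ((hA n).sub (hA m)) ((hA (m + 1)).sub (hA m)) hp).trans
      ((add_le_add ih (step m)).trans (le_of_eq ?_))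
    rw [ENNReal.coe_pow, ← mul_add, ← ENNReal.coe_add]
    congr 2
    have h1 : (1 / 2 : ℝ≥0) ^ m ≤ (1 / 2) ^ n := pow_le_pow_of_le_one (by simp) (by norm_num) hnm
    have h2 : (1 / 2 : ℝ≥0) ^ (m + 1) ≤ (1 / 2) ^ n :=
      pow_le_pow_of_le_one (by simp) (by norm_num) (by omega)
    rw [← NNReal.coe_inj]
    push_cast [NNReal.coe_sub h1, NNReal.coe_sub h2]
    rw [pow_succ]
    ring

theorem IsHeatFamily.measureConv_fourier (h : IsHeatFamily σ μ) (n : ℕ) (ψ : 𝓢(Eucl d, ℂ))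
    (x : Eucl d) : measureConv (μ n) ψ x =
      𝓕⁻ (fun η => (Real.exp (-((1 / 2) ^ n * σ ((2 * Real.pi) • η))) : ℂ) * 𝓕 (ψ : Eucl d → ℂ) η) x := by
  have := h.prob n
  have hint : Integrable (𝓕 (ψ : Eucl d → ℂ)) := by
    rw [← SchwartzMap.fourier_coe]
    exact (𝓕 ψ).integrable
  have hinv : 𝓕⁻ (𝓕 (ψ : Eucl d → ℂ)) = ψ :=
    ψ.continuous.fourierInv_fourier_eq ψ.integrable hint
  have e1 : ∀ z, ψ (x - z) = ∫ η, Complex.exp (↑(2 * Real.pi * inner ℝ η (x - z)) * Complex.I) •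
      𝓕 (ψ : Eucl d → ℂ) η := fun z => by
    conv_lhs => rw [← hinv]
    rw [Real.fourierInv_eq']
  unfold measureConv
  simp_rw [e1]
  rw [integral_integral_swap]
  · rw [Real.fourierInv_eq']
    congr 1; ext η
    have e2 : ∀ z : Eucl d, Complex.exp (↑(2 * Real.pi * inner ℝ η (x - z)) * Complex.I) •
        𝓕 (ψ : Eucl d → ℂ) η = Complex.exp (inner ℝ z ((-(2 * Real.pi)) • η) * Complex.I) *
          (Complex.exp (↑(2 * Real.pi * inner ℝ η x) * Complex.I) * 𝓕 (ψ : Eucl d → ℂ) η) := by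
      intro z
      rw [smul_eq_mul, ← mul_assoc, ← Complex.exp_add]
      congr 2
      rw [inner_sub_right, real_inner_smul_right, real_inner_comm z η]
      push_cast
      ring
    simp_rw [e2]
    rw [integral_mul_const, ← charFun_apply, h.charFun_eq, neg_smul, h.even, smul_eq_mul]
    ring
  · have e3 : Integrable (fun a : Eucl d × Eucl d => 𝓕 (ψ : Eucl d → ℂ) a.2) ((μ n).prod volume) :=
      hint.comp_snd (μ n)
    refine e3.mono ?_ (Eventually.of_forall fun a => ?_)
    · exact (by fun_prop : Continuous fun a : Eucl d × Eucl d =>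
        Complex.exp (↑(2 * Real.pi * inner ℝ a.2 (x - a.1)) * Complex.I)).aestronglyMeasurable.smul
        e3.aestronglyMeasurable
    · simp only [Function.uncurry]
      rw [norm_smul, Complex.norm_exp_ofReal_mul_I, one_mul]

/-- On the Fourier side the symbols `2^n (1 - exp(-2^{-n} σ))` converge to `σ` and stay below `σ ≤ 1
+ |ξ|`, which is integrable against a Schwartz function. -/
theorem IsHeatFamily.tendsto_approxGen (h : IsHeatFamily σ μ) (ψ : 𝓢(Eucl d, ℂ)) (x : Eucl d) :
    Tendsto (fun n => approxGen n (μ n) ψ x) atTop (𝓝 (multiplierOp σ ψ x)) := by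
  have hint : Integrable (𝓕 (ψ : Eucl d → ℂ)) := by
    rw [← SchwartzMap.fourier_coe]
    exact (𝓕 ψ).integrable
  have hinv : 𝓕⁻ (𝓕 (ψ : Eucl d → ℂ)) = ψ :=
    ψ.continuous.fourierInv_fourier_eq ψ.integrable hint
  have hσc := h.continuous
  have hcont : Continuous (𝓕 (ψ : Eucl d → ℂ)) := by
    rw [← SchwartzMap.fourier_coe]
    exact (𝓕 ψ).continuous
  have hdom : Integrable fun η => (1 + ‖(2 * Real.pi) • η‖) * ‖𝓕 (ψ : Eucl d → ℂ) η‖ := by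
    have k1 : Integrable fun η => ‖η‖ ^ 1 * ‖(𝓕 ψ) η‖ := (𝓕 ψ).integrable_pow_mul volume 1
    rw [SchwartzMap.fourier_coe] at k1
    refine (hint.norm.add (k1.const_mul (2 * Real.pi))).congr (Eventually.of_forall fun η => ?_)
    simp only [Pi.add_apply]
    rw [norm_smul, Real.norm_of_nonneg (by positivity)]
    ring
  have key : ∀ n, approxGen n (μ n) ψ x = ∫ η, (Complex.exp (↑(2 * Real.pi * inner ℝ η x) * Complex.I)) •
      ((2 ^ n * (1 - Real.exp (-((1 / 2) ^ n * σ ((2 * Real.pi) • η)))) : ℝ) * 𝓕 (ψ : Eucl d → ℂ) η) := by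
    intro n
    have hE : Integrable fun η => (Real.exp (-((1 / 2) ^ n * σ ((2 * Real.pi) • η))) : ℂ) *
        𝓕 (ψ : Eucl d → ℂ) η := by
      refine hint.mono (by fun_prop : Continuous _).aestronglyMeasurable (Eventually.of_forall fun η => ?_)
      rw [norm_mul, Complex.norm_real, Real.norm_of_nonneg (Real.exp_pos _).le]
      refine mul_le_of_le_one_left (norm_nonneg _) (Real.exp_le_one_iff.2 ?_)
      rw [neg_nonpos]
      exact mul_nonneg (by positivity) (h.nonneg _)
    unfold approxGen
    rw [h.measureConv_fourier]
    rw [show ψ x = 𝓕⁻ (𝓕 (ψ : Eucl d → ℂ)) x by rw [hinv]]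
    rw [Real.fourierInv_eq', Real.fourierInv_eq', ← integral_sub, ← integral_const_mul]
    · congr 1; ext η
      simp only [smul_eq_mul]
      push_cast
      ring
    · refine hint.mono (by fun_prop : Continuous _).aestronglyMeasurable (Eventually.of_forall fun η => ?_)
      rw [norm_smul, Complex.norm_exp_ofReal_mul_I, one_mul]
    · refine hE.mono (by fun_prop : Continuous _).aestronglyMeasurable (Eventually.of_forall fun η => ?_)
      rw [norm_smul, Complex.norm_exp_ofReal_mul_I, one_mul]
  simp_rw [key]
  unfold multiplierOp
  rw [Real.fourierInv_eq']
  refine tendsto_integral_of_dominated_convergence _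
    (fun n => (by fun_prop : Continuous _).aestronglyMeasurable) hdom
    (fun n => Eventually.of_forall fun η => ?_) (Eventually.of_forall fun η => ?_)
  · have k0 : 0 ≤ (1 / 2 : ℝ) ^ n * σ ((2 * Real.pi) • η) := mul_nonneg (by positivity) (h.nonneg _)
    have k1 : Real.exp (-((1 / 2) ^ n * σ ((2 * Real.pi) • η))) ≤ 1 :=
      Real.exp_le_one_iff.2 (neg_nonpos.2 k0)
    have k2 := Real.add_one_le_exp (-((1 / 2) ^ n * σ ((2 * Real.pi) • η)))
    rw [norm_smul, Complex.norm_exp_ofReal_mul_I, one_mul, norm_mul, Complex.norm_real,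
      Real.norm_of_nonneg (mul_nonneg (by positivity) (by linarith))]
    gcongr
    calc _ ≤ 2 ^ n * ((1 / 2) ^ n * σ ((2 * Real.pi) • η)) := by gcongr; linarith
      _ = σ ((2 * Real.pi) • η) := by rw [← mul_assoc, ← mul_pow]; norm_num
      _ ≤ _ := h.le _
  · refine Tendsto.const_smul (Tendsto.mul_const _ ?_) _
    refine (Complex.continuous_ofReal.tendsto _).comp ?_
    set s := σ ((2 * Real.pi) • η)
    have hd : HasDerivAt (fun t : ℝ => 1 - Real.exp (-(t * s))) s 0 := by
      have := (((hasDerivAt_id (0 : ℝ)).mul_const s).neg.exp).const_sub 1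
      simpa using this
    have ht : Tendsto (fun n : ℕ => (1 / 2 : ℝ) ^ n) atTop (𝓝[≠] 0) := by
      refine tendsto_nhdsWithin_iff.2 ⟨tendsto_pow_atTop_nhds_zero_of_lt_one (by norm_num) (by norm_num),
        Eventually.of_forall fun n => ?_⟩
      simp
    have := (hasDerivAt_iff_tendsto_slope.1 hd).comp ht
    refine this.congr fun n => ?_
    simp only [Function.comp, slope_def_field, zero_mul, neg_zero, Real.exp_zero, sub_self, sub_zero]
    rw [one_div, inv_pow, div_inv_eq_mul, mul_comm]

end approxGen

/-! ### Identification of the weak generator -/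

section identification

variable {σ : Eucl d → ℝ} {μ : ℕ → Measure (Eucl d)}

theorem integral_approxGen_mul {μ : Measure (Eucl d)} [IsProbabilityMeasure μ]
    (hμ : μ.map (fun x => -x) = μ) {u w : Eucl d → ℂ} (hu : IsBC u) (hw : IsBC w)
    (hi : Integrable w) (n : ℕ) : ∫ x, approxGen n μ u x * w x = ∫ x, u x * approxGen n μ w x := by
  obtain ⟨M, hM⟩ := hu.bounded
  have hiw : Integrable (measureConv μ w) :=
    (isPropagatorPair_measureConv hμ).left.integrable hw hi
  have h1 : Integrable fun x => u x * w x :=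
    hi.bdd_mul (c := M) hu.continuous.aestronglyMeasurable (Eventually.of_forall hM)
  have h2 : Integrable fun x => u x * measureConv μ w x :=
    hiw.bdd_mul (c := M) hu.continuous.aestronglyMeasurable (Eventually.of_forall hM)
  have h3 : Integrable fun x => measureConv μ u x * w x :=
    hi.bdd_mul (c := M) (isBC_measureConv hu).continuous.aestronglyMeasurable
      (Eventually.of_forall (norm_measureConv_le hM))
  unfold approxGen
  have e1 : ∀ x, 2 ^ n * (u x - measureConv μ u x) * w x =
      2 ^ n * (u x * w x - measureConv μ u x * w x) := fun x => by ring
  have e2 : ∀ x, u x * (2 ^ n * (w x - measureConv μ w x)) =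
      2 ^ n * (u x * w x - u x * measureConv μ w x) := fun x => by ring
  simp_rw [e1, e2]
  rw [integral_const_mul, integral_const_mul, integral_sub h1 h3, integral_sub h1 h2,
    integral_measureConv_mul hμ hu hw hi]

theorem integrable_approxGen {μ : Measure (Eucl d)} [IsProbabilityMeasure μ]
    (hμ : μ.map (fun x => -x) = μ) {w : Eucl d → ℂ} (hw : IsBC w)
    (hi : Integrable w) (n : ℕ) : Integrable (approxGen n μ w) :=
  (hi.sub ((isPropagatorPair_measureConv hμ).left.integrable hw hi)).const_mul _

/-- The `L^1` Cauchy estimate passes to the pointwise limit by Fatou. -/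
theorem IsHeatFamily.exists_eLpNorm_approxGen_sub_multiplierOp_le (h : IsHeatFamily σ μ)
    {ψ : Eucl d → ℂ} (hψ : ContDiff ℝ ∞ ψ) (hc : HasCompactSupport ψ) :
    ∃ B : ℝ≥0, ∀ n, eLpNorm (fun x => approxGen n (μ n) ψ x - multiplierOp σ ψ x) 1 volume ≤
      B * ((1 / 2) ^ n : ℝ≥0) := by
  obtain ⟨c, hcau⟩ := h.exists_eLpNorm_approxGen_sub_le
  obtain ⟨M, hM⟩ := exists_hasSecondDiffBound_one hψ hc
  have hprob := h.prob
  have hBC : IsBC ψ := ⟨hψ.continuous, hψ.continuous.bounded_above_of_compact_support hc⟩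
  have hA : ∀ k, AEStronglyMeasurable (approxGen k (μ k) ψ) volume := fun k =>
    (isBC_approxGen hBC k).continuous.aestronglyMeasurable
  refine ⟨c * M, fun n => ?_⟩
  have hlim := h.tendsto_approxGen (hc.toSchwartzMap hψ)
  refine (Lp.eLpNorm_lim_le_liminf_eLpNorm (μ := volume) (p := 1)
    (f := fun m x => approxGen n (μ n) ψ x - approxGen m (μ m) ψ x)
    (fun m => (hA n).sub (hA m)) _ (Eventually.of_forall fun x => (hlim x).const_sub _)).trans ?_
  refine liminf_le_of_frequently_le' (Eventually.frequently ?_)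
  filter_upwards [eventually_ge_atTop n] with m hm
  refine (hcau 1 M ψ le_rfl hBC hM n m hm).trans ?_
  push_cast
  gcongr
  exact tsub_le_self

/-- The approximations of `σ(D)u` converge uniformly, with rate, to some continuous `w`. Moving them
onto a test function, where they converge in `L^1`, shows that `w` satisfies the weak definition, so
`w = W` almost everywhere and then everywhere by continuity. -/
theorem IsHeatFamily.exists_norm_approxGen_sub_le (h : IsHeatFamily σ μ) :
    ∃ c : ℝ≥0, ∀ (M : ℝ≥0) (u W : Eucl d → ℝ), IsBC (fun x => (u x : ℂ)) →
      HasSecondDiffBound ⊤ M (fun x => (u x : ℂ)) → Continuous W → IsMultiplierImage σ u W →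
      ∀ n x, ‖approxGen n (μ n) (fun x => (u x : ℂ)) x - W x‖ ≤ c * M * (1 / 2) ^ n := by
  obtain ⟨c, hcau⟩ := h.exists_eLpNorm_approxGen_sub_le
  have hprob := h.prob
  refine ⟨c, fun M u W hu hM hWc hW => ?_⟩
  set D : ℕ → Eucl d → ℂ := fun n => approxGen n (μ n) (fun x => (u x : ℂ)) with hD
  have hDB : ∀ n, IsBC (D n) := fun n => isBC_approxGen hu n
  have hle : ∀ n m x, n ≤ m → ‖D n x - D m x‖ ≤ c * M * (1 / 2) ^ n := by
    intro n m x hnm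
    have h1 := (nnnorm_le_eLpNorm_top ((hDB n).continuous.sub (hDB m).continuous) x).trans
      (hcau ⊤ M _ le_top hu hM n m hnm)
    have h2 : ‖D n x - D m x‖ₑ ≤ ((c * M * (1 / 2) ^ n : ℝ≥0) : ℝ≥0∞) := by
      refine h1.trans ?_
      push_cast
      gcongr
      exact tsub_le_self
    rw [enorm_le_coe] at h2
    exact_mod_cast h2
  have hpow : Tendsto (fun n : ℕ => (c * M * (1 / 2) ^ n : ℝ)) atTop (𝓝 0) := by
    have := (tendsto_pow_atTop_nhds_zero_of_lt_one (r := (1 / 2 : ℝ)) (by norm_num)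
      (by norm_num)).const_mul ((c : ℝ) * M)
    simpa using this
  have hex : ∀ x, ∃ w, Tendsto (fun n => D n x) atTop (𝓝 w) := fun x => by
    refine cauchySeq_tendsto_of_complete (cauchySeq_of_le_tendsto_0 (fun n => c * M * (1 / 2) ^ n + c * M * (1 / 2) ^ n)
      (fun n m N hn hm => ?_) (by simpa using hpow.add hpow))
    rw [dist_eq_norm]
    have h1 := hle N n x hn
    have h2 := hle N m x hm
    rw [norm_sub_rev] at h1
    have := norm_add_le (D n x - D N x) (D N x - D m x)
    rw [sub_add_sub_cancel] at this
    linarith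
  choose w hw using hex
  have hDw : ∀ n x, ‖D n x - w x‖ ≤ c * M * (1 / 2) ^ n := fun n x =>
    le_of_tendsto ((hw x).const_sub (D n x)).norm
      ((eventually_ge_atTop n).mono fun m hm => hle n m x hm)
  have hwc : Continuous w := by
    have : TendstoUniformly D w atTop := by
      rw [Metric.tendstoUniformly_iff]
      intro ε hε
      filter_upwards [hpow.eventually (gt_mem_nhds hε)] with n hn x
      rw [dist_comm, dist_eq_norm]
      exact (hDw n x).trans_lt hn
    exact this.continuous (Frequently.of_forall fun n => (hDB n).continuous)
  have hae : ∀ᵐ x, (W x : ℂ) = w x := by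
    refine ae_eq_of_integral_contDiff_smul_eq
      ((Complex.continuous_ofReal.comp hWc).locallyIntegrable) hwc.locallyIntegrable fun g hg hgc => ?_
    set ψ : Eucl d → ℂ := fun x => (g x : ℂ) with hψ
    have hψs : ContDiff ℝ ∞ ψ := Complex.ofRealCLM.contDiff.comp hg
    have hψc : HasCompactSupport ψ := hgc.comp_left (g := fun r : ℝ => (r : ℂ)) rfl
    have hψB : IsBC ψ := ⟨hψs.continuous, hψs.continuous.bounded_above_of_compact_support hψc⟩
    have hψi : Integrable ψ := hψs.continuous.integrable_of_hasCompactSupport hψc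
    have e1 : ∫ x, g x • (W x : ℂ) = ∫ x, (u x : ℂ) * multiplierOp σ ψ x := by
      rw [← hW.2 g hg hgc]
      simp_rw [Complex.real_smul, mul_comm]
    have e2 : ∀ n, ∫ x, D n x * ψ x = ∫ x, (u x : ℂ) * approxGen n (μ n) ψ x := fun n =>
      integral_approxGen_mul (h.map_neg n) hu hψB hψi n
    obtain ⟨B, hB⟩ := h.exists_eLpNorm_approxGen_sub_multiplierOp_le hψs hψc
    obtain ⟨N, hN⟩ := hu.bounded
    have hpowB : Tendsto (fun n : ℕ => (B * ((1 / 2) ^ n : ℝ≥0) : ℝ≥0∞)) atTop (𝓝 0) := by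
      have h1 : Tendsto (fun n : ℕ => B * (1 / 2 : ℝ≥0) ^ n) atTop (𝓝 0) := by
        
        have := (NNReal.tendsto_pow_atTop_nhds_zero_of_lt_one (r := (1 / 2 : ℝ≥0))
          (by rw [← NNReal.coe_lt_coe]; norm_num)).const_mul B
        simpa using this
      have h2 := ENNReal.tendsto_coe.2 h1
      simpa only [ENNReal.coe_mul, ENNReal.coe_zero] using h2
    have hGm : AEStronglyMeasurable (multiplierOp σ ψ) volume :=
      aestronglyMeasurable_of_tendsto_ae atTop
        (fun n => (isBC_approxGen hψB n).continuous.aestronglyMeasurable)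
        (Eventually.of_forall (h.tendsto_approxGen (hψc.toSchwartzMap hψs)))
    have hDi : ∀ n, Integrable (approxGen n (μ n) ψ) := fun n =>
      integrable_approxGen (h.map_neg n) hψB hψi n
    have hGi : Integrable (multiplierOp σ ψ) := by
      have k1 : MemLp (fun x => approxGen 0 (μ 0) ψ x - multiplierOp σ ψ x) 1 volume :=
        ⟨(hDi 0).aestronglyMeasurable.sub hGm, (hB 0).trans_lt (by finiteness)⟩
      have k2 := (hDi 0).sub (memLp_one_iff_integrable.1 k1)
      refine k2.congr (Eventually.of_forall fun x => ?_)
      simp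
    have e3 : Tendsto (fun n => ∫ x, (u x : ℂ) * approxGen n (μ n) ψ x) atTop
        (𝓝 (∫ x, (u x : ℂ) * multiplierOp σ ψ x)) := by
      refine tendsto_integral_of_L1 _ (hGi.bdd_mul (c := N) hu.continuous.aestronglyMeasurable
        (Eventually.of_forall hN)).aestronglyMeasurable (Eventually.of_forall fun n =>
        (hDi n).bdd_mul (c := N) hu.continuous.aestronglyMeasurable (Eventually.of_forall hN)) ?_
      have hup : Tendsto (fun n : ℕ => ENNReal.ofReal N * (B * ((1 / 2) ^ n : ℝ≥0) : ℝ≥0∞)) atTop (𝓝 0) := by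
        simpa using ENNReal.Tendsto.const_mul hpowB (Or.inr ENNReal.ofReal_ne_top)
      refine tendsto_of_tendsto_of_tendsto_of_le_of_le tendsto_const_nhds hup (fun _ => zero_le) fun n => ?_
      calc _ ≤ ∫⁻ x, ENNReal.ofReal N * ‖approxGen n (μ n) ψ x - multiplierOp σ ψ x‖ₑ := by
            refine lintegral_mono fun x => ?_
            rw [← mul_sub, enorm_mul]
            gcongr
            rw [← ofReal_norm]
            exact ENNReal.ofReal_le_ofReal (hN x)
        _ = ENNReal.ofReal N * eLpNorm (fun x => approxGen n (μ n) ψ x - multiplierOp σ ψ x) 1 volume := by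
            rw [lintegral_const_mul' _ _ ENNReal.ofReal_ne_top, eLpNorm_one_eq_lintegral_enorm]
        _ ≤ _ := by gcongr; exact hB n
    have e4 : Tendsto (fun n => ∫ x, D n x * ψ x) atTop (𝓝 (∫ x, w x * ψ x)) := by
      obtain ⟨N0, hN0⟩ := (hDB 0).bounded
      refine tendsto_integral_of_dominated_convergence (fun x => (N0 + c * M) * ‖ψ x‖)
        (fun n => ((hDB n).continuous.mul hψB.continuous).aestronglyMeasurable) (hψi.norm.const_mul _)
        (fun n => Eventually.of_forall fun x => ?_) (Eventually.of_forall fun x => (hw x).mul_const _)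
      rw [norm_mul]
      gcongr
      have k1 := hle 0 n x (Nat.zero_le _)
      have k2 := norm_sub_le (D 0 x) (D 0 x - D n x)
      rw [sub_sub_cancel] at k2
      simp only [pow_zero, mul_one] at k1
      linarith [hN0 x]
    simp_rw [e2] at e4
    rw [e1, tendsto_nhds_unique e3 e4]
    simp_rw [Complex.real_smul, mul_comm, hψ]
  have heq : (fun x => (W x : ℂ)) = w :=
    Continuous.ae_eq_iff_eq volume (Complex.continuous_ofReal.comp hWc) hwc |>.1 hae
  intro n x
  have := hDw n x
  rwa [← heq] at this

end identification

/-! ### Integral identities for the Duhamel formula -/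

section duhamel

theorem lintegral_exp_mul_eq {a s t : ℝ} (ha : 0 ≤ a) (hst : s ≤ t) :
    ∫⁻ τ in Ioc s t, ENNReal.ofReal (a * Real.exp (-(a * (t - τ)))) =
      ENNReal.ofReal (1 - Real.exp (-(a * (t - s)))) := by
  have hc : Continuous fun τ => a * Real.exp (-(a * (t - τ))) := by fun_prop
  rw [← ofReal_integral_eq_lintegral_ofReal (hc.integrableOn_Ioc)
    (Eventually.of_forall fun τ => mul_nonneg ha (Real.exp_pos _).le),
    ← intervalIntegral.integral_of_le hst]
  congr 1
  have hd : ∀ τ ∈ uIcc s t, HasDerivAt (fun τ => Real.exp (-(a * (t - τ))))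
      (a * Real.exp (-(a * (t - τ)))) τ := fun τ _ => by
    have := ((((hasDerivAt_id τ).const_sub t).const_mul a).neg).exp
    refine this.congr_deriv ?_
    simp
    ring
  rw [intervalIntegral.integral_eq_sub_of_hasDerivAt hd (hc.intervalIntegrable _ _)]
  simp

theorem lintegral_mul_lintegral_Ioc {k g : ℝ → ℝ≥0∞} (hk : Measurable k) (hg : Measurable g) (t : ℝ) :
    ∫⁻ τ in Ioc 0 t, k τ * ∫⁻ s in Ioc 0 τ, g s = ∫⁻ s in Ioc 0 t, g s * ∫⁻ τ in Ioc s t, k τ := by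
  have e1 : ∀ τ ∈ Ioc 0 t, k τ * ∫⁻ s in Ioc 0 τ, g s =
      ∫⁻ s in Ioc 0 t, (Iic τ).indicator (fun s => k τ * g s) s := fun τ hτ => by
    rw [← lintegral_const_mul _ hg, setLIntegral_indicator measurableSet_Iic]
    congr 2
    ext s; constructor
    · exact fun h => ⟨h.2, h.1, h.2.trans hτ.2⟩
    · exact fun h => ⟨h.2.1, h.1⟩
  have e2 : ∀ s ∈ Ioc 0 t, g s * ∫⁻ τ in Ioc s t, k τ =
      ∫⁻ τ in Ioc 0 t, (Iic τ).indicator (fun s => k τ * g s) s := fun s hs => by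
    rw [← lintegral_const_mul _ hk]
    have : ∀ τ, (Iic τ).indicator (fun s => k τ * g s) s = (Ici s).indicator (fun τ => g s * k τ) τ :=
      fun τ => by
        simp only [indicator, mem_Iic, mem_Ici, mul_comm]
    simp_rw [this]
    rw [setLIntegral_indicator measurableSet_Ici]
    refine setLIntegral_congr ?_
    have h1 : Ici s ∩ Ioc 0 t = Icc s t := by
      ext τ; constructor
      · exact fun h => ⟨h.1, h.2.2⟩
      · exact fun h => ⟨h.1, hs.1.trans_le h.1, h.2⟩
    rw [h1]
    exact Ioc_ae_eq_Icc
  rw [setLIntegral_congr_fun measurableSet_Ioc e1, setLIntegral_congr_fun measurableSet_Ioc e2]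
  refine lintegral_lintegral_swap ?_
  have hm : MeasurableSet {a : ℝ × ℝ | a.2 ≤ a.1} := measurableSet_le measurable_snd measurable_fst
  have h2 : Measurable (fun a : ℝ × ℝ => k a.1 * g a.2) :=
    (hk.comp measurable_fst).mul (hg.comp measurable_snd)
  exact (h2.indicator hm).aemeasurable

/-- The function `b + ∫_0^t g` is a fixed point of the Duhamel map for the rate `a`, and an extra
constant `D` is multiplied by `1 - e^{-at}`. -/
theorem lintegral_duhamel_eq {a t : ℝ} (ha : 0 ≤ a) (ht : 0 ≤ t) {g : ℝ → ℝ≥0∞} (hg : Measurable g)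
    (b D : ℝ≥0∞) :
    ENNReal.ofReal (Real.exp (-(a * t))) * b + ∫⁻ τ in Ioc 0 t, ENNReal.ofReal (Real.exp (-(a * (t - τ)))) *
      (g τ + ENNReal.ofReal a * (b + (∫⁻ s in Ioc 0 τ, g s) + D)) =
    b + (∫⁻ τ in Ioc 0 t, g τ) + ENNReal.ofReal (1 - Real.exp (-(a * t))) * D := by
  set k : ℝ → ℝ≥0∞ := fun τ => ENNReal.ofReal (a * Real.exp (-(a * (t - τ)))) with hk
  have hkm : Measurable k := by fun_prop
  have hle : ∀ s ≤ t, Real.exp (-(a * (t - s))) ≤ 1 := fun s hs =>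
    Real.exp_le_one_iff.2 (neg_nonpos.2 (mul_nonneg ha (sub_nonneg.2 hs)))
  have hone : ∀ s ≤ t, ENNReal.ofReal (Real.exp (-(a * (t - s)))) +
      ENNReal.ofReal (1 - Real.exp (-(a * (t - s)))) = 1 := fun s hs => by
    rw [← ENNReal.ofReal_add (Real.exp_pos _).le (by linarith [hle s hs])]
    simp
  have e1 : ∀ τ, ENNReal.ofReal (Real.exp (-(a * (t - τ)))) *
      (g τ + ENNReal.ofReal a * (b + (∫⁻ s in Ioc 0 τ, g s) + D)) =
      ENNReal.ofReal (Real.exp (-(a * (t - τ)))) * g τ + (k τ * ∫⁻ s in Ioc 0 τ, g s) + k τ * (b + D) := by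
    intro τ
    simp only [hk]
    rw [ENNReal.ofReal_mul ha]
    ring
  have hme : Measurable fun τ => ENNReal.ofReal (Real.exp (-(a * (t - τ)))) * g τ :=
    Measurable.mul (by fun_prop) hg
  simp_rw [e1]
  rw [lintegral_add_right _ (hkm.mul_const _), lintegral_add_left hme,
    lintegral_mul_const _ hkm, lintegral_mul_lintegral_Ioc hkm hg, lintegral_exp_mul_eq ha ht, sub_zero]
  have e2 : (∫⁻ τ in Ioc 0 t, ENNReal.ofReal (Real.exp (-(a * (t - τ)))) * g τ) +
      ∫⁻ s in Ioc 0 t, g s * ∫⁻ τ in Ioc s t, k τ = ∫⁻ s in Ioc 0 t, g s := by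
    have e3 : ∀ s ∈ Ioc 0 t, g s * ∫⁻ τ in Ioc s t, k τ =
        g s * ENNReal.ofReal (1 - Real.exp (-(a * (t - s)))) := fun s hs => by
      rw [lintegral_exp_mul_eq ha hs.2]
    rw [setLIntegral_congr_fun measurableSet_Ioc e3, ← lintegral_add_left hme]
    refine setLIntegral_congr_fun measurableSet_Ioc fun s hs => ?_
    rw [mul_comm, ← mul_add, hone s hs.2, mul_one]
  have h0 := hone 0 ht
  rw [sub_zero] at h0
  rw [e2]
  calc _ = (ENNReal.ofReal (Real.exp (-(a * t))) + ENNReal.ofReal (1 - Real.exp (-(a * t)))) * b +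
        (∫⁻ s in Ioc 0 t, g s) + ENNReal.ofReal (1 - Real.exp (-(a * t))) * D := by ring
    _ = _ := by rw [h0, one_mul]

theorem enorm_integral_mul_le_of_norm_sub_le {u u₀ W : Eucl d → ℂ} {G : ℝ → Eucl d → ℂ} {t ε N : ℝ}
    (ht : 0 ≤ t) (hG : Continuous fun z : ℝ × Eucl d => G z.1 z.2) (hN : ∀ τ x, ‖G τ x‖ ≤ N)
    (hW : Integrable W) (hu : IsBC u) (hu₀ : IsBC u₀)
    (h : ∀ x, ‖u x - u₀ x - ∫ τ in (0 : ℝ)..t, G τ x‖ ≤ ε) :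
    ‖∫ x, u x * W x‖ₑ ≤ ‖∫ x, u₀ x * W x‖ₑ + (∫⁻ τ in Ioc 0 t, ‖∫ x, G τ x * W x‖ₑ) +
      ENNReal.ofReal ε * eLpNorm W 1 volume := by
  obtain ⟨M, hM⟩ := hu.bounded
  obtain ⟨M₀, hM₀⟩ := hu₀.bounded
  have i1 : Integrable fun x => u x * W x :=
    hW.bdd_mul (c := M) hu.continuous.aestronglyMeasurable (Eventually.of_forall hM)
  have i2 : Integrable fun x => u₀ x * W x :=
    hW.bdd_mul (c := M₀) hu₀.continuous.aestronglyMeasurable (Eventually.of_forall hM₀)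
  have i3 : Integrable (fun a : ℝ × Eucl d => G a.1 a.2 * W a.2)
      ((volume.restrict (Ioc 0 t)).prod volume) :=
    (hW.comp_snd _).bdd_mul (c := N) hG.aestronglyMeasurable (Eventually.of_forall fun a => hN _ _)
  have e1 : ∫ x, (∫ τ in (0 : ℝ)..t, G τ x) * W x = ∫ τ in Ioc 0 t, (∫ x, G τ x * W x) := by
    simp_rw [intervalIntegral.integral_of_le ht, ← integral_mul_const]
    exact (integral_integral_swap i3).symm
  have i4 : Integrable fun x => (∫ τ in (0 : ℝ)..t, G τ x) * W x := by
    simp_rw [intervalIntegral.integral_of_le ht, ← integral_mul_const]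
    exact i3.integral_prod_right
  have e2 : ∫ x, u x * W x = (∫ x, u₀ x * W x) + (∫ x, (∫ τ in (0 : ℝ)..t, G τ x) * W x) +
      ∫ x, (u x - u₀ x - ∫ τ in (0 : ℝ)..t, G τ x) * W x := by
    have i5 : Integrable fun x => u x * W x - u₀ x * W x := i1.sub i2
    simp_rw [sub_mul]
    rw [integral_sub i5 i4, integral_sub i1 i2]
    ring
  rw [e2]
  refine (enorm_add_le _ _).trans (add_le_add ((enorm_add_le _ _).trans (add_le_add le_rfl ?_)) ?_)
  · rw [e1]
    exact enorm_integral_le_lintegral_enorm _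
  · refine (enorm_integral_le_lintegral_enorm _).trans ?_
    rw [eLpNorm_one_eq_lintegral_enorm, ← lintegral_const_mul' _ _ ENNReal.ofReal_ne_top]
    refine lintegral_mono fun x => ?_
    rw [enorm_mul]
    gcongr
    rw [← ofReal_norm]
    exact ENNReal.ofReal_le_ofReal (h x)

end duhamel

/-! ### Duhamel's formula along characteristics -/

section clamped

variable {T : ℝ}

theorem continuous_clamp {F : Type*} [NormedAddCommGroup F] {u : ℝ → Eucl d → F} (hT : 0 < T)
    (hu : ContinuousOn (fun z : ℝ × Eucl d => u z.1 z.2) (Icc 0 T ×ˢ univ)) :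
    Continuous fun z : ℝ × Eucl d => u (max 0 (min T z.1)) z.2 :=
  hu.comp_continuous (f := fun z : ℝ × Eucl d => (max 0 (min T z.1), z.2)) (by fun_prop)
    fun z => ⟨clamp_mem hT z.1, mem_univ _⟩

theorem continuous_measureConv_prod {μ : Measure (Eucl d)} [IsProbabilityMeasure μ]
    {u : ℝ → Eucl d → ℂ} {M : ℝ} (hu : Continuous fun z : ℝ × Eucl d => u z.1 z.2)
    (hM : ∀ τ x, ‖u τ x‖ ≤ M) : Continuous fun z : ℝ × Eucl d => measureConv μ (u z.1) z.2 := by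
  unfold measureConv
  refine continuous_of_dominated (bound := fun _ => M) (fun z => ?_)
    (fun z => Eventually.of_forall fun y => hM _ _) (integrable_const M)
    (Eventually.of_forall fun y => ?_)
  · exact (hu.comp (by fun_prop : Continuous fun y : Eucl d => (z.1, z.2 - y))).aestronglyMeasurable
  · exact hu.comp (by fun_prop : Continuous fun z : ℝ × Eucl d => (z.1, z.2 - y))

variable {v : ℝ → Eucl d → Eucl d} {Φ : ℝ → ℝ → Eucl d → Eucl d}

theorem abs_lipTime_sub_le (hV : lipschitzIntegral T v ≠ ⊤) {s t : ℝ} (hs : s ∈ Icc 0 T)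
    (ht : t ∈ Icc 0 T) : |lipTime v t - lipTime v s| ≤ lipTime v T := by
  have h1 := lipTime_mono hV hs.1 hs.2 le_rfl
  have h2 := lipTime_mono hV ht.1 ht.2 le_rfl
  have h3 : 0 ≤ lipTime v s := ENNReal.toReal_nonneg
  have h4 : 0 ≤ lipTime v t := ENNReal.toReal_nonneg
  exact abs_le.2 ⟨by linarith, by linarith⟩

theorem IsFlow.continuous_clamp (hΦ : IsFlow T v Φ) (hT : 0 < T) (hv : IsSmoothDivFree T v)
    (hV : lipschitzIntegral T v ≠ ⊤) {t : ℝ} (ht : t ∈ Icc 0 T) :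
    Continuous fun z : ℝ × Eucl d => Φ t (max 0 (min T z.1)) z.2 := by
  refine continuous_prod_of_continuous_lipschitzWith' _ (Real.toNNReal (Real.exp (lipTime v T)))
    (fun τ => ?_) (fun x => ?_)
  · refine (hΦ.lipschitzWith hT hv hV ht (clamp_mem hT τ)).weaken (Real.toNNReal_le_toNNReal ?_)
    exact Real.exp_le_exp.2 (abs_lipTime_sub_le hV ht (clamp_mem hT τ))
  · exact (hΦ.trajectory t ht x).continuousOn.comp_continuous (by fun_prop) fun τ => clamp_mem hT τ

end clamped

section transport

variable {T : ℝ} {v : ℝ → Eucl d → Eucl d} {u : ℝ → Eucl d → ℝ} {X : ℝ → Eucl d} {τ : ℝ}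

theorem IsSmoothBounded.hasFDerivWithinAt (hu : IsSmoothBounded T u) (hτ : τ ∈ Icc 0 T) (x : Eucl d) :
    HasFDerivWithinAt (fun z : ℝ × Eucl d => u z.1 z.2)
      (fderivWithin ℝ (fun z : ℝ × Eucl d => u z.1 z.2) (Icc 0 T ×ˢ univ) (τ, x))
      (Icc 0 T ×ˢ univ) (τ, x) :=
  ((hu.smooth.differentiableOn (by simp)) (τ, x) ⟨hτ, mem_univ x⟩).hasFDerivWithinAt

theorem IsSmoothBounded.derivWithin_eq (hT : 0 < T) (hu : IsSmoothBounded T u) (hτ : τ ∈ Icc 0 T)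
    (x : Eucl d) : derivWithin (fun s => u s x) (Icc 0 T) τ =
      fderivWithin ℝ (fun z : ℝ × Eucl d => u z.1 z.2) (Icc 0 T ×ˢ univ) (τ, x) (1, 0) := by
  have h2 : HasDerivWithinAt (fun s : ℝ => (s, x)) ((1 : ℝ), (0 : Eucl d)) (Icc 0 T) τ :=
    (hasDerivWithinAt_id τ _).prodMk (hasDerivWithinAt_const τ _ x)
  have hm : MapsTo (fun s : ℝ => (s, x)) (Icc 0 T) (Icc 0 T ×ˢ univ) := fun s hs => ⟨hs, mem_univ x⟩
  exact ((hu.hasFDerivWithinAt hτ x).comp_hasDerivWithinAt τ h2 hm).derivWithin (uniqueDiffOn_Icc hT τ hτ)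

theorem IsSmoothBounded.hasDerivWithinAt_trajectory (hT : 0 < T) (hu : IsSmoothBounded T u)
    (hX : IsTrajectory T v X) (hτ : τ ∈ Icc 0 T) :
    HasDerivWithinAt (fun s => u s (X s)) (derivWithin (fun s => u s (X τ)) (Icc 0 T) τ +
      fderiv ℝ (u τ) (X τ) (v τ (X τ))) (Icc 0 T) τ := by
  have h2 : HasDerivWithinAt (fun s : ℝ => (s, X s)) ((1 : ℝ), v τ (X τ)) (Icc 0 T) τ :=
    (hasDerivWithinAt_id τ _).prodMk (hX τ hτ)
  have hm : MapsTo (fun s : ℝ => (s, X s)) (Icc 0 T) (Icc 0 T ×ˢ univ) := fun s hs => ⟨hs, mem_univ _⟩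
  refine ((hu.hasFDerivWithinAt hτ (X τ)).comp_hasDerivWithinAt τ h2 hm).congr_deriv ?_
  rw [hu.derivWithin_eq hT hτ, fderiv_slice_eq hu.smooth hτ, ContinuousLinearMap.comp_apply,
    ContinuousLinearMap.inr_apply, ← map_add]
  simp

theorem IsSmoothBounded.continuous_derivWithin (hT : 0 < T) (hu : IsSmoothBounded T u)
    (hτ : τ ∈ Icc 0 T) : Continuous fun x => derivWithin (fun s => u s x) (Icc 0 T) τ := by
  have h1 := hu.smooth.continuousOn_fderivWithin ((uniqueDiffOn_Icc hT).prod uniqueDiffOn_univ) (by simp)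
  have h2 := h1.comp_continuous (f := fun x : Eucl d => (τ, x)) (by fun_prop) fun x => ⟨hτ, mem_univ x⟩
  simp_rw [hu.derivWithin_eq hT hτ]
  exact h2.clm_apply continuous_const

theorem IsSmoothBounded.exists_norm_le (hu : IsSmoothBounded T u) :
    ∃ M : ℝ≥0, ∀ τ ∈ Icc 0 T, ∀ x, ‖u τ x‖ ≤ M := by
  obtain ⟨M, hM⟩ := hu.bounded 0
  refine ⟨M.toNNReal, fun τ hτ x => ?_⟩
  have := hM τ hτ x
  rw [norm_iteratedFDeriv_zero] at this
  exact this.trans (Real.le_coe_toNNReal M)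

theorem IsSmoothBounded.exists_lipschitz (hu : IsSmoothBounded T u) :
    ∃ L : ℝ, 0 ≤ L ∧ ∀ τ ∈ Icc 0 T, ∀ x y, ‖u τ x - u τ y‖ ≤ L * ‖x - y‖ := by
  obtain ⟨M, hM⟩ := hu.bounded 1
  refine ⟨max M 0, le_max_right _ _, fun τ hτ x y => ?_⟩
  refine Convex.norm_image_sub_le_of_norm_fderiv_le (s := univ)
    (fun z _ => (contDiff_slice hu.smooth hτ).differentiable (by simp) z) (fun z _ => ?_)
    convex_univ (mem_univ _) (mem_univ _)
  rw [← norm_iteratedFDeriv_one]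
  exact (hM τ hτ z).trans (le_max_left _ _)

theorem IsSmoothBounded.isBC (hu : IsSmoothBounded T u) (hτ : τ ∈ Icc 0 T) : IsBC (u τ) := by
  obtain ⟨M, hM⟩ := hu.exists_norm_le
  exact ⟨(contDiff_slice hu.smooth hτ).continuous, M, hM τ hτ⟩

theorem IsBC.ofReal {w : Eucl d → ℝ} (hw : IsBC w) : IsBC fun x => (w x : ℂ) :=
  ⟨Complex.continuous_ofReal.comp hw.continuous, hw.bounded.imp fun M hM x => by simpa using hM x⟩

theorem IsSmoothBounded.exists_hasSecondDiffBound (hu : IsSmoothBounded T u) :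
    ∃ M, ∀ τ ∈ Icc 0 T, HasSecondDiffBound ⊤ M fun x => (u τ x : ℂ) := by
  obtain ⟨M0, h0⟩ := hu.bounded 0
  obtain ⟨M2, h2⟩ := hu.bounded 2
  obtain ⟨M4, h4⟩ := hu.bounded 4
  set M : ℝ := max M0 (max M2 M4)
  refine ⟨16 * M.toNNReal, fun τ hτ => ?_⟩
  have hs := contDiff_slice hu.smooth hτ
  have hk : ∀ k : ℕ, ∀ x, ‖iteratedFDeriv ℝ k (fun x => (u τ x : ℂ)) x‖ = ‖iteratedFDeriv ℝ k (u τ) x‖ :=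
    fun k x => Complex.ofRealLI.norm_iteratedFDeriv_comp_left
      (hs.contDiffAt (x := x)) (by exact_mod_cast le_top)
  have hsc : ContDiff ℝ ∞ fun x => (u τ x : ℂ) := Complex.ofRealCLM.contDiff.comp hs
  refine hasSecondDiffBound_top (hsc.of_le ENat.LEInfty.out)
    (fun x => ?_) (fun x => ?_) (fun x => ?_)
  · rw [hk]
    exact (h0 τ hτ x).trans ((le_max_left _ _).trans (Real.le_coe_toNNReal M))
  · rw [hk]
    exact (h2 τ hτ x).trans (((le_max_left _ _).trans (le_max_right _ _)).trans (Real.le_coe_toNNReal M))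
  · rw [hk]
    exact (h4 τ hτ x).trans (((le_max_right _ _).trans (le_max_right _ _)).trans (Real.le_coe_toNNReal M))

/-- The equation turns the residual into `κ` times the error of the approximate generator, which is
uniform in time because the bounds on the derivatives of `θ` are. -/
theorem IsSmoothSolution.exists_residual_le {κ α β lam : ℝ} {f θ : ℝ → Eucl d → ℝ}
    {μ : ℕ → Measure (Eucl d)} (hμ : IsHeatFamily (logSymbol α β lam) μ) (hT : 0 < T) (hκ : 0 ≤ κ)
    (hv : IsSmoothDivFree T v) (hf : IsSmoothBounded T f) (hθ : IsSmoothSolution κ α β lam T v f θ) :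
    ∃ C : ℝ≥0, ∀ n, ∀ τ ∈ Icc 0 T, ∀ x,
      ‖((derivWithin (fun s => θ s x) (Icc 0 T) τ + fderiv ℝ (θ τ) x (v τ x) : ℝ) : ℂ) +
        κ * approxGen n (μ n) (fun x => (θ τ x : ℂ)) x - f τ x‖ ≤ C * (1 / 2) ^ n := by
  obtain ⟨c, hc⟩ := hμ.exists_norm_approxGen_sub_le
  obtain ⟨M, hM⟩ := hθ.smooth.exists_hasSecondDiffBound
  obtain ⟨Lθ, hL⟩ := hθ.equation
  refine ⟨κ.toNNReal * (c * M), fun n τ hτ x => ?_⟩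
  obtain ⟨h1, h2⟩ := hL τ hτ
  have e1 : ((derivWithin (fun s => θ s x) (Icc 0 T) τ + fderiv ℝ (θ τ) x (v τ x) : ℝ) : ℂ) +
        κ * approxGen n (μ n) (fun x => (θ τ x : ℂ)) x - f τ x =
      κ * (approxGen n (μ n) (fun x => (θ τ x : ℂ)) x - Lθ τ x) := by
    rw [← h2 x]
    push_cast
    ring
  rw [e1, norm_mul, Complex.norm_real, Real.norm_of_nonneg hκ]
  rcases hκ.eq_or_lt with h0 | h0
  · rw [← h0]; simp
  -- The weak image is only assumed locally integrable; for `κ > 0` the equation itself shows that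
  -- it is continuous. For `κ = 0` it has no influence.
  have hc1 : Continuous (Lθ τ) := by
    have e2 : Lθ τ = fun x => κ⁻¹ * (f τ x - derivWithin (fun s => θ s x) (Icc 0 T) τ -
        fderiv ℝ (θ τ) x (v τ x)) := by
      ext x
      rw [← h2 x]
      field_simp
      ring
    rw [e2]
    have k1 := (hf.isBC hτ).continuous
    have k2 := hθ.smooth.continuous_derivWithin hT hτ
    have k3 : Continuous fun x => fderiv ℝ (θ τ) x (v τ x) :=
      ((contDiff_slice hθ.smooth.smooth hτ).continuous_fderiv (by simp)).clm_apply
        (contDiff_slice hv.smooth hτ).continuous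
    exact continuous_const.mul ((k1.sub k2).sub k3)
  have := hc M (θ τ) (Lθ τ) (hθ.smooth.isBC hτ).ofReal (hM τ hτ) hc1 h1 n x
  push_cast
  rw [Real.coe_toNNReal κ hκ, mul_assoc]
  gcongr

/-- The source of the Duhamel formula along characteristics, constant in time outside `[0, T]`. -/
noncomputable def duhamelSource (T a t : ℝ) (μ : Measure (Eucl d)) (Φ : ℝ → ℝ → Eucl d → Eucl d)
    (f θ : ℝ → Eucl d → ℝ) (τ : ℝ) (x : Eucl d) : ℂ :=
  Real.exp (-(a * (t - max 0 (min T τ)))) *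
    ((f (max 0 (min T τ)) (Φ t (max 0 (min T τ)) x) : ℂ) +
      a * measureConv μ (fun y => (θ (max 0 (min T τ)) y : ℂ)) (Φ t (max 0 (min T τ)) x))

variable {Φ : ℝ → ℝ → Eucl d → Eucl d} {f θ : ℝ → Eucl d → ℝ} {μ : Measure (Eucl d)} {a t : ℝ}

theorem continuous_duhamelSource [IsProbabilityMeasure μ] (hΦ : IsFlow T v Φ) (hT : 0 < T)
    (hv : IsSmoothDivFree T v) (hV : lipschitzIntegral T v ≠ ⊤) (hf : IsSmoothBounded T f)
    (hθ : IsSmoothBounded T θ) (ht : t ∈ Icc 0 T) :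
    Continuous fun z : ℝ × Eucl d => duhamelSource T a t μ Φ f θ z.1 z.2 := by
  have h1 := hΦ.continuous_clamp hT hv hV ht
  have h2 := continuous_clamp hT hf.smooth.continuousOn
  have h3 := continuous_clamp hT hθ.smooth.continuousOn
  obtain ⟨M, hM⟩ := hθ.exists_norm_le
  have h4 := continuous_measureConv_prod (μ := μ) (u := fun τ x => (θ (max 0 (min T τ)) x : ℂ)) (M := M)
    (Complex.continuous_ofReal.comp h3) (fun τ x => by
      rw [Complex.norm_real]; exact hM _ (clamp_mem hT τ) x)
  have h5 : Continuous fun z : ℝ × Eucl d => (z.1, Φ t (max 0 (min T z.1)) z.2) :=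
    continuous_fst.prodMk h1
  unfold duhamelSource
  exact (Complex.continuous_ofReal.comp (by fun_prop)).mul
    ((Complex.continuous_ofReal.comp (h2.comp h5)).add (continuous_const.mul (h4.comp h5)))

theorem exists_norm_duhamelSource_le [IsProbabilityMeasure μ] (hT : 0 < T) (ha : 0 ≤ a)
    (hf : IsSmoothBounded T f) (hθ : IsSmoothBounded T θ) :
    ∃ N : ℝ, ∀ τ x, ‖duhamelSource T a t μ Φ f θ τ x‖ ≤ N := by
  obtain ⟨M, hM⟩ := hθ.exists_norm_le
  obtain ⟨M', hM'⟩ := hf.exists_norm_le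
  refine ⟨Real.exp (a * (T - t)) * (M' + a * M), fun τ x => ?_⟩
  have hτ := clamp_mem hT τ
  unfold duhamelSource
  rw [norm_mul, Complex.norm_real, Real.norm_of_nonneg (Real.exp_pos _).le]
  have h1 : Real.exp (-(a * (t - max 0 (min T τ)))) ≤ Real.exp (a * (T - t)) := by
    refine Real.exp_le_exp.2 ?_
    have := mul_le_mul_of_nonneg_left hτ.2 ha
    linarith
  refine mul_le_mul h1 ((norm_add_le _ _).trans (add_le_add ?_ ?_)) (norm_nonneg _) (Real.exp_pos _).le
  · rw [Complex.norm_real]; exact hM' _ hτ _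
  · rw [norm_mul, Complex.norm_real, Real.norm_of_nonneg ha]
    exact mul_le_mul_of_nonneg_left (norm_measureConv_le (fun y => by
      rw [Complex.norm_real]; exact hM _ hτ y) _) ha

/-- Along the characteristic through `x` at time `t`, the derivative of `e^{-a(t-τ)} θ` is the
Duhamel source plus `e^{-a(t-τ)}` times a residual of size at most `η`. -/
theorem norm_sub_duhamel_le [IsProbabilityMeasure μ] (hΦ : IsFlow T v Φ) (hT : 0 < T)
    (hv : IsSmoothDivFree T v) (hV : lipschitzIntegral T v ≠ ⊤) (hf : IsSmoothBounded T f)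
    (hθ : IsSmoothBounded T θ) (ht : t ∈ Icc 0 T) {η : ℝ}
    (h : ∀ τ ∈ Icc 0 T, ∀ x,
      ‖((derivWithin (fun s => θ s x) (Icc 0 T) τ + fderiv ℝ (θ τ) x (v τ x) : ℝ) : ℂ) +
        a * (θ τ x - measureConv μ (fun x => (θ τ x : ℂ)) x) - f τ x‖ ≤ η) (x : Eucl d) :
    ‖(θ t x : ℂ) - Real.exp (-(a * t)) * θ 0 (Φ t 0 x) - ∫ τ in (0 : ℝ)..t, duhamelSource T a t μ Φ f θ τ x‖
      ≤ ∫ τ in (0 : ℝ)..t, Real.exp (-(a * (t - τ))) * η := by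
  set X : ℝ → Eucl d := fun τ => Φ t τ x with hX
  have hXt := hΦ.trajectory t ht x
  set G : ℝ → ℂ := fun τ => duhamelSource T a t μ Φ f θ τ x with hG
  have hGc : Continuous G := (continuous_duhamelSource hΦ hT hv hV hf hθ ht).comp
    (by fun_prop : Continuous fun τ : ℝ => (τ, x))
  set b : ℝ → ℝ := fun τ => Real.exp (-(a * (t - τ))) * η with hb
  have hbc : Continuous b := by fun_prop
  set y : ℝ → ℂ := fun τ => Real.exp (-(a * (t - τ))) * (θ τ (X τ) : ℂ) with hy
  set E : ℝ → ℂ := fun τ =>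
    ((derivWithin (fun s => θ s (X τ)) (Icc 0 T) τ + fderiv ℝ (θ τ) (X τ) (v τ (X τ)) : ℝ) : ℂ) +
        a * (θ τ (X τ) - measureConv μ (fun x => (θ τ x : ℂ)) (X τ)) - f τ (X τ) with hE
  have hyd : ∀ τ ∈ Icc 0 T, HasDerivWithinAt y (G τ + Real.exp (-(a * (t - τ))) * E τ) (Icc 0 T) τ := by
    intro τ hτ
    have h1 : HasDerivAt (fun τ : ℝ => Real.exp (-(a * (t - τ)))) (a * Real.exp (-(a * (t - τ)))) τ := by
      have := ((((hasDerivAt_id τ).const_sub t).const_mul a).neg).exp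
      refine this.congr_deriv ?_
      simp
      ring
    have h2 := (hθ.hasDerivWithinAt_trajectory hT hXt hτ).ofReal_comp
    have h3 := h1.hasDerivWithinAt.ofReal_comp.mul h2
    refine h3.congr_deriv ?_
    simp only [hG, hE, duhamelSource, clamp_eq hτ]
    push_cast
    ring
  have hsub : Icc 0 t ⊆ Icc 0 T := Icc_subset_Icc_right ht.2
  have key := image_norm_le_of_norm_deriv_right_le_deriv_boundary' (a := 0) (b := t)
    (f := fun τ => y τ - y 0 - ∫ s in (0 : ℝ)..τ, G s)
    (f' := fun τ => Real.exp (-(a * (t - τ))) * E τ)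
    (B := fun τ => ∫ s in (0 : ℝ)..τ, b s) (B' := b) ?_ ?_ (by simp)
    (intervalIntegral.continuous_primitive (fun _ _ => hbc.intervalIntegrable _ _) 0).continuousOn
    (fun τ _ => (hbc.integral_hasStrictDerivAt 0 τ).hasDerivAt.hasDerivWithinAt) ?_
    (right_mem_Icc.2 ht.1)
  · refine le_trans (le_of_eq ?_) key
    simp only [hy, hX, hΦ.self t ht, sub_self, mul_zero, neg_zero, Real.exp_zero, sub_zero]
    simp [hG]
  · refine ContinuousOn.sub (ContinuousOn.sub (fun τ hτ => ?_) continuousOn_const)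
      (intervalIntegral.continuous_primitive (fun _ _ => hGc.intervalIntegrable _ _) 0).continuousOn
    exact ((hyd τ (hsub hτ)).continuousWithinAt).mono hsub
  · intro τ hτ
    have hτT : τ ∈ Icc 0 T := hsub ⟨hτ.1, hτ.2.le⟩
    have h1 : HasDerivWithinAt y (G τ + Real.exp (-(a * (t - τ))) * E τ) (Ici τ) τ := by
      refine (hyd τ hτT).mono_of_mem_nhdsWithin ?_
      exact Filter.mem_of_superset (Icc_mem_nhdsGE (hτ.2.trans_le ht.2)) (Icc_subset_Icc_left hτ.1)
    have h2 := (hGc.integral_hasStrictDerivAt 0 τ).hasDerivAt.hasDerivWithinAt (s := Ici τ)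
    refine ((h1.sub_const (y 0)).sub h2).congr_deriv ?_
    ring
  · intro τ hτ
    rw [norm_mul, Complex.norm_real, Real.norm_of_nonneg (Real.exp_pos _).le]
    exact mul_le_mul_of_nonneg_left (h τ (hsub ⟨hτ.1, hτ.2.le⟩) (X τ)) (Real.exp_pos _).le

end transport

/-! ### Bounding all pairings with propagators by iteration -/

section contraction

variable {T t τ : ℝ} {v : ℝ → Eucl d → Eucl d} {Φ : ℝ → ℝ → Eucl d → Eucl d}
  {f θ : ℝ → Eucl d → ℝ}

/-- The largest expansion factor allowed to propagators acting after the time `τ`. -/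
noncomputable def expansion (T : ℝ) (v : ℝ → Eucl d → Eucl d) (τ : ℝ) : ℝ≥0 :=
  Real.toNNReal (Real.exp (lipTime v T - lipTime v τ))

theorem expansion_le (τ : ℝ) : expansion T v τ ≤ Real.toNNReal (Real.exp (lipTime v T)) := by
  refine Real.toNNReal_le_toNNReal (Real.exp_le_exp.2 ?_)
  have : 0 ≤ lipTime v τ := ENNReal.toReal_nonneg
  linarith

theorem one_le_expansion (hV : lipschitzIntegral T v ≠ ⊤) (hτ : τ ∈ Icc 0 T) :
    1 ≤ expansion T v τ := by
  unfold expansion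
  rw [← Real.toNNReal_one]
  refine Real.toNNReal_le_toNNReal (Real.one_le_exp ?_)
  linarith [lipTime_mono hV hτ.1 hτ.2 le_rfl]

/-- Expansion factors multiply: the flow from `t` back to `τ` uses up exactly the part `V(t) - V(τ)`
of the exponent allowed at time `τ`. -/
theorem IsFlow.isPropagatorPair_comp (hΦ : IsFlow T v Φ) (hT : 0 < T) (hv : IsSmoothDivFree T v)
    (hV : lipschitzIntegral T v ≠ ⊤) (ht : t ∈ Icc 0 T) (hτ : 0 ≤ τ) (hτt : τ ≤ t)
    {S S' : (Eucl d → ℂ) → Eucl d → ℂ} (hS : IsPropagatorPair (expansion T v t) S S') :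
    IsPropagatorPair (expansion T v τ) (fun u => S fun x => u (Φ t τ x))
      (fun w x => S' w (Φ τ t x)) := by
  have h1 := hS.comp (hΦ.isPropagatorPair hT hv hV ht ⟨hτ, hτt.trans ht.2⟩)
  refine h1.mono (le_of_eq ?_)
  unfold expansion
  rw [← Real.toNNReal_mul (Real.exp_pos _).le, ← Real.exp_add,
    abs_of_nonpos (by linarith [lipTime_mono hV hτ hτt ht.2])]
  congr 2
  ring

theorem integral_comp_flow_mul (hΦ : IsFlow T v Φ) (hT : 0 < T) (hv : IsSmoothDivFree T v)
    (hV : lipschitzIntegral T v ≠ ⊤) (ht : t ∈ Icc 0 T) (hτ : τ ∈ Icc 0 T) {u w : Eucl d → ℂ}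
    (hu : IsBC u) (hw : IsBC w) (hi : Integrable w) :
    ∫ x, u (Φ t τ x) * w x = ∫ x, u x * w (Φ τ t x) :=
  (hΦ.isPropagatorPair hT hv hV ht hτ).duality u w hu hw hi

/-- Pair the Duhamel formula with `S' w` and transpose flow and convolution onto it. The resulting
operators are again admissible at the earlier time, so the assumed bound can be inserted under the
integral. The class of propagators must be this large because each iteration composes new flows and
convolutions. -/
theorem contraction_step {μ : Measure (Eucl d)} [IsProbabilityMeasure μ]
    (hμ : μ.map (fun x => -x) = μ) (hΦ : IsFlow T v Φ) (hT : 0 < T) (hv : IsSmoothDivFree T v)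
    (hV : lipschitzIntegral T v ≠ ⊤) (hf : IsSmoothBounded T f) (hθ : IsSmoothBounded T θ)
    {a η : ℝ} (ha : 0 ≤ a) (hη : 0 ≤ η)
    (h : ∀ τ ∈ Icc 0 T, ∀ x,
      ‖((derivWithin (fun s => θ s x) (Icc 0 T) τ + fderiv ℝ (θ τ) x (v τ x) : ℝ) : ℂ) +
        a * (θ τ x - measureConv μ (fun x => (θ τ x : ℂ)) x) - f τ x‖ ≤ η)
    {w : Eucl d → ℂ} (hw : IsBC w) (hi : Integrable w) {b D : ℝ≥0∞} {g : ℝ → ℝ≥0∞} (hg : Measurable g)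
    (hb : ∀ S S', IsPropagatorPair (expansion T v 0) S S' → ‖∫ x, (θ 0 x : ℂ) * S' w x‖ₑ ≤ b)
    (hgb : ∀ τ ∈ Icc 0 T, ∀ S S', IsPropagatorPair (expansion T v τ) S S' →
      ‖∫ x, (f τ x : ℂ) * S' w x‖ₑ + ENNReal.ofReal η * eLpNorm w 1 volume ≤ g τ)
    (hD : ∀ τ ∈ Icc 0 T, ∀ S S', IsPropagatorPair (expansion T v τ) S S' →
      ‖∫ x, (θ τ x : ℂ) * S' w x‖ₑ ≤ b + (∫⁻ s in Ioc 0 τ, g s) + D) :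
    ∀ t ∈ Icc 0 T, ∀ S S', IsPropagatorPair (expansion T v t) S S' →
      ‖∫ x, (θ t x : ℂ) * S' w x‖ₑ ≤ b + (∫⁻ s in Ioc 0 t, g s) +
        ENNReal.ofReal (1 - Real.exp (-(a * T))) * D := by
  intro t ht S S' hS
  have h0 : (0 : ℝ) ∈ Icc 0 T := ⟨le_rfl, hT.le⟩
  have hθB : ∀ τ ∈ Icc 0 T, IsBC fun x => (θ τ x : ℂ) := fun τ hτ => (hθ.isBC hτ).ofReal
  have hfB : ∀ τ ∈ Icc 0 T, IsBC fun x => (f τ x : ℂ) := fun τ hτ => (hf.isBC hτ).ofReal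
  have hWB : IsBC (S' w) := hS.right.isBC hw
  have hWi : Integrable (S' w) := hS.right.integrable hw hi
  have hcomp : ∀ τ ∈ Icc 0 T, ∀ u : Eucl d → ℂ, IsBC u → IsBC fun x => u (Φ t τ x) := fun τ hτ u hu =>
    (hΦ.isPropagatorPair hT hv hV ht hτ).left.isBC hu
  have hmul : ∀ {u W : Eucl d → ℂ}, IsBC u → Integrable W → Integrable fun x => u x * W x := by
    intro u W hu hW
    obtain ⟨M, hM⟩ := hu.bounded
    exact hW.bdd_mul (c := M) hu.continuous.aestronglyMeasurable (Eventually.of_forall hM)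
  obtain ⟨N, hN⟩ := exists_norm_duhamelSource_le (a := a) (t := t) (μ := μ) (Φ := Φ) hT ha hf hθ
  have hconst : ∀ (c : ℝ) (u : Eucl d → ℂ), IsBC u → IsBC fun x => (c : ℂ) * u x := by
    intro c u hu
    obtain ⟨M, hM⟩ := hu.bounded
    refine ⟨continuous_const.mul hu.continuous, ‖(c : ℂ)‖ * M, fun x => ?_⟩
    rw [norm_mul]
    gcongr
    exact hM x
  have key := enorm_integral_mul_le_of_norm_sub_le (u := fun x => (θ t x : ℂ))
    (u₀ := fun x => Real.exp (-(a * t)) * (θ 0 (Φ t 0 x) : ℂ)) (W := S' w)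
    (G := duhamelSource T a t μ Φ f θ) ht.1 (continuous_duhamelSource hΦ hT hv hV hf hθ ht) hN hWi
    (hθB t ht) (hconst _ _ (hcomp 0 h0 _ (hθB 0 h0)))
    (norm_sub_duhamel_le hΦ hT hv hV hf hθ ht h)
  have hexp : ∀ r : ℝ, ‖((Real.exp r : ℝ) : ℂ)‖ₑ = ENNReal.ofReal (Real.exp r) := fun r => by
    rw [enorm_ofReal, Real.enorm_of_nonneg (Real.exp_pos r).le]
  have p1 : ‖∫ x, (Real.exp (-(a * t)) * (θ 0 (Φ t 0 x) : ℂ)) * S' w x‖ₑ ≤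
      ENNReal.ofReal (Real.exp (-(a * t))) * b := by
    simp_rw [mul_assoc]
    rw [integral_const_mul, enorm_mul, hexp]
    gcongr
    rw [integral_comp_flow_mul (u := fun x => (θ 0 x : ℂ)) hΦ hT hv hV ht h0 (hθB 0 h0) hWB hWi]
    exact hb _ _ (hΦ.isPropagatorPair_comp hT hv hV ht le_rfl ht.1 hS)
  have p2 : ∀ τ ∈ Ioc 0 t, ‖∫ x, duhamelSource T a t μ Φ f θ τ x * S' w x‖ₑ +
      ENNReal.ofReal (Real.exp (-(a * (t - τ)))) * (ENNReal.ofReal η * eLpNorm w 1 volume) ≤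
      ENNReal.ofReal (Real.exp (-(a * (t - τ)))) *
        (g τ + ENNReal.ofReal a * (b + (∫⁻ s in Ioc 0 τ, g s) + D)) := by
    intro τ hτ
    have hτT : τ ∈ Icc 0 T := ⟨hτ.1.le, hτ.2.trans ht.2⟩
    have hpair := hΦ.isPropagatorPair_comp hT hv hV ht hτ.1.le hτ.2 hS
    -- Convolution with a probability measure has factor one, so the allowance at time `τ` is not
    -- exceeded.
    have hpair2 := hpair.comp (isPropagatorPair_measureConv hμ)
    rw [mul_one] at hpair2
    have q1 := hgb τ hτT _ _ hpair
    have q2 := hD τ hτT _ _ hpair2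
    have hcB := isBC_measureConv (μ := μ) (hθB τ hτT)
    have e1 : ∫ x, duhamelSource T a t μ Φ f θ τ x * S' w x =
        Real.exp (-(a * (t - τ))) * ((∫ x, (f τ x : ℂ) * S' w (Φ τ t x)) +
          a * ∫ x, (θ τ x : ℂ) * measureConv μ (fun x => S' w (Φ τ t x)) x) := by
      have hW2B : IsBC fun x => S' w (Φ τ t x) := (hpair.right.isBC hw)
      have hW2i : Integrable fun x => S' w (Φ τ t x) := (hpair.right.integrable hw hi)
      rw [← integral_measureConv_mul hμ (hθB τ hτT) hW2B hW2i,
        ← integral_comp_flow_mul (u := fun x => (f τ x : ℂ)) hΦ hT hv hV ht hτT (hfB τ hτT) hWB hWi,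
        ← integral_comp_flow_mul hΦ hT hv hV ht hτT hcB hWB hWi]
      have i1 := hmul (hcomp τ hτT _ (hfB τ hτT)) hWi
      have i2 := hmul (hcomp τ hτT _ hcB) hWi
      rw [← integral_const_mul (a : ℂ), ← integral_add i1 (i2.const_mul _), ← integral_const_mul]
      simp only [duhamelSource, clamp_eq hτT]
      congr 1; ext x
      ring
    rw [e1, enorm_mul, hexp, ← mul_add]
    refine mul_le_mul' le_rfl ?_
    refine (add_le_add (enorm_add_le _ _) le_rfl).trans ?_
    rw [add_right_comm]
    refine add_le_add q1 ?_
    rw [enorm_mul, enorm_ofReal, Real.enorm_of_nonneg ha]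
    gcongr
  have p3 : ENNReal.ofReal (∫ τ in (0 : ℝ)..t, Real.exp (-(a * (t - τ))) * η) * eLpNorm (S' w) 1 volume ≤
      ∫⁻ τ in Ioc 0 t, ENNReal.ofReal (Real.exp (-(a * (t - τ)))) * (ENNReal.ofReal η * eLpNorm w 1 volume) := by
    have hc : Continuous fun τ => Real.exp (-(a * (t - τ))) * η := by fun_prop
    rw [intervalIntegral.integral_of_le ht.1, ofReal_integral_eq_lintegral_ofReal hc.integrableOn_Ioc
      (Eventually.of_forall fun τ => mul_nonneg (Real.exp_pos _).le hη), ← lintegral_mul_const _ (by fun_prop)]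
    refine lintegral_mono fun τ => ?_
    rw [ENNReal.ofReal_mul (Real.exp_pos _).le, mul_assoc]
    gcongr
    exact hS.right.eLpNorm_le w 1 hw le_rfl
  refine (key.trans (add_le_add (add_le_add p1 le_rfl) p3)).trans ?_
  rw [add_assoc, ← lintegral_add_right _ (by fun_prop)]
  refine (add_le_add le_rfl (setLIntegral_mono' measurableSet_Ioc p2)).trans ?_
  rw [lintegral_duhamel_eq ha ht.1 hg]
  gcongr
  exact ht.2

/-- For fixed `n` the contraction is iterated from the crude bound `sup |θ| ‖w‖_1`, which removes
the error since `1 - e^{-aT} < 1`; the residual, charged to `g`, vanishes as `n → ∞`. The order of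
limits matters: the contraction factor tends to one with `n` when `κ > 0`. -/
theorem IsSmoothSolution.enorm_integral_mul_le {κ α β lam : ℝ} (hd : d = 2 ∨ d = 3)
    (hp : LogParam α β lam) (hT : 0 < T) (hκ : 0 ≤ κ) (hv : IsSmoothDivFree T v)
    (hV : lipschitzIntegral T v ≠ ⊤) (hf : IsSmoothBounded T f)
    (hθ : IsSmoothSolution κ α β lam T v f θ)
    {w : Eucl d → ℂ} (hw : IsBC w) (hi : Integrable w) {b : ℝ≥0∞} {g : ℝ → ℝ≥0∞} (hg : Measurable g)
    (hb : ∀ S S', IsPropagatorPair (Real.toNNReal (Real.exp (lipTime v T))) S S' →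
      ‖∫ x, (θ 0 x : ℂ) * S' w x‖ₑ ≤ b)
    (hgb : ∀ τ ∈ Icc 0 T, ∀ S S', IsPropagatorPair (Real.toNNReal (Real.exp (lipTime v T))) S S' →
      ‖∫ x, (f τ x : ℂ) * S' w x‖ₑ ≤ g τ) (ht : t ∈ Icc 0 T) :
    ‖∫ x, (θ t x : ℂ) * w x‖ₑ ≤ b + ∫⁻ s in Ioc 0 t, g s := by
  obtain ⟨Φ, hΦ⟩ := exists_isFlow hT hv hV
  obtain ⟨μ, hμ⟩ := exists_isHeatFamily hd hp
  obtain ⟨C, hC⟩ := hθ.exists_residual_le hμ hT hκ hv hf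
  obtain ⟨M, hM⟩ := hθ.smooth.exists_norm_le
  have hprob := hμ.prob
  set N : ℝ≥0∞ := eLpNorm w 1 volume with hN
  have hNt : N ≠ ⊤ := (memLp_one_iff_integrable.2 hi).eLpNorm_ne_top
  have main : ∀ n : ℕ, ‖∫ x, (θ t x : ℂ) * w x‖ₑ ≤ b +
      ∫⁻ s in Ioc 0 t, (g s + ENNReal.ofReal (C * (1 / 2) ^ n) * N) := by
    intro n
    set a : ℝ := κ * 2 ^ n with ha
    have ha0 : 0 ≤ a := by positivity
    set q : ℝ := 1 - Real.exp (-(a * T)) with hq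
    have hq0 : 0 ≤ q := by
      have : Real.exp (-(a * T)) ≤ 1 := Real.exp_le_one_iff.2 (neg_nonpos.2 (mul_nonneg ha0 hT.le))
      linarith
    have hq1 : q < 1 := by linarith [Real.exp_pos (-(a * T))]
    have iter : ∀ k : ℕ, ∀ τ ∈ Icc 0 T, ∀ S S', IsPropagatorPair (expansion T v τ) S S' →
        ‖∫ x, (θ τ x : ℂ) * S' w x‖ₑ ≤ b +
          (∫⁻ s in Ioc 0 τ, (g s + ENNReal.ofReal (C * (1 / 2) ^ n) * N)) +
          ENNReal.ofReal q ^ k * (M * N) := by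
      intro k
      induction k with
      | zero =>
        intro τ hτ S S' hS
        rw [pow_zero, one_mul]
        refine le_trans ?_ le_add_self
        refine (enorm_integral_le_lintegral_enorm _).trans ?_
        calc _ ≤ ∫⁻ x, (M : ℝ≥0∞) * ‖S' w x‖ₑ := by
              refine lintegral_mono fun x => ?_
              rw [enorm_mul, enorm_ofReal]
              gcongr
              rw [enorm_le_coe]
              exact hM τ hτ x
          _ = M * eLpNorm (S' w) 1 volume := by
              rw [lintegral_const_mul' _ _ ENNReal.coe_ne_top, eLpNorm_one_eq_lintegral_enorm]
          _ ≤ _ := by gcongr; exact hS.right.eLpNorm_le w 1 hw le_rfl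
      | succ k ih =>
        rw [pow_succ', mul_assoc]
        refine contraction_step (η := C * (1 / 2) ^ n) (hμ.map_neg n) hΦ hT hv hV hf hθ.smooth ha0 (by positivity)
          (fun τ hτ x => ?_) hw hi (hg.add_const _) (fun S S' hS => hb S S' (hS.mono (expansion_le _)))
          (fun τ hτ S S' hS => ?_) ih
        · refine (le_of_eq ?_).trans (hC n τ hτ x)
          unfold approxGen
          congr 3
          rw [ha]
          push_cast
          ring
        · gcongr
          exact hgb τ hτ S S' (hS.mono (expansion_le _))
    have hlim : Tendsto (fun k : ℕ => b +
        (∫⁻ s in Ioc 0 t, (g s + ENNReal.ofReal (C * (1 / 2) ^ n) * N)) +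
          ENNReal.ofReal q ^ k * (M * N)) atTop (𝓝 (b +
        (∫⁻ s in Ioc 0 t, (g s + ENNReal.ofReal (C * (1 / 2) ^ n) * N)) + 0)) := by
      refine Tendsto.add tendsto_const_nhds ?_
      have h1 : Tendsto (fun k : ℕ => ENNReal.ofReal q ^ k) atTop (𝓝 0) :=
        ENNReal.tendsto_pow_atTop_nhds_zero_of_lt_one (ENNReal.ofReal_lt_one.2 hq1)
      simpa using ENNReal.Tendsto.mul_const h1 (b := (M : ℝ≥0∞) * N) (Or.inr (by finiteness))
    rw [add_zero] at hlim
    -- Only the identity propagator is needed at the end; the larger class served the induction.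
    exact ge_of_tendsto' hlim fun k => iter k t ht _ _
      (isPropagatorPair_id.mono (one_le_expansion hV ht))
  have hlim : Tendsto (fun n : ℕ => b + ((∫⁻ s in Ioc 0 t, g s) +
      ENNReal.ofReal (C * (1 / 2) ^ n) * N * ENNReal.ofReal t)) atTop
      (𝓝 (b + ((∫⁻ s in Ioc 0 t, g s) + 0))) := by
    refine tendsto_const_nhds.add (tendsto_const_nhds.add ?_)
    have h1 : Tendsto (fun n : ℕ => ENNReal.ofReal (C * (1 / 2) ^ n)) atTop (𝓝 0) := by
      have := (tendsto_pow_atTop_nhds_zero_of_lt_one (r := (1 / 2 : ℝ)) (by norm_num)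
        (by norm_num)).const_mul (C : ℝ)
      simpa using ENNReal.tendsto_ofReal this
    have h2 := ENNReal.Tendsto.mul_const (b := N * ENNReal.ofReal t) h1 (Or.inr (by finiteness))
    simpa [mul_assoc] using h2
  rw [add_zero] at hlim
  refine ge_of_tendsto' hlim fun n => (main n).trans (le_of_eq ?_)
  rw [lintegral_add_right _ measurable_const, setLIntegral_const, Real.volume_Ioc, sub_zero]

end contraction

/-! ### Measurability in time -/

section measurability

theorem eLpNorm_top_eq_iSup {F : Type*} [NormedAddCommGroup F] {u : Eucl d → F} (hu : Continuous u) :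
    eLpNorm u ⊤ volume = ⨆ x, ‖u x‖ₑ := by
  refine le_antisymm ?_ (iSup_le fun x => nnnorm_le_eLpNorm_top hu x)
  rw [eLpNorm_exponent_top]
  exact essSup_le_of_ae_le _ (Eventually.of_forall fun x => le_iSup (fun x => ‖u x‖ₑ) x)

/-- For `p = ∞` the norm is a supremum of continuous functions of time, hence lower semicontinuous;
for finite `p` it is a parameter integral. -/
theorem measurable_eLpNorm_prod {F : Type*} [NormedAddCommGroup F] {u : ℝ → Eucl d → F}
    (hu : Continuous fun z : ℝ × Eucl d => u z.1 z.2) {p : ℝ≥0∞} (hp : 1 ≤ p) :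
    Measurable fun τ => eLpNorm (u τ) p volume := by
  rcases eq_or_ne p ⊤ with rfl | htop
  · have hx : ∀ x, Continuous fun τ => u τ x := fun x =>
      hu.comp (by fun_prop : Continuous fun τ : ℝ => (τ, x))
    have e : (fun τ => eLpNorm (u τ) ⊤ volume) = fun τ => ⨆ x, ‖u τ x‖ₑ := funext fun τ =>
      eLpNorm_top_eq_iSup (hu.comp (by fun_prop : Continuous fun x : Eucl d => (τ, x)))
    rw [e]
    exact (lowerSemicontinuous_iSup fun x => (hx x).enorm.lowerSemicontinuous).measurable
  · simp_rw [eLpNorm_eq_lintegral_rpow_enorm_toReal (zero_lt_one.trans_le hp).ne' htop]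
    exact ((hu.enorm.measurable.pow_const _).lintegral_prod_right').pow_const _

theorem continuous_dyadicBlock_prod (P : DyadicPartition d) (m : ℕ) {u : ℝ → Eucl d → ℝ} {M : ℝ}
    (hu : Continuous fun z : ℝ × Eucl d => u z.1 z.2) (hM : ∀ τ x, ‖u τ x‖ ≤ M) :
    Continuous fun z : ℝ × Eucl d => dyadicBlock P m (u z.1) z.2 := by
  have hk := integrable_multiplierKernel (P.symbol_smooth m) (P.symbol_compact m)
  have e : ∀ z : ℝ × Eucl d, dyadicBlock P m (u z.1) z.2 =
      ∫ y, multiplierKernel (P.symbol m) y * (u z.1 (z.2 - y) : ℂ) := fun z =>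
    kernelConv_eq (multiplierKernel (P.symbol m)) (fun y => (u z.1 y : ℂ)) z.2
  simp_rw [e]
  refine continuous_of_dominated (bound := fun y => ‖multiplierKernel (P.symbol m) y‖ * M)
    (fun z => hk.aestronglyMeasurable.mul ?_) (fun z => Eventually.of_forall fun y => ?_)
    (hk.norm.mul_const M) (Eventually.of_forall fun y => continuous_const.mul ?_)
  · exact (Complex.continuous_ofReal.comp
      (hu.comp (by fun_prop : Continuous fun y : Eucl d => (z.1, z.2 - y)))).aestronglyMeasurable
  · rw [norm_mul, Complex.norm_real]
    gcongr
    exact hM _ _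
  · exact Complex.continuous_ofReal.comp
      (hu.comp (by fun_prop : Continuous fun z : ℝ × Eucl d => (z.1, z.2 - y)))

theorem measurable_blockSum (P : DyadicPartition d) {p : ℝ≥0∞} (hp : 1 ≤ p) (K : ℝ≥0) (j : ℕ)
    {u : ℝ → Eucl d → ℝ} {M : ℝ} (hu : Continuous fun z : ℝ × Eucl d => u z.1 z.2)
    (hM : ∀ τ x, ‖u τ x‖ ≤ M) : Measurable fun τ => blockSum P p K j (u τ) := by
  unfold blockSum
  exact Measurable.tsum fun m =>
    (measurable_eLpNorm_prod (continuous_dyadicBlock_prod P m hu hM) hp).const_mul _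

end measurability

/-! ### The estimate block by block, and its summation -/

section estimate

/-- Summing over the output block first leaves, for each block of `u`, the logarithmic sum of
off-diagonal gains. -/
theorem tsum_blockSum_le (P : DyadicPartition d) (p : ℝ≥0∞) {V : ℝ} (hV : 0 ≤ V) (u : Eucl d → ℝ) :
    ∑' j, blockSum P p (Real.toNNReal (Real.exp V)) j u ≤
      12 * (1 + ENNReal.ofReal V) * besovNorm P p u := by
  unfold blockSum besovNorm
  rw [ENNReal.tsum_comm, ← ENNReal.tsum_mul_left]
  refine ENNReal.tsum_le_tsum fun q => ?_
  rw [ENNReal.tsum_mul_right]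
  gcongr
  exact tsum_offDiagonal_le hV q

/-- Duality in `g` reduces the block of `θ(t)` to a pairing with `Δ_j g`; the data and the source
are then paired with back-propagated copies of it. The constant depends only on the partition. -/
theorem exists_eLpNorm_dyadicBlock_le (hd : d = 2 ∨ d = 3) (P : DyadicPartition d) :
    ∃ C : ℝ≥0, ∀ (κ α β lam T : ℝ) (p : ℝ≥0∞) (v : ℝ → Eucl d → Eucl d) (f θ : ℝ → Eucl d → ℝ),
      LogParam α β lam → 0 ≤ κ → 1 ≤ p → 0 < T → IsSmoothDivFree T v → IsSmoothBounded T f →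
      IsSmoothSolution κ α β lam T v f θ → lipschitzIntegral T v ≠ ⊤ → ∀ t ∈ Icc 0 T, ∀ j,
      eLpNorm (dyadicBlock P j (θ t)) p volume ≤
        C * (blockSum P p (Real.toNNReal (Real.exp (lipTime v T))) j (θ 0) +
          ∫⁻ τ in Ioc 0 t, blockSum P p (Real.toNNReal (Real.exp (lipTime v T))) j
            (f (max 0 (min T τ)))) := by
  obtain ⟨C, hC⟩ := exists_enorm_integral_mul_propagator_block_le P
  obtain ⟨C₂, hk⟩ := P.exists_isKernelBound
  refine ⟨C, fun κ α β lam T p v f θ hL hκ hp hT hv hf hθ hV t ht j => ?_⟩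
  set K := Real.toNNReal (Real.exp (lipTime v T)) with hK
  have hK1 : 1 ≤ K := by
    rw [hK, ← Real.toNNReal_one]
    exact Real.toNNReal_le_toNNReal (Real.one_le_exp ENNReal.toReal_nonneg)
  have hpq := ENNReal.HolderConjugate.conjExponent hp
  set q := p.conjExponent
  obtain ⟨M, hM⟩ := hf.exists_norm_le
  obtain ⟨Lf, hLf0, hLf⟩ := hf.exists_lipschitz
  obtain ⟨Lθ, hLθ0, hLθ⟩ := hθ.smooth.exists_lipschitz
  have hfm : Measurable fun τ => blockSum P p K j (f (max 0 (min T τ))) :=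
    measurable_blockSum P hp K j (u := fun τ => f (max 0 (min T τ)))
      (continuous_clamp hT hf.smooth.continuousOn) fun τ x => hM _ (clamp_mem hT τ) x
  have hB : IsBC (dyadicBlock P j (θ t)) :=
    isBC_kernelConv_of_isBC (hk j).integrable (hθ.smooth.isBC ht).ofReal
  refine eLpNorm_le_of_forall_integral_mul_le p q hB.continuous fun g hg => ?_
  have hw : IsBC (kernelConv (blockKernel P j) g) := isBC_kernelConv_of_isTest (hk j).isBC hg
  have hi : Integrable (kernelConv (blockKernel P j) g) :=
    (isTest_kernelConv (hk j).isBC (hk j).integrable hg).integrable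
  obtain ⟨Mθ, hMθ⟩ := (hθ.smooth.isBC ht).ofReal.bounded
  have h0 : (0 : ℝ) ∈ Icc 0 T := ⟨le_rfl, hT.le⟩
  have e1 : ∫ x, dyadicBlock P j (θ t) x * g x =
      ∫ x, (θ t x : ℂ) * kernelConv (blockKernel P j) g x :=
    integral_kernelConv_mul (hk j).isBC.continuous (hk j).integrable (hk j).even
      (hθ.smooth.isBC ht).ofReal.continuous.measurable hMθ hg.integrable
  rw [e1]
  have key := hθ.enorm_integral_mul_le hd hL hT hκ hv hV hf hw hi
    (b := C * blockSum P p K j (θ 0) * eLpNorm g q volume)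
    (g := fun τ => C * blockSum P p K j (f (max 0 (min T τ))) * eLpNorm g q volume)
    ((hfm.const_mul _).mul_const _)
    (fun S S' hS => hC K S S' hK1 hS j g p q hpq hg (θ 0) Lθ (hθ.smooth.isBC h0) hLθ0 (hLθ 0 h0))
    (fun τ hτ S S' hS => by
      rw [clamp_eq hτ]
      exact hC K S S' hK1 hS j g p q hpq hg (f τ) Lf (hf.isBC hτ) hLf0 (hLf τ hτ)) ht
  refine key.trans (le_of_eq ?_)
  rw [lintegral_mul_const _ (hfm.const_mul _), lintegral_const_mul _ hfm]
  ring

theorem IsSmoothBounded.mono {T t : ℝ} {u : ℝ → Eucl d → ℝ} (hu : IsSmoothBounded T u) (ht : t ≤ T) :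
    IsSmoothBounded t u where
  smooth := hu.smooth.mono (prod_mono_left (Icc_subset_Icc_right ht))
  bounded k := (hu.bounded k).imp fun _ hM τ hτ => hM τ ⟨hτ.1, hτ.2.trans ht⟩

theorem IsSmoothSolution.mono {κ α β lam T t : ℝ} {v : ℝ → Eucl d → Eucl d} {f θ : ℝ → Eucl d → ℝ}
    (hθ : IsSmoothSolution κ α β lam T v f θ) (h0 : 0 < t) (ht : t ≤ T) :
    IsSmoothSolution κ α β lam t v f θ where
  smooth := hθ.smooth.mono ht
  equation := by
    obtain ⟨Lθ, h⟩ := hθ.equation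
    refine ⟨Lθ, fun τ hτ => ?_⟩
    have hτT : τ ∈ Icc 0 T := ⟨hτ.1, hτ.2.trans ht⟩
    obtain ⟨h1, h2⟩ := h τ hτT
    refine ⟨h1, fun x => ?_⟩
    have hdiff : DifferentiableWithinAt ℝ (fun s => θ s x) (Icc 0 T) τ := by
      have k1 := (hθ.smooth.smooth.differentiableOn (by simp)) (τ, x) ⟨hτT, mem_univ x⟩
      have k2 : MapsTo (fun s : ℝ => (s, x)) (Icc 0 T) (Icc 0 T ×ˢ univ) :=
        fun s hs => ⟨hs, mem_univ x⟩
      exact k1.comp τ (by fun_prop) k2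
    rw [derivWithin_subset (Icc_subset_Icc_right ht) (uniqueDiffOn_Icc h0 τ hτ) hdiff]
    exact h2 x

end estimate

theorem mainTheorem7 (d : ℕ) (hd : d = 2 ∨ d = 3) (P : DyadicPartition d)
    (α lam : ℝ) (hα : 0 ≤ α) :
    ∃ C : ℝ≥0, ∀ (κ β T : ℝ) (p : ℝ≥0∞)
      (v : ℝ → EuclideanSpace ℝ (Fin d) → EuclideanSpace ℝ (Fin d))
      (f θ : ℝ → EuclideanSpace ℝ (Fin d) → ℝ),
      0 ≤ κ → 0 < β → β ≤ 1 → Real.exp ((3 + 2 * α) / β) ≤ lam → 1 ≤ p → 0 < T →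
      IsSmoothDivFree T v → IsSmoothBounded T f → IsSmoothSolution κ α β lam T v f θ →
      ∀ t ∈ Set.Icc 0 T, lipschitzIntegral t v ≠ ⊤ →
        cheminLernerNorm P p t θ ≤
          C * (besovNorm P p (θ 0) + timeL1BesovNorm P p t f) * (1 + lipschitzIntegral t v) := by
  obtain ⟨C, hC⟩ := exists_eLpNorm_dyadicBlock_le hd P
  refine ⟨C * 12, fun κ β T p v f θ hκ hβ hβ1 hlam hp hT hv hf hθ t ht hV => ?_⟩
  -- At `t = 0` the time interval is empty and the left-hand side is zero.
  rcases ht.1.eq_or_lt with h0 | h0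
  · rw [← h0]
    simp [cheminLernerNorm]
  -- The problem is restricted to `[0, t]`, since the Lipschitz integral is known to be finite only
  -- up to time `t`, and the bound must involve its value there.
  have hft := hf.mono ht.2
  set V := lipTime v t with hVdef
  set K := Real.toNNReal (Real.exp V) with hK
  have hV0 : 0 ≤ V := ENNReal.toReal_nonneg
  have hVeq : ENNReal.ofReal V = lipschitzIntegral t v := ENNReal.ofReal_toReal hV
  set F : ℝ → EuclideanSpace ℝ (Fin d) → ℝ := fun τ => f (max 0 (min t τ)) with hF
  obtain ⟨M, hM⟩ := hft.exists_norm_le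
  have hFm : ∀ j, Measurable fun τ => blockSum P p K j (F τ) := fun j =>
    measurable_blockSum P hp K j (u := F)
      (continuous_clamp h0 hft.smooth.continuousOn) fun τ x => hM _ (clamp_mem h0 τ) x
  have h1 : ∀ j, essSup (fun τ => eLpNorm (dyadicBlock P j (θ τ)) p volume)
      (volume.restrict (Ioc 0 t)) ≤
      C * (blockSum P p K j (θ 0) + ∫⁻ τ in Ioc 0 t, blockSum P p K j (F τ)) := by
    intro j
    refine essSup_le_of_ae_le _ ((ae_restrict_iff' measurableSet_Ioc).2
      (Eventually.of_forall fun τ hτ => ?_))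
    refine (hC κ α β lam t p v f θ ⟨hα, hβ, hβ1, hlam⟩ hκ hp h0 (hv.mono ht.2) hft
      (hθ.mono h0 ht.2) hV τ ⟨hτ.1.le, hτ.2⟩ j).trans ?_
    exact mul_le_mul' le_rfl (add_le_add le_rfl (lintegral_mono_set (Ioc_subset_Ioc_right hτ.2)))
  calc cheminLernerNorm P p t θ
      ≤ ∑' j, C * (blockSum P p K j (θ 0) + ∫⁻ τ in Ioc 0 t, blockSum P p K j (F τ)) :=
        ENNReal.tsum_le_tsum h1
    _ = C * (∑' j, blockSum P p K j (θ 0) + ∫⁻ τ in Ioc 0 t, ∑' j, blockSum P p K j (F τ)) := by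
        rw [ENNReal.tsum_mul_left, ENNReal.tsum_add,
          lintegral_tsum fun j => (hFm j).aemeasurable]
    _ ≤ C * (12 * (1 + ENNReal.ofReal V) * besovNorm P p (θ 0) +
          ∫⁻ τ in Ioc 0 t, 12 * (1 + ENNReal.ofReal V) * besovNorm P p (F τ)) := by
        gcongr
        · exact tsum_blockSum_le P p hV0 _
        · exact tsum_blockSum_le P p hV0 _
    _ = C * (12 * (1 + ENNReal.ofReal V) * besovNorm P p (θ 0) +
          12 * (1 + ENNReal.ofReal V) * timeL1BesovNorm P p t f) := by
        rw [lintegral_const_mul' _ _ (by finiteness)]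
        congr 3
        refine setLIntegral_congr_fun measurableSet_Ioc fun τ hτ => ?_
        simp only [hF]
        rw [clamp_eq ⟨hτ.1.le, hτ.2⟩]
    _ = _ := by
        rw [hVeq]
        push_cast
        ring
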